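/- Let $n\ge 2$ and $\mathbb K\in\{\mathbb R,\mathbb C\}$. Let $\mathrm{Vect}(\mathbb R^n)$ be the Lie algebra of smooth vector fields on $\mathbb R^n$, acting by the Lie derivative $L_X$ on the space $\Omega(\mathbb R^n)=\bigoplus_{k=0}^n\Omega^k(\mathbb R^n)$ of smooth differential forms with coefficients in $\mathbb K$, and let $\mathcal D$ be the algebra of linear differential operators (of finite order, with smooth coefficients) on $\Omega(\mathbb R^n)$. Let $d$ be the de Rham differential, and let $C_0^k(X)=\mathrm{Div}(X)$ $(0\le k\le n)$, $C_1^k(X)=d\circ\mathrm{Div}(X)$, $\widetilde C_1^k(X)=\mathrm{Div}(X)\circ d$ $(0\le k\le n-1)$, $C_2^k(X)=d\circ\mathrm{Div}(X)\circ d$ $(0\le k\le n-2)$, each restricted to $\Omega^k(\mathbb R^n)$ and extended by zero to the forms of the other degrees. For values $t=(t_0^k,t_1^k,\widetilde t_1^k,t_2^k)$ of $4n$ parameters put $$\mathcal L_X(t)=L_X+\sum_{k=0}^n t_0^kC_0^k(X)+\sum_{k=0}^{n-1}\bigl(t_1^kC_1^k(X)+\widetilde t_1^k\widetilde C_1^k(X)\bigr)+\sum_{k=0}^{n-2}t_2^kC_2^k(X)$$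 and consider the $4n-4$ quadratic expressions $$\begin{aligned}R_1^k(t)&=t_0^k\widetilde t_1^k+t_0^{k+1}t_1^k&&(0\le k\le n-1),\\ R_2^k(t)&=t_0^kt_2^k+t_1^{k+1}t_1^k&&(0\le k\le n-2),\\ \widetilde R_2^k(t)&=t_0^{k+2}t_2^k+\widetilde t_1^{k+1}\widetilde t_1^k&&(0\le k\le n-2),\\ R_3^k(t)&=t_1^{k+2}t_2^k+\widetilde t_1^kt_2^{k+1}&&(0\le k\le n-3).\end{aligned}$$ For a finite set $s$ of formal parameters and an ideal $J$ of $\mathbb K[[s]]$, a *deformation with base* $A=\mathbb K[[s]]/J$ is given by a map $\rho:\mathrm{Vect}(\mathbb R^n)\to\mathrm{End}(\Omega(\mathbb R^n))[[s]]$ with constant term $L_X$, each of whose coefficients is a bidifferential operator in $X$ and the form (of finite order, with smooth coefficients), such that $[\rho(X),\rho(Y)]-\rho([X,Y])\in J\cdot\mathrm{End}(\Omega(\mathbb R^n))[[s]]$ for all $X,Y$; it is considered modulo $J\cdot\mathrm{End}(\Omega(\mathbb R^n))[[s]]$. Two deformations $\rho,\rho'$ with the same base are *equivalent* if $\rho'(X)\equiv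 U\rho(X)U^{-1}$ modulo $J\cdot\mathrm{End}(\Omega(\mathbb R^n))[[s]]$ for all $X$, for some $U\in\mathcal D[[s]]$ with constant term $1$. A family $\rho_1$ *integrates* over $A$ if there is a deformation with base $A$ whose terms of order $\le1$ in the parameters are those of $\rho_1$. Let $\mathfrak m$ be the ideal of series without constant term. An ideal is *homogeneous* if it is generated by homogeneous elements. **(i)** Let the $4n$ parameters $t$ be independent. For every homogeneous ideal $I$ of $\mathbb K[[t]]$, the infinitesimal deformation $\mathcal L_X(t)$ integrates over $\mathbb K[[t]]/I$ if and only if all the quadratic expressions $R_1^k,R_2^k,\widetilde R_2^k,R_3^k$ lie in $I$. For an arbitrary ideal $I$, if $\mathcal L_X(t)$ integrates over $\mathbb K[[t]]/I$ then all of them lie in $I+\mathfrak m^3$; and $\mathcal L_X(t)$ is itself a deformation with base $\mathbb K[[t]]/I$ if and only if all of them lie in $I$. Likewise, for a vector of constants $c\in\mathbb K^{4n}$, the family $\mathcal L_X(hc)$ with one formal parameter $h$ integrates over $\mathbb K[[h]]$ if and only if $R_1^k(c)=R_2^k(c)=\widetilde R_2^k(c)=R_3^k(c)=0$ for all $k$.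 **(ii)** Every deformation with any base $\mathbb K[[s_1,\dots,s_m]]/J$ is equivalent to a deformation of order $1$, that is, to $\mathcal L_X(t)$ for some values $t\in\mathfrak m^{4n}$ of the parameters which satisfy all the relations $R_1^k(t)=R_2^k(t)=\widetilde R_2^k(t)=R_3^k(t)=0$ in $\mathbb K[[s_1,\dots,s_m]]/J$. **(iii)** The deformation $\mathcal L_X(t)$ with base $\mathcal A=\mathbb K[[t]]/(R_1^k,R_2^k,\widetilde R_2^k,R_3^k)$ is miniversal: it is a deformation, and for every deformation $\rho'$ with a base $\mathcal A'=\mathbb K[[s_1,\dots,s_m]]/J$ there is a homomorphism of unital $\mathbb K$-algebras $\psi:\mathcal A\to\mathcal A'$ such that $\rho'$ is equivalent to $(\mathrm{Id}\otimes\psi)\circ\mathcal L$; moreover $\psi$ is unique if $\mathfrak m^2\subset J$. -/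

import Mathlib

open scoped ContDiff

set_option maxSynthPendingDepth 3

noncomputable section

namespace FormDeformation

/-! ### Vector fields and differential forms on `ℝⁿ` -/

/-- The space `ℝⁿ`. -/
abbrev Rn (n : ℕ) := EuclideanSpace ℝ (Fin n)

/-- `Vect(ℝⁿ)`: the smooth vector fields on `ℝⁿ`. -/
def Vect (n : ℕ) : Submodule ℝ (Rn n → Rn n) where
  carrier := {X | ContDiff ℝ ∞ X}
  add_mem' {X Y} (hX : ContDiff ℝ ∞ X) (hY : ContDiff ℝ ∞ Y) := hX.add hY
  zero_mem' := (contDiff_const : ContDiff ℝ ∞ fun _ : Rn n => (0 : Rn n))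
  smul_mem' c X (hX : ContDiff ℝ ∞ X) := hX.const_smul c

/-- The Lie bracket of vector fields. -/
def bracket {n : ℕ} (X Y : Vect n) : Vect n :=
  ⟨VectorField.lieBracket ℝ X.1 Y.1, by
    have hX : ContDiff ℝ ∞ X.1 := X.2
    have hY : ContDiff ℝ ∞ Y.1 := Y.2
    exact ((hY.fderiv_right (m := ∞) (by simp)).clm_apply hX).sub
      ((hX.fderiv_right (m := ∞) (by simp)).clm_apply hY)⟩

/-- The divergence of a vector field with respect to the standard volume form. -/
def divergence {n : ℕ} (X : Vect n) (x : Rn n) : ℝ :=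
  LinearMap.trace ℝ (Rn n) (fderiv ℝ X.1 x).toLinearMap

/-- The fibre of the bundle of inhomogeneous exterior forms with values in `𝕜`: the direct sum of
the spaces of alternating `k`-linear forms on `ℝⁿ`, `0 ≤ k ≤ n`. -/
def Fibre (𝕜 : Type) [RCLike 𝕜] (n : ℕ) := (k : Fin (n + 1)) → Rn n [⋀^Fin k]→L[ℝ] 𝕜

instance (𝕜 : Type) [RCLike 𝕜] (n : ℕ) : NormedAddCommGroup (Fibre 𝕜 n) :=
  inferInstanceAs (NormedAddCommGroup ((k : Fin (n + 1)) → Rn n [⋀^Fin k]→L[ℝ] 𝕜))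

instance (𝕜 : Type) [RCLike 𝕜] (n : ℕ) : NormedSpace ℝ (Fibre 𝕜 n) :=
  inferInstanceAs (NormedSpace ℝ ((k : Fin (n + 1)) → Rn n [⋀^Fin k]→L[ℝ] 𝕜))

instance (𝕜 : Type) [RCLike 𝕜] (n : ℕ) : Module 𝕜 (Fibre 𝕜 n) :=
  inferInstanceAs (Module 𝕜 ((k : Fin (n + 1)) → Rn n [⋀^Fin k]→L[ℝ] 𝕜))

instance (𝕜 : Type) [RCLike 𝕜] (n : ℕ) : SMulCommClass ℝ 𝕜 (Fibre 𝕜 n) :=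
  inferInstanceAs (SMulCommClass ℝ 𝕜 ((k : Fin (n + 1)) → Rn n [⋀^Fin k]→L[ℝ] 𝕜))

instance (𝕜 : Type) [RCLike 𝕜] (n : ℕ) : ContinuousConstSMul 𝕜 (Fibre 𝕜 n) :=
  inferInstanceAs (ContinuousConstSMul 𝕜 ((k : Fin (n + 1)) → Rn n [⋀^Fin k]→L[ℝ] 𝕜))

@[simp]
theorem fibre_add_apply {𝕜 : Type} [RCLike 𝕜] {n : ℕ} (a b : Fibre 𝕜 n) (k : Fin (n + 1)) :
    (a + b) k = a k + b k := rfl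

@[simp]
theorem fibre_smul_apply {𝕜 : Type} [RCLike 𝕜] {n : ℕ} (c : 𝕜) (a : Fibre 𝕜 n)
    (k : Fin (n + 1)) : (c • a) k = c • a k := rfl

theorem contDiff_fibre {𝕜 : Type} [RCLike 𝕜] {n : ℕ} {f : Rn n → Fibre 𝕜 n} :
    ContDiff ℝ ∞ f ↔ ∀ k, ContDiff ℝ ∞ fun x => f x k :=
  contDiff_pi (F' := fun k : Fin (n + 1) => Rn n [⋀^Fin k]→L[ℝ] 𝕜)

/-- `Ω(ℝⁿ) = ⨁ₖ Ωᵏ(ℝⁿ)`: the smooth differential forms on `ℝⁿ`, with coefficients in `𝕜`. -/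
def Form (𝕜 : Type) [RCLike 𝕜] (n : ℕ) : Submodule 𝕜 (Rn n → Fibre 𝕜 n) where
  carrier := {η | ContDiff ℝ ∞ η}
  add_mem' {X Y} (hX : ContDiff ℝ ∞ X) (hY : ContDiff ℝ ∞ Y) := hX.add hY
  zero_mem' := (contDiff_const : ContDiff ℝ ∞ fun _ : Rn n => (0 : Fibre 𝕜 n))
  smul_mem' c X (hX : ContDiff ℝ ∞ X) := hX.const_smul c

variable {𝕜 : Type} [RCLike 𝕜] {n : ℕ}

theorem smooth_form (η : Form 𝕜 n) : ContDiff ℝ ∞ η.1 := η.2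

theorem smooth_form_apply (η : Form 𝕜 n) (k : Fin (n + 1)) :
    ContDiff ℝ ∞ (fun x => η.1 x k) := contDiff_fibre.1 η.2 k

theorem smooth_vect (X : Vect n) : ContDiff ℝ ∞ X.1 := X.2

/-! ### The operators `d`, `L_X`, multiplication by `Div X`, restriction to `Ωᵏ` -/

theorem extDeriv_contDiff {k : ℕ} {η : Rn n → Rn n [⋀^Fin k]→L[ℝ] 𝕜} (h : ContDiff ℝ ∞ η) :
    ContDiff ℝ ∞ (extDeriv η) :=
  (ContinuousAlternatingMap.alternatizeUncurryFinCLM ℝ (Rn n) 𝕜 (n := k)).contDiff.comp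
    (h.fderiv_right (m := ∞) (by simp))

theorem extDeriv_smul_scalar {k : ℕ} {η : Rn n → Rn n [⋀^Fin k]→L[ℝ] 𝕜} (h : ContDiff ℝ ∞ η)
    (c : 𝕜) (x : Rn n) : extDeriv (fun y => c • η y) x = c • extDeriv η x := by
  have h' : fderiv ℝ (fun y => c • η y) x = c • fderiv ℝ η x :=
    fderiv_const_smul (h.differentiable (by simp) x) c
  ext v
  simp only [extDeriv, ContinuousAlternatingMap.smul_apply,
    ContinuousAlternatingMap.alternatizeUncurryFin_apply, h', smul_apply, Finset.smul_sum]
  exact Finset.sum_congr rfl fun i _ => smul_comm _ _ _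

/-- The de Rham differential on `Ω(ℝⁿ)`. -/
def d : Module.End 𝕜 (Form 𝕜 n) where
  toFun η := ⟨fun x => Fin.cases (motive := fun k : Fin (n + 1) => Rn n [⋀^Fin k]→L[ℝ] 𝕜)
      0 (fun k : Fin n => extDeriv (fun y => η.1 y k.castSucc) x), by
    refine contDiff_fibre.2 fun k => ?_
    refine Fin.cases ?_ (fun k => ?_) k
    · exact contDiff_const
    · exact extDeriv_contDiff (smooth_form_apply η k.castSucc)⟩
  map_add' η θ := by
    ext1
    funext x k
    refine Fin.cases ?_ (fun k => ?_) k
    · exact (add_zero (0 : Rn n [⋀^Fin 0]→L[ℝ] 𝕜)).symm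
    · exact extDeriv_fun_add ((smooth_form_apply η k.castSucc).differentiable (by simp) x)
        ((smooth_form_apply θ k.castSucc).differentiable (by simp) x)
  map_smul' c η := by
    ext1
    funext x k
    refine Fin.cases ?_ (fun k => ?_) k
    · exact (smul_zero c : c • (0 : Rn n [⋀^Fin 0]→L[ℝ] 𝕜) = 0).symm
    · exact extDeriv_smul_scalar (smooth_form_apply η k.castSucc) c x

/-- The Lie derivative along `X`: the value of `L_X η` at `x` on `(v₁, …, v_k)` is
`(∂_X η)(v₁, …, v_k) + ∑ᵢ η(v₁, …, DX(vᵢ), …, v_k)`. -/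
def lieDerivative (X : Vect n) : Module.End 𝕜 (Form 𝕜 n) where
  toFun η := ⟨fun x k => fderiv ℝ η.1 x (X.1 x) k +
      (η.1 x k).fderivCompContinuousLinearMap (ContinuousLinearMap.id ℝ (Rn n))
        (fderiv ℝ X.1 x), by
    refine contDiff_fibre.2 fun k => ?_
    refine ContDiff.add (contDiff_fibre.1 (((smooth_form η).fderiv_right (m := ∞)
      (by simp)).clm_apply (smooth_vect X)) k) ?_
    exact ((ContinuousAlternatingMap.fderivCompContinuousLinearMapCLM 𝕜
      (ContinuousLinearMap.id ℝ (Rn n))).contDiff.comp (smooth_form_apply η k)).clm_apply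
      ((smooth_vect X).fderiv_right (m := ∞) (by simp))⟩
  map_add' η θ := by
    ext1
    funext x k
    have h : fderiv ℝ (η.1 + θ.1) x = fderiv ℝ η.1 x + fderiv ℝ θ.1 x :=
      fderiv_add ((smooth_form η).differentiable (by simp) x)
        ((smooth_form θ).differentiable (by simp) x)
    change fderiv ℝ (η.1 + θ.1) x (X.1 x) k + (η.1 x k + θ.1 x k).fderivCompContinuousLinearMap
        (ContinuousLinearMap.id ℝ (Rn n)) (fderiv ℝ X.1 x) =
      (fderiv ℝ η.1 x (X.1 x) k +
        (η.1 x k).fderivCompContinuousLinearMap (ContinuousLinearMap.id ℝ (Rn n)) (fderiv ℝ X.1 x)) +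
      (fderiv ℝ θ.1 x (X.1 x) k +
        (θ.1 x k).fderivCompContinuousLinearMap (ContinuousLinearMap.id ℝ (Rn n)) (fderiv ℝ X.1 x))
    ext v
    simp only [h, add_apply, fibre_add_apply, ContinuousAlternatingMap.add_apply,
      ContinuousAlternatingMap.fderivCompContinuousLinearMap_apply, Finset.sum_add_distrib]
    abel
  map_smul' c η := by
    ext1
    funext x k
    have h : fderiv ℝ (c • η.1) x = c • fderiv ℝ η.1 x :=
      fderiv_const_smul ((smooth_form η).differentiable (by simp) x) c
    change fderiv ℝ (c • η.1) x (X.1 x) k + (c • η.1 x k).fderivCompContinuousLinearMap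
        (ContinuousLinearMap.id ℝ (Rn n)) (fderiv ℝ X.1 x) =
      c • (fderiv ℝ η.1 x (X.1 x) k +
        (η.1 x k).fderivCompContinuousLinearMap (ContinuousLinearMap.id ℝ (Rn n)) (fderiv ℝ X.1 x))
    ext v
    simp only [h, smul_apply, fibre_smul_apply, ContinuousAlternatingMap.smul_apply,
      ContinuousAlternatingMap.add_apply,
      ContinuousAlternatingMap.fderivCompContinuousLinearMap_apply, smul_add, Finset.smul_sum]

theorem divergence_contDiff (X : Vect n) : ContDiff ℝ ∞ (divergence X) :=
  (LinearMap.toContinuousLinearMap ((LinearMap.trace ℝ (Rn n)).comp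
    (ContinuousLinearMap.coeLM ℝ (M := Rn n) (N₃ := Rn n)))).contDiff.comp
    ((smooth_vect X).fderiv_right (m := ∞) (by simp))

/-- Multiplication of forms by the function `Div X`. -/
def divMul (X : Vect n) : Module.End 𝕜 (Form 𝕜 n) where
  toFun η := ⟨fun x => divergence X x • η.1 x, (divergence_contDiff X).smul (smooth_form η)⟩
  map_add' η θ := by
    ext1
    funext x
    exact smul_add _ _ _
  map_smul' c η := by
    ext1
    funext x
    exact smul_comm (divergence X x) c (η.1 x)

/-- The projection of `Ω(ℝⁿ)` onto `Ωᵏ(ℝⁿ)`; `A * restr k` is `A` restricted to `Ωᵏ(ℝⁿ)` (and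
extended by zero to the forms of the other degrees). -/
def restr (k : Fin (n + 1)) : Module.End 𝕜 (Form 𝕜 n) where
  toFun η := ⟨fun x j => if j = k then η.1 x j else 0, by
    refine contDiff_fibre.2 fun j => ?_
    by_cases h : j = k
    · simpa only [h, if_true] using smooth_form_apply η j
    · simpa only [h, if_false] using contDiff_const⟩
  map_add' η θ := by
    ext1
    funext x j
    change (if j = k then η.1 x j + θ.1 x j else 0) =
      (if j = k then η.1 x j else 0) + (if j = k then θ.1 x j else 0)
    split_ifs
    · rfl
    · exact (add_zero _).symm
  map_smul' c η := by
    ext1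
    funext x j
    change (if j = k then c • η.1 x j else 0) = c • (if j = k then η.1 x j else 0)
    split_ifs
    · rfl
    · exact (smul_zero c).symm

/-! ### The cocycles -/

/-- `C₀ᵏ(X) = Div X` on `Ωᵏ`, `0 ≤ k ≤ n`. -/
def C0 (k : Fin (n + 1)) (X : Vect n) : Module.End 𝕜 (Form 𝕜 n) := divMul X * restr k

/-- `C₁ᵏ(X) = d ∘ Div X` on `Ωᵏ`, `0 ≤ k ≤ n - 1`. -/
def C1 (k : Fin n) (X : Vect n) : Module.End 𝕜 (Form 𝕜 n) := d * divMul X * restr k.castSucc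

/-- `C̃₁ᵏ(X) = Div X ∘ d` on `Ωᵏ`, `0 ≤ k ≤ n - 1`. -/
def C1t (k : Fin n) (X : Vect n) : Module.End 𝕜 (Form 𝕜 n) := divMul X * d * restr k.castSucc

/-- `C₂ᵏ(X) = d ∘ Div X ∘ d` on `Ωᵏ`, `0 ≤ k ≤ n - 2`. -/
def C2 (k : Fin (n - 1)) (X : Vect n) : Module.End 𝕜 (Form 𝕜 n) :=
  d * divMul X * d * restr ⟨k, by omega⟩

/-! ### Differential operators -/

/-- Linear differential operators of finite order with smooth coefficients on `Ω(ℝⁿ)`: operators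
of the form `(P η)(x) = ∑_{j ≤ r} aⱼ(x) (Dʲη(x))`, where the `aⱼ(x)` are linear maps depending
smoothly on `x`. -/
def IsDiffOp (P : Module.End 𝕜 (Form 𝕜 n)) : Prop :=
  ∃ (r : ℕ) (a : (j : ℕ) → Rn n → ((Rn n [×j]→L[ℝ] Fibre 𝕜 n) →L[ℝ] Fibre 𝕜 n)),
    (∀ j, ContDiff ℝ ∞ (a j)) ∧
    ∀ (η : Form 𝕜 n) (x : Rn n),
      (P η).1 x = ∑ j ∈ Finset.range (r + 1), a j x (iteratedFDeriv ℝ j η.1 x)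

/-- Differentiable 1-cochains on `Vect(ℝⁿ)` with values in the differential operators on `Ω(ℝⁿ)`:
maps `c` with `(c(X) η)(x) = ∑_{i, j ≤ r} b_{ij}(x) (Dⁱ X(x), Dʲ η(x))`, where the `b_{ij}(x)` are
bilinear and depend smoothly on `x`. Such a `c` is `ℝ`-linear in `X`. -/
def IsDiffCochain (c : Vect n → Module.End 𝕜 (Form 𝕜 n)) : Prop :=
  ∃ (r : ℕ) (b : (i j : ℕ) → Rn n →
      ((Rn n [×i]→L[ℝ] Rn n) →L[ℝ] (Rn n [×j]→L[ℝ] Fibre 𝕜 n) →L[ℝ] Fibre 𝕜 n)),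
    (∀ i j, ContDiff ℝ ∞ (b i j)) ∧
    ∀ (X : Vect n) (η : Form 𝕜 n) (x : Rn n),
      (c X η).1 x = ∑ i ∈ Finset.range (r + 1), ∑ j ∈ Finset.range (r + 1),
        b i j x (iteratedFDeriv ℝ i X.1 x) (iteratedFDeriv ℝ j η.1 x)

/-! ### Deformations with base `𝕜[[σ]] / J` -/

variable {σ τ : Type}

/-- Formal power series in the parameters `σ` with coefficients in `End(Ω(ℝⁿ))`. -/
abbrev OpSeries (σ 𝕜 : Type) [RCLike 𝕜] (n : ℕ) := MvPowerSeries σ (Module.End 𝕜 (Form 𝕜 n))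

/-- The embedding of `𝕜[[σ]]` into the centre of `End(Ω(ℝⁿ))[[σ]]`. -/
def scalars : MvPowerSeries σ 𝕜 →+* OpSeries σ 𝕜 n :=
  MvPowerSeries.map (algebraMap 𝕜 (Module.End 𝕜 (Form 𝕜 n)))

/-- Two series represent the same element of `End(Ω(ℝⁿ)) ⊗̂ (𝕜[[σ]] / J)`: their difference lies
in `J · End(Ω(ℝⁿ))[[σ]]`. -/
def CongrMod (J : Ideal (MvPowerSeries σ 𝕜)) (f g : OpSeries σ 𝕜 n) : Prop :=
  f - g ∈ J.map (scalars (σ := σ) (𝕜 := 𝕜) (n := n))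

/-- The series `ρ(X) = L_X + (terms of positive order in the parameters)`, with differentiable
coefficients, is a deformation of the `Vect(ℝⁿ)`-action on `Ω(ℝⁿ)` with base `𝕜[[σ]] / J`: the
homomorphism condition `[ρ(X), ρ(Y)] = ρ([X, Y])` holds over `𝕜[[σ]] / J`. -/
structure IsDeformation (J : Ideal (MvPowerSeries σ 𝕜)) (ρ : Vect n → OpSeries σ 𝕜 n) :
    Prop where
  differentiable : ∀ α : σ →₀ ℕ, IsDiffCochain fun X => MvPowerSeries.coeff α (ρ X)
  constantCoeff_eq : ∀ X, MvPowerSeries.constantCoeff (ρ X) = lieDerivative X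
  hom : ∀ X Y, CongrMod J (ρ X * ρ Y - ρ Y * ρ X) (ρ (bracket X Y))

/-- Equivalence of deformations with the same base `𝕜[[σ]] / J`: they are intertwined by the inner
automorphism `f ↦ U f U⁻¹` given by a series `U = 1 + (terms of positive order)` of differential
operators. -/
def Equivalent (J : Ideal (MvPowerSeries σ 𝕜)) (ρ ρ' : Vect n → OpSeries σ 𝕜 n) : Prop :=
  ∃ U : (OpSeries σ 𝕜 n)ˣ,
    (∀ α : σ →₀ ℕ, IsDiffOp (MvPowerSeries.coeff α U.1)) ∧
    MvPowerSeries.constantCoeff U.1 = 1 ∧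
    ∀ X, CongrMod J (ρ' X) (U.1 * ρ X * (U⁻¹).1)

/-- The first-order family `ρ₁` integrates to a formal deformation with base `𝕜[[σ]] / J`: there is
a deformation whose terms of order `≤ 1` in the parameters are those of `ρ₁`. -/
def Integrates (J : Ideal (MvPowerSeries σ 𝕜)) (ρ₁ : Vect n → OpSeries σ 𝕜 n) : Prop :=
  ∃ ρ : Vect n → OpSeries σ 𝕜 n, IsDeformation J ρ ∧
    ∀ X (α : σ →₀ ℕ), α.degree ≤ 1 →
      MvPowerSeries.coeff α (ρ X) = MvPowerSeries.coeff α (ρ₁ X)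

/-- The maximal ideal of `𝕜[[σ]]`. -/
def maxIdeal (σ 𝕜 : Type) [RCLike 𝕜] : Ideal (MvPowerSeries σ 𝕜) :=
  RingHom.ker MvPowerSeries.constantCoeff

/-- Ideals of `𝕜[[σ]]` generated by homogeneous elements. -/
def IsHomogeneousIdeal (I : Ideal (MvPowerSeries σ 𝕜)) : Prop :=
  ∃ S : Set (MvPowerSeries σ 𝕜), (∀ f ∈ S, ∃ p : ℕ, f.IsHomogeneous p) ∧ I = Ideal.span S

/-- Substitution of the series `s i` (without constant term) for the parameters `i : σ` in an
operator-valued series: `∑_α f_α tᵅ ↦ ∑_α f_α sᵅ`. -/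
def substitute (s : σ → MvPowerSeries τ 𝕜) (f : OpSeries σ 𝕜 n) : OpSeries τ 𝕜 n :=
  fun β => ∑ᶠ α : σ →₀ ℕ,
    MvPowerSeries.coeff β (α.prod fun i e => s i ^ e) • MvPowerSeries.coeff α f

/-- The deformation `ρ'` with base `𝕜[[τ]] / J` is equivalent to the deformation `(Id ⊗ ψ) ∘ ρ`
induced from `ρ`, of base `𝕜[[σ]] / I`, by the homomorphism `ψ` of the bases. Here `(Id ⊗ ψ) ∘ ρ` is
computed by substituting for each parameter a series without constant term that represents its image
under `ψ`. -/
def IsInducedBy (I : Ideal (MvPowerSeries σ 𝕜)) (ρ : Vect n → OpSeries σ 𝕜 n)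
    (J : Ideal (MvPowerSeries τ 𝕜)) (ρ' : Vect n → OpSeries τ 𝕜 n)
    (ψ : (MvPowerSeries σ 𝕜 ⧸ I) →ₐ[𝕜] (MvPowerSeries τ 𝕜 ⧸ J)) : Prop :=
  ∃ s : σ → MvPowerSeries τ 𝕜,
    (∀ i, MvPowerSeries.constantCoeff (s i) = 0) ∧
    (∀ i, Ideal.Quotient.mk J (s i) = ψ (Ideal.Quotient.mk I (MvPowerSeries.X i))) ∧
    Equivalent J ρ' fun X => substitute s (ρ X)

/-- The deformation `ρ` with base `𝕜[[σ]] / I` is miniversal: every deformation `ρ'` with a base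
`A' = 𝕜[[t₁, …, t_m]] / J` is, up to equivalence, induced from `ρ` by a unital homomorphism of the
bases, and this homomorphism is unique if the square of the maximal ideal of `A'` is zero. -/
def IsMiniversal (I : Ideal (MvPowerSeries σ 𝕜)) (ρ : Vect n → OpSeries σ 𝕜 n) : Prop :=
  IsDeformation I ρ ∧
  ∀ (m : ℕ) (J : Ideal (MvPowerSeries (Fin m) 𝕜)) (ρ' : Vect n → OpSeries (Fin m) 𝕜 n),
    IsDeformation J ρ' →
    (∃ ψ, IsInducedBy I ρ J ρ' ψ) ∧
    (maxIdeal (Fin m) 𝕜 ^ 2 ≤ J →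
      ∀ ψ ψ', IsInducedBy I ρ J ρ' ψ → IsInducedBy I ρ J ρ' ψ' → ψ = ψ')

/-! ### The infinitesimal deformation and the quadratic relations -/

/-- The `4 n` parameters `t₀ᵏ` (`0 ≤ k ≤ n`), `t₁ᵏ`, `t̃₁ᵏ` (`0 ≤ k ≤ n - 1`) and `t₂ᵏ`
(`0 ≤ k ≤ n - 2`). -/
inductive Param (n : ℕ) : Type
  | t0 (k : Fin (n + 1))
  | t1 (k : Fin n)
  | t1t (k : Fin n)
  | t2 (k : Fin (n - 1))

/-- The labels of the `4 n - 4` relations. -/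
inductive Rel (n : ℕ) : Type
  | R1 (k : Fin n)
  | R2 (k : Fin (n - 1))
  | R2t (k : Fin (n - 1))
  | R3 (k : Fin (n - 2))

open Param in
/-- The quadratic expressions `R₁ᵏ`, `R₂ᵏ`, `R̃₂ᵏ`, `R₃ᵏ` in the values `t` of the parameters. -/
def relation {A : Type} [CommRing A] (t : Param n → A) : Rel n → A
  | .R1 k => t (t0 k.castSucc) * t (t1t k) + t (t0 k.succ) * t (t1 k)
  | .R2 k => t (t0 ⟨k, by omega⟩) * t (t2 k) + t (t1 ⟨k + 1, by omega⟩) * t (t1 ⟨k, by omega⟩)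
  | .R2t k => t (t0 ⟨k + 2, by omega⟩) * t (t2 k) + t (t1t ⟨k + 1, by omega⟩) * t (t1t ⟨k, by omega⟩)
  | .R3 k => t (t1 ⟨k + 2, by omega⟩) * t (t2 ⟨k, by omega⟩) +
      t (t1t ⟨k, by omega⟩) * t (t2 ⟨k + 1, by omega⟩)

/-- `L_X + ∑ₖ t₀ᵏ C₀ᵏ(X) + ∑ₖ (t₁ᵏ C₁ᵏ(X) + t̃₁ᵏ C̃₁ᵏ(X)) + ∑ₖ t₂ᵏ C₂ᵏ(X)`, for values `t` of the
`4 n` parameters in `𝕜[[σ]]`. -/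
def firstOrder (t : Param n → MvPowerSeries σ 𝕜) (X : Vect n) : OpSeries σ 𝕜 n :=
  MvPowerSeries.C (lieDerivative X)
    + ∑ k : Fin (n + 1), scalars (t (.t0 k)) * MvPowerSeries.C (C0 k X)
    + ∑ k : Fin n, (scalars (t (.t1 k)) * MvPowerSeries.C (C1 k X)
        + scalars (t (.t1t k)) * MvPowerSeries.C (C1t k X))
    + ∑ k : Fin (n - 1), scalars (t (.t2 k)) * MvPowerSeries.C (C2 k X)

/-- The infinitesimal deformation of the `Vect(ℝⁿ)`-action on `Ω(ℝⁿ)` with `4 n` independent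
parameters. -/
def infDeformation (𝕜 : Type) [RCLike 𝕜] (n : ℕ) : Vect n → OpSeries (Param n) 𝕜 n :=
  firstOrder MvPowerSeries.X

/-- The quadratic relations, as elements of the algebra of power series in the `4 n` parameters. -/
def quadRel (𝕜 : Type) [RCLike 𝕜] (n : ℕ) : Rel n → MvPowerSeries (Param n) 𝕜 :=
  relation MvPowerSeries.X

end FormDeformation

end

set_option linter.unusedVariables false

noncomputable section

namespace FormDeformation

variable {𝕜 : Type} [RCLike 𝕜] {n : ℕ}

/-! Three facts carry the theorem, all about the complex of differentiable cochains on vector fields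
with values in the differential operators on forms.

First, the first cohomology is spanned by the `4n` classes of the cocycles `coc p`, built from the
divergence, `d` and the projections to the degrees (`IsCocycle.exists_cobd`). Second, the family of
order one has a curvature that is known exactly: after the cocycle identities only its quadratic
part remains, and since `d² = 0` and multiplications by functions commute, this part is a sum of the
quadratic relations times fixed operators `curvRel` (`curvature_firstOrder`, from
`curvature_algebra`). Third, these operators are independent modulo coboundaries: explicit
evaluations at the origin, on the Euler field and the fields `xᵢ² ∂ᵢ`, form a dual family and
annihilate every coboundary (`exists_relTest`). Similar evaluations separate the classes of the `coc
p` (`exists_paramTest`).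

The cohomology is computed by normalizing a cocycle on polynomial fields of increasing degree. On
constant fields it is removed by the Poincaré lemma (`exists_commutator_pd`). Its values on linear
fields are then translation invariant, so they form a `gl`-cocycle in a finite-dimensional module.
An inner product for which `xᵢ ∂ⱼ` and `xⱼ ∂ᵢ` are adjoint makes the Casimir operator semisimple,
and the cocycle becomes the trace times an invariant operator. Weight arguments on the fibre show
that the invariants are spanned by the degree projections and by `d` composed with them. Subtracting
multiples of `Div X` and `d ∘ Div X` leaves a cocycle vanishing on affine fields. On quadratic
fields it is given by a `gl`-equivariant family of operators indexed like `dxₘ`, classified in the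
same way. For `n ≥ 2` all fields of higher degree are combinations of brackets of fields of lower
degree of at least two, so nothing else remains.

Part (i): a deformation agreeing with the family to order one has, through degree two, the same
curvature up to a coboundary. Applying the evaluations to it yields elements of the ideal that agree
with the relations modulo cubic terms. For homogeneous ideals and for one parameter with zero ideal
the cubic ambiguity disappears; for the family itself the evaluations give the relations exactly.

Part (ii): the conjugating series, the values of the parameters and an error term in `J` are
constructed together, exponent by exponent along a monomial order. At a leading exponent of `J` the
discrepancy is absorbed by the error term (`exists_division`). At any other exponent it is a cocycle
(`cobd₂_coeff_defect`): each relation agrees up to this exponent with an element of `J`, so the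
coboundary of the discrepancy is the coefficient, at a non-leading exponent, of an element of `J`
times operators with no earlier terms. Hence it splits into a coboundary, absorbed by the
conjugation, and a combination of the `coc p`, absorbed by the parameters.

Part (iii): the values of the parameters in (ii) satisfy the relations and so define the
homomorphism of the bases. If the square of the maximal ideal is zero in the base, the evaluations
dual to the `coc p` recover these values from the equivalence class. -/

/-- The standard basis vectors of `ℝⁿ`. -/
def basisVec (i : Fin n) : Rn n := EuclideanSpace.single i 1

theorem basisVec_apply (i j : Fin n) : basisVec i j = if j = i then 1 else 0 := by
  simp [basisVec]

theorem sum_smul_basisVec (v : Rn n) : ∑ i, v i • basisVec i = v := by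
  ext j
  simp [basisVec_apply]

/-! ### Smooth functions and their partial derivatives -/

/-- The algebra of smooth real functions on `ℝⁿ`. -/
def Fn (n : ℕ) : Subalgebra ℝ (Rn n → ℝ) where
  carrier := {f | ContDiff ℝ ∞ f}
  mul_mem' {f g} (hf : ContDiff ℝ ∞ f) (hg : ContDiff ℝ ∞ g) := hf.mul hg
  add_mem' {f g} (hf : ContDiff ℝ ∞ f) (hg : ContDiff ℝ ∞ g) := hf.add hg
  algebraMap_mem' r := (contDiff_const : ContDiff ℝ ∞ fun _ : Rn n => r)

theorem smooth_fn (f : Fn n) : ContDiff ℝ ∞ f.1 := f.2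

theorem differentiable_fn (f : Fn n) : Differentiable ℝ f.1 := (smooth_fn f).differentiable (by simp)

theorem differentiable_form (η : Form 𝕜 n) : Differentiable ℝ η.1 :=
  (smooth_form η).differentiable (by simp)

theorem differentiable_vect (X : Vect n) : Differentiable ℝ X.1 :=
  (smooth_vect X).differentiable (by simp)

/-- The coordinate functions. -/
def coord (i : Fin n) : Fn n :=
  ⟨fun x => x i, ((EuclideanSpace.proj (𝕜 := ℝ) i : Rn n →L[ℝ] ℝ).contDiff (n := ∞))⟩

/-- Partial derivatives of functions. -/
def fnPd (i : Fin n) : Fn n →ₗ[ℝ] Fn n where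
  toFun f := ⟨fun x => fderiv ℝ f.1 x (basisVec i),
    ((smooth_fn f).fderiv_right (m := ∞) (by simp)).clm_apply contDiff_const⟩
  map_add' f g := by
    ext x
    change fderiv ℝ (f.1 + g.1) x (basisVec i) = _
    rw [fderiv_add (differentiable_fn f x) (differentiable_fn g x)]; rfl
  map_smul' c f := by
    ext x
    change fderiv ℝ (c • f.1) x (basisVec i) = _
    rw [fderiv_const_smul (differentiable_fn f x)]; rfl

theorem fnPd_apply (i : Fin n) (f : Fn n) (x : Rn n) :
    (fnPd i f).1 x = fderiv ℝ f.1 x (basisVec i) := rfl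

theorem fnPd_mul (i : Fin n) (f g : Fn n) : fnPd i (f * g) = f * fnPd i g + fnPd i f * g := by
  ext x
  change fderiv ℝ (f.1 * g.1) x (basisVec i) =
    f.1 x * fderiv ℝ g.1 x (basisVec i) + fderiv ℝ f.1 x (basisVec i) * g.1 x
  rw [fderiv_mul (differentiable_fn f x) (differentiable_fn g x)]
  simp [mul_comm]

theorem fnPd_coord (i j : Fin n) : fnPd i (coord j) = if j = i then 1 else 0 := by
  ext x
  have h : fderiv ℝ (coord j).1 x = (EuclideanSpace.proj (𝕜 := ℝ) j : Rn n →L[ℝ] ℝ) :=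
    (EuclideanSpace.proj (𝕜 := ℝ) j : Rn n →L[ℝ] ℝ).hasFDerivAt.fderiv
  rw [fnPd_apply, h]
  split_ifs with hij
  · subst hij; simp [basisVec_apply]
  · simp [basisVec_apply, hij]

theorem fnPd_algebraMap (i : Fin n) (c : ℝ) : fnPd i (algebraMap ℝ (Fn n) c) = 0 := by
  ext x
  change fderiv ℝ (fun _ : Rn n => c) x (basisVec i) = 0
  simp

theorem fnPd_one (i : Fin n) : fnPd i (1 : Fn n) = 0 := by
  simpa using fnPd_algebraMap i 1

theorem fderiv_fderiv_apply {F : Type*} [NormedAddCommGroup F] [NormedSpace ℝ F] {f : Rn n → F}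
    (hf : ContDiff ℝ ∞ f) (x v w : Rn n) :
    fderiv ℝ (fun y => fderiv ℝ f y v) x w = fderiv ℝ (fderiv ℝ f) x w v := by
  have h : DifferentiableAt ℝ (fderiv ℝ f) x :=
    (hf.fderiv_right (m := ∞) (by simp)).differentiable (by simp) x
  rw [fderiv_clm_apply h (differentiableAt_const v)]
  simp

theorem fderiv_fderiv_symm {F : Type*} [NormedAddCommGroup F] [NormedSpace ℝ F] {f : Rn n → F}
    (hf : ContDiff ℝ ∞ f) (x v w : Rn n) :
    fderiv ℝ (fderiv ℝ f) x w v = fderiv ℝ (fderiv ℝ f) x v w :=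
  (hf.contDiffAt.isSymmSndFDerivAt (by
    simp [minSmoothness_of_isRCLikeNormedField]; exact WithTop.coe_le_coe.2 le_top)).eq w v

theorem fnPd_comm (i j : Fin n) (f : Fn n) : fnPd i (fnPd j f) = fnPd j (fnPd i f) := by
  ext x
  change fderiv ℝ (fun y => fderiv ℝ f.1 y (basisVec j)) x (basisVec i) =
    fderiv ℝ (fun y => fderiv ℝ f.1 y (basisVec i)) x (basisVec j)
  rw [fderiv_fderiv_apply (smooth_fn f), fderiv_fderiv_apply (smooth_fn f),
    fderiv_fderiv_symm (smooth_fn f)]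

/-! ### Elementary operators on forms -/

@[ext] theorem form_ext {η θ : Form 𝕜 n} (h : ∀ x, η.1 x = θ.1 x) : η = θ :=
  Subtype.ext (funext h)

theorem fibre_ext {a b : Fibre 𝕜 n} (h : ∀ k, a k = b k) : a = b := funext h

@[simp] theorem form_add_apply (η θ : Form 𝕜 n) (x : Rn n) : (η + θ).1 x = η.1 x + θ.1 x := rfl
@[simp] theorem form_sub_apply (η θ : Form 𝕜 n) (x : Rn n) : (η - θ).1 x = η.1 x - θ.1 x := rfl
@[simp] theorem form_smul_apply (c : 𝕜) (η : Form 𝕜 n) (x : Rn n) : (c • η).1 x = c • η.1 x := rfl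
@[simp] theorem fibre_zero_apply (k : Fin (n + 1)) : (0 : Fibre 𝕜 n) k = 0 := rfl
@[simp] theorem fibre_rsmul_apply (c : ℝ) (a : Fibre 𝕜 n) (k : Fin (n + 1)) :
    (c • a) k = c • a k := rfl

theorem form_sum_apply {ι : Type*} (s : Finset ι) (η : ι → Form 𝕜 n) (x : Rn n) :
    (∑ i ∈ s, η i).1 x = ∑ i ∈ s, (η i).1 x := by
  classical
  induction s using Finset.induction_on with
  | empty => simp
  | insert a s ha ih => simp [Finset.sum_insert ha, ih]

theorem fibre_sum_apply {ι : Type*} (s : Finset ι) (η : ι → Fibre 𝕜 n) (k : Fin (n + 1)) :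
    (∑ i ∈ s, η i) k = ∑ i ∈ s, η i k := by
  classical
  induction s using Finset.induction_on with
  | empty => simp
  | insert a s ha ih => simp [Finset.sum_insert ha, ih]

/-- Multiplication of forms by a smooth function. -/
def mulF : Fn n →+* Module.End 𝕜 (Form 𝕜 n) where
  toFun f :=
    { toFun := fun η => ⟨fun x => f.1 x • η.1 x, (smooth_fn f).smul (smooth_form η)⟩
      map_add' := fun η θ => form_ext fun x => smul_add _ _ _
      map_smul' := fun c η => form_ext fun x => smul_comm (f.1 x) c (η.1 x) }
  map_zero' := LinearMap.ext fun η => form_ext fun x => zero_smul _ _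
  map_one' := LinearMap.ext fun η => form_ext fun x => one_smul _ _
  map_add' f g := LinearMap.ext fun η => form_ext fun x => add_smul _ _ _
  map_mul' f g := LinearMap.ext fun η => form_ext fun x => mul_smul _ _ _

theorem mulF_apply (f : Fn n) (η : Form 𝕜 n) (x : Rn n) :
    (mulF f η).1 x = f.1 x • η.1 x := rfl

/-- Partial derivatives of forms. -/
def pd (i : Fin n) : Module.End 𝕜 (Form 𝕜 n) where
  toFun η := ⟨fun x => fderiv ℝ η.1 x (basisVec i),
    ((smooth_form η).fderiv_right (m := ∞) (by simp)).clm_apply contDiff_const⟩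
  map_add' η θ := by
    ext1 x
    change fderiv ℝ (η.1 + θ.1) x (basisVec i) = _
    rw [fderiv_add (differentiable_form η x) (differentiable_form θ x)]; rfl
  map_smul' c η := by
    ext1 x
    change fderiv ℝ (c • η.1) x (basisVec i) = _
    rw [fderiv_const_smul (differentiable_form η x)]; rfl

theorem pd_apply (i : Fin n) (η : Form 𝕜 n) (x : Rn n) :
    (pd i η).1 x = fderiv ℝ η.1 x (basisVec i) := rfl

theorem fderiv_fibre_apply (η : Form 𝕜 n) (x v : Rn n) (k : Fin (n + 1)) :
    fderiv ℝ η.1 x v k = fderiv ℝ (fun y => η.1 y k) x v := by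
  have h := hasFDerivAt_pi'.1 (differentiable_form η x).hasFDerivAt k
  exact (DFunLike.congr_fun h.fderiv v).symm

theorem pd_apply_apply (i : Fin n) (η : Form 𝕜 n) (x : Rn n) (k : Fin (n + 1)) :
    (pd i η).1 x k = fderiv ℝ (fun y => η.1 y k) x (basisVec i) :=
  fderiv_fibre_apply η x _ k

theorem fderiv_eq_sum_pd (η : Form 𝕜 n) (x v : Rn n) :
    fderiv ℝ η.1 x v = ∑ i, v i • (pd i η).1 x := by
  conv_lhs => rw [← sum_smul_basisVec v]
  rw [map_sum]
  exact Finset.sum_congr rfl fun i _ => by rw [map_smul]; rfl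

theorem pd_comm (i j : Fin n) : (pd i * pd j : Module.End 𝕜 (Form 𝕜 n)) = pd j * pd i := by
  refine LinearMap.ext fun η => form_ext fun x => ?_
  change fderiv ℝ (fun y => fderiv ℝ η.1 y (basisVec j)) x (basisVec i) =
    fderiv ℝ (fun y => fderiv ℝ η.1 y (basisVec i)) x (basisVec j)
  rw [fderiv_fderiv_apply (smooth_form η), fderiv_fderiv_apply (smooth_form η),
    fderiv_fderiv_symm (smooth_form η)]

theorem pd_mulF (i : Fin n) (f : Fn n) :
    (pd i * mulF f : Module.End 𝕜 (Form 𝕜 n)) = mulF f * pd i + mulF (fnPd i f) := by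
  refine LinearMap.ext fun η => form_ext fun x => ?_
  change fderiv ℝ (fun y => f.1 y • η.1 y) x (basisVec i) =
    f.1 x • fderiv ℝ η.1 x (basisVec i) + fderiv ℝ f.1 x (basisVec i) • η.1 x
  rw [fderiv_fun_smul (differentiable_fn f x) (differentiable_form η x)]
  simp

/-- The projection onto `k`-forms, for any natural number `k`. -/
def degProj (k : ℕ) : Module.End 𝕜 (Form 𝕜 n) where
  toFun η := ⟨fun x j => if (j : ℕ) = k then η.1 x j else 0, by
    refine contDiff_fibre.2 fun j => ?_
    by_cases h : (j : ℕ) = k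
    · simpa only [h, if_true] using smooth_form_apply η j
    · simpa only [h, if_false] using contDiff_const⟩
  map_add' η θ := by
    refine form_ext fun x => fibre_ext fun j => ?_
    change (if (j : ℕ) = k then η.1 x j + θ.1 x j else 0) =
      (if (j : ℕ) = k then η.1 x j else 0) + (if (j : ℕ) = k then θ.1 x j else 0)
    split_ifs <;> simp
  map_smul' c η := by
    refine form_ext fun x => fibre_ext fun j => ?_
    change (if (j : ℕ) = k then c • η.1 x j else 0) = c • (if (j : ℕ) = k then η.1 x j else 0)
    split_ifs <;> simp

theorem degProj_apply (k : ℕ) (η : Form 𝕜 n) (x : Rn n) (j : Fin (n + 1)) :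
    (degProj k η).1 x j = if (j : ℕ) = k then η.1 x j else 0 := rfl

theorem restr_eq (k : Fin (n + 1)) : (restr k : Module.End 𝕜 (Form 𝕜 n)) = degProj k := by
  refine LinearMap.ext fun η => form_ext fun x => fibre_ext fun j => ?_
  change (if j = k then η.1 x j else 0) = if (j : ℕ) = k then η.1 x j else 0
  simp [Fin.ext_iff]

/-- Exterior multiplication by `dxᵢ`. -/
def wedge (i : Fin n) : Module.End 𝕜 (Form 𝕜 n) where
  toFun η := ⟨fun x => Fin.cases (motive := fun k : Fin (n + 1) => Rn n [⋀^Fin k]→L[ℝ] 𝕜)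
      0 (fun k : Fin n => ContinuousAlternatingMap.alternatizeUncurryFin
        ((EuclideanSpace.proj (𝕜 := ℝ) i : Rn n →L[ℝ] ℝ).smulRight (η.1 x k.castSucc))), by
    refine contDiff_fibre.2 fun k => ?_
    refine Fin.cases ?_ (fun k => ?_) k
    · exact contDiff_const
    · let Φ : (Rn n [⋀^Fin k]→L[ℝ] 𝕜) →L[ℝ] (Rn n →L[ℝ] Rn n [⋀^Fin k]→L[ℝ] 𝕜) :=
        ContinuousLinearMap.smulRightL ℝ (Rn n) (Rn n [⋀^Fin k]→L[ℝ] 𝕜)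
          (EuclideanSpace.proj (𝕜 := ℝ) i : Rn n →L[ℝ] ℝ)
      let Ψ : (Rn n [⋀^Fin k]→L[ℝ] 𝕜) →L[ℝ] (Rn n [⋀^Fin (k + 1)]→L[ℝ] 𝕜) :=
        (ContinuousAlternatingMap.alternatizeUncurryFinCLM ℝ (Rn n) 𝕜 (n := k)) ∘L Φ
      exact Ψ.contDiff.comp (smooth_form_apply η k.castSucc)⟩
  map_add' η θ := by
    refine form_ext fun x => fibre_ext fun k => ?_
    refine Fin.cases ?_ (fun k => ?_) k
    · exact (add_zero (0 : Rn n [⋀^Fin 0]→L[ℝ] 𝕜)).symm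
    · ext v
      change (ContinuousAlternatingMap.alternatizeUncurryFin _) v =
        ((ContinuousAlternatingMap.alternatizeUncurryFin _ +
        ContinuousAlternatingMap.alternatizeUncurryFin _ : Rn n [⋀^Fin (k + 1)]→L[ℝ] 𝕜)) v
      rw [ContinuousAlternatingMap.add_apply]
      simp only [ContinuousAlternatingMap.alternatizeUncurryFin_apply, ← Finset.sum_add_distrib]
      refine Finset.sum_congr rfl fun j _ => ?_
      simp
  map_smul' c η := by
    refine form_ext fun x => fibre_ext fun k => ?_
    refine Fin.cases ?_ (fun k => ?_) k
    · exact (smul_zero c : c • (0 : Rn n [⋀^Fin 0]→L[ℝ] 𝕜) = 0).symm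
    · ext v
      change (ContinuousAlternatingMap.alternatizeUncurryFin _) v =
        (c • (ContinuousAlternatingMap.alternatizeUncurryFin _ :
          Rn n [⋀^Fin (k + 1)]→L[ℝ] 𝕜)) v
      rw [ContinuousAlternatingMap.smul_apply]
      simp only [ContinuousAlternatingMap.alternatizeUncurryFin_apply, Finset.smul_sum]
      refine Finset.sum_congr rfl fun j _ => ?_
      simp only [ContinuousLinearMap.smulRight_apply, ContinuousAlternatingMap.smul_apply,
        form_smul_apply, fibre_smul_apply]
      rw [smul_comm _ c, smul_comm _ c]

@[simp] theorem wedge_zero_apply (i : Fin n) (η : Form 𝕜 n) (x : Rn n) :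
    (wedge i η).1 x 0 = 0 := rfl

/-- Interior multiplication by `∂ⱼ` on the fibre. -/
def fibreInterior (j : Fin n) (a : Fibre 𝕜 n) : Fibre 𝕜 n :=
  Fin.lastCases (motive := fun k : Fin (n + 1) => Rn n [⋀^Fin k]→L[ℝ] 𝕜)
    0 (fun k : Fin n => (a k.succ).curryLeft (basisVec j))

theorem fibreInterior_last (j : Fin n) (a : Fibre 𝕜 n) : fibreInterior j a (Fin.last n) = 0 := by
  simp only [fibreInterior, Fin.lastCases_last]

theorem fibreInterior_castSucc (j : Fin n) (a : Fibre 𝕜 n) (k : Fin n) :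
    fibreInterior j a k.castSucc = (a k.succ).curryLeft (basisVec j) := by
  simp only [fibreInterior, Fin.lastCases_castSucc]

/-- Interior multiplication by `∂ⱼ`. -/
def interior (j : Fin n) : Module.End 𝕜 (Form 𝕜 n) where
  toFun η := ⟨fun x => fibreInterior j (η.1 x), by
    refine contDiff_fibre.2 fun k => ?_
    refine Fin.lastCases ?_ (fun k => ?_) k
    · simp only [fibreInterior_last]; exact contDiff_const
    · simp only [fibreInterior_castSucc]
      let Φ : (Rn n [⋀^Fin (k + 1)]→L[ℝ] 𝕜) →L[ℝ] (Rn n →L[ℝ] Rn n [⋀^Fin k]→L[ℝ] 𝕜) :=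
        (ContinuousAlternatingMap.curryLeftLI (𝕜 := ℝ)).toContinuousLinearMap
      exact (Φ.contDiff.comp (smooth_form_apply η k.succ)).clm_apply contDiff_const⟩
  map_add' η θ := by
    refine form_ext fun x => fibre_ext fun k => ?_
    change fibreInterior j (η.1 x + θ.1 x) k = fibreInterior j (η.1 x) k + fibreInterior j (θ.1 x) k
    refine Fin.lastCases ?_ (fun k => ?_) k
    · simp only [fibreInterior_last, add_zero]
    · simp only [fibreInterior_castSucc]
      rfl
  map_smul' c η := by
    refine form_ext fun x => fibre_ext fun k => ?_
    change fibreInterior j (c • η.1 x) k = c • fibreInterior j (η.1 x) k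
    refine Fin.lastCases ?_ (fun k => ?_) k
    · simp only [fibreInterior_last, smul_zero]
    · simp only [fibreInterior_castSucc]
      rfl

@[simp] theorem interior_last_apply (j : Fin n) (η : Form 𝕜 n) (x : Rn n) :
    (interior j η).1 x (Fin.last n) = 0 := fibreInterior_last j _

theorem interior_castSucc_apply (j : Fin n) (η : Form 𝕜 n) (x : Rn n) (k : Fin n) :
    (interior j η).1 x k.castSucc = (η.1 x k.succ).curryLeft (basisVec j) :=
  fibreInterior_castSucc j _ k

/-- A fibrewise operation that does not depend on the point passes through differentiation. This is
the common source of the commutation of `pd` with `wedge`, `interior` and `degProj`. -/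
theorem pd_fibrewise {j k : Fin (n + 1)}
    (Ψ : (Rn n [⋀^Fin j]→L[ℝ] 𝕜) →L[ℝ] (Rn n [⋀^Fin k]→L[ℝ] 𝕜)) {η θ : Form 𝕜 n}
    (h : ∀ x, θ.1 x k = Ψ (η.1 x j)) (m : Fin n) (x : Rn n) :
    (pd m θ).1 x k = Ψ ((pd m η).1 x j) := by
  rw [pd_apply_apply, pd_apply_apply, funext h]
  have h1 : DifferentiableAt ℝ (fun y => η.1 y j) x :=
    (smooth_form_apply η j).differentiable (by simp) x
  have h2 := (Ψ.hasFDerivAt (x := η.1 x j)).comp x h1.hasFDerivAt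
  rw [show (fun y => Ψ (η.1 y j)) = Ψ ∘ (fun y => η.1 y j) from rfl, h2.fderiv]
  rfl

theorem pd_eq_zero_of_component {k : Fin (n + 1)} {θ : Form 𝕜 n}
    (h : ∀ x, θ.1 x k = 0) (m : Fin n) (x : Rn n) : (pd m θ).1 x k = 0 := by
  rw [pd_apply_apply, funext h]
  simp

/-- `wedge i` as a continuous linear map from `k`-forms to `(k+1)`-forms. -/
def wedgeCLM (i : Fin n) (k : ℕ) : (Rn n [⋀^Fin k]→L[ℝ] 𝕜) →L[ℝ] (Rn n [⋀^Fin (k + 1)]→L[ℝ] 𝕜) :=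
  (ContinuousAlternatingMap.alternatizeUncurryFinCLM ℝ (Rn n) 𝕜 (n := k)) ∘L
    (ContinuousLinearMap.smulRightL ℝ (Rn n) (Rn n [⋀^Fin k]→L[ℝ] 𝕜)
          (EuclideanSpace.proj (𝕜 := ℝ) i : Rn n →L[ℝ] ℝ))

theorem wedge_succ_eq (i : Fin n) (η : Form 𝕜 n) (x : Rn n) (k : Fin n) :
    (wedge i η).1 x k.succ = wedgeCLM i k (η.1 x k.castSucc) := rfl

/-- `interior j` as a continuous linear map from `(k+1)`-forms to `k`-forms. -/
def interiorCLM (j : Fin n) (k : ℕ) :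
    (Rn n [⋀^Fin (k + 1)]→L[ℝ] 𝕜) →L[ℝ] (Rn n [⋀^Fin k]→L[ℝ] 𝕜) :=
  (ContinuousLinearMap.apply ℝ (Rn n [⋀^Fin k]→L[ℝ] 𝕜) (basisVec j)) ∘L
    (ContinuousAlternatingMap.curryLeftLI (𝕜 := ℝ)).toContinuousLinearMap

theorem interior_castSucc_eq (i : Fin n) (η : Form 𝕜 n) (x : Rn n) (k : Fin n) :
    (interior i η).1 x k.castSucc = interiorCLM i k (η.1 x k.succ) :=
  interior_castSucc_apply i η x k

theorem interiorCLM_apply (j : Fin n) (k : ℕ) (a : Rn n [⋀^Fin (k + 1)]→L[ℝ] 𝕜)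
    (v : Fin k → Rn n) : interiorCLM j k a v = a (Matrix.vecCons (basisVec j) v) := rfl

theorem wedgeCLM_apply (i : Fin n) (k : ℕ) (a : Rn n [⋀^Fin k]→L[ℝ] 𝕜)
    (v : Fin (k + 1) → Rn n) : wedgeCLM i k a v =
      ∑ j : Fin (k + 1), (-1 : ℤ) ^ (j : ℕ) • v j i • a (j.removeNth v) :=
  ContinuousAlternatingMap.alternatizeUncurryFin_apply _ v

theorem pd_wedge (m i : Fin n) :
    (pd m * wedge i : Module.End 𝕜 (Form 𝕜 n)) = wedge i * pd m := by
  refine LinearMap.ext fun η => form_ext fun x => fibre_ext fun k => ?_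
  simp only [Module.End.mul_apply]
  refine Fin.cases ?_ (fun k => ?_) k
  · rw [wedge_zero_apply, pd_eq_zero_of_component]
    exact fun x => wedge_zero_apply i η x
  · rw [wedge_succ_eq]
    exact pd_fibrewise (j := k.castSucc) (k := k.succ) (wedgeCLM i k)
      (fun x => wedge_succ_eq i η x k) m x

theorem pd_interior (m i : Fin n) :
    (pd m * interior i : Module.End 𝕜 (Form 𝕜 n)) = interior i * pd m := by
  refine LinearMap.ext fun η => form_ext fun x => fibre_ext fun k => ?_
  simp only [Module.End.mul_apply]
  refine Fin.lastCases ?_ (fun k => ?_) k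
  · rw [interior_last_apply, pd_eq_zero_of_component]
    exact fun x => interior_last_apply i η x
  · rw [interior_castSucc_eq]
    exact pd_fibrewise (j := k.succ) (k := k.castSucc) (interiorCLM i k)
      (fun x => interior_castSucc_eq i η x k) m x

theorem pd_degProj (m : Fin n) (k : ℕ) :
    (pd m * degProj k : Module.End 𝕜 (Form 𝕜 n)) = degProj k * pd m := by
  refine LinearMap.ext fun η => form_ext fun x => fibre_ext fun j => ?_
  simp only [Module.End.mul_apply, degProj_apply]
  split_ifs with h
  · exact pd_fibrewise (.id ℝ _) (fun y => by simp [degProj_apply, h]) m x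
  · exact pd_eq_zero_of_component (fun y => by simp [degProj_apply, h]) m x

theorem wedge_mulF (i : Fin n) (f : Fn n) :
    (wedge i * mulF f : Module.End 𝕜 (Form 𝕜 n)) = mulF f * wedge i := by
  refine LinearMap.ext fun η => form_ext fun x => fibre_ext fun k => ?_
  simp only [Module.End.mul_apply, mulF_apply, fibre_rsmul_apply]
  refine Fin.cases ?_ (fun k => ?_) k
  · exact (smul_zero (f.1 x)).symm
  · rw [wedge_succ_eq, wedge_succ_eq, mulF_apply, fibre_rsmul_apply, map_smul]

theorem interior_mulF (i : Fin n) (f : Fn n) :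
    (interior i * mulF f : Module.End 𝕜 (Form 𝕜 n)) = mulF f * interior i := by
  refine LinearMap.ext fun η => form_ext fun x => fibre_ext fun k => ?_
  simp only [Module.End.mul_apply, mulF_apply, fibre_rsmul_apply]
  refine Fin.lastCases ?_ (fun k => ?_) k
  · simp
  · rw [interior_castSucc_eq, interior_castSucc_eq, mulF_apply, fibre_rsmul_apply, map_smul]

theorem degProj_mulF (k : ℕ) (f : Fn n) :
    (degProj k * mulF f : Module.End 𝕜 (Form 𝕜 n)) = mulF f * degProj k := by
  refine LinearMap.ext fun η => form_ext fun x => fibre_ext fun j => ?_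
  simp only [Module.End.mul_apply, mulF_apply, fibre_rsmul_apply, degProj_apply]
  split_ifs <;> simp

theorem mulF_comm (f g : Fn n) :
    (mulF f * mulF g : Module.End 𝕜 (Form 𝕜 n)) = mulF g * mulF f := by
  rw [← map_mul, mul_comm, map_mul]

theorem degProj_succ_wedge (k : ℕ) (i : Fin n) :
    (degProj (k + 1) * wedge i : Module.End 𝕜 (Form 𝕜 n)) = wedge i * degProj k := by
  refine LinearMap.ext fun η => form_ext fun x => fibre_ext fun j => ?_
  simp only [Module.End.mul_apply, degProj_apply]
  refine Fin.cases ?_ (fun j => ?_) j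
  · exact ite_self _
  · rw [wedge_succ_eq, wedge_succ_eq, degProj_apply]
    simp only [Fin.val_succ, Fin.val_castSucc, add_left_inj]
    split_ifs <;> simp

theorem degProj_zero_wedge (i : Fin n) :
    (degProj 0 * wedge i : Module.End 𝕜 (Form 𝕜 n)) = 0 := by
  refine LinearMap.ext fun η => form_ext fun x => fibre_ext fun j => ?_
  simp only [Module.End.mul_apply, degProj_apply]
  refine Fin.cases ?_ (fun j => ?_) j
  · exact ite_self _
  · simp

theorem degProj_interior (k : ℕ) (i : Fin n) :
    (degProj k * interior i : Module.End 𝕜 (Form 𝕜 n)) = interior i * degProj (k + 1) := by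
  refine LinearMap.ext fun η => form_ext fun x => fibre_ext fun j => ?_
  simp only [Module.End.mul_apply, degProj_apply]
  refine Fin.lastCases ?_ (fun j => ?_) j
  · simp
  · rw [interior_castSucc_eq, interior_castSucc_eq, degProj_apply]
    simp only [Fin.val_succ, Fin.val_castSucc, add_left_inj]
    split_ifs <;> simp

theorem interior_degProj_zero (i : Fin n) :
    (interior i * degProj 0 : Module.End 𝕜 (Form 𝕜 n)) = 0 := by
  refine LinearMap.ext fun η => form_ext fun x => fibre_ext fun j => ?_
  simp only [Module.End.mul_apply]
  refine Fin.lastCases ?_ (fun j => ?_) j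
  · simp
  · rw [interior_castSucc_eq, degProj_apply]
    simp

theorem degProj_mul_self (k : ℕ) :
    (degProj k * degProj k : Module.End 𝕜 (Form 𝕜 n)) = degProj k := by
  refine LinearMap.ext fun η => form_ext fun x => fibre_ext fun j => ?_
  simp only [Module.End.mul_apply, degProj_apply]
  split_ifs <;> rfl

theorem degProj_mul_ne {k l : ℕ} (h : k ≠ l) :
    (degProj k * degProj l : Module.End 𝕜 (Form 𝕜 n)) = 0 := by
  refine LinearMap.ext fun η => form_ext fun x => fibre_ext fun j => ?_
  simp only [Module.End.mul_apply, degProj_apply]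
  split_ifs with h1 h2
  · omega
  · rfl
  · rfl

theorem degProj_of_lt {k : ℕ} (h : n < k) : (degProj k : Module.End 𝕜 (Form 𝕜 n)) = 0 := by
  refine LinearMap.ext fun η => form_ext fun x => fibre_ext fun j => ?_
  rw [degProj_apply, if_neg (by omega)]; rfl

theorem sum_degProj : (∑ k : Fin (n + 1), degProj k : Module.End 𝕜 (Form 𝕜 n)) = 1 := by
  refine LinearMap.ext fun η => form_ext fun x => fibre_ext fun j => ?_
  rw [LinearMap.sum_apply, form_sum_apply, fibre_sum_apply, Finset.sum_eq_single j]
  · simp [degProj_apply]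
  · intro b _ hb
    rw [degProj_apply, if_neg fun h => hb (Fin.ext h.symm)]
  · simp

/-- Since `n + 1` vectors of `ℝⁿ` are dependent, it is harmless that `wedge` discards the product of
`dxᵢ` with the component of degree `n`. -/
theorem alternating_top_eq_zero (a : Rn n [⋀^Fin (n + 1)]→L[ℝ] 𝕜) : a = 0 := by
  ext v
  refine a.toAlternatingMap.map_linearDependent v fun h => ?_
  have := h.fintype_card_le_finrank
  simp at this

/-- In the alternating sum for the product, the summand feeding `∂ⱼ` to `dxᵢ` gives the Kronecker
delta. In the others, removing an argument and inserting `∂ⱼ` commute up to an index shift by one,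
and the resulting sign cancels them against the second product. -/
theorem interiorCLM_wedgeCLM (i j : Fin n) (k : ℕ) (a : Rn n [⋀^Fin (k + 1)]→L[ℝ] 𝕜) :
    interiorCLM j (k + 1) (wedgeCLM i (k + 1) a) + wedgeCLM i k (interiorCLM j k a) =
      if i = j then a else 0 := by
  ext v
  rw [ContinuousAlternatingMap.add_apply, interiorCLM_apply, wedgeCLM_apply, wedgeCLM_apply,
    Fin.sum_univ_succ]
  have h : ∀ l : Fin (k + 1), ((l.succ.removeNth (Matrix.vecCons (basisVec j) v) :
      Fin (k + 1) → Rn n)) = Matrix.vecCons (basisVec j) (l.removeNth v) := by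
    intro l
    funext m
    refine Fin.cases ?_ (fun m => ?_) m
    · simp [Fin.removeNth]
    · simp [Fin.removeNth]
  simp only [h, interiorCLM_apply]
  have h0 : ((0 : Fin (k + 2)).removeNth (Matrix.vecCons (basisVec j) v) :
      Fin (k + 1) → Rn n) = v := by
    funext m; simp [Fin.removeNth]
  rw [h0]
  simp only [Matrix.cons_val_zero, Matrix.cons_val_succ, Fin.val_succ, pow_succ, basisVec_apply]
  rw [add_assoc, ← Finset.sum_add_distrib, Finset.sum_eq_zero]
  · split_ifs <;> simp
  · intro l _; simp

theorem interiorCLM_wedgeCLM_zero (i j : Fin n) (a : Rn n [⋀^Fin 0]→L[ℝ] 𝕜) :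
    interiorCLM j 0 (wedgeCLM i 0 a) = if i = j then a else 0 := by
  ext v
  rw [interiorCLM_apply, wedgeCLM_apply, Fin.sum_univ_succ]
  have h0 : ((0 : Fin 1).removeNth (Matrix.vecCons (basisVec j) v) :
      Fin 0 → Rn n) = v := by
    funext m; exact m.elim0
  rw [h0]
  simp [basisVec_apply]
  split_ifs <;> simp

theorem interior_wedge (i j : Fin n) :
    (interior j * wedge i + wedge i * interior j : Module.End 𝕜 (Form 𝕜 n)) =
      if i = j then 1 else 0 := by
  refine LinearMap.ext fun η => form_ext fun x => fibre_ext fun k => ?_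
  have hr : ((if i = j then 1 else 0 : Module.End 𝕜 (Form 𝕜 n)) η).1 x k =
      if i = j then η.1 x k else 0 := by split_ifs <;> rfl
  rw [hr]
  change (interior j (wedge i η)).1 x k + (wedge i (interior j η)).1 x k = _
  obtain ⟨n, rfl⟩ : ∃ m, n = m + 1 := ⟨n - 1, by have := i.2; omega⟩
  -- Degree zero and the top degree are separate: one of the two products is zero there by
  -- convention.
  refine Fin.cases ?_ (fun k => ?_) k
  · rw [wedge_zero_apply, add_zero]
    have := interior_castSucc_eq j (wedge i η) x 0
    rw [wedge_succ_eq] at this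
    exact this.trans (interiorCLM_wedgeCLM_zero i j (η.1 x 0))
  · refine Fin.lastCases ?_ (fun k => ?_) k
    · have h := interiorCLM_wedgeCLM i j n (η.1 x (Fin.last (n + 1)))
      rw [alternating_top_eq_zero (wedgeCLM i (n + 1) (η.1 x (Fin.last (n + 1)))), map_zero,
        zero_add] at h
      have e1 : (wedge i (interior j η)).1 x (Fin.last n).succ =
          wedgeCLM i n (interiorCLM j n (η.1 x (Fin.last (n + 1)))) := by
        rw [wedge_succ_eq, interior_castSucc_eq]; rfl
      have e2 : (interior j (wedge i η)).1 x (Fin.last n).succ = 0 :=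
        interior_last_apply j (wedge i η) x
      exact (congrArg₂ (· + ·) e2 e1).trans ((zero_add _).trans h)
    · have e1 : (wedge i (interior j η)).1 x k.castSucc.succ =
          wedgeCLM i k (interiorCLM j k (η.1 x k.succ.castSucc)) := by
        rw [wedge_succ_eq, interior_castSucc_eq]; rfl
      have e2 : (interior j (wedge i η)).1 x k.castSucc.succ =
          interiorCLM j (k + 1) (wedgeCLM i (k + 1) (η.1 x k.succ.castSucc)) := by
        have := interior_castSucc_eq j (wedge i η) x k.succ
        rw [wedge_succ_eq] at this
        exact this
      exact (congrArg₂ (· + ·) e2 e1).trans (interiorCLM_wedgeCLM i j k (η.1 x k.succ.castSucc))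

/-- Same reason as `d² = 0`: alternatizing twice kills whatever is symmetric in the two new
arguments, here the symmetrization of `dxᵢ ⊗ dxⱼ ⊗ a`. -/
theorem wedgeCLM_anticomm (i j : Fin n) (k : ℕ) (a : Rn n [⋀^Fin k]→L[ℝ] 𝕜) :
    wedgeCLM i (k + 1) (wedgeCLM j k a) + wedgeCLM j (k + 1) (wedgeCLM i k a) = 0 := by
  let p : Fin n → (Rn n →L[ℝ] ℝ) := fun i => EuclideanSpace.proj (𝕜 := ℝ) i
  let f : Rn n →L[ℝ] Rn n →L[ℝ] Rn n [⋀^Fin k]→L[ℝ] 𝕜 :=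
    (p i).smulRight ((p j).smulRight a) + (p j).smulRight ((p i).smulRight a)
  have hf : ∀ x y, f x y = f y x := by
    intro x y
    simp only [f, add_apply, ContinuousLinearMap.smulRight_apply, smul_apply]
    rw [smul_comm (p i x), smul_comm (p j x), add_comm]
  have h := ContinuousAlternatingMap.alternatizeUncurryFin_alternatizeUncurryFinCLM_comp_of_symmetric
    hf
  have h2 : ContinuousAlternatingMap.alternatizeUncurryFinCLM ℝ (Rn n) 𝕜 ∘L f =
      (p i).smulRight (wedgeCLM j k a) + (p j).smulRight (wedgeCLM i k a) := by
    refine ContinuousLinearMap.ext fun x => ?_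
    change ContinuousAlternatingMap.alternatizeUncurryFinCLM ℝ (Rn n) 𝕜
      (p i x • (p j).smulRight a + p j x • (p i).smulRight a) = _
    rw [map_add, map_smul, map_smul]
    rfl
  rw [h2, ContinuousAlternatingMap.alternatizeUncurryFin_add] at h
  exact h

theorem wedge_anticomm (i j : Fin n) (η : Form 𝕜 n) :
    wedge i (wedge j η) = - wedge j (wedge i η) := by
  rw [eq_neg_iff_add_eq_zero]
  refine form_ext fun x => fibre_ext fun k => ?_
  rw [form_add_apply, fibre_add_apply]
  refine Fin.cases ?_ (fun k => ?_) k
  · exact add_zero _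
  · rw [wedge_succ_eq, wedge_succ_eq]
    obtain ⟨k, hk⟩ := k
    cases k with
    | zero =>
      have h : ∀ i : Fin n, (wedge i η).1 x (Fin.castSucc ⟨0, hk⟩) = 0 := fun i =>
        wedge_zero_apply i η x
      rw [h, h, map_zero, map_zero, add_zero]; rfl
    | succ k =>
      have h : ∀ i : Fin n, (wedge i η).1 x (Fin.castSucc ⟨k + 1, hk⟩) =
          wedgeCLM i k (η.1 x (Fin.castSucc ⟨k, by omega⟩)) := fun i =>
        wedge_succ_eq i η x ⟨k, by omega⟩
      rw [h, h]
      exact wedgeCLM_anticomm i j k _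

theorem interiorCLM_anticomm (i j : Fin n) (k : ℕ) (a : Rn n [⋀^Fin (k + 2)]→L[ℝ] 𝕜) :
    interiorCLM i k (interiorCLM j (k + 1) a) + interiorCLM j k (interiorCLM i (k + 1) a) = 0 := by
  ext v
  rw [ContinuousAlternatingMap.add_apply]
  simp only [interiorCLM_apply]
  have := a.map_swap (Matrix.vecCons (basisVec i) (Matrix.vecCons (basisVec j) v))
    (i := 0) (j := 1) (by simp)
  have h3 : (Matrix.vecCons (basisVec i) (Matrix.vecCons (basisVec j) v)) ∘
      ⇑(Equiv.swap (0 : Fin (k + 2)) 1) =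
      Matrix.vecCons (basisVec j) (Matrix.vecCons (basisVec i) v) := by
    funext m
    refine Fin.cases ?_ (fun m => Fin.cases ?_ (fun m => ?_) m) m
    · simp
    · simp
    · simp only [Function.comp_apply]
      rw [Equiv.swap_apply_of_ne_of_ne (Fin.succ_ne_zero _)]
      · simp
      · simp [Fin.ext_iff]
  rw [h3] at this
  exact eq_neg_iff_add_eq_zero.1 this

theorem interior_anticomm (i j : Fin n) (η : Form 𝕜 n) :
    interior i (interior j η) = - interior j (interior i η) := by
  rw [eq_neg_iff_add_eq_zero]
  refine form_ext fun x => fibre_ext fun k => ?_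
  rw [form_add_apply, fibre_add_apply]
  obtain ⟨n, rfl⟩ : ∃ m, n = m + 1 := ⟨n - 1, by have := i.2; omega⟩
  refine Fin.lastCases ?_ (fun k => ?_) k
  · rw [interior_last_apply, interior_last_apply]; exact add_zero _
  · rw [interior_castSucc_eq, interior_castSucc_eq]
    refine Fin.lastCases ?_ (fun k => ?_) k
    · have h : ∀ i : Fin (n + 1), (interior i η).1 x (Fin.last n).succ = 0 := fun i =>
        interior_last_apply i η x
      rw [h, h, map_zero, map_zero, add_zero]; rfl
    · have h : ∀ i : Fin (n + 1), (interior i η).1 x k.castSucc.succ =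
          interiorCLM i (k + 1) (η.1 x k.succ.succ) := fun i =>
        interior_castSucc_eq i η x k.succ
      rw [h, h]
      exact interiorCLM_anticomm i j k _

/-- The sum of the `dxᵢ ⊗ ιᵢ a` is `a` curried in its first argument, and alternatizing a form that
is already alternating counts it once for each argument. This number operator later recovers the
degree from the action of `gl`. -/
theorem sum_wedgeCLM_interiorCLM (k : ℕ) (a : Rn n [⋀^Fin (k + 1)]→L[ℝ] 𝕜) :
    ∑ i, wedgeCLM i k (interiorCLM i k a) = (k + 1) • a := by
  rw [← ContinuousAlternatingMap.alternatizeUncurryFin_curryLeft,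
    ← ContinuousAlternatingMap.alternatizeUncurryFinCLM_apply]
  simp only [wedgeCLM, ContinuousLinearMap.comp_apply, ← map_sum]
  congr 1
  refine ContinuousLinearMap.ext fun v => ?_
  conv_rhs => rw [← sum_smul_basisVec v, map_sum]
  rw [sum_apply]
  refine Finset.sum_congr rfl fun i _ => ?_
  rw [map_smul]
  rfl

theorem sum_wedge_interior_degProj (k : ℕ) (η : Form 𝕜 n) :
    ∑ i, wedge i (interior i (degProj k η)) = (k : 𝕜) • degProj k η := by
  refine form_ext fun x => fibre_ext fun j => ?_
  rw [form_sum_apply, fibre_sum_apply, form_smul_apply, fibre_smul_apply]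
  refine Fin.cases ?_ (fun j => ?_) j
  · rw [degProj_apply]
    split_ifs with h
    · simp only [Fin.val_zero] at h
      subst h
      rw [Nat.cast_zero, zero_smul]
      exact Finset.sum_eq_zero fun i _ => wedge_zero_apply _ _ _
    · rw [smul_zero]
      exact Finset.sum_eq_zero fun i _ => wedge_zero_apply _ _ _
  · simp only [wedge_succ_eq, interior_castSucc_eq]
    rw [sum_wedgeCLM_interiorCLM, degProj_apply]
    split_ifs with h
    · rw [← h]; exact (Nat.cast_smul_eq_nsmul 𝕜 _ _).symm
    · rw [smul_zero, smul_zero]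

/-! Application forms of the commutation relations. -/

theorem pd_mulF_apply (i : Fin n) (f : Fn n) (η : Form 𝕜 n) :
    pd i (mulF f η) = mulF f (pd i η) + mulF (fnPd i f) η :=
  LinearMap.congr_fun (pd_mulF i f) η

theorem pd_wedge_apply (m i : Fin n) (η : Form 𝕜 n) : pd m (wedge i η) = wedge i (pd m η) :=
  LinearMap.congr_fun (pd_wedge m i) η

theorem pd_interior_apply (m i : Fin n) (η : Form 𝕜 n) :
    pd m (interior i η) = interior i (pd m η) :=
  LinearMap.congr_fun (pd_interior m i) η

theorem pd_degProj_apply (m : Fin n) (k : ℕ) (η : Form 𝕜 n) :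
    pd m (degProj k η) = degProj k (pd m η) :=
  LinearMap.congr_fun (pd_degProj m k) η

theorem wedge_mulF_apply (i : Fin n) (f : Fn n) (η : Form 𝕜 n) :
    wedge i (mulF f η) = mulF f (wedge i η) :=
  LinearMap.congr_fun (wedge_mulF i f) η

theorem interior_mulF_apply (i : Fin n) (f : Fn n) (η : Form 𝕜 n) :
    interior i (mulF f η) = mulF f (interior i η) :=
  LinearMap.congr_fun (interior_mulF i f) η

theorem degProj_mulF_apply (k : ℕ) (f : Fn n) (η : Form 𝕜 n) :
    degProj k (mulF f η) = mulF f (degProj k η) :=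
  LinearMap.congr_fun (degProj_mulF k f) η

theorem pd_pd_comm (i j : Fin n) (η : Form 𝕜 n) : pd i (pd j η) = pd j (pd i η) :=
  LinearMap.congr_fun (pd_comm i j) η

theorem mulF_mulF_comm (f g : Fn n) (η : Form 𝕜 n) : mulF f (mulF g η) = mulF g (mulF f η) :=
  LinearMap.congr_fun (mulF_comm f g) η

theorem mulF_mul_apply (f g : Fn n) (η : Form 𝕜 n) : mulF (f * g) η = mulF f (mulF g η) := by
  rw [map_mul]; rfl

theorem mulF_add_apply (f g : Fn n) (η : Form 𝕜 n) : mulF (f + g) η = mulF f η + mulF g η := by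
  rw [map_add]; rfl

theorem interior_wedge_apply (i j : Fin n) (η : Form 𝕜 n) :
    interior j (wedge i η) = (if i = j then η else 0) - wedge i (interior j η) := by
  have h := LinearMap.congr_fun (interior_wedge (𝕜 := 𝕜) i j) η
  rw [eq_sub_iff_add_eq]
  refine h.trans ?_
  split_ifs <;> rfl

/-! ### The operators `d`, `L_X` and `Div X` in terms of elementary operators -/

/-- The components of a vector field. -/
def comp (X : Vect n) (j : Fin n) : Fn n :=
  ⟨fun x => X.1 x j, ((EuclideanSpace.proj (𝕜 := ℝ) j : Rn n →L[ℝ] ℝ).contDiff (n := ∞)).comp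
    (smooth_vect X)⟩

theorem comp_apply (X : Vect n) (j : Fin n) (x : Rn n) : (comp X j).1 x = X.1 x j := rfl

@[ext] theorem vect_ext {X Y : Vect n} (h : ∀ j, comp X j = comp Y j) : X = Y := by
  refine Subtype.ext (funext fun x => ?_)
  ext j
  exact congrFun (congrArg Subtype.val (h j)) x

theorem fderiv_comp_apply (X : Vect n) (j : Fin n) (x v : Rn n) :
    fderiv ℝ (comp X j).1 x v = fderiv ℝ X.1 x v j := by
  have h := ((EuclideanSpace.proj (𝕜 := ℝ) j : Rn n →L[ℝ] ℝ).hasFDerivAt (x := X.1 x)).comp x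
    (differentiable_vect X x).hasFDerivAt
  exact DFunLike.congr_fun h.fderiv v

theorem d_eq (η : Form 𝕜 n) : d η = ∑ i, wedge i (pd i η) := by
  refine form_ext fun x => fibre_ext fun k => ?_
  rw [form_sum_apply, fibre_sum_apply]
  refine Fin.cases ?_ (fun k => ?_) k
  · rw [Finset.sum_eq_zero fun i _ => wedge_zero_apply _ _ _]; rfl
  · simp only [wedge_succ_eq]
    change ContinuousAlternatingMap.alternatizeUncurryFinCLM ℝ (Rn n) 𝕜
      (fderiv ℝ (fun y => η.1 y k.castSucc) x) = _
    simp only [wedgeCLM, ContinuousLinearMap.comp_apply, ← map_sum]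
    congr 1
    refine ContinuousLinearMap.ext fun v => ?_
    rw [← fderiv_fibre_apply, fderiv_eq_sum_pd, fibre_sum_apply, sum_apply]
    rfl

theorem fderivComp_eq_sum (k : ℕ) (a : Rn n [⋀^Fin (k + 1)]→L[ℝ] 𝕜) (B : Rn n →L[ℝ] Rn n) :
    a.fderivCompContinuousLinearMap (ContinuousLinearMap.id ℝ (Rn n)) B =
      ∑ j, ∑ i, B (basisVec i) j • wedgeCLM i k (interiorCLM j k a) := by
  rw [ContinuousAlternatingMap.fderivCompContinuousLinearMap_eq_alternatizeUncurryFin]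
  simp only [wedgeCLM, ContinuousLinearMap.comp_apply, ← map_sum, ← map_smul]
  congr 1
  refine ContinuousLinearMap.ext fun v => ?_
  simp only [sum_apply]
  change (a.curryLeft (B v)).compContinuousLinearMap (ContinuousLinearMap.id ℝ (Rn n)) = _
  have h : (a.curryLeft (B v)).compContinuousLinearMap (ContinuousLinearMap.id ℝ (Rn n)) =
      a.curryLeft (B v) := by ext w; rfl
  rw [h]
  conv_lhs => rw [← sum_smul_basisVec (B v), map_sum]
  refine Finset.sum_congr rfl fun j _ => ?_
  rw [map_smul]
  conv_lhs => rw [← sum_smul_basisVec v, map_sum]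
  rw [WithLp.ofLp_sum, Finset.sum_apply, Finset.sum_smul]
  refine Finset.sum_congr rfl fun i _ => ?_
  rw [map_smul, PiLp.smul_apply, smul_eq_mul, mul_comm, mul_smul, map_smul (interiorCLM j k),
    map_smul]
  rfl

theorem fderivComp_zero (a : Rn n [⋀^Fin 0]→L[ℝ] 𝕜) (B : Rn n →L[ℝ] Rn n) :
    a.fderivCompContinuousLinearMap (ContinuousLinearMap.id ℝ (Rn n)) B = 0 := by
  ext v; simp [ContinuousAlternatingMap.fderivCompContinuousLinearMap_apply]

theorem lieDerivative_eq (X : Vect n) (η : Form 𝕜 n) :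
    lieDerivative X η = ∑ j, mulF (comp X j) (pd j η) +
      ∑ j, ∑ i, mulF (fnPd i (comp X j)) (wedge i (interior j η)) := by
  refine form_ext fun x => fibre_ext fun k => ?_
  change fderiv ℝ η.1 x (X.1 x) k + (η.1 x k).fderivCompContinuousLinearMap
        (ContinuousLinearMap.id ℝ (Rn n)) (fderiv ℝ X.1 x) = _
  rw [form_add_apply, fibre_add_apply]
  congr 1
  · rw [fderiv_eq_sum_pd, form_sum_apply]; rfl
  · simp only [form_sum_apply, fibre_sum_apply, mulF_apply, fibre_rsmul_apply]
    refine Fin.cases ?_ (fun k => ?_) k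
    · exact (fderivComp_zero (η.1 x 0) _).trans
        (Finset.sum_eq_zero fun j _ => Finset.sum_eq_zero fun i _ => smul_zero _).symm
    · simp only [wedge_succ_eq, interior_castSucc_eq]
      refine (fderivComp_eq_sum k (η.1 x k.succ) _).trans ?_
      refine Finset.sum_congr rfl fun j _ => Finset.sum_congr rfl fun i _ => ?_
      rw [fnPd_apply, fderiv_comp_apply]

/-- The divergence as a smooth function. -/
def divFn (X : Vect n) : Fn n := ∑ i, fnPd i (comp X i)

theorem divFn_apply (X : Vect n) (x : Rn n) : (divFn X).1 x = divergence X x := by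
  rw [divergence, LinearMap.trace_eq_sum_inner _ (EuclideanSpace.basisFun (Fin n) ℝ), divFn]
  have h : (∑ i, fnPd i (comp X i)).1 x = ∑ i, (fnPd i (comp X i)).1 x := by
    simp only [AddSubmonoidClass.coe_finsetSum, Finset.sum_apply]
  rw [h]
  refine Finset.sum_congr rfl fun i _ => ?_
  rw [fnPd_apply, fderiv_comp_apply, EuclideanSpace.basisFun_apply]
  rw [EuclideanSpace.inner_single_left]
  simp [basisVec]

theorem divMul_eq (X : Vect n) : (divMul X : Module.End 𝕜 (Form 𝕜 n)) = mulF (divFn X) := by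
  refine LinearMap.ext fun η => form_ext fun x => ?_
  rw [mulF_apply, divFn_apply]; rfl

theorem comp_bracket (X Y : Vect n) (j : Fin n) :
    comp (bracket X Y) j = ∑ i, (comp X i * fnPd i (comp Y j) - comp Y i * fnPd i (comp X j)) := by
  have key : ∀ (Z : Vect n) (x v : Rn n), fderiv ℝ Z.1 x v j =
      ∑ i, v i * (fnPd i (comp Z j)).1 x := by
    intro Z x v
    rw [← fderiv_comp_apply]
    conv_lhs => rw [← sum_smul_basisVec v, map_sum]
    exact Finset.sum_congr rfl fun i _ => by rw [map_smul]; rfl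
  ext x
  have h : (∑ i, (comp X i * fnPd i (comp Y j) - comp Y i * fnPd i (comp X j))).1 x =
      ∑ i, (X.1 x i * (fnPd i (comp Y j)).1 x - Y.1 x i * (fnPd i (comp X j)).1 x) := by
    simp only [AddSubmonoidClass.coe_finsetSum, Finset.sum_apply]; rfl
  rw [h, Finset.sum_sub_distrib, ← key, ← key]
  rfl

/-- The vector field `f ∂ⱼ`. -/
def fld (f : Fn n) (j : Fin n) : Vect n :=
  ⟨fun x => f.1 x • basisVec j, (smooth_fn f).smul contDiff_const⟩

theorem comp_fld (f : Fn n) (j i : Fin n) : comp (fld f j) i = if i = j then f else 0 := by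
  ext x
  change f.1 x * basisVec j i = _
  rw [basisVec_apply]
  split_ifs <;> simp

theorem comp_add (X Y : Vect n) (i : Fin n) : comp (X + Y) i = comp X i + comp Y i := rfl
theorem comp_zero (i : Fin n) : comp (0 : Vect n) i = 0 := rfl
theorem comp_smul (c : ℝ) (X : Vect n) (i : Fin n) : comp (c • X) i = c • comp X i := rfl
theorem comp_sub (X Y : Vect n) (i : Fin n) : comp (X - Y) i = comp X i - comp Y i := rfl

theorem comp_sum {ι : Type*} (s : Finset ι) (X : ι → Vect n) (i : Fin n) :
    comp (∑ a ∈ s, X a) i = ∑ a ∈ s, comp (X a) i := by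
  classical
  induction s using Finset.induction_on with
  | empty => simp [comp_zero]
  | insert a s ha ih => simp [Finset.sum_insert ha, ih, comp_add]

/-- Exterior multiplication by `df`. -/
def dmul (f : Fn n) : Module.End 𝕜 (Form 𝕜 n) := ∑ i, mulF (fnPd i f) * wedge i

theorem dmul_apply (f : Fn n) (η : Form 𝕜 n) :
    dmul f η = ∑ i, mulF (fnPd i f) (wedge i η) := by
  simp [dmul, LinearMap.sum_apply]

theorem dmul_mulF (f g : Fn n) (η : Form 𝕜 n) : dmul f (mulF g η) = mulF g (dmul f η) := by
  simp only [dmul_apply, map_sum]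
  refine Finset.sum_congr rfl fun i _ => ?_
  rw [wedge_mulF_apply, mulF_mulF_comm]

theorem wedge_dmul (i : Fin n) (f : Fn n) (η : Form 𝕜 n) :
    wedge i (dmul f η) = - dmul f (wedge i η) := by
  simp only [dmul_apply, map_sum, ← Finset.sum_neg_distrib]
  refine Finset.sum_congr rfl fun j _ => ?_
  rw [wedge_mulF_apply, wedge_anticomm, map_neg]

theorem dmul_anticomm (f g : Fn n) (η : Form 𝕜 n) : dmul f (dmul g η) = - dmul g (dmul f η) := by
  rw [dmul_apply f, dmul_apply f, map_sum, ← Finset.sum_neg_distrib]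
  refine Finset.sum_congr rfl fun j _ => ?_
  rw [wedge_dmul, dmul_mulF, map_neg]

theorem interior_dmul (j : Fin n) (g : Fn n) (η : Form 𝕜 n) :
    interior j (dmul g η) = mulF (fnPd j g) η - dmul g (interior j η) := by
  simp only [dmul_apply, map_sum, interior_mulF_apply, interior_wedge_apply, map_sub,
    Finset.sum_sub_distrib]
  congr 1
  rw [Finset.sum_eq_single j]
  · simp
  · intro b _ hb; simp [hb]
  · simp

theorem pd_dmul (j : Fin n) (g : Fn n) (η : Form 𝕜 n) :
    pd j (dmul g η) = dmul g (pd j η) + dmul (fnPd j g) η := by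
  simp only [dmul_apply, map_sum, pd_mulF_apply, pd_wedge_apply, Finset.sum_add_distrib]
  simp only [fnPd_comm j]

theorem dmul_mul (f g : Fn n) (η : Form 𝕜 n) :
    dmul (f * g) η = mulF f (dmul g η) + mulF g (dmul f η) := by
  simp only [dmul_apply, map_sum, fnPd_mul, mulF_add_apply, mulF_mul_apply,
    Finset.sum_add_distrib]
  simp only [mulF_mulF_comm _ g]

theorem sum_antisymm_eq_zero {ι : Type*} [Fintype ι] (f : ι → ι → Form 𝕜 n)
    (h : ∀ i j, f i j = - f j i) : ∑ i, ∑ j, f i j = 0 := by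
  have h1 : ∑ i, ∑ j, f i j = - ∑ i, ∑ j, f i j := by
    conv_lhs => rw [Finset.sum_comm]
    simp only [← Finset.sum_neg_distrib]
    exact Finset.sum_congr rfl fun i _ => Finset.sum_congr rfl fun j _ => h j i
  have h2 : (2 : 𝕜) • ∑ i, ∑ j, f i j = 0 := by
    rw [two_smul]
    nth_rewrite 2 [h1]
    exact add_neg_cancel _
  exact (smul_eq_zero.1 h2).resolve_left two_ne_zero

theorem d_d (η : Form 𝕜 n) : d (d η) = 0 := by
  simp only [d_eq, map_sum, pd_wedge_apply]
  refine sum_antisymm_eq_zero _ fun i j => ?_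
  rw [wedge_anticomm, pd_pd_comm]

theorem d_mulF (f : Fn n) (η : Form 𝕜 n) : d (mulF f η) = mulF f (d η) + dmul f η := by
  simp only [d_eq, dmul_apply, map_sum, pd_mulF_apply, map_add, wedge_mulF_apply,
    Finset.sum_add_distrib]

theorem d_pd (j : Fin n) (η : Form 𝕜 n) : d (pd j η) = pd j (d η) := by
  simp only [d_eq, map_sum, pd_wedge_apply]
  exact Finset.sum_congr rfl fun i _ => by rw [pd_pd_comm]

theorem interior_d (j : Fin n) (η : Form 𝕜 n) : interior j (d η) = pd j η - d (interior j η) := by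
  simp only [d_eq, map_sum, interior_wedge_apply, Finset.sum_sub_distrib, pd_interior_apply]
  congr 1
  rw [Finset.sum_eq_single j]
  · simp
  · intro b _ hb; simp [hb]
  · simp

/-- Expand `d² = 0` on the form `f η`. -/
theorem d_dmul (f : Fn n) (η : Form 𝕜 n) : d (dmul f η) = - dmul f (d η) := by
  have h := d_d (mulF f η)
  rw [d_mulF, map_add, d_mulF, d_d, map_zero, zero_add] at h
  rw [eq_neg_iff_add_eq_zero, add_comm, h]

theorem degProj_wedge_apply (k : ℕ) (i : Fin n) (η : Form 𝕜 n) :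
    degProj (k + 1) (wedge i η) = wedge i (degProj k η) :=
  LinearMap.congr_fun (degProj_succ_wedge k i) η

theorem degProj_zero_wedge_apply (i : Fin n) (η : Form 𝕜 n) : degProj 0 (wedge i η) = 0 :=
  LinearMap.congr_fun (degProj_zero_wedge i) η

theorem degProj_interior_apply (k : ℕ) (i : Fin n) (η : Form 𝕜 n) :
    degProj k (interior i η) = interior i (degProj (k + 1) η) :=
  LinearMap.congr_fun (degProj_interior k i) η

theorem degProj_d (k : ℕ) (η : Form 𝕜 n) : degProj (k + 1) (d η) = d (degProj k η) := by
  simp only [d_eq, map_sum, degProj_wedge_apply, pd_degProj_apply]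

theorem degProj_zero_d (η : Form 𝕜 n) : degProj 0 (d η) = 0 := by
  simp only [d_eq, map_sum, degProj_zero_wedge_apply, Finset.sum_const_zero]

theorem interior_degProj_zero_apply (i : Fin n) (η : Form 𝕜 n) : interior i (degProj 0 η) = 0 :=
  LinearMap.congr_fun (interior_degProj_zero i) η

theorem degProj_wedge_interior (k : ℕ) (i j : Fin n) (η : Form 𝕜 n) :
    degProj k (wedge i (interior j η)) = wedge i (interior j (degProj k η)) := by
  cases k with
  | zero => rw [degProj_zero_wedge_apply, interior_degProj_zero_apply, map_zero]
  | succ k => rw [degProj_wedge_apply, degProj_interior_apply]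

/-! ### The Lie derivative -/

theorem lieDerivative_fld (f : Fn n) (j : Fin n) (η : Form 𝕜 n) :
    lieDerivative (fld f j) η = mulF f (pd j η) + dmul f (interior j η) := by
  rw [lieDerivative_eq, dmul_apply]
  congr 1
  · rw [Finset.sum_eq_single j]
    · simp [comp_fld]
    · intro b _ hb; simp [comp_fld, hb]
    · simp
  · rw [Finset.sum_eq_single j]
    · simp [comp_fld]
    · intro b _ hb; simp [comp_fld, hb]
    · simp

/-- On the fields `f ∂ⱼ` the Lie derivative has one transport term and one contraction, so
identities for `L_X` are checked on them and then summed. -/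
theorem lieDerivative_eq_sum_fld (X : Vect n) :
    (lieDerivative X : Module.End 𝕜 (Form 𝕜 n)) = ∑ j, lieDerivative (fld (comp X j) j) := by
  refine LinearMap.ext fun η => ?_
  simp only [LinearMap.sum_apply, lieDerivative_fld, dmul_apply, Finset.sum_add_distrib]
  exact lieDerivative_eq X η

theorem lieDerivative_add (X Y : Vect n) :
    (lieDerivative (X + Y) : Module.End 𝕜 (Form 𝕜 n)) = lieDerivative X + lieDerivative Y := by
  refine LinearMap.ext fun η => ?_
  simp only [LinearMap.add_apply, lieDerivative_eq, comp_add, map_add, LinearMap.add_apply,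
    Finset.sum_add_distrib]
  abel

theorem lieDerivative_zero : (lieDerivative 0 : Module.End 𝕜 (Form 𝕜 n)) = 0 := by
  refine LinearMap.ext fun η => ?_
  simp [lieDerivative_eq, comp_zero]

theorem lieDerivative_sum {ι : Type*} (s : Finset ι) (X : ι → Vect n) :
    (lieDerivative (∑ i ∈ s, X i) : Module.End 𝕜 (Form 𝕜 n)) = ∑ i ∈ s, lieDerivative (X i) := by
  classical
  induction s using Finset.induction_on with
  | empty => simp [lieDerivative_zero]
  | insert a s ha ih => simp [Finset.sum_insert ha, ih, lieDerivative_add]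

theorem bracket_fld (f g : Fn n) (j l : Fin n) :
    bracket (fld f j) (fld g l) = fld (f * fnPd j g) l - fld (g * fnPd l f) j := by
  ext1 m
  rw [comp_bracket, comp_sub, comp_fld, comp_fld, Finset.sum_sub_distrib]
  congr 1
  · rw [Finset.sum_eq_single j]
    · simp only [comp_fld, if_true]; split_ifs <;> simp
    · intro b _ hb; simp [comp_fld, hb]
    · simp
  · rw [Finset.sum_eq_single l]
    · simp only [comp_fld, if_true]; split_ifs <;> simp
    · intro b _ hb; simp [comp_fld, hb]
    · simp

theorem bracket_eq_sum_fld (X Y : Vect n) :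
    bracket X Y = ∑ j, ∑ l, bracket (fld (comp X j) j) (fld (comp Y l) l) := by
  ext1 m
  simp only [bracket_fld, comp_sum, comp_sub, comp_fld, comp_bracket, Finset.sum_sub_distrib]
  congr 1
  · simp
  · rw [Finset.sum_comm]; simp

theorem lieDerivative_sub (X Y : Vect n) :
    (lieDerivative (X - Y) : Module.End 𝕜 (Form 𝕜 n)) = lieDerivative X - lieDerivative Y := by
  rw [eq_sub_iff_add_eq, ← lieDerivative_add, sub_add_cancel]

theorem lieDerivative_bracket_fld (f g : Fn n) (j l : Fin n) (η : Form 𝕜 n) :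
    lieDerivative (bracket (fld f j) (fld g l)) η =
      lieDerivative (fld f j) (lieDerivative (fld g l) η) -
        lieDerivative (fld g l) (lieDerivative (fld f j) η) := by
  rw [bracket_fld, lieDerivative_sub]
  simp only [LinearMap.sub_apply, lieDerivative_fld, map_add, pd_mulF_apply, pd_dmul,
    interior_mulF_apply, interior_dmul, dmul_mulF, mulF_mul_apply, dmul_mul, map_sub,
    pd_interior_apply]
  rw [interior_anticomm l j, pd_pd_comm j l, mulF_mulF_comm f g (pd l (pd j η)),
    map_neg, map_neg, dmul_anticomm f g]
  abel

theorem lieDerivative_bracket (X Y : Vect n) :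
    (lieDerivative (bracket X Y) : Module.End 𝕜 (Form 𝕜 n)) =
      lieDerivative X * lieDerivative Y - lieDerivative Y * lieDerivative X := by
  rw [bracket_eq_sum_fld, lieDerivative_eq_sum_fld X, lieDerivative_eq_sum_fld Y,
    Finset.sum_mul_sum, Finset.sum_mul_sum, lieDerivative_sum]
  rw [Finset.sum_comm (s := Finset.univ) (t := Finset.univ)
    (f := fun i j => lieDerivative (fld (comp Y i) i) * lieDerivative (fld (comp X j) j)),
    ← Finset.sum_sub_distrib]
  refine Finset.sum_congr rfl fun j _ => ?_
  rw [lieDerivative_sum, ← Finset.sum_sub_distrib]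
  refine Finset.sum_congr rfl fun l _ => LinearMap.ext fun η => ?_
  exact lieDerivative_bracket_fld _ _ _ _ η

theorem lieDerivative_d (X : Vect n) (η : Form 𝕜 n) :
    lieDerivative X (d η) = d (lieDerivative X η) := by
  rw [lieDerivative_eq_sum_fld]
  simp only [LinearMap.sum_apply, map_sum]
  refine Finset.sum_congr rfl fun j _ => ?_
  rw [lieDerivative_fld, lieDerivative_fld, interior_d, map_add, d_mulF, d_dmul, map_sub, d_pd]
  abel

/-- The derivative of a function along a vector field. -/
def along (X : Vect n) (f : Fn n) : Fn n := ∑ i, comp X i * fnPd i f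

theorem lieDerivative_mulF (X : Vect n) (f : Fn n) (η : Form 𝕜 n) :
    lieDerivative X (mulF f η) = mulF f (lieDerivative X η) + mulF (along X f) η := by
  have h : ∀ j, lieDerivative (fld (comp X j) j) (mulF f η) =
      mulF f (lieDerivative (fld (comp X j) j) η) + mulF (comp X j * fnPd j f) η := by
    intro j
    simp only [lieDerivative_fld, pd_mulF_apply, map_add, interior_mulF_apply, dmul_mulF,
      mulF_mul_apply]
    rw [mulF_mulF_comm (comp X j) f]
    abel
  rw [lieDerivative_eq_sum_fld, along]
  simp only [LinearMap.sum_apply, map_sum, h, Finset.sum_add_distrib]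

theorem lieDerivative_degProj (X : Vect n) (k : ℕ) (η : Form 𝕜 n) :
    lieDerivative X (degProj k η) = degProj k (lieDerivative X η) := by
  rw [lieDerivative_eq, lieDerivative_eq]
  simp only [map_add, map_sum, degProj_mulF_apply, degProj_wedge_interior, pd_degProj_apply]

/-- The terms with second derivatives give the right-hand side. The products of first derivatives
form the trace of the product of the two Jacobians, which is symmetric in `X` and `Y`, and cancel.
This identity makes the divergence a cocycle. -/
theorem divFn_bracket (X Y : Vect n) :
    divFn (bracket X Y) = along X (divFn Y) - along Y (divFn X) := by
  simp only [divFn, along, comp_bracket, map_sum, map_sub, fnPd_mul, Finset.sum_sub_distrib,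
    Finset.sum_add_distrib, Finset.mul_sum]
  have h1 : ∀ X Y : Vect n, ∑ x, ∑ i, comp X i * fnPd x (fnPd i (comp Y x)) =
      ∑ i, ∑ x, comp X i * fnPd i (fnPd x (comp Y x)) := by
    intro X Y
    rw [Finset.sum_comm]
    simp only [fnPd_comm]
  have h2 : ∑ x, ∑ i, fnPd x (comp X i) * fnPd i (comp Y x) =
      ∑ x, ∑ i, fnPd x (comp Y i) * fnPd i (comp X x) := by
    rw [Finset.sum_comm]
    simp only [mul_comm]
  rw [h1, h1, h2]
  abel

/-! ### Finite dimensionality of the fibre -/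

instance : IsScalarTower ℝ 𝕜 (Fibre 𝕜 n) :=
  inferInstanceAs (IsScalarTower ℝ 𝕜 ((k : Fin (n + 1)) → Rn n [⋀^Fin k]→L[ℝ] 𝕜))

@[simp] theorem form_rsmul_apply (c : ℝ) (η : Form 𝕜 n) (x : Rn n) :
    (c • η).1 x = c • η.1 x := rfl

instance (k : ℕ) : FiniteDimensional ℝ (Rn n [⋀^Fin k]→L[ℝ] 𝕜) :=
  let φ : (Rn n [⋀^Fin k]→L[ℝ] 𝕜) →ₗ[ℝ] MultilinearMap ℝ (fun _ : Fin k => Rn n) 𝕜 :=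
    { toFun := fun a => a.toMultilinearMap
      map_add' := fun _ _ => rfl
      map_smul' := fun _ _ => rfl }
  haveI : Module.Finite ℝ 𝕜 := FiniteDimensional.rclike_to_real
  haveI : Module.Finite ℝ (MultilinearMap ℝ (fun _ : Fin k => Rn n) 𝕜) :=
    Module.Finite.multilinearMap
  haveI : IsNoetherian ℝ (MultilinearMap ℝ (fun _ : Fin k => Rn n) 𝕜) :=
    isNoetherian_of_isNoetherianRing_of_finite ℝ _
  Module.Finite.of_injective φ fun a b h => by
    ext v
    exact DFunLike.congr_fun h v

instance : FiniteDimensional ℝ (Fibre 𝕜 n) :=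
  inferInstanceAs (FiniteDimensional ℝ ((k : Fin (n + 1)) → Rn n [⋀^Fin k]→L[ℝ] 𝕜))

instance : FiniteDimensional 𝕜 (Fibre 𝕜 n) :=
  Module.Finite.of_restrictScalars_finite ℝ 𝕜 (Fibre 𝕜 n)

/-! ### Flat functions and Taylor polynomials -/

section Taylor

variable {F : Type*} [NormedAddCommGroup F] [NormedSpace ℝ F]

/-- Partial derivatives of functions with values in a normed space. -/
def part (i : Fin n) (f : Rn n → F) (y : Rn n) : F := fderiv ℝ f y (basisVec i)

theorem contDiff_part {f : Rn n → F} (hf : ContDiff ℝ ∞ f) (i : Fin n) : ContDiff ℝ ∞ (part i f) :=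
  (hf.fderiv_right (m := ∞) (by simp)).clm_apply contDiff_const

theorem part_comm {f : Rn n → F} (hf : ContDiff ℝ ∞ f) (i j : Fin n) :
    part i (part j f) = part j (part i f) := by
  funext x
  change fderiv ℝ (fun y => fderiv ℝ f y (basisVec j)) x (basisVec i) =
    fderiv ℝ (fun y => fderiv ℝ f y (basisVec i)) x (basisVec j)
  rw [fderiv_fderiv_apply hf, fderiv_fderiv_apply hf, fderiv_fderiv_symm hf]

theorem part_add {f g : Rn n → F} (hf : ContDiff ℝ ∞ f) (hg : ContDiff ℝ ∞ g) (i : Fin n) :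
    part i (f + g) = part i f + part i g := by
  funext x
  change fderiv ℝ (f + g) x _ = _
  rw [fderiv_add (hf.differentiable (by simp) x) (hg.differentiable (by simp) x)]; rfl

theorem part_smul {f : Rn n → ℝ} {g : Rn n → F} (hf : ContDiff ℝ ∞ f) (hg : ContDiff ℝ ∞ g)
    (i : Fin n) :
    part i (fun y => f y • g y) = (fun y => f y • part i g y) + fun y => part i f y • g y := by
  funext x
  change fderiv ℝ (fun y => f y • g y) x _ = _
  rw [fderiv_fun_smul (hf.differentiable (by simp) x) (hg.differentiable (by simp) x)]; rfl

theorem part_const (i : Fin n) (a : F) : part i (fun _ : Rn n => a) = 0 := by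
  funext x; simp [part]

theorem part_comp_clm {G : Type*} [NormedAddCommGroup G] [NormedSpace ℝ G] (Φ : F →L[ℝ] G)
    {f : Rn n → F} (hf : ContDiff ℝ ∞ f) (i : Fin n) :
    part i (fun y => Φ (f y)) = fun y => Φ (part i f y) := by
  funext x
  have h2 := (Φ.hasFDerivAt (x := f x)).comp x (hf.differentiable (by simp) x).hasFDerivAt
  change fderiv ℝ (Φ ∘ f) x _ = _
  rw [h2.fderiv]; rfl

/-- The derivatives of order at most `r` of `f` at `x` vanish. -/
def FlatAt : ℕ → Rn n → (Rn n → F) → Prop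
  | 0, x, f => f x = 0
  | r + 1, x, f => f x = 0 ∧ ∀ i, FlatAt r x (part i f)

theorem FlatAt.eq_zero {r : ℕ} {x : Rn n} {f : Rn n → F} (h : FlatAt r x f) : f x = 0 := by
  cases r with
  | zero => exact h
  | succ r => exact h.1

theorem FlatAt.mono {r s : ℕ} {x : Rn n} {f : Rn n → F} (h : FlatAt r x f) (hs : s ≤ r) :
    FlatAt s x f := by
  induction s generalizing r f with
  | zero => exact h.eq_zero
  | succ s ih =>
    obtain ⟨r, rfl⟩ : ∃ m, r = m + 1 := ⟨r - 1, by omega⟩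
    exact ⟨h.1, fun i => ih (h.2 i) (by omega)⟩

theorem FlatAt.add {r : ℕ} {x : Rn n} {f g : Rn n → F} (hf : ContDiff ℝ ∞ f)
    (hg : ContDiff ℝ ∞ g) (h : FlatAt r x f) (h' : FlatAt r x g) : FlatAt r x (f + g) := by
  induction r generalizing f g with
  | zero => change f x + g x = 0; rw [h.eq_zero, h'.eq_zero, add_zero]
  | succ r ih =>
    refine ⟨by change f x + g x = 0; rw [h.eq_zero, h'.eq_zero, add_zero], fun i => ?_⟩
    rw [part_add hf hg]
    exact ih (contDiff_part hf i) (contDiff_part hg i) (h.2 i) (h'.2 i)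

theorem FlatAt.smul {r : ℕ} {x : Rn n} {f : Rn n → ℝ} {g : Rn n → F} (hf : ContDiff ℝ ∞ f)
    (hg : ContDiff ℝ ∞ g) (h : FlatAt r x g) : FlatAt r x (fun y => f y • g y) := by
  induction r generalizing f g with
  | zero => change f x • g x = 0; rw [h.eq_zero, smul_zero]
  | succ r ih =>
    refine ⟨by change f x • g x = 0; rw [h.eq_zero, smul_zero], fun i => ?_⟩
    rw [part_smul hf hg]
    exact (ih hf (contDiff_part hg i) (h.2 i)).add (hf.smul (contDiff_part hg i))
      ((contDiff_part hf i).smul hg) (ih (contDiff_part hf i) hg (h.mono (by omega)))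

/-- The order gained from a factor vanishing at `x` is the reason why commutators with coordinates
lower the order of an operator. -/
theorem FlatAt.smul_succ {r : ℕ} {x : Rn n} {f : Rn n → ℝ} {g : Rn n → F} (hf : ContDiff ℝ ∞ f)
    (hg : ContDiff ℝ ∞ g) (hx : f x = 0) (h : FlatAt r x g) :
    FlatAt (r + 1) x (fun y => f y • g y) := by
  induction r generalizing g with
  | zero =>
    refine ⟨by change f x • g x = 0; rw [hx, zero_smul], fun i => ?_⟩
    rw [part_smul hf hg]
    change f x • part i g x + part i f x • g x = 0
    rw [hx, h.eq_zero, smul_zero, zero_smul, add_zero]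
  | succ r ih =>
    refine ⟨by change f x • g x = 0; rw [hx, zero_smul], fun i => ?_⟩
    rw [part_smul hf hg]
    exact (ih (contDiff_part hg i) (h.2 i)).add (hf.smul (contDiff_part hg i))
      ((contDiff_part hf i).smul hg) (FlatAt.smul (contDiff_part hf i) hg h)

theorem FlatAt.iteratedFDeriv_eq_zero {r j : ℕ} {x : Rn n} {f : Rn n → F} (hf : ContDiff ℝ ∞ f)
    (h : FlatAt r x f) (hj : j ≤ r) : iteratedFDeriv ℝ j f x = 0 := by
  induction j generalizing f r with
  | zero => ext v; rw [iteratedFDeriv_zero_apply, h.eq_zero]; rfl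
  | succ j ih =>
    obtain ⟨r, rfl⟩ : ∃ m, r = m + 1 := ⟨r - 1, by omega⟩
    ext v
    rw [iteratedFDeriv_succ_apply_right, ← sum_smul_basisVec (v (Fin.last j)), map_sum]
    refine Finset.sum_eq_zero fun i _ => ?_
    rw [map_smul]
    have h1 := ih (contDiff_part hf i) (h.2 i) (by omega)
    have h2 := iteratedFDeriv_clm_apply_const_apply (n := ∞) (i := j)
      (hf.fderiv_right (m := ∞) (by simp))
      (by exact_mod_cast le_top) (x := x) (u := basisVec i) (m := Fin.init v)
    rw [← h2]
    change v (Fin.last j) i • (iteratedFDeriv ℝ j (part i f) x) (Fin.init v) = 0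
    rw [h1]
    exact smul_zero _

/-- The homogeneous component of degree `j` of the Taylor expansion at `x`. -/
def tay (x : Rn n) : ℕ → (Rn n → F) → Rn n → F
  | 0, f => fun _ => f x
  -- Euler's identity for homogeneous polynomials serves as the definition; no multi-indices or
  -- factorials are needed.
  | j + 1, f => fun y => ((j : ℝ) + 1)⁻¹ • ∑ i, (y i - x i) • tay x j (part i f) y

theorem contDiff_coord_sub (x : Rn n) (i : Fin n) : ContDiff ℝ ∞ fun y : Rn n => y i - x i :=
  (smooth_fn (coord i)).sub contDiff_const

theorem contDiff_tay (x : Rn n) (j : ℕ) (f : Rn n → F) : ContDiff ℝ ∞ (tay x j f) := by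
  induction j generalizing f with
  | zero => exact contDiff_const
  | succ j ih =>
    exact contDiff_const.smul (ContDiff.sum fun i _ => (contDiff_coord_sub x i).smul (ih _))

theorem part_coord_sub (x : Rn n) (m i : Fin n) :
    part m (fun y : Rn n => y i - x i) = fun _ => if i = m then 1 else 0 := by
  funext y
  have h := congrArg Subtype.val (fnPd_coord m i)
  have h1 := congrFun h y
  rw [fnPd_apply] at h1
  change fderiv ℝ (fun y : Rn n => y i - x i) y (basisVec m) = _
  rw [fderiv_sub_const]
  refine h1.trans ?_
  split_ifs <;> rfl

theorem part_sum {ι : Type*} (s : Finset ι) (f : ι → Rn n → F) (hf : ∀ i, ContDiff ℝ ∞ (f i))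
    (m : Fin n) : part m (fun y => ∑ i ∈ s, f i y) = fun y => ∑ i ∈ s, part m (f i) y := by
  funext x
  simp only [part]
  rw [fderiv_fun_sum fun i _ => (hf i).differentiable (by simp) x]
  simp

theorem part_tay_zero (x : Rn n) (f : Rn n → F) (m : Fin n) : part m (tay x 0 f) = 0 :=
  part_const m _

/-- The product rule applied to Euler's recursion yields one copy of the expected term directly; the
remaining copies come from the induction hypothesis and the recursion read backwards. Their total
number is cancelled by the normalizing factor. -/
theorem part_tay_succ (x : Rn n) (j : ℕ) {f : Rn n → F} (hf : ContDiff ℝ ∞ f) (m : Fin n) :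
    part m (tay x (j + 1) f) = tay x j (part m f) := by
  have key : ∀ j (f : Rn n → F), part m (tay x (j + 1) f) = fun y => ((j : ℝ) + 1)⁻¹ •
      (tay x j (part m f) y + ∑ i, (y i - x i) • part m (tay x j (part i f)) y) := by
    intro j f
    have hs : ∀ i, ContDiff ℝ ∞ fun y : Rn n => (y i - x i) • tay x j (part i f) y := fun i =>
      (contDiff_coord_sub x i).smul (contDiff_tay x j _)
    have hsm : ContDiff ℝ ∞ fun y : Rn n => ∑ i, (y i - x i) • tay x j (part i f) y :=
      ContDiff.sum fun i _ => hs i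
    have h1 : part m (tay x (j + 1) f) = fun y => ((j : ℝ) + 1)⁻¹ •
        part m (fun y => ∑ i, (y i - x i) • tay x j (part i f) y) y :=
      part_comp_clm (((j : ℝ) + 1)⁻¹ • ContinuousLinearMap.id ℝ F) hsm m
    rw [h1, part_sum Finset.univ (fun i y => (y i - x i) • tay x j (part i f) y) hs]
    funext y
    congr 1
    have h2 : ∀ i, part m (fun y => (y i - x i) • tay x j (part i f) y) y =
        (y i - x i) • part m (tay x j (part i f)) y +
          if i = m then tay x j (part i f) y else 0 := by
      intro i
      rw [part_smul (contDiff_coord_sub x i) (contDiff_tay x j _), part_coord_sub]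
      simp
    simp only [h2, Finset.sum_add_distrib]
    rw [add_comm]
    simp
  induction j generalizing f with
  | zero =>
    rw [key]
    funext y
    simp [part_tay_zero]
  | succ j ih =>
    rw [key]
    funext y
    simp only [ih (contDiff_part hf _)]
    have h3 : ∑ i, (y i - x i) • tay x j (part m (part i f)) y =
        ((j : ℝ) + 1) • tay x (j + 1) (part m f) y := by
      rw [tay, smul_smul, mul_inv_cancel₀ (by positivity), one_smul]
      exact Finset.sum_congr rfl fun i _ => by rw [part_comm hf]
    rw [h3, ← one_smul ℝ (tay x (j + 1) (part m f) y), smul_smul, ← add_smul, smul_smul]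
    rw [show ((↑(j + 1) : ℝ) + 1)⁻¹ * (1 + (↑j + 1) * 1) = 1 by
      push_cast; rw [inv_mul_eq_one₀ (by positivity)]; ring]

theorem tay_self (x : Rn n) (j : ℕ) (f : Rn n → F) : tay x (j + 1) f x = 0 := by
  simp [tay]

theorem flatAt_sub_tay (x : Rn n) (r : ℕ) {f : Rn n → F} (hf : ContDiff ℝ ∞ f) :
    FlatAt r x (f + fun y => - ∑ j ∈ Finset.range (r + 1), tay x j f y) := by
  have hs : ∀ r (f : Rn n → F),
      ContDiff ℝ ∞ (fun y => - ∑ j ∈ Finset.range (r + 1), tay x j f y) := fun r f =>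
    ContDiff.neg (f := fun y => ∑ j ∈ Finset.range (r + 1), tay x j f y)
      (ContDiff.sum fun i _ => contDiff_tay x i _)
  have h0 : ∀ r (f : Rn n → F),
      (f + fun y => - ∑ j ∈ Finset.range (r + 1), tay x j f y) x = 0 := by
    intro r f
    change f x + - ∑ j ∈ Finset.range (r + 1), tay x j f x = 0
    rw [Finset.sum_range_succ']
    simp [tay_self]
    simp [tay]
  induction r generalizing f with
  | zero => exact h0 0 f
  | succ r ih =>
    refine ⟨h0 _ _, fun i => ?_⟩
    rw [part_add hf (hs _ _)]
    convert ih (contDiff_part hf i) using 2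
    have h1 : part i (fun y => - ∑ j ∈ Finset.range (r + 1 + 1), tay x j f y) = fun y =>
        - part i (fun y => ∑ j ∈ Finset.range (r + 1 + 1), tay x j f y) y :=
      part_comp_clm (-ContinuousLinearMap.id ℝ F)
        (f := fun y => ∑ j ∈ Finset.range (r + 1 + 1), tay x j f y)
        (ContDiff.sum fun i _ => contDiff_tay x i _) i
    rw [h1, part_sum _ (fun j => tay x j f) fun j => contDiff_tay x j f]
    funext y
    simp only []
    rw [Finset.sum_range_succ', part_tay_zero]
    simp [part_tay_succ x _ hf]

end Taylor

/-! ### Local operators between spaces of smooth functions -/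

section Local

variable {F G H : Type*} [NormedAddCommGroup F] [NormedSpace ℝ F]
  [NormedAddCommGroup G] [NormedSpace ℝ G] [NormedAddCommGroup H] [NormedSpace ℝ H]

/-- Smooth functions on `ℝⁿ` with values in a normed space. -/
def Sm (n : ℕ) (F : Type*) [NormedAddCommGroup F] [NormedSpace ℝ F] :
    Submodule ℝ (Rn n → F) where
  carrier := {f | ContDiff ℝ ∞ f}
  add_mem' {f g} (hf : ContDiff ℝ ∞ f) (hg : ContDiff ℝ ∞ g) := hf.add hg
  zero_mem' := (contDiff_const : ContDiff ℝ ∞ fun _ : Rn n => (0 : F))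
  smul_mem' c f (hf : ContDiff ℝ ∞ f) := hf.const_smul c

theorem smooth_sm (f : Sm n F) : ContDiff ℝ ∞ f.1 := f.2

theorem sm_sum_apply {ι : Type*} (s : Finset ι) (f : ι → Sm n F) (x : Rn n) :
    (∑ i ∈ s, f i).1 x = ∑ i ∈ s, (f i).1 x := by
  rw [show (∑ i ∈ s, f i).1 = ∑ i ∈ s, (f i).1 from map_sum (Sm n F).subtype f s]
  exact Finset.sum_apply _ _ _

/-- Multiplication by a coordinate. -/
def coordMul (i : Fin n) : Sm n F →ₗ[ℝ] Sm n F where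
  toFun f := ⟨fun y => y i • f.1 y, (smooth_fn (coord i)).smul (smooth_sm f)⟩
  map_add' f g := by ext1; funext y; exact smul_add _ _ _
  map_smul' c f := by ext1; funext y; exact smul_comm _ _ _

/-- Partial derivatives as linear maps. -/
def smPart (i : Fin n) : Sm n F →ₗ[ℝ] Sm n F where
  toFun f := ⟨part i f.1, contDiff_part (smooth_sm f) i⟩
  map_add' f g := by ext1; exact part_add (smooth_sm f) (smooth_sm g) i
  map_smul' c f := by
    ext1
    exact part_comp_clm (c • ContinuousLinearMap.id ℝ F) (smooth_sm f) i

/-- Constant functions. -/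
def smConst (n : ℕ) : F →ₗ[ℝ] Sm n F where
  toFun a := ⟨fun _ => a, show ContDiff ℝ ∞ fun _ : Rn n => a from contDiff_const⟩
  map_add' _ _ := rfl
  map_smul' _ _ := rfl

/-- The homogeneous components of the Taylor expansion. -/
def smTay (x : Rn n) (j : ℕ) (f : Sm n F) : Sm n F := ⟨tay x j f.1, contDiff_tay x j f.1⟩

theorem smTay_zero (x : Rn n) (f : Sm n F) : smTay x 0 f = smConst n (f.1 x) := rfl

theorem smTay_succ (x : Rn n) (j : ℕ) (f : Sm n F) :
    smTay x (j + 1) f = ((j : ℝ) + 1)⁻¹ • ∑ i, (coordMul i (smTay x j (smPart i f)) -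
      x i • smTay x j (smPart i f)) := by
  ext1
  funext y
  change _ = ((j : ℝ) + 1)⁻¹ • (∑ i, (coordMul i (smTay x j (smPart i f)) -
      x i • smTay x j (smPart i f))).1 y
  rw [sm_sum_apply]
  change ((j : ℝ) + 1)⁻¹ • _ = _
  congr 1
  refine Finset.sum_congr rfl fun i _ => ?_
  exact sub_smul _ _ _

/-- The commutator with the multiplication by a coordinate. -/
def adCoord (i : Fin n) (T : Sm n F →ₗ[ℝ] Sm n G) : Sm n F →ₗ[ℝ] Sm n G :=
  T ∘ₗ coordMul i - coordMul i ∘ₗ T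

/-- Multiplication by `yᵢ - xᵢ` vanishes when evaluated at `x`, so only the commutators of `T` with
the coordinates survive. All later inductions on the Taylor degree trade a degree for such a
commutator. -/
theorem map_smTay_succ (T : Sm n F →ₗ[ℝ] Sm n G) (x : Rn n) (j : ℕ) (f : Sm n F) :
    (T (smTay x (j + 1) f)).1 x =
      ((j : ℝ) + 1)⁻¹ • ∑ i, (adCoord i T (smTay x j (smPart i f))).1 x := by
  rw [smTay_succ, map_smul, map_sum]
  change ((j : ℝ) + 1)⁻¹ • (∑ i, T _).1 x = _
  rw [sm_sum_apply]
  congr 1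
  refine Finset.sum_congr rfl fun i _ => ?_
  rw [map_sub, map_smul]
  rfl

/-- The map is local of order at most `r`. -/
def LocalMap (r : ℕ) (T : Sm n F →ₗ[ℝ] Sm n G) : Prop :=
  ∀ x f, FlatAt r x f.1 → (T f).1 x = 0

/-- The remainder of the Taylor polynomial of degree `r` is flat to order `r`, hence invisible to
`T` at `x`. No continuity of `T` enters. -/
theorem LocalMap.apply_eq {r : ℕ} {T : Sm n F →ₗ[ℝ] Sm n G} (hT : LocalMap r T) (f : Sm n F)
    (x : Rn n) : (T f).1 x = ∑ j ∈ Finset.range (r + 1), (T (smTay x j f)).1 x := by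
  have h := hT x (f - ∑ j ∈ Finset.range (r + 1), smTay x j f) (by
    convert flatAt_sub_tay x r (smooth_sm f) using 1
    funext y
    change f.1 y - (∑ j ∈ Finset.range (r + 1), smTay x j f).1 y = _
    rw [sm_sum_apply, sub_eq_add_neg]
    rfl)
  rw [map_sub, map_sum] at h
  change (T f).1 x - (∑ j ∈ Finset.range (r + 1), T (smTay x j f)).1 x = 0 at h
  rw [sm_sum_apply] at h
  exact sub_eq_zero.1 h

/-- Insertion of the `i`-th basis vector in the last argument. -/
def insertLast (F : Type*) [NormedAddCommGroup F] [NormedSpace ℝ F] (j : ℕ) (i : Fin n) :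
    (Rn n [×(j + 1)]→L[ℝ] F) →L[ℝ] (Rn n [×j]→L[ℝ] F) :=
  (ContinuousLinearMap.compContinuousMultilinearMapL ℝ (fun _ : Fin j => Rn n) (Rn n →L[ℝ] F) F
    (ContinuousLinearMap.apply ℝ F (basisVec i))).comp
  (continuousMultilinearCurryRightEquiv' ℝ j (Rn n) F).toContinuousLinearEquiv.toContinuousLinearMap

theorem iteratedFDeriv_part {f : Rn n → F} (hf : ContDiff ℝ ∞ f) (j : ℕ) (i : Fin n) (x : Rn n) :
    iteratedFDeriv ℝ j (part i f) x = insertLast F j i (iteratedFDeriv ℝ (j + 1) f x) := by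
  ext v
  have h2 := iteratedFDeriv_clm_apply_const_apply (n := ∞) (i := j)
      (hf.fderiv_right (m := ∞) (by simp))
      (by exact_mod_cast le_top) (x := x) (u := basisVec i) (m := v)
  refine h2.trans ?_
  change _ = iteratedFDeriv ℝ (j + 1) f x (Fin.snoc v (basisVec i))
  rw [iteratedFDeriv_succ_apply_right]
  simp

theorem contDiff_smul_sum {ι : Type*} [Fintype ι] (c : ℝ) (f : ι → Rn n → F)
    (hf : ∀ i, ContDiff ℝ ∞ (f i)) : ContDiff ℝ ∞ fun x => c • ∑ i, f i x :=
  ContDiff.const_smul (f := fun x => ∑ i, f i x) c (ContDiff.sum fun i _ => hf i)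

theorem contDiff_smulRight (φ : F →L[ℝ] ℝ) {f : Rn n → G} (hf : ContDiff ℝ ∞ f) :
    ContDiff ℝ ∞ fun x => φ.smulRight (f x) :=
  ContDiff.comp (g := ContinuousLinearMap.smulRightL ℝ F G φ)
    (ContinuousLinearMap.contDiff _) hf

/-- Locality is not needed on a single Taylor component. In degree zero the coefficients are the
images of constant functions, smooth because `T` takes smooth values; each higher degree reduces to
commutators with coordinates. -/
theorem exists_symbol [FiniteDimensional ℝ F] (T : Sm n F →ₗ[ℝ] Sm n G) (j : ℕ) :
    ∃ a : Rn n → ((Rn n [×j]→L[ℝ] F) →L[ℝ] G), ContDiff ℝ ∞ a ∧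
      ∀ f x, (T (smTay x j f)).1 x = a x (iteratedFDeriv ℝ j f.1 x) := by
  induction j generalizing T with
  | zero =>
    let b := Module.finBasis ℝ F
    let φ : Fin (Module.finrank ℝ F) → ((Rn n [×0]→L[ℝ] F) →L[ℝ] ℝ) := fun k =>
      (LinearMap.toContinuousLinearMap (b.coord k)).comp
        (ContinuousMultilinearMap.apply ℝ (fun _ : Fin 0 => Rn n) F 0)
    refine ⟨fun x => ∑ k, (φ k).smulRight ((T (smConst n (b k))).1 x), ?_, ?_⟩
    · refine ContDiff.sum fun k _ => ?_
      exact contDiff_smulRight (φ k) (smooth_sm _)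
    · intro f x
      rw [smTay_zero]
      conv_lhs => rw [← b.sum_repr (f.1 x)]
      rw [map_sum, map_sum, sm_sum_apply, sum_apply]
      refine Finset.sum_congr rfl fun k _ => ?_
      rw [map_smul, map_smul]
      rfl
  | succ j ih =>
    choose a ha h using fun i : Fin n => ih (adCoord i T)
    refine ⟨fun x => ((j : ℝ) + 1)⁻¹ • ∑ i, (a i x).comp (insertLast F j i), ?_, ?_⟩
    · exact contDiff_smul_sum _ _ fun i => (ha i).clm_comp contDiff_const
    · intro f x
      rw [map_smTay_succ]
      simp only [h, smul_apply, sum_apply, ContinuousLinearMap.comp_apply]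
      congr 1
      refine Finset.sum_congr rfl fun i _ => ?_
      exact congrArg _ (iteratedFDeriv_part (smooth_sm f) j i x)

theorem LocalMap.exists_eq [FiniteDimensional ℝ F] {r : ℕ} {T : Sm n F →ₗ[ℝ] Sm n G}
    (hT : LocalMap r T) : ∃ a : (j : ℕ) → Rn n → ((Rn n [×j]→L[ℝ] F) →L[ℝ] G),
      (∀ j, ContDiff ℝ ∞ (a j)) ∧ ∀ f x, (T f).1 x =
        ∑ j ∈ Finset.range (r + 1), a j x (iteratedFDeriv ℝ j f.1 x) := by
  choose a ha h using fun j => exists_symbol T j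
  exact ⟨a, ha, fun f x => by rw [hT.apply_eq]; simp only [h]⟩

theorem part_iteratedFDeriv {f : Rn n → F} (hf : ContDiff ℝ ∞ f) (j : ℕ) (i : Fin n) (x : Rn n) :
    part i (iteratedFDeriv ℝ j f) x = iteratedFDeriv ℝ j (part i f) x := by
  induction j generalizing f with
  | zero =>
    have h1 : iteratedFDeriv ℝ 0 f = fun y =>
        (continuousMultilinearCurryFin0 ℝ (Rn n) F).symm.toContinuousLinearEquiv.toContinuousLinearMap
          (f y) := rfl
    rw [h1, part_comp_clm _ hf]
    rfl
  | succ j ih =>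
    have hs : ∀ {g : Rn n → F}, ContDiff ℝ ∞ g → ∀ m, ContDiff ℝ ∞ (iteratedFDeriv ℝ m g) :=
      fun hg m => hg.iteratedFDeriv_right (m := ∞) (i := m) (by exact_mod_cast le_top)
    have key : ∀ v : Fin (j + 1) → Rn n, part i (iteratedFDeriv ℝ (j + 1) f) x v =
        iteratedFDeriv ℝ (j + 1) (part i f) x v := by
      intro v
      have e1 : ∀ (g : Rn n → F), ContDiff ℝ ∞ g → ∀ y, iteratedFDeriv ℝ (j + 1) g y v =
          ∑ k, v (Fin.last j) k • iteratedFDeriv ℝ j (part k g) y (Fin.init v) := by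
        intro g hg y
        rw [iteratedFDeriv_succ_apply_right, ← sum_smul_basisVec (v (Fin.last j)), map_sum]
        refine Finset.sum_congr rfl fun k _ => ?_
        rw [map_smul, sum_smul_basisVec]
        exact congrArg _ (iteratedFDeriv_clm_apply_const_apply (n := ∞) (i := j)
          (hg.fderiv_right (m := ∞) (by simp)) (by exact_mod_cast le_top) (x := y)
          (u := basisVec k) (m := Fin.init v)).symm
      have e2 := congrFun (part_comp_clm (ContinuousMultilinearMap.apply ℝ
        (fun _ : Fin (j + 1) => Rn n) F v) (hs hf (j + 1)) i) x
      change part i (fun y => iteratedFDeriv ℝ (j + 1) f y v) x =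
        part i (iteratedFDeriv ℝ (j + 1) f) x v at e2
      rw [← e2, e1 _ (contDiff_part hf i), funext (e1 f hf)]
      have hc : ∀ k, ContDiff ℝ ∞ (fun y => v (Fin.last j) k •
          iteratedFDeriv ℝ j (part k f) y (Fin.init v)) := fun k =>
        contDiff_const.smul ((ContinuousMultilinearMap.apply ℝ
          (fun _ : Fin j => Rn n) F (Fin.init v)).contDiff.comp (hs (contDiff_part hf k) j))
      rw [part_sum Finset.univ _ hc]
      refine Finset.sum_congr rfl fun k _ => ?_
      have e3 := congrFun (part_comp_clm (v (Fin.last j) k • ContinuousMultilinearMap.apply ℝ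
        (fun _ : Fin j => Rn n) F (Fin.init v)) (hs (contDiff_part hf k) j) i) x
      refine e3.trans ?_
      change v (Fin.last j) k • (part i (iteratedFDeriv ℝ j (part k f)) x) (Fin.init v) = _
      rw [ih (contDiff_part hf k), part_comm hf]
    ext v
    exact key v

/-- In terms of the symbol, the commutator with a partial derivative merely differentiates the
coefficients, so the order does not grow. -/
theorem LocalMap.commutator_part [FiniteDimensional ℝ F] {r : ℕ} {T : Sm n F →ₗ[ℝ] Sm n G}
    (hT : LocalMap r T) (i : Fin n) : LocalMap r (smPart i ∘ₗ T - T ∘ₗ smPart i) := by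
  obtain ⟨a, ha, h⟩ := hT.exists_eq
  intro x f hf
  change part i (T f).1 x - (T (smPart i f)).1 x = 0
  have hs : ∀ m, ContDiff ℝ ∞ (iteratedFDeriv ℝ m f.1) :=
      fun m => (smooth_sm f).iteratedFDeriv_right (m := ∞) (i := m) (by exact_mod_cast le_top)
  rw [h, show (T f).1 = fun y => _ from funext (h f), part_sum _
    (fun j y => a j y (iteratedFDeriv ℝ j f.1 y)) (fun j => (ha j).clm_apply (hs j)),
    ← Finset.sum_sub_distrib]
  refine Finset.sum_eq_zero fun j hj => ?_
  have hz : iteratedFDeriv ℝ j f.1 x = 0 :=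
    hf.iteratedFDeriv_eq_zero (smooth_sm f) (by simpa [Nat.lt_succ_iff] using hj)
  have hd : part i (fun y => a j y (iteratedFDeriv ℝ j f.1 y)) x =
      a j x (part i (iteratedFDeriv ℝ j f.1) x) + part i (a j) x (iteratedFDeriv ℝ j f.1 x) := by
    change fderiv ℝ _ x _ = _
    rw [fderiv_clm_apply ((ha j).differentiable (by simp) x) ((hs j).differentiable (by simp) x)]
    rfl
  rw [hd, part_iteratedFDeriv (smooth_sm f), hz, map_zero, add_zero]
  exact sub_self _

/-- Induct through `∂ᵢ T f = T ∂ᵢ f + [∂ᵢ, T] f`, whose commutator has the same order as `T`.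
Composition of local operators rests on this. -/
theorem LocalMap.flatAt [FiniteDimensional ℝ F] {r s : ℕ} {T : Sm n F →ₗ[ℝ] Sm n G}
    (hT : LocalMap r T) {x : Rn n} {f : Sm n F} (hf : FlatAt (r + s) x f.1) :
    FlatAt s x (T f).1 := by
  induction s generalizing T f with
  | zero => exact hT x f hf
  | succ s ih =>
    refine ⟨hT x f (hf.mono (by omega)), fun i => ?_⟩
    have h1 := ih hT (f := smPart i f) (hf.2 i)
    have h2 := ih (hT.commutator_part i) (f := f) (hf.mono (by omega))
    have h3 := h1.add (smooth_sm _) (smooth_sm _) h2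
    convert h3 using 1
    funext y
    change part i (T f).1 y = (T (smPart i f)).1 y + (part i (T f).1 y - (T (smPart i f)).1 y)
    abel

/-- Local bilinear maps have smooth symbols. -/
theorem exists_symbol₂ [FiniteDimensional ℝ F] [FiniteDimensional ℝ G]
    (T : Sm n F →ₗ[ℝ] Sm n G →ₗ[ℝ] Sm n H) (i j : ℕ) :
    ∃ b : Rn n → ((Rn n [×i]→L[ℝ] F) →L[ℝ] (Rn n [×j]→L[ℝ] G) →L[ℝ] H), ContDiff ℝ ∞ b ∧
      ∀ f g x, (T (smTay x i f) (smTay x j g)).1 x =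
        b x (iteratedFDeriv ℝ i f.1 x) (iteratedFDeriv ℝ j g.1 x) := by
  induction i generalizing T with
  | zero =>
    let b := Module.finBasis ℝ F
    let φ : Fin (Module.finrank ℝ F) → ((Rn n [×0]→L[ℝ] F) →L[ℝ] ℝ) := fun k =>
      (LinearMap.toContinuousLinearMap (b.coord k)).comp
        (ContinuousMultilinearMap.apply ℝ (fun _ : Fin 0 => Rn n) F 0)
    choose a ha h using fun k => exists_symbol (T (smConst n (b k))) j
    refine ⟨fun x => ∑ k, (φ k).smulRight (a k x), ?_, ?_⟩
    · refine ContDiff.sum fun k _ => ?_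
      exact contDiff_smulRight (φ k) (ha k)
    · intro f g x
      rw [smTay_zero]
      conv_lhs => rw [← b.sum_repr (f.1 x)]
      rw [map_sum, map_sum, LinearMap.sum_apply, sm_sum_apply, sum_apply,
        sum_apply]
      refine Finset.sum_congr rfl fun k _ => ?_
      rw [map_smul, map_smul]
      change b.repr (f.1 x) k • (T (smConst n (b k)) (smTay x j g)).1 x = _
      rw [h]
      rfl
  | succ i ih =>
    let T' : Fin n → (Sm n F →ₗ[ℝ] Sm n G →ₗ[ℝ] Sm n H) := fun m =>
      T ∘ₗ coordMul m - LinearMap.compRight ℝ (coordMul m) ∘ₗ T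
    choose a ha h using fun m : Fin n => ih (T' m)
    refine ⟨fun x => ((i : ℝ) + 1)⁻¹ • ∑ m, (a m x).comp (insertLast F i m), ?_, ?_⟩
    · exact contDiff_smul_sum _ _ fun i => (ha i).clm_comp contDiff_const
    · intro f g x
      have h1 := map_smTay_succ (T.flip (smTay x j g)) x i f
      refine h1.trans ?_
      simp only [smul_apply, sum_apply, ContinuousLinearMap.comp_apply]
      congr 1
      refine Finset.sum_congr rfl fun m _ => ?_
      refine (h m (smPart m f) g x).trans ?_
      exact congrArg (fun z => a m x z (iteratedFDeriv ℝ j g.1 x))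
        (iteratedFDeriv_part (smooth_sm f) i m x)

end Local

/-! ### Differential operators on forms and differentiable cochains -/

/-- Forms as smooth functions. -/
def toSm : Form 𝕜 n →ₗ[ℝ] Sm n (Fibre 𝕜 n) where
  toFun η := ⟨η.1, η.2⟩
  map_add' _ _ := rfl
  map_smul' _ _ := rfl

/-- Smooth functions as forms. -/
def ofSm : Sm n (Fibre 𝕜 n) →ₗ[ℝ] Form 𝕜 n where
  toFun η := ⟨η.1, η.2⟩
  map_add' _ _ := rfl
  map_smul' _ _ := rfl

/-- Smooth functions as vector fields. -/
def vectOfSm : Sm n (Rn n) →ₗ[ℝ] Vect n where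
  toFun X := ⟨X.1, X.2⟩
  map_add' _ _ := rfl
  map_smul' _ _ := rfl

/-- Operators on forms as maps between spaces of smooth functions. -/
def smOp (P : Module.End 𝕜 (Form 𝕜 n)) : Sm n (Fibre 𝕜 n) →ₗ[ℝ] Sm n (Fibre 𝕜 n) :=
  toSm ∘ₗ (P.restrictScalars ℝ) ∘ₗ ofSm

/-- The operator is local of order at most `r`. -/
def LocalOp (r : ℕ) (P : Module.End 𝕜 (Form 𝕜 n)) : Prop :=
  ∀ x η, FlatAt r x η.1 → (P η).1 x = 0

theorem LocalOp.smOp {r : ℕ} {P : Module.End 𝕜 (Form 𝕜 n)} (hP : LocalOp r P) :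
    LocalMap r (smOp P) := fun x f hf => hP x (ofSm f) hf

/-- Dependence on a finite jet alone already forces smooth coefficients. Sums, products and
commutators can then be handled through jets, without any calculus of symbols. -/
theorem isDiffOp_iff {P : Module.End 𝕜 (Form 𝕜 n)} : IsDiffOp P ↔ ∃ r, LocalOp r P := by
  constructor
  · rintro ⟨r, a, -, h⟩
    refine ⟨r, fun x η hη => ?_⟩
    rw [h]
    refine Finset.sum_eq_zero fun j hj => ?_
    rw [hη.iteratedFDeriv_eq_zero η.2 (by simpa [Nat.lt_succ_iff] using hj), map_zero]
  · rintro ⟨r, h⟩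
    obtain ⟨a, ha, h⟩ := h.smOp.exists_eq
    exact ⟨r, a, ha, fun η x => h (toSm η) x⟩

theorem LocalOp.mono {r s : ℕ} {P : Module.End 𝕜 (Form 𝕜 n)} (hP : LocalOp r P) (h : r ≤ s) :
    LocalOp s P := fun x η hη => hP x η (hη.mono h)

theorem LocalOp.flatAt {r s : ℕ} {P : Module.End 𝕜 (Form 𝕜 n)} (hP : LocalOp r P) {x : Rn n}
    {η : Form 𝕜 n} (hη : FlatAt (r + s) x η.1) : FlatAt s x (P η).1 :=
  hP.smOp.flatAt (f := toSm η) hη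

theorem LocalOp.add {r : ℕ} {P Q : Module.End 𝕜 (Form 𝕜 n)} (hP : LocalOp r P)
    (hQ : LocalOp r Q) : LocalOp r (P + Q) := fun x η hη => by
  rw [LinearMap.add_apply, form_add_apply, hP x η hη, hQ x η hη, add_zero]

theorem LocalOp.zero (r : ℕ) : LocalOp r (0 : Module.End 𝕜 (Form 𝕜 n)) := fun x η hη => rfl

theorem LocalOp.smul {r : ℕ} {P : Module.End 𝕜 (Form 𝕜 n)} (hP : LocalOp r P) (c : 𝕜) :
    LocalOp r (c • P) := fun x η hη => by
  rw [LinearMap.smul_apply, form_smul_apply, hP x η hη, smul_zero]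

theorem LocalOp.neg {r : ℕ} {P : Module.End 𝕜 (Form 𝕜 n)} (hP : LocalOp r P) :
    LocalOp r (-P) := by
  rw [← neg_one_smul 𝕜 P]; exact hP.smul _

theorem LocalOp.sub {r : ℕ} {P Q : Module.End 𝕜 (Form 𝕜 n)} (hP : LocalOp r P)
    (hQ : LocalOp r Q) : LocalOp r (P - Q) := by
  rw [sub_eq_add_neg]; exact hP.add hQ.neg

theorem LocalOp.sum {r : ℕ} {ι : Type*} (s : Finset ι) {P : ι → Module.End 𝕜 (Form 𝕜 n)}
    (hP : ∀ i, LocalOp r (P i)) : LocalOp r (∑ i ∈ s, P i) := by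
  classical
  induction s using Finset.induction_on with
  | empty => exact LocalOp.zero r
  | insert i s hi ih => rw [Finset.sum_insert hi]; exact (hP i).add ih

theorem LocalOp.mul {r s : ℕ} {P Q : Module.End 𝕜 (Form 𝕜 n)} (hP : LocalOp r P)
    (hQ : LocalOp s Q) : LocalOp (r + s) (P * Q) := fun x η hη =>
  hP x (Q η) (hQ.flatAt (by rwa [add_comm s r]))

theorem localOp_one : LocalOp 0 (1 : Module.End 𝕜 (Form 𝕜 n)) := fun x η hη => hη

theorem localOp_wedge (i : Fin n) : LocalOp 0 (wedge i : Module.End 𝕜 (Form 𝕜 n)) := fun x η hη => by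
  have h : η.1 x = 0 := hη
  funext k
  refine Fin.cases ?_ (fun k => ?_) k
  · rfl
  · rw [wedge_succ_eq, h]; exact map_zero _

theorem localOp_interior (i : Fin n) : LocalOp 0 (interior i : Module.End 𝕜 (Form 𝕜 n)) :=
  fun x η hη => by
  have h : η.1 x = 0 := hη
  funext k
  refine Fin.lastCases ?_ (fun k => ?_) k
  · simp [interior, fibreInterior]
  · rw [interior_castSucc_eq, h]; exact map_zero _

theorem localOp_degProj (k : ℕ) : LocalOp 0 (degProj k : Module.End 𝕜 (Form 𝕜 n)) :=
  fun x η hη => by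
  have h : η.1 x = 0 := hη
  funext j
  rw [degProj_apply, h]
  split_ifs <;> rfl

theorem localOp_pd (i : Fin n) : LocalOp 1 (pd i : Module.End 𝕜 (Form 𝕜 n)) :=
  fun x η hη => by
  rw [pd_apply]
  exact hη.2 i

/-- The commutator with the multiplication by a coordinate. -/
def adc (i : Fin n) (P : Module.End 𝕜 (Form 𝕜 n)) : Module.End 𝕜 (Form 𝕜 n) :=
  P * mulF (coord i) - mulF (coord i) * P

theorem LocalOp.adc {r : ℕ} {P : Module.End 𝕜 (Form 𝕜 n)} (hP : LocalOp (r + 1) P) (i : Fin n) :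
    LocalOp r (adc i P) := fun x η hη => by
  -- Subtracting the constant `xᵢ` does not change the commutator, but makes the factor vanish at
  -- the point.
  have h := hP x (mulF (coord i) η - x i • η) (by
    have h1 := hη.smul_succ (contDiff_coord_sub x i) (smooth_form η) (sub_self _)
    convert h1 using 1
    funext y
    exact (sub_smul _ _ _).symm)
  rw [map_sub, LinearMap.map_smul_of_tower] at h
  exact h

theorem LocalOp.adc_zero {P : Module.End 𝕜 (Form 𝕜 n)} (hP : LocalOp 0 P) (i : Fin n) :
    FormDeformation.adc i P = 0 := by
  refine LinearMap.ext fun η => form_ext fun x => ?_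
  have h := hP x (mulF (coord i) η - x i • η) (sub_self _)
  rw [map_sub, LinearMap.map_smul_of_tower] at h
  exact h

/-- The differential operators on `Ω(ℝⁿ)`. -/
def DiffOp (𝕜 : Type) [RCLike 𝕜] (n : ℕ) : Subalgebra 𝕜 (Module.End 𝕜 (Form 𝕜 n)) where
  carrier := {P | ∃ r, LocalOp r P}
  mul_mem' := fun ⟨r, hP⟩ ⟨s, hQ⟩ => ⟨_, hP.mul hQ⟩
  add_mem' := fun ⟨r, hP⟩ ⟨s, hQ⟩ =>
    ⟨r + s, (hP.mono (by omega)).add (hQ.mono (by omega))⟩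
  algebraMap_mem' c := ⟨0, by
    rw [Algebra.algebraMap_eq_smul_one]; exact localOp_one.smul c⟩

theorem mem_diffOp_iff {P : Module.End 𝕜 (Form 𝕜 n)} : P ∈ DiffOp 𝕜 n ↔ IsDiffOp P :=
  isDiffOp_iff.symm

theorem degProj_mem (k : ℕ) : degProj k ∈ DiffOp 𝕜 n := ⟨0, localOp_degProj k⟩

theorem localOp_d : LocalOp 1 (d : Module.End 𝕜 (Form 𝕜 n)) := by
  have h : (d : Module.End 𝕜 (Form 𝕜 n)) = ∑ i, wedge i * pd i := by
    ext1 η; rw [d_eq, LinearMap.sum_apply]; rfl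
  rw [h]
  exact LocalOp.sum _ fun i => by simpa using (localOp_wedge i).mul (localOp_pd i)

theorem d_mem : d ∈ DiffOp 𝕜 n := ⟨1, localOp_d⟩

/-! ### Differentiable cochains as local bilinear maps -/

/-- The cochain is local of order at most `r` in both arguments. -/
def LocalCochain (r : ℕ) (c : Vect n →ₗ[ℝ] Module.End 𝕜 (Form 𝕜 n)) : Prop :=
  ∀ x X η, FlatAt r x X.1 ∨ FlatAt r x η.1 → (c X η).1 x = 0

/-- Cochains as bilinear maps between spaces of smooth functions. -/
def smCochain (c : Vect n →ₗ[ℝ] Module.End 𝕜 (Form 𝕜 n)) :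
    Sm n (Rn n) →ₗ[ℝ] Sm n (Fibre 𝕜 n) →ₗ[ℝ] Sm n (Fibre 𝕜 n) :=
  LinearMap.mk₂ ℝ (fun X η => toSm (c (vectOfSm X) (ofSm η)))
    (fun X Y η => by rw [map_add, map_add]; rfl) (fun a X η => by rw [map_smul, map_smul]; rfl)
    (fun X η θ => by rw [map_add, map_add, map_add])
    (fun a X η => by rw [map_smul, LinearMap.map_smul_of_tower, map_smul])

theorem LocalCochain.local_left {r : ℕ} {c : Vect n →ₗ[ℝ] Module.End 𝕜 (Form 𝕜 n)}
    (hc : LocalCochain r c) (η : Form 𝕜 n) : LocalMap r ((smCochain c).flip (toSm η)) :=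
  fun x X hX => hc x (vectOfSm X) η (Or.inl hX)

theorem LocalCochain.local_right {r : ℕ} {c : Vect n →ₗ[ℝ] Module.End 𝕜 (Form 𝕜 n)}
    (hc : LocalCochain r c) (X : Vect n) : LocalOp r (c X) :=
  fun x η h => hc x X η (Or.inr h)

theorem LocalCochain.mono {r s : ℕ} {c : Vect n →ₗ[ℝ] Module.End 𝕜 (Form 𝕜 n)}
    (hc : LocalCochain r c) (h : r ≤ s) : LocalCochain s c :=
  fun x X η hX => hc x X η (hX.imp (fun a => a.mono h) (fun a => a.mono h))

/-- The space of differentiable `1`-cochains. -/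
def Cochain (𝕜 : Type) [RCLike 𝕜] (n : ℕ) :
    Submodule 𝕜 (Vect n →ₗ[ℝ] Module.End 𝕜 (Form 𝕜 n)) where
  carrier := {c | ∃ r, LocalCochain r c}
  add_mem' := fun {c c'} ⟨r, hP⟩ ⟨s, hQ⟩ => ⟨r + s, fun x X η h => by
    change (c X η).1 x + (c' X η).1 x = 0
    rw [hP.mono (show r ≤ r + s by omega) x X η h, hQ.mono (show s ≤ r + s by omega) x X η h,
      add_zero]⟩
  zero_mem' := ⟨0, fun x X η h => rfl⟩
  smul_mem' a c := fun ⟨r, hP⟩ => ⟨r, fun x X η h => by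
    change a • (c X η).1 x = 0
    rw [hP x X η h, smul_zero]⟩

/-- Replace first the field and then the form by their Taylor polynomials at `x`; on each pair of
components the symbol is smooth. -/
theorem isDiffCochain_of_mem {c : Vect n →ₗ[ℝ] Module.End 𝕜 (Form 𝕜 n)} (hc : c ∈ Cochain 𝕜 n) :
    IsDiffCochain c := by
  obtain ⟨r, hc⟩ := hc
  choose b hb h using fun i j => exists_symbol₂ (smCochain c) i j
  refine ⟨r, b, hb, fun X η x => ?_⟩
  have h1 := (hc.local_left η).apply_eq ⟨X.1, X.2⟩ x
  refine h1.trans (Finset.sum_congr rfl fun i _ => ?_)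
  have h2 := (hc.local_right (vectOfSm (smTay x i ⟨X.1, X.2⟩))).smOp.apply_eq (toSm η) x
  refine h2.trans (Finset.sum_congr rfl fun j _ => ?_)
  exact h i j ⟨X.1, X.2⟩ (toSm η) x

theorem iteratedFDeriv_add_smooth {F : Type*} [NormedAddCommGroup F] [NormedSpace ℝ F]
    {f g : Rn n → F} (hf : ContDiff ℝ ∞ f) (hg : ContDiff ℝ ∞ g) (i : ℕ) (x : Rn n) :
    iteratedFDeriv ℝ i (f + g) x = iteratedFDeriv ℝ i f x + iteratedFDeriv ℝ i g x :=
  iteratedFDeriv_add_apply (hf.of_le (by exact_mod_cast le_top)).contDiffAt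
    (hg.of_le (by exact_mod_cast le_top)).contDiffAt

theorem iteratedFDeriv_smul_smooth {F : Type*} [NormedAddCommGroup F] [NormedSpace ℝ F]
    {f : Rn n → F} (hf : ContDiff ℝ ∞ f) (c : ℝ) (i : ℕ) (x : Rn n) :
    iteratedFDeriv ℝ i (c • f) x = c • iteratedFDeriv ℝ i f x :=
  iteratedFDeriv_const_smul_apply (hf.of_le (by exact_mod_cast le_top)).contDiffAt

/-- A formula bilinear in the jets is linear in the field, so cochains may be treated as linear maps
from here on. -/
theorem IsDiffCochain.exists_mem {c : Vect n → Module.End 𝕜 (Form 𝕜 n)} (hc : IsDiffCochain c) :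
    ∃ c' ∈ Cochain 𝕜 n, ∀ X, c X = c' X := by
  obtain ⟨r, b, -, h⟩ := hc
  refine ⟨{ toFun := c, map_add' := fun X Y => ?_, map_smul' := fun a X => ?_ }, ⟨r, ?_⟩,
    fun X => rfl⟩
  · refine LinearMap.ext fun η => form_ext fun x => ?_
    rw [LinearMap.add_apply, form_add_apply, h, h, h, ← Finset.sum_add_distrib]
    refine Finset.sum_congr rfl fun i _ => ?_
    rw [← Finset.sum_add_distrib]
    refine Finset.sum_congr rfl fun j _ => ?_
    rw [show (X + Y).1 = X.1 + Y.1 from rfl, iteratedFDeriv_add_smooth X.2 Y.2, map_add]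
    rfl
  · refine LinearMap.ext fun η => form_ext fun x => ?_
    change (c (a • X) η).1 x = a • (c X η).1 x
    rw [h, h, Finset.smul_sum]
    refine Finset.sum_congr rfl fun i _ => ?_
    rw [Finset.smul_sum]
    refine Finset.sum_congr rfl fun j _ => ?_
    rw [show (a • X).1 = a • X.1 from rfl, iteratedFDeriv_smul_smooth X.2, map_smul]
    rfl
  · rintro x X η hX
    change (c X η).1 x = 0
    rw [h]
    refine Finset.sum_eq_zero fun i hi => Finset.sum_eq_zero fun j hj => ?_
    rcases hX with hX | hX
    · rw [hX.iteratedFDeriv_eq_zero X.2 (by simpa [Nat.lt_succ_iff] using hi), map_zero]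
      rfl
    · rw [hX.iteratedFDeriv_eq_zero η.2 (by simpa [Nat.lt_succ_iff] using hj), map_zero]

/-- Composition of a cochain with an operator from the left. -/
def lmulC (P : Module.End 𝕜 (Form 𝕜 n)) (c : Vect n →ₗ[ℝ] Module.End 𝕜 (Form 𝕜 n)) :
    Vect n →ₗ[ℝ] Module.End 𝕜 (Form 𝕜 n) := (LinearMap.mulLeft ℝ P) ∘ₗ c

/-- Composition of a cochain with an operator from the right. -/
def rmulC (P : Module.End 𝕜 (Form 𝕜 n)) (c : Vect n →ₗ[ℝ] Module.End 𝕜 (Form 𝕜 n)) :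
    Vect n →ₗ[ℝ] Module.End 𝕜 (Form 𝕜 n) := (LinearMap.mulRight ℝ P) ∘ₗ c

@[simp] theorem lmulC_apply (P : Module.End 𝕜 (Form 𝕜 n))
    (c : Vect n →ₗ[ℝ] Module.End 𝕜 (Form 𝕜 n)) (X : Vect n) : lmulC P c X = P * c X := rfl

@[simp] theorem rmulC_apply (P : Module.End 𝕜 (Form 𝕜 n))
    (c : Vect n →ₗ[ℝ] Module.End 𝕜 (Form 𝕜 n)) (X : Vect n) : rmulC P c X = c X * P := rfl

theorem lmulC_mem {P : Module.End 𝕜 (Form 𝕜 n)} {c : Vect n →ₗ[ℝ] Module.End 𝕜 (Form 𝕜 n)}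
    (hP : P ∈ DiffOp 𝕜 n) (hc : c ∈ Cochain 𝕜 n) : lmulC P c ∈ Cochain 𝕜 n := by
  obtain ⟨r, hP⟩ := hP
  obtain ⟨s, hc⟩ := hc
  -- `P` reads the `r`-jet of `c X η`, and that is determined by the `(s + r)`-jet of either
  -- argument.
  refine ⟨s + r, fun x X η h => ?_⟩
  change (P (c X η)).1 x = 0
  refine hP x _ ?_
  rcases h with h | h
  · exact (hc.local_left η).flatAt (f := ⟨X.1, X.2⟩) h
  · exact (hc.local_right X).flatAt h

theorem rmulC_mem {P : Module.End 𝕜 (Form 𝕜 n)} {c : Vect n →ₗ[ℝ] Module.End 𝕜 (Form 𝕜 n)}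
    (hP : P ∈ DiffOp 𝕜 n) (hc : c ∈ Cochain 𝕜 n) : rmulC P c ∈ Cochain 𝕜 n := by
  obtain ⟨r, hP⟩ := hP
  obtain ⟨s, hc⟩ := hc
  refine ⟨r + s, fun x X η h => ?_⟩
  change (c X (P η)).1 x = 0
  refine hc x _ _ ?_
  rcases h with h | h
  · exact Or.inl (h.mono (by omega))
  · exact Or.inr (hP.flatAt h)

theorem mulF_rsmul (a : ℝ) (f : Fn n) :
    (mulF (a • f) : Module.End 𝕜 (Form 𝕜 n)) = a • mulF f :=
  LinearMap.ext fun η => form_ext fun x => by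
    rw [mulF_apply]
    exact mul_smul _ _ _

/-- The action by the Lie derivative as a cochain. -/
def lieC (𝕜 : Type) [RCLike 𝕜] (n : ℕ) : Vect n →ₗ[ℝ] Module.End 𝕜 (Form 𝕜 n) where
  toFun X := lieDerivative X
  map_add' X Y := lieDerivative_add X Y
  map_smul' a X := by
    refine LinearMap.ext fun η => ?_
    rw [lieDerivative_eq, RingHom.id_apply, LinearMap.smul_apply, lieDerivative_eq, smul_add,
      Finset.smul_sum, Finset.smul_sum]
    simp only [comp_smul, map_smul, mulF_rsmul, LinearMap.smul_apply, Finset.smul_sum]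

@[simp] theorem lieC_apply (X : Vect n) : lieC 𝕜 n X = lieDerivative X := rfl

theorem fnPd_comp_apply (X : Vect n) (i j : Fin n) (x : Rn n) :
    (fnPd i (comp X j)).1 x = part i X.1 x j := by
  rw [fnPd_apply]
  exact congrFun (part_comp_clm (EuclideanSpace.proj j : Rn n →L[ℝ] ℝ) (smooth_vect X) i) x

theorem fnPd_comp_eq_zero {X : Vect n} {x : Rn n} (h : FlatAt 1 x X.1) (i j : Fin n) :
    (fnPd i (comp X j)).1 x = 0 := by
  rw [fnPd_comp_apply]
  have h1 : part i X.1 x = 0 := h.2 i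
  rw [h1]; rfl

theorem lieC_local : LocalCochain 1 (lieC 𝕜 n) := by
  intro x X η h
  rw [lieC_apply, lieDerivative_eq, form_add_apply, form_sum_apply, form_sum_apply]
  simp only [form_sum_apply, mulF_apply]
  rcases h with h | h
  · have h0 : ∀ j, (comp X j).1 x = 0 := fun j => by
      rw [comp_apply, h.eq_zero]; rfl
    simp [h0, fnPd_comp_eq_zero h]
  · have h1 : ∀ j, (pd j η).1 x = 0 := fun j => localOp_pd j x η h
    have h2 : ∀ i j, (wedge i (interior j η)).1 x = 0 := fun i j =>
      ((localOp_wedge i).mul (localOp_interior j)) x η (h.mono (by omega))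
    simp [h1, h2]

theorem lieC_mem : lieC 𝕜 n ∈ Cochain 𝕜 n := ⟨1, lieC_local⟩

/-- The divergence as a linear map. -/
def divL (n : ℕ) : Vect n →ₗ[ℝ] Fn n where
  toFun X := divFn X
  map_add' X Y := by simp only [divFn, comp_add, map_add, Finset.sum_add_distrib]
  map_smul' a X := by simp only [divFn, comp_smul, map_smul, Finset.smul_sum, RingHom.id_apply]

/-- The multiplication by the divergence as a cochain. -/
def divC (𝕜 : Type) [RCLike 𝕜] (n : ℕ) : Vect n →ₗ[ℝ] Module.End 𝕜 (Form 𝕜 n) where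
  toFun X := mulF (divL n X)
  map_add' X Y := by rw [map_add, map_add]
  map_smul' a X := by rw [map_smul, mulF_rsmul]; rfl

theorem divC_local : LocalCochain 1 (divC 𝕜 n) := by
  intro x X η h
  change (mulF (divFn X) η).1 x = 0
  rw [mulF_apply]
  rcases h with h | h
  · have : (divFn X).1 x = 0 := by
      rw [divFn, AddSubmonoidClass.coe_finsetSum, Finset.sum_apply]
      exact Finset.sum_eq_zero fun i _ => fnPd_comp_eq_zero h i i
    rw [this, zero_smul]
  · rw [h.eq_zero, smul_zero]

theorem divC_mem : divC 𝕜 n ∈ Cochain 𝕜 n := ⟨1, divC_local⟩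

/-! ### Taylor components of forms, constant forms, translation-invariant operators -/

/-- The homogeneous components of the Taylor expansion of a form. -/
def tayForm (x : Rn n) (j : ℕ) (η : Form 𝕜 n) : Form 𝕜 n := ofSm (smTay x j (toSm η))

/-- Forms with constant coefficients. -/
def constForm (a : Fibre 𝕜 n) : Form 𝕜 n := ⟨fun _ => a, show ContDiff ℝ ∞ fun _ : Rn n => a from contDiff_const⟩

theorem tayForm_zero (x : Rn n) (η : Form 𝕜 n) : tayForm x 0 η = constForm (η.1 x) := rfl

theorem pd_constForm (i : Fin n) (a : Fibre 𝕜 n) : pd i (constForm a) = 0 := by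
  refine form_ext fun x => ?_
  rw [pd_apply]
  exact congrFun (part_const i a) x

theorem apply_tayForm_succ (P : Module.End 𝕜 (Form 𝕜 n)) (x : Rn n) (j : ℕ) (η : Form 𝕜 n) :
    (P (tayForm x (j + 1) η)).1 x =
      ((j : ℝ) + 1)⁻¹ • ∑ i, (adc i P (tayForm x j (pd i η))).1 x :=
  map_smTay_succ (smOp P) x j (toSm η)

theorem LocalOp.apply_eq {r : ℕ} {P : Module.End 𝕜 (Form 𝕜 n)} (hP : LocalOp r P)
    (η : Form 𝕜 n) (x : Rn n) :
    (P η).1 x = ∑ j ∈ Finset.range (r + 1), (P (tayForm x j η)).1 x :=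
  hP.smOp.apply_eq (toSm η) x

/-- A form whose partial derivatives vanish is constant. -/
theorem apply_eq_apply_zero {η : Form 𝕜 n} (h : ∀ m, pd m η = 0) (x : Rn n) : η.1 x = η.1 0 := by
  refine is_const_of_fderiv_eq_zero (𝕜 := ℝ) ((smooth_form η).differentiable (by simp)) ?_ x 0
  intro y
  ext1 v
  rw [fderiv_eq_sum_pd]
  simp [h]

theorem eq_constForm {η : Form 𝕜 n} (h : ∀ m, pd m η = 0) : η = constForm (η.1 0) :=
  form_ext fun x => apply_eq_apply_zero h x

/-- The operator commutes with translations. -/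
def TransInv (P : Module.End 𝕜 (Form 𝕜 n)) : Prop := ∀ m η, pd m (P η) = P (pd m η)

theorem adc_apply (i : Fin n) (P : Module.End 𝕜 (Form 𝕜 n)) (η : Form 𝕜 n) :
    adc i P η = P (mulF (coord i) η) - mulF (coord i) (P η) := rfl

theorem pd_coord_mul (m i : Fin n) (η : Form 𝕜 n) :
    pd m (mulF (coord i) η) = mulF (coord i) (pd m η) + if i = m then η else 0 := by
  rw [pd_mulF_apply, fnPd_coord]
  split_ifs <;> simp

theorem TransInv.adc {P : Module.End 𝕜 (Form 𝕜 n)} (hP : TransInv P) (i : Fin n) :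
    TransInv (adc i P) := by
  intro m η
  rw [adc_apply, adc_apply, map_sub, hP, pd_coord_mul, pd_coord_mul, hP, map_add]
  split_ifs <;> simp

theorem TransInv.add {P Q : Module.End 𝕜 (Form 𝕜 n)} (hP : TransInv P) (hQ : TransInv Q) :
    TransInv (P + Q) := fun m η => by
  rw [LinearMap.add_apply, LinearMap.add_apply, map_add, hP, hQ]

theorem TransInv.smul {P : Module.End 𝕜 (Form 𝕜 n)} (hP : TransInv P) (c : 𝕜) :
    TransInv (c • P) := fun m η => by
  rw [LinearMap.smul_apply, LinearMap.smul_apply, map_smul, hP]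

theorem TransInv.mul {P Q : Module.End 𝕜 (Form 𝕜 n)} (hP : TransInv P) (hQ : TransInv Q) :
    TransInv (P * Q) := fun m η => by
  rw [Module.End.mul_apply, Module.End.mul_apply, hP, hQ]

theorem TransInv.zero : TransInv (0 : Module.End 𝕜 (Form 𝕜 n)) := fun m η => by simp

theorem transInv_wedge (i : Fin n) : TransInv (wedge i : Module.End 𝕜 (Form 𝕜 n)) :=
  fun m η => pd_wedge_apply m i η

theorem transInv_interior (i : Fin n) : TransInv (interior i : Module.End 𝕜 (Form 𝕜 n)) :=
  fun m η => pd_interior_apply m i η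

theorem transInv_degProj (k : ℕ) : TransInv (degProj k : Module.End 𝕜 (Form 𝕜 n)) :=
  fun m η => pd_degProj_apply m k η

theorem transInv_d : TransInv (d : Module.End 𝕜 (Form 𝕜 n)) :=
  fun m η => (d_pd m η).symm

/-- The monomials in the coordinates. -/
def mon (w : List (Fin n)) : Fn n := (w.map coord).prod

@[simp] theorem mon_nil : mon ([] : List (Fin n)) = 1 := rfl
@[simp] theorem mon_cons (i : Fin n) (w : List (Fin n)) : mon (i :: w) = coord i * mon w := by
  simp [mon]

theorem mulF_coord_apply_zero (i : Fin n) (η : Form 𝕜 n) : (mulF (coord i) η).1 0 = 0 := by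
  rw [mulF_apply]
  exact zero_smul _ _

/-- A translation-invariant differential operator is determined by its values at the origin on
polynomial forms. -/
theorem eq_zero_of_mon {r : ℕ} {P : Module.End 𝕜 (Form 𝕜 n)} (hr : LocalOp r P) (hP : TransInv P)
    (h : ∀ w a, (P (mulF (mon w) (constForm a))).1 0 = 0) : P = 0 := by
  -- All translation-invariant operators are treated at once, because the induction on the Taylor
  -- degree replaces `P` by its commutators with coordinates. In degree zero invariance moves the
  -- evaluation point from `x` to the origin.
  have key : ∀ (j : ℕ) (P : Module.End 𝕜 (Form 𝕜 n)), TransInv P →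
      (∀ w a, (P (mulF (mon w) (constForm a))).1 0 = 0) →
      ∀ x η, (P (tayForm x j η)).1 x = 0 := by
    intro j
    induction j with
    | zero =>
      intro P hP h x η
      rw [tayForm_zero, apply_eq_apply_zero]
      · simpa using h [] (η.1 x)
      · intro m
        rw [hP, pd_constForm, map_zero]
    | succ j ih =>
      intro P hP h x η
      rw [apply_tayForm_succ]
      rw [Finset.sum_eq_zero, smul_zero]
      intro i _
      refine ih _ (hP.adc i) ?_ x _
      intro w a
      rw [adc_apply, form_sub_apply, mulF_coord_apply_zero, sub_zero]
      simpa [mulF_mul_apply] using h (i :: w) a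
  refine LinearMap.ext fun η => form_ext fun x => ?_
  rw [hr.apply_eq]
  exact Finset.sum_eq_zero fun j _ => key j P hP h x η

/-- A local cochain is determined by its values on polynomial vector fields. -/
theorem cochain_eq_zero_of_mon {c : Vect n →ₗ[ℝ] Module.End 𝕜 (Form 𝕜 n)} (hc : c ∈ Cochain 𝕜 n)
    (h : ∀ w i, c (fld (mon w) i) = 0) : c = 0 := by
  obtain ⟨r, hc⟩ := hc
  -- The map is arbitrary here, so that its commutators with coordinates stay in the class; a
  -- coordinate times a monomial is again a monomial. Locality enters only afterwards.
  have key : ∀ (j : ℕ) (T : Sm n (Rn n) →ₗ[ℝ] Sm n (Fibre 𝕜 n)),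
      (∀ w i, T ⟨(fld (mon w) i).1, (fld (mon w) i).2⟩ = 0) →
      ∀ x X, (T (smTay x j X)).1 x = 0 := by
    intro j
    induction j with
    | zero =>
      intro T h x X
      rw [smTay_zero, ← sum_smul_basisVec (X.1 x), map_sum, map_sum, sm_sum_apply]
      refine Finset.sum_eq_zero fun i _ => ?_
      rw [map_smul, map_smul]
      have h1 := h [] i
      have h2 : (⟨(fld (mon []) i).1, (fld (mon []) i).2⟩ : Sm n (Rn n)) =
          smConst n (basisVec i) := by
        ext1; funext y; exact one_smul ℝ _
      rw [h2] at h1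
      rw [h1, smul_zero]; rfl
    | succ j ih =>
      intro T h x X
      rw [map_smTay_succ, Finset.sum_eq_zero, smul_zero]
      intro i _
      refine ih _ ?_ x _
      intro w m
      change T (coordMul i _) - coordMul i (T _) = 0
      have h2 : coordMul i (⟨(fld (mon w) m).1, (fld (mon w) m).2⟩ : Sm n (Rn n)) =
          ⟨(fld (mon (i :: w)) m).1, (fld (mon (i :: w)) m).2⟩ := by
        ext1; funext y
        rw [mon_cons]
        exact (mul_smul _ _ _).symm
      rw [h2, h, h, map_zero, sub_zero]
  refine LinearMap.ext fun X => LinearMap.ext fun η => form_ext fun x => ?_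
  have h1 := (hc.local_left η).apply_eq ⟨X.1, X.2⟩ x
  refine h1.trans (Finset.sum_eq_zero fun j _ => key j _ ?_ x _)
  intro w i
  change toSm (c (fld (mon w) i) (ofSm (toSm η))) = 0
  rw [h]
  rfl

/-! ### The Poincaré lemma for cochains -/

instance : NormedSpace 𝕜 (Fibre 𝕜 n) :=
  inferInstanceAs (NormedSpace 𝕜 ((k : Fin (n + 1)) → Rn n [⋀^Fin k]→L[ℝ] 𝕜))

instance : CompleteSpace (Fibre 𝕜 n) := FiniteDimensional.complete ℝ _

/-- The Poincaré lemma for fibre-valued `1`-forms on the convex set `ℝⁿ`. The primitive is smooth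
because its derivative is. -/
theorem exists_form_pd_eq (g : Fin n → Form 𝕜 n) (hg : ∀ i k, pd k (g i) = pd i (g k)) :
    ∃ f : Form 𝕜 n, ∀ i, pd i f = g i := by
  let θ : Rn n → Rn n →L[ℝ] Fibre 𝕜 n := fun x =>
    ∑ i, (EuclideanSpace.proj i : Rn n →L[ℝ] ℝ).smulRight ((g i).1 x)
  have hθ : ContDiff ℝ ∞ θ :=
    ContDiff.sum fun i _ => contDiff_smulRight _ (smooth_form (g i))
  have hb : ∀ x k, θ x (basisVec k) = (g k).1 x := by
    intro x k
    simp only [θ, sum_apply, ContinuousLinearMap.smulRight_apply]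
    rw [Finset.sum_eq_single k]
    · simp [basisVec_apply]
    · intro i _ hi
      simp [basisVec_apply, hi]
    · simp
  have hbb : ∀ x k l, fderiv ℝ θ x (basisVec k) (basisVec l) = (pd k (g l)).1 x := by
    intro x k l
    rw [pd_apply, ← funext fun y => hb y l]
    have := congrFun (part_comp_clm (ContinuousLinearMap.apply ℝ (Fibre 𝕜 n) (basisVec l)) hθ k) x
    exact this.symm
  obtain ⟨f, hf⟩ := (convex_univ (𝕜 := ℝ) (E := Rn n)).exists_forall_hasFDerivAt_of_fderiv_symmetric
    isOpen_univ (hθ.differentiable (by simp)).differentiableOn (by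
      intro x _ u v
      have e : ∀ u v : Rn n, fderiv ℝ θ x u v = ∑ i, ∑ j, (u i * v j) • (pd i (g j)).1 x := by
        intro u v
        conv_lhs => rw [← sum_smul_basisVec u, ← sum_smul_basisVec v]
        simp only [map_sum, map_smul, sum_apply, smul_apply, hbb, Finset.smul_sum, mul_smul]
        rw [Finset.sum_comm]
        exact Finset.sum_congr rfl fun i _ => Finset.sum_congr rfl fun j _ => smul_comm _ _ _
      rw [e, e, Finset.sum_comm]
      refine Finset.sum_congr rfl fun i _ => Finset.sum_congr rfl fun j _ => ?_
      rw [hg, mul_comm])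
  have hf' : ∀ x, fderiv ℝ f x = θ x := fun x => (hf x (Set.mem_univ x)).fderiv
  refine ⟨⟨f, contDiff_infty_iff_fderiv.2 ⟨fun x => (hf x (Set.mem_univ x)).differentiableAt, ?_⟩⟩,
    fun i => form_ext fun x => ?_⟩
  · rw [funext hf']; exact hθ
  · rw [pd_apply]
    change fderiv ℝ f x (basisVec i) = _
    rw [hf', hb]

/-- The hypothesis is the cocycle condition for the commuting operators `∂ᵢ`, and the equation `[∂ᵢ,
u] = Pᵢ` is solved on one Taylor component at a time. The part of `u` of order `j` is a matrix of
functions found by integration, reached by taking `j` commutators with coordinates. -/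
theorem exists_commutator_tay (j : ℕ) (P : Fin n → Module.End 𝕜 (Form 𝕜 n))
    (hP : ∀ i k η, pd k (P i η) - P i (pd k η) = pd i (P k η) - P k (pd i η)) :
    ∃ u : Module.End 𝕜 (Form 𝕜 n), LocalOp j u ∧
      ∀ i η x, (pd i (u η)).1 x - (u (pd i η)).1 x = (P i (tayForm x j η)).1 x := by
  induction j generalizing P with
  | zero =>
    let b := Module.finBasis 𝕜 (Fibre 𝕜 n)
    -- On a constant form the compatibility condition loses its inner derivatives and becomes
    -- closedness.
    have hex : ∀ k, ∃ f : Form 𝕜 n, ∀ i, pd i f = P i (constForm (b k)) := by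
      intro k
      refine exists_form_pd_eq _ fun i l => ?_
      have := hP i l (constForm (b k))
      simpa [pd_constForm] using this
    choose f hf using hex
    let φ : (k : Fin (Module.finrank 𝕜 (Fibre 𝕜 n))) → Fibre 𝕜 n →L[ℝ] 𝕜 := fun k =>
      LinearMap.toContinuousLinearMap ((b.coord k).restrictScalars ℝ)
    have hφ : ∀ k η, ContDiff ℝ ∞ fun x => φ k ((η : Form 𝕜 n).1 x) := fun k η =>
      (φ k).contDiff.comp (smooth_form η)
    have hs : ∀ k η, ContDiff ℝ ∞ fun x => φ k ((η : Form 𝕜 n).1 x) • (f k).1 x := fun k η =>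
      (hφ k η).smul (smooth_form (f k))
    let u : Module.End 𝕜 (Form 𝕜 n) :=
      { toFun := fun η => ⟨fun x => ∑ k, φ k (η.1 x) • (f k).1 x, ContDiff.sum fun k _ => hs k η⟩
        map_add' := fun η θ => form_ext fun x => by
          change ∑ k, φ k ((η + θ).1 x) • (f k).1 x =
            ∑ k, φ k (η.1 x) • (f k).1 x + ∑ k, φ k (θ.1 x) • (f k).1 x
          rw [← Finset.sum_add_distrib]
          exact Finset.sum_congr rfl fun k _ => by rw [form_add_apply, map_add, add_smul]
        map_smul' := fun c η => form_ext fun x => by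
          change ∑ k, φ k ((c • η).1 x) • (f k).1 x = c • ∑ k, φ k (η.1 x) • (f k).1 x
          rw [Finset.smul_sum]
          refine Finset.sum_congr rfl fun k _ => ?_
          change (b.coord k) (c • η.1 x) • _ = c • (b.coord k) (η.1 x) • _
          rw [map_smul, smul_assoc] }
    refine ⟨u, fun x η h => ?_, fun i η x => ?_⟩
    · change ∑ k, φ k (η.1 x) • (f k).1 x = 0
      simp [h.eq_zero]
    · rw [pd_apply]
      change part i (fun x => ∑ k, φ k (η.1 x) • (f k).1 x) x -
        ∑ k, φ k ((pd i η).1 x) • (f k).1 x = _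
      rw [part_sum Finset.univ _ (fun k => hs k η), ← Finset.sum_sub_distrib]
      have h1 : ∀ k, part i (fun x => φ k (η.1 x) • (f k).1 x) x -
          φ k ((pd i η).1 x) • (f k).1 x = φ k (η.1 x) • (P i (constForm (b k))).1 x := by
        intro k
        change fderiv ℝ _ x _ - _ = _
        rw [fderiv_fun_smul ((hφ k η).differentiable (by simp) x)
          ((smooth_form (f k)).differentiable (by simp) x), ← hf, pd_apply, pd_apply]
        have h2 := congrFun (part_comp_clm (φ k) (smooth_form η) i) x
        change fderiv ℝ (fun x => φ k (η.1 x)) x (basisVec i) =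
          φ k (fderiv ℝ η.1 x (basisVec i)) at h2
        rw [← h2]
        exact add_sub_cancel_right _ _
      rw [Finset.sum_congr rfl fun k _ => h1 k, tayForm_zero]
      have h3 : constForm (η.1 x) = ∑ k, (b.coord k (η.1 x)) • constForm (b k) := by
        refine form_ext fun y => ?_
        rw [form_sum_apply]
        exact (b.sum_repr (η.1 x)).symm
      rw [h3, map_sum, form_sum_apply]
      exact Finset.sum_congr rfl fun k _ => by rw [map_smul]; rfl
  | succ j ih =>
    -- Commutators with a coordinate inherit the compatibility condition, since the Kronecker terms
    -- cancel.
    have hadc : ∀ m i k η, pd k (adc m (P i) η) - adc m (P i) (pd k η) =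
        pd i (adc m (P k) η) - adc m (P k) (pd i η) := by
      intro m i k η
      have h1 := hP i k (mulF (coord m) η)
      have h2 := congrArg (mulF (coord m)) (hP i k η)
      simp only [map_sub] at h2
      simp only [pd_coord_mul, adc_apply, map_sub, map_add] at h1 ⊢
      have e : ∀ (Q : Module.End 𝕜 (Form 𝕜 n)) (p : Prop) [Decidable p],
        Q (if p then η else 0) = if p then Q η else 0 := by
        intro Q p _; split_ifs <;> simp
      simp only [e] at h1
      rw [← sub_eq_zero] at h1 h2 ⊢
      refine Eq.trans ?_ ((congrArg₂ (· - ·) h1 h2).trans (sub_zero 0))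
      abel
    choose u hu h using fun m => ih (fun i => adc m (P i)) (hadc m)
    -- The solution copies the recursion of the Taylor components, with one derivative for each
    -- commutator.
    refine ⟨((j : ℝ) + 1)⁻¹ • ∑ m, u m * pd m, ?_, fun i η x => ?_⟩
    · rw [← algebraMap_smul 𝕜]
      exact (LocalOp.sum _ fun m => (hu m).mul (localOp_pd m)).smul _
    · rw [apply_tayForm_succ]
      simp only [← h, LinearMap.smul_apply, LinearMap.sum_apply, Module.End.mul_apply,
        LinearMap.map_smul_of_tower, map_sum, form_rsmul_apply, form_sum_apply, ← smul_sub,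
        ← Finset.sum_sub_distrib, pd_pd_comm i]

theorem exists_commutator_pd {r : ℕ} (P : Fin n → Module.End 𝕜 (Form 𝕜 n))
    (hr : ∀ i, LocalOp r (P i))
    (hP : ∀ i k η, pd k (P i η) - P i (pd k η) = pd i (P k η) - P k (pd i η)) :
    ∃ u ∈ DiffOp 𝕜 n, ∀ i, pd i * u - u * pd i = P i := by
  choose u hu h using fun j => exists_commutator_tay j P hP
  refine ⟨∑ j ∈ Finset.range (r + 1), u j, Subalgebra.sum_mem _ fun j _ => ⟨j, hu j⟩, fun i => ?_⟩
  refine LinearMap.ext fun η => form_ext fun x => ?_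
  rw [(hr i).apply_eq]
  simp only [← h, LinearMap.sub_apply, Module.End.mul_apply, LinearMap.sum_apply, map_sum,
    form_sub_apply, form_sum_apply, Finset.sum_sub_distrib]

/-! ### Cocycles of `gl` with values in a module with a contravariant inner product -/

section Casimir

variable {ι M : Type*} [Fintype ι] [DecidableEq ι] [AddCommGroup M] [Module 𝕜 M]

/-- Move `A k l` to the right: the cocycle rule turns `A k l (c j i)` into `A j i (c k l)`, and the
Kronecker terms cancel in pairs after summation. For the cocycle of an element of `M` this says that
the Casimir operator commutes with the action. -/
theorem casimir_cocycle (A : ι → ι → M →ₗ[𝕜] M)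
    (hA : ∀ i j k l x, A i j (A k l x) - A k l (A i j x) =
      (if j = k then A i l x else 0) - if i = l then A k j x else 0)
    (c : ι → ι → M)
    (hc : ∀ i j k l, A i j (c k l) - A k l (c i j) =
      (if j = k then c i l else 0) - if i = l then c k j else 0) (k l : ι) :
    A k l (∑ i, ∑ j, A i j (c j i)) = ∑ i, ∑ j, A i j (A j i (c k l)) := by
  have h : ∀ i j, A k l (A i j (c j i)) = A i j (A j i (c k l)) +
      ((if l = j then A i j (c k i) else 0) - (if k = i then A i j (c j l) else 0)) +
      ((if l = i then A k j (c j i) else 0) - (if k = j then A i l (c j i) else 0)) := by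
    intro i j
    have h1 := hA k l i j (c j i)
    have h2 := congrArg (A i j) (hc k l j i)
    rw [map_sub, map_sub] at h2
    have e : ∀ (p : Prop) [Decidable p] (x : M), A i j (if p then x else 0) =
        if p then A i j x else 0 := by
      intro p _ x; split_ifs <;> simp
    rw [e, e] at h2
    rw [← h2, ← h1]
    abel
  simp only [map_sum, h, Finset.sum_add_distrib, Finset.sum_sub_distrib, Finset.sum_ite_eq,
    Finset.mem_univ, if_true]
  have e1 : ∑ i, ∑ j, (if k = i then A i j (c j l) else 0) = ∑ j, A k j (c j l) := by
    rw [Finset.sum_comm]; simp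
  have e2 : ∑ i, ∑ j, (if l = i then A k j (c j i) else 0) = ∑ j, A k j (c j l) := by
    rw [Finset.sum_comm]; simp
  rw [e1, e2]
  abel

/-- Over a module with an inner product for which `A i j` and `A j i` are adjoint, every
`gl`-cocycle is cohomologous to a cocycle with invariant values. -/
theorem exists_sub_invariant [FiniteDimensional 𝕜 M] (A : ι → ι → M →ₗ[𝕜] M)
    (hA : ∀ i j k l x, A i j (A k l x) - A k l (A i j x) =
      (if j = k then A i l x else 0) - if i = l then A k j x else 0)
    (S : M →+ M →+ ℝ) (hS : ∀ i j x y, S (A i j x) y = S x (A j i y))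
    (hpos : ∀ x, 0 ≤ S x x) (hdef : ∀ x, S x x = 0 → x = 0)
    (c : ι → ι → M)
    (hc : ∀ i j k l, A i j (c k l) - A k l (c i j) =
      (if j = k then c i l else 0) - if i = l then c k j else 0) :
    ∃ u, ∀ i j k l, A i j (c k l - A k l u) = 0 := by
  -- The Casimir operator. By adjointness `S (Ω x) x` is a sum of squares, so its kernel consists of
  -- the invariants.
  let Ω : M →ₗ[𝕜] M := ∑ i, ∑ j, A i j ∘ₗ A j i
  have hΩ : ∀ x, Ω x = ∑ i, ∑ j, A i j (A j i x) := by
    intro x; simp [Ω, LinearMap.sum_apply]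
  have hcomm : ∀ k l x, A k l (Ω x) = Ω (A k l x) := by
    intro k l x
    rw [hΩ, hΩ]
    exact casimir_cocycle A hA (fun i j => A i j x) (fun i j k l => hA i j k l x) k l
  have hSΩ : ∀ x y, S (Ω x) y = ∑ i, ∑ j, S (A j i x) (A j i y) := by
    intro x y
    rw [hΩ, map_sum, AddMonoidHom.finsetSum_apply]
    refine Finset.sum_congr rfl fun i _ => ?_
    rw [map_sum, AddMonoidHom.finsetSum_apply]
    exact Finset.sum_congr rfl fun j _ => hS _ _ _ _
  have hker : ∀ x, Ω x = 0 → ∀ i j, A i j x = 0 := by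
    intro x hx
    have h1 : S (Ω x) x = 0 := by rw [hx]; simp
    rw [hSΩ] at h1
    rw [Finset.sum_eq_zero_iff_of_nonneg fun i _ => Finset.sum_nonneg fun j _ => hpos _] at h1
    intro i j
    have h2 := h1 j (Finset.mem_univ j)
    rw [Finset.sum_eq_zero_iff_of_nonneg fun j _ => hpos _] at h2
    exact hdef _ (h2 i (Finset.mem_univ i))
  -- Kernel and range of `Ω` meet trivially, so in finite dimension `Ω` is bijective on its range.
  have hinj : ∀ x, Ω (Ω x) = 0 → Ω x = 0 := by
    intro x hx
    refine hdef _ ?_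
    have h3 := hker _ hx
    rw [hSΩ]
    refine Finset.sum_eq_zero fun i _ => Finset.sum_eq_zero fun j _ => ?_
    rw [h3 j i, map_zero]
  have hsurj : ∀ v, ∃ u, Ω (Ω u) = Ω v := by
    let R := LinearMap.range Ω
    let Ω' : R →ₗ[𝕜] R := Ω.restrict (fun x _ => LinearMap.mem_range_self Ω x)
    have hi : Function.Injective Ω' := by
      rw [← LinearMap.ker_eq_bot, LinearMap.ker_eq_bot']
      rintro ⟨_, x, rfl⟩ hx
      refine Subtype.ext (hinj x ?_)
      exact congrArg Subtype.val hx
    intro v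
    obtain ⟨⟨_, u, rfl⟩, hu⟩ := (LinearMap.injective_iff_surjective.1 hi)
      ⟨Ω v, LinearMap.mem_range_self Ω v⟩
    exact ⟨u, congrArg Subtype.val hu⟩
  -- With this `u` the contraction of `c` and `Ω u` differ by an invariant. Applying `A k l` gives
  -- `Ω (c k l) = Ω (A k l u)`, hence an invariant difference.
  obtain ⟨u, hu⟩ := hsurj (∑ i, ∑ j, A i j (c j i))
  refine ⟨u, fun i j k l => hker _ ?_ i j⟩
  have h5 := hker (∑ i, ∑ j, A i j (c j i) - Ω u) (by rw [map_sub, hu, sub_self]) k l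
  rw [map_sub, casimir_cocycle A hA c hc, ← hΩ, hcomm] at h5
  rw [map_sub, h5]

end Casimir

/-! ### The action of linear vector fields -/

/-- The Lie derivative along `yᵢ ∂ⱼ`. -/
def gl (i j : Fin n) : Module.End 𝕜 (Form 𝕜 n) := mulF (coord i) * pd j + wedge i * interior j

theorem gl_apply (i j : Fin n) (η : Form 𝕜 n) :
    gl i j η = mulF (coord i) (pd j η) + wedge i (interior j η) := rfl

theorem dmul_coord (i : Fin n) (η : Form 𝕜 n) : dmul (coord i) η = wedge i η := by
  rw [dmul_apply]
  simp only [fnPd_coord]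
  rw [Finset.sum_eq_single i]
  · simp
  · intro j _ hj
    simp [Ne.symm hj]
  · simp

theorem lieDerivative_coord (i j : Fin n) :
    (lieDerivative (fld (coord i) j) : Module.End 𝕜 (Form 𝕜 n)) = gl i j := by
  refine LinearMap.ext fun η => ?_
  rw [lieDerivative_fld, dmul_coord, gl_apply]

theorem lieDerivative_one (j : Fin n) :
    (lieDerivative (fld 1 j) : Module.End 𝕜 (Form 𝕜 n)) = pd j := by
  refine LinearMap.ext fun η => ?_
  rw [lieDerivative_fld, dmul_apply]
  simp [fnPd_one]

theorem gl_pd (i j m : Fin n) (η : Form 𝕜 n) :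
    pd m (gl i j η) = gl i j (pd m η) + if i = m then pd j η else 0 := by
  rw [gl_apply, gl_apply, map_add, pd_coord_mul, pd_wedge_apply, pd_interior_apply, pd_pd_comm m j]
  abel

theorem gl_coord (i j m : Fin n) (η : Form 𝕜 n) :
    gl i j (mulF (coord m) η) = mulF (coord m) (gl i j η) +
      if m = j then mulF (coord i) η else 0 := by
  rw [gl_apply, gl_apply, map_add, pd_coord_mul, map_add, interior_mulF_apply, wedge_mulF_apply,
    mulF_mulF_comm]
  split_ifs
  · abel
  · rw [map_zero]; abel

theorem gl_wedge (i j m : Fin n) (η : Form 𝕜 n) :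
    gl i j (wedge m η) = wedge m (gl i j η) + if m = j then wedge i η else 0 := by
  rw [gl_apply, gl_apply, map_add, pd_wedge_apply, wedge_mulF_apply, interior_wedge_apply, map_sub,
    wedge_anticomm i m]
  split_ifs
  · abel
  · rw [map_zero]; abel

theorem gl_interior (i j m : Fin n) (η : Form 𝕜 n) :
    interior m (gl i j η) = gl i j (interior m η) + if i = m then interior j η else 0 := by
  rw [gl_apply, gl_apply, map_add, pd_interior_apply, interior_mulF_apply, interior_wedge_apply,
    interior_anticomm m j, map_neg]
  abel

theorem gl_degProj (i j : Fin n) (k : ℕ) (η : Form 𝕜 n) :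
    gl i j (degProj k η) = degProj k (gl i j η) := by
  rw [← lieDerivative_coord, lieDerivative_degProj]

theorem gl_gl (i j k l : Fin n) (η : Form 𝕜 n) :
    gl i j (gl k l η) - gl k l (gl i j η) =
      (if j = k then gl i l η else 0) - if i = l then gl k j η else 0 := by
  have h := LinearMap.congr_fun (lieDerivative_bracket (𝕜 := 𝕜) (fld (coord i) j) (fld (coord k) l)) η
  rw [bracket_fld, lieDerivative_sub, fnPd_coord, fnPd_coord] at h
  simp only [lieDerivative_coord, LinearMap.sub_apply, Module.End.mul_apply] at h
  rw [← h]
  have hz : ∀ m, fld 0 m = (0 : Vect n) := fun m => by ext1; simp [comp_fld, comp_zero]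
  congr 1 <;> split_ifs <;>
    first
    | (exfalso; omega)
    | simp [lieDerivative_coord, hz, lieDerivative_zero]

/-! ### An inner product on translation-invariant operators -/

/-- The commutator with `gl i j`. -/
def glAd (i j : Fin n) : Module.End 𝕜 (Form 𝕜 n) →ₗ[𝕜] Module.End 𝕜 (Form 𝕜 n) :=
  LinearMap.mulLeft 𝕜 (gl i j) - LinearMap.mulRight 𝕜 (gl i j)

theorem glAd_apply (i j : Fin n) (P : Module.End 𝕜 (Form 𝕜 n)) :
    glAd i j P = gl i j * P - P * gl i j := rfl

theorem glAd_apply_apply (i j : Fin n) (P : Module.End 𝕜 (Form 𝕜 n)) (η : Form 𝕜 n) :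
    glAd i j P η = gl i j (P η) - P (gl i j η) := rfl

/-- The constant function `1`. -/
def vac (𝕜 : Type) [RCLike 𝕜] (n : ℕ) : Form 𝕜 n :=
  constForm (Fin.cases (motive := fun k : Fin (n + 1) => Rn n [⋀^Fin k]→L[ℝ] 𝕜)
    (ContinuousAlternatingMap.constOfIsEmpty ℝ (Rn n) (Fin 0) (1 : 𝕜)) fun _ => 0)

/-- The value at the origin of the component of degree `0`. -/
def ev (𝕜 : Type) [RCLike 𝕜] (n : ℕ) : Form 𝕜 n →ₗ[𝕜] 𝕜 where
  toFun η := η.1 0 0 0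
  map_add' _ _ := rfl
  map_smul' _ _ := rfl

theorem ev_coord (i : Fin n) (η : Form 𝕜 n) : ev 𝕜 n (mulF (coord i) η) = 0 := by
  change (mulF (coord i) η).1 0 0 0 = 0
  rw [mulF_coord_apply_zero]; rfl

theorem ev_wedge (i : Fin n) (η : Form 𝕜 n) : ev 𝕜 n (wedge i η) = 0 := rfl

theorem pd_vac (i : Fin n) : pd i (vac 𝕜 n) = 0 := pd_constForm _ _

theorem interior_vac (i : Fin n) : interior i (vac 𝕜 n) = 0 := by
  refine form_ext fun x => fibre_ext fun k => ?_
  refine Fin.lastCases ?_ (fun k => ?_) k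
  · rw [interior_last_apply]; rfl
  · rw [interior_castSucc_eq]
    exact map_zero _

theorem gl_vac (i j : Fin n) : gl i j (vac 𝕜 n) = 0 := by
  rw [gl_apply, pd_vac, interior_vac, map_zero, map_zero, add_zero]

theorem ev_gl (i j : Fin n) (η : Form 𝕜 n) : ev 𝕜 n (gl i j η) = 0 := by
  rw [gl_apply, map_add, ev_coord, ev_wedge, add_zero]

/-- A positive semidefinite form on operators, for which the adjoint of `glAd i j` is `glAd j i`. -/
def pairing : ℕ → (Module.End 𝕜 (Form 𝕜 n) →ₗ[ℝ] Module.End 𝕜 (Form 𝕜 n) →ₗ[ℝ] ℝ)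
  | 0 => LinearMap.mk₂ ℝ (fun P Q => RCLike.re (starRingEnd 𝕜 (ev 𝕜 n (P (vac 𝕜 n))) *
      ev 𝕜 n (Q (vac 𝕜 n))))
      (fun P P' Q => by simp [add_mul])
      (fun a P Q => by
        rw [LinearMap.smul_apply, LinearMap.map_smul_of_tower]
        simp [RCLike.real_smul_eq_coe_mul, mul_assoc])
      (fun P Q Q' => by simp [mul_add])
      (fun a P Q => by
        rw [LinearMap.smul_apply, LinearMap.map_smul_of_tower]
        simp [RCLike.real_smul_eq_coe_mul]
        ring)
  -- Each step adjoins one more factor `xₘ` or `dxₘ` on the right, or one contraction on the left.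
  -- After `k` steps the form is a sum of squares of matrix coefficients in which at most `k` such
  -- factors occur.
  | k + 1 => pairing k + ∑ m, (
      (pairing k).compl₁₂ (LinearMap.mulRight ℝ (mulF (coord m))) (LinearMap.mulRight ℝ (mulF (coord m)))
      + (pairing k).compl₁₂ (LinearMap.mulRight ℝ (wedge m)) (LinearMap.mulRight ℝ (wedge m))
      + (pairing k).compl₁₂ (LinearMap.mulLeft ℝ (interior m)) (LinearMap.mulLeft ℝ (interior m)))

theorem pairing_zero_apply (P Q : Module.End 𝕜 (Form 𝕜 n)) : pairing 0 P Q =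
    RCLike.re (starRingEnd 𝕜 (ev 𝕜 n (P (vac 𝕜 n))) * ev 𝕜 n (Q (vac 𝕜 n))) := rfl

theorem pairing_succ_apply (k : ℕ) (P Q : Module.End 𝕜 (Form 𝕜 n)) : pairing (k + 1) P Q =
    pairing k P Q + ∑ m, (pairing k (P * mulF (coord m)) (Q * mulF (coord m)) +
      pairing k (P * wedge m) (Q * wedge m) + pairing k (interior m * P) (interior m * Q)) := by
  rw [pairing, LinearMap.add_apply, LinearMap.add_apply, LinearMap.sum_apply, LinearMap.sum_apply]
  rfl

theorem pairing_nonneg (k : ℕ) (P : Module.End 𝕜 (Form 𝕜 n)) : 0 ≤ pairing k P P := by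
  induction k generalizing P with
  | zero =>
    rw [pairing_zero_apply, RCLike.conj_mul]
    norm_cast
    positivity
  | succ k ih =>
    rw [pairing_succ_apply]
    exact add_nonneg (ih _) (Finset.sum_nonneg fun m _ =>
      add_nonneg (add_nonneg (ih _) (ih _)) (ih _))

theorem glAd_mul_coord (i j m : Fin n) (P : Module.End 𝕜 (Form 𝕜 n)) :
    glAd i j P * mulF (coord m) =
      glAd i j (P * mulF (coord m)) - if m = j then P * mulF (coord i) else 0 := by
  refine LinearMap.ext fun η => ?_
  have h := gl_coord i j m η
  simp only [glAd_apply, LinearMap.sub_apply, Module.End.mul_apply, h,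
    map_add]
  split_ifs
  · rw [Module.End.mul_apply]; abel
  · rw [map_zero, LinearMap.zero_apply]; abel

theorem glAd_mul_wedge (i j m : Fin n) (P : Module.End 𝕜 (Form 𝕜 n)) :
    glAd i j P * wedge m =
      glAd i j (P * wedge m) - if m = j then P * wedge i else 0 := by
  refine LinearMap.ext fun η => ?_
  have h := gl_wedge i j m η
  simp only [glAd_apply, LinearMap.sub_apply, Module.End.mul_apply, h,
    map_add]
  split_ifs
  · rw [Module.End.mul_apply]; abel
  · rw [map_zero, LinearMap.zero_apply]; abel

theorem glAd_interior_mul (i j m : Fin n) (P : Module.End 𝕜 (Form 𝕜 n)) :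
    interior m * glAd i j P =
      glAd i j (interior m * P) + if m = i then interior j * P else 0 := by
  refine LinearMap.ext fun η => ?_
  have h := gl_interior i j m (P η)
  simp only [glAd_apply, LinearMap.add_apply, LinearMap.sub_apply, Module.End.mul_apply, h,
    map_sub]
  by_cases hm : m = i
  · simp [hm]; abel
  · simp [hm, Ne.symm hm]

/-- At level zero both sides vanish: `gl` kills the constant function `1`, and `ev` kills the image
of `gl`. At the next level the corrections from passing `xₘ`, `dxₘ` and the contractions are the
same on both sides once summed over `m`. -/
theorem pairing_adjoint (k : ℕ) (i j : Fin n) (P Q : Module.End 𝕜 (Form 𝕜 n)) :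
    pairing k (glAd i j P) Q = pairing k P (glAd j i Q) := by
  induction k generalizing P Q with
  | zero =>
    rw [pairing_zero_apply, pairing_zero_apply, glAd_apply_apply, glAd_apply_apply, gl_vac, gl_vac]
    simp [ev_gl]
  | succ k ih =>
    rw [pairing_succ_apply, pairing_succ_apply, ih]
    congr 1
    have e1 : ∀ (p : Prop) [Decidable p] (A B : Module.End 𝕜 (Form 𝕜 n)),
        pairing k (if p then A else 0) B = if p then pairing k A B else 0 := by
      intro p _ A B; split_ifs <;> simp
    have e2 : ∀ (p : Prop) [Decidable p] (A B : Module.End 𝕜 (Form 𝕜 n)),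
        pairing k B (if p then A else 0) = if p then pairing k B A else 0 := by
      intro p _ A B; split_ifs <;> simp
    simp only [glAd_mul_coord, glAd_mul_wedge, glAd_interior_mul, map_add, map_sub, LinearMap.add_apply,
      LinearMap.sub_apply, e1, e2, ih, Finset.sum_add_distrib, Finset.sum_sub_distrib, Finset.sum_ite_eq', Finset.mem_univ, if_true]

/-! ### Matrix coefficients at the origin and definiteness of the inner product -/

/-- Products of interior multiplications. -/
def interiors (s : List (Fin n)) : Module.End 𝕜 (Form 𝕜 n) := (s.map interior).prod

/-- Products of exterior multiplications. -/
def wedges (v : List (Fin n)) : Module.End 𝕜 (Form 𝕜 n) := (v.map wedge).prod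

theorem wedges_cons (i : Fin n) (s : List (Fin n)) :
    (wedges (i :: s) : Module.End 𝕜 (Form 𝕜 n)) = wedge i * wedges s := by
  simp [wedges]

theorem interiors_append (s t : List (Fin n)) :
    (interiors (s ++ t) : Module.End 𝕜 (Form 𝕜 n)) = interiors s * interiors t := by
  simp [interiors]

/-- The form is built from nonnegative terms, so its vanishing passes down the recursion to every
single matrix coefficient. -/
theorem pairing_eq_zero {k : ℕ} {P : Module.End 𝕜 (Form 𝕜 n)} (h : pairing k P P = 0)
    (s w v : List (Fin n)) (hk : s.length + w.length + v.length ≤ k) :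
    ev 𝕜 n (interiors s (P (mulF (mon w) (wedges v (vac 𝕜 n))))) = 0 := by
  have hmono : ∀ k (P : Module.End 𝕜 (Form 𝕜 n)), pairing (k + 1) P P = 0 → pairing k P P = 0 ∧
      ∀ m, pairing k (P * mulF (coord m)) (P * mulF (coord m)) = 0 ∧
        pairing k (P * wedge m) (P * wedge m) = 0 ∧
        pairing k (interior m * P) (interior m * P) = 0 := by
    intro k P h
    rw [pairing_succ_apply] at h
    have h0 := pairing_nonneg k P
    have hm : ∀ m ∈ Finset.univ, 0 ≤ pairing k (P * mulF (coord m)) (P * mulF (coord m)) +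
      pairing k (P * wedge m) (P * wedge m) + pairing k (interior m * P) (interior m * P) :=
      fun m _ => add_nonneg (add_nonneg (pairing_nonneg _ _) (pairing_nonneg _ _))
        (pairing_nonneg _ _)
    have hs := Finset.sum_nonneg hm
    refine ⟨by linarith, fun m => ?_⟩
    have h2 := (Finset.sum_eq_zero_iff_of_nonneg hm).1 (by linarith) m (Finset.mem_univ m)
    have h3 := pairing_nonneg k (P * mulF (coord m))
    have h4 := pairing_nonneg k (P * wedge m)
    have h5 := pairing_nonneg k (interior m * P)
    exact ⟨by linarith, by linarith, by linarith⟩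
  induction k generalizing P s w v with
  | zero =>
    obtain rfl : s = [] := List.eq_nil_of_length_eq_zero (by omega)
    obtain rfl : w = [] := List.eq_nil_of_length_eq_zero (by omega)
    obtain rfl : v = [] := List.eq_nil_of_length_eq_zero (by omega)
    rw [pairing_zero_apply, RCLike.conj_mul] at h
    have h1 : ‖ev 𝕜 n (P (vac 𝕜 n))‖ ^ 2 = 0 := by exact_mod_cast h
    have h2 : ev 𝕜 n (P (vac 𝕜 n)) = 0 := by simpa using h1
    simpa [interiors, wedges] using h2
  | succ k ih =>
    obtain ⟨h0, hm⟩ := hmono k P h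
    rcases s.eq_nil_or_concat with rfl | ⟨s, m, rfl⟩
    · cases w with
      | nil =>
        cases v with
        | nil => exact ih h0 _ _ _ (by simp)
        | cons m v =>
          have := ih (hm m).2.1 [] [] v (by simp at hk ⊢; omega)
          simpa [wedges_cons] using this
      | cons m w =>
        have := ih (hm m).1 [] w v (by simp at hk ⊢; omega)
        simpa [mulF_mul_apply] using this
    · have := ih (hm m).2.2 s w v (by simp at hk ⊢; omega)
      simpa [interiors_append, interiors, List.concat_eq_append] using this

/-- A form is determined at the origin by its interior multiplications. -/
theorem apply_zero_eq_zero {η : Form 𝕜 n}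
    (h : ∀ s : List (Fin n), s.length ≤ n → ev 𝕜 n (interiors s η) = 0) : η.1 0 = 0 := by
  have key : ∀ (k : ℕ) (hk : k < n + 1) (η : Form 𝕜 n),
      (∀ s : List (Fin n), s.length = k → ev 𝕜 n (interiors s η) = 0) → η.1 0 ⟨k, hk⟩ = 0 := by
    intro k
    induction k with
    | zero =>
      intro hk η h
      ext v
      have h1 := h [] rfl
      change η.1 0 0 0 = 0 at h1
      change η.1 0 0 v = 0
      rw [← h1]
      congr 1
      exact Subsingleton.elim (α := Fin 0 → Rn n) _ _
    | succ k ih =>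
      intro hk η h
      ext v
      have h1 : ∀ j, (η.1 0 ⟨k + 1, hk⟩).curryLeft (basisVec j) = 0 := by
        intro j
        have h2 := ih (by omega) (interior j η) (by
          intro s hs
          have := h (s ++ [j]) (by simp [hs])
          simpa [interiors_append, interiors] using this)
        have h3 := interior_castSucc_apply j η 0 ⟨k, by omega⟩
        exact h3.symm.trans h2
      have h2 : (η.1 0 ⟨k + 1, hk⟩).curryLeft (v 0) = 0 := by
        rw [← sum_smul_basisVec (v 0), map_sum]
        refine Finset.sum_eq_zero fun j _ => ?_
        rw [map_smul, h1, smul_zero]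
      have h3 := DFunLike.congr_fun h2 (Matrix.vecTail v)
      change η.1 0 ⟨k + 1, hk⟩ (Matrix.vecCons (Matrix.vecHead v) (Matrix.vecTail v)) = 0 at h3
      rw [Matrix.cons_head_tail] at h3
      exact h3
  exact fibre_ext fun k => key k k.2 η fun s hs => h s (by omega)

theorem pd_wedges_vac (m : Fin n) (v : List (Fin n)) : pd m (wedges v (vac 𝕜 n)) = 0 := by
  induction v with
  | nil => exact pd_vac m
  | cons i v ih => rw [wedges_cons, Module.End.mul_apply, pd_wedge_apply, ih, map_zero]

/-- Constant forms are combinations of products of the `dxᵢ`. -/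
theorem constForm_mem_span (a : Fibre 𝕜 n) : constForm a ∈ Submodule.span 𝕜
    {η | ∃ v : List (Fin n), v.length ≤ n ∧ η = wedges v (vac 𝕜 n)} := by
  have key : ∀ (k : ℕ), k ≤ n → ∀ η : Form 𝕜 n, (∀ m, pd m η = 0) → degProj k η = η →
      η ∈ Submodule.span 𝕜 {η | ∃ v : List (Fin n), v.length ≤ k ∧ η = wedges v (vac 𝕜 n)} := by
    intro k
    induction k with
    | zero =>
      intro _ η hη hd
      have h : η = ev 𝕜 n η • vac 𝕜 n := by
        refine form_ext fun x => ?_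
        rw [apply_eq_apply_zero hη]
        refine fibre_ext fun j => ?_
        refine Fin.cases ?_ (fun j => ?_) j
        · ext v
          change η.1 0 0 v = η.1 0 0 0 • (1 : 𝕜)
          rw [smul_eq_mul, mul_one]
          congr 1
          exact Subsingleton.elim (α := Fin 0 → Rn n) _ _
        · have h1 : η.1 0 j.succ = 0 := by
            rw [← hd, degProj_apply, if_neg (by simp)]
          rw [h1]
          exact (smul_zero (ev 𝕜 n η) :
            ev 𝕜 n η • (0 : Rn n [⋀^Fin (j + 1)]→L[ℝ] 𝕜) = 0).symm
      rw [h]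
      exact Submodule.smul_mem _ _ (Submodule.subset_span ⟨[], by simp, rfl⟩)
    | succ k ih =>
      intro hk η hη hd
      -- A nonzero multiple of the form is a sum of products of `dxᵢ` with its contractions, which
      -- have lower degree.
      have h := sum_wedge_interior_degProj (k + 1) η
      rw [hd] at h
      have h0 : ((k + 1 : ℕ) : 𝕜) ≠ 0 := Nat.cast_ne_zero.2 (by omega)
      have h1 : η = ((k + 1 : ℕ) : 𝕜)⁻¹ • ∑ i, wedge i (interior i η) := by
        rw [h, smul_smul, inv_mul_cancel₀ h0, one_smul]
      rw [h1]
      refine Submodule.smul_mem _ _ (Submodule.sum_mem _ fun i _ => ?_)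
      have h2 := ih (by omega) (interior i η) (fun m => by rw [pd_interior_apply, hη, map_zero])
        (by rw [degProj_interior_apply, hd])
      have h3 := Submodule.mem_map_of_mem (f := wedge i) h2
      rw [Submodule.map_span] at h3
      refine Submodule.span_mono ?_ h3
      rintro _ ⟨_, ⟨v, hv, rfl⟩, rfl⟩
      exact ⟨i :: v, by simpa using hv, by rw [wedges_cons]; rfl⟩
  have h : constForm a = ∑ k : Fin (n + 1), degProj k (constForm a) := by
    rw [← LinearMap.sum_apply, sum_degProj]; rfl
  rw [h]
  refine Submodule.sum_mem _ fun k _ => ?_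
  refine Submodule.span_mono ?_ (key k (by omega) _
    (fun m => by rw [pd_degProj_apply, pd_constForm, map_zero]) ?_)
  · rintro _ ⟨v, hv, rfl⟩
    exact ⟨v, by omega, rfl⟩
  · exact LinearMap.congr_fun (degProj_mul_self k) _

theorem flatAt_mon (w : List (Fin n)) {r : ℕ} (h : r < w.length) (η : Form 𝕜 n) :
    FlatAt r 0 (mulF (mon w) η).1 := by
  induction w generalizing r with
  | nil => simp at h
  | cons i w ih =>
    rw [mon_cons, mulF_mul_apply]
    cases r with
    | zero => exact mulF_coord_apply_zero i _
    | succ r => exact (ih (by simpa using h)).smul_succ (smooth_fn (coord i)) (smooth_form _) rfl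

/-- The bound `r + 2 * n` comes from monomials of length at most `r`, longer ones being too flat at
the origin to be seen, and at most `n` contractions and `n` factors `dx`. It yields both the finite
dimension of `invOp` and the definiteness of the pairing on it. -/
theorem eq_zero_of_words {r : ℕ} {P : Module.End 𝕜 (Form 𝕜 n)} (hr : LocalOp r P)
    (hP : TransInv P) (h : ∀ s w v : List (Fin n), s.length + w.length + v.length ≤ r + 2 * n →
      ev 𝕜 n (interiors s (P (mulF (mon w) (wedges v (vac 𝕜 n))))) = 0) : P = 0 := by
  refine eq_zero_of_mon hr hP fun w a => ?_
  by_cases hw : r < w.length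
  · exact hr _ _ (flatAt_mon w hw _)
  refine apply_zero_eq_zero fun s hs => ?_
  suffices H : ∀ η ∈ Submodule.span 𝕜 {η | ∃ v : List (Fin n), v.length ≤ n ∧
      η = wedges v (vac 𝕜 n)}, ev 𝕜 n (interiors s (P (mulF (mon w) η))) = 0 from
    H _ (constForm_mem_span a)
  intro η hη
  induction hη using Submodule.span_induction with
  | mem η hη => obtain ⟨v, hv, rfl⟩ := hη; exact h s w v (by omega)
  | zero => simp
  | add η θ _ _ hη hθ => simp only [map_add, hη, hθ, add_zero]
  | smul c η _ hη => simp only [map_smul, hη, smul_zero]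

/-- The translation-invariant operators of order at most `r`. -/
def invOp (𝕜 : Type) [RCLike 𝕜] (n r : ℕ) : Submodule 𝕜 (Module.End 𝕜 (Form 𝕜 n)) where
  carrier := {P | LocalOp r P ∧ TransInv P}
  add_mem' h h' := ⟨h.1.add h'.1, h.2.add h'.2⟩
  zero_mem' := ⟨LocalOp.zero r, TransInv.zero⟩
  smul_mem' c _ h := ⟨h.1.smul c, h.2.smul c⟩

instance (r : ℕ) : FiniteDimensional 𝕜 (invOp 𝕜 n r) := by
  let T : Type := {l : List (Fin n) // l.length ≤ r + 2 * n}
  have : Finite T := List.finite_length_le _ _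
  let φ : invOp 𝕜 n r →ₗ[𝕜] (T → T → T → 𝕜) :=
    { toFun := fun P s w v =>
        ev 𝕜 n (interiors s.1 (P.1 (mulF (mon w.1) (wedges v.1 (vac 𝕜 n)))))
      map_add' := fun P Q => by
        funext s w v
        exact (congrArg (ev 𝕜 n) (map_add _ _ _)).trans (map_add _ _ _)
      map_smul' := fun c P => by
        funext s w v
        exact (congrArg (ev 𝕜 n) (map_smul _ _ _)).trans (map_smul _ _ _) }
  refine Module.Finite.of_injective φ ?_
  rw [← LinearMap.ker_eq_bot, LinearMap.ker_eq_bot']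
  intro P hP
  refine Subtype.ext (eq_zero_of_words P.2.1 P.2.2 fun s w v h => ?_)
  exact congrFun (congrFun (congrFun hP ⟨s, by omega⟩) ⟨w, by omega⟩) ⟨v, by omega⟩

theorem glAd_mem {r : ℕ} {P : Module.End 𝕜 (Form 𝕜 n)} (h : P ∈ invOp 𝕜 n r) (i j : Fin n) :
    glAd i j P ∈ invOp 𝕜 n r := by
  constructor
  -- Written so that the order visibly does not grow: `P` commutes with `∂ⱼ`, and the commutator
  -- with `xᵢ` loses the order that `∂ⱼ` costs.
  · have e : glAd i j P = wedge i * interior j * P - P * (wedge i * interior j) - adc i P * pd j := by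
      refine LinearMap.ext fun η => ?_
      rw [glAd_apply_apply, gl_apply, gl_apply, h.2, map_add]
      simp only [LinearMap.sub_apply, Module.End.mul_apply, adc_apply]
      abel
    rw [e]
    refine LocalOp.sub (LocalOp.sub ?_ ?_) ?_
    · simpa using ((localOp_wedge i).mul (localOp_interior j)).mul h.1
    · simpa using h.1.mul ((localOp_wedge i).mul (localOp_interior j))
    · cases r with
      | zero => rw [h.1.adc_zero, zero_mul]; exact LocalOp.zero 0
      | succ r => exact (h.1.adc i).mul (localOp_pd j)
  · intro m η
    rw [glAd_apply_apply, glAd_apply_apply, map_sub, gl_pd, h.2 m η, h.2 m (gl i j η), gl_pd, map_add]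
    split_ifs
    · rw [h.2 j η]; abel
    · rw [map_zero]; abel

/-- A cocycle of `gl` with values in translation-invariant operators is cohomologous to a cocycle
with invariant values. -/
theorem exists_glAd_invariant {r : ℕ} (c : Fin n → Fin n → Module.End 𝕜 (Form 𝕜 n))
    (hc : ∀ i j, c i j ∈ invOp 𝕜 n r)
    (h : ∀ i j k l, glAd i j (c k l) - glAd k l (c i j) =
      (if j = k then c i l else 0) - if i = l then c k j else 0) :
    ∃ u ∈ invOp 𝕜 n r, ∀ i j k l, glAd i j (c k l - glAd k l u) = 0 := by
  let A : Fin n → Fin n → invOp 𝕜 n r →ₗ[𝕜] invOp 𝕜 n r := fun i j =>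
    (glAd i j).restrict fun P hP => glAd_mem hP i j
  have hS : ∀ x : invOp 𝕜 n r, pairing (r + 2 * n) x.1 x.1 = 0 → x = 0 := fun x hx =>
    Subtype.ext (eq_zero_of_words x.2.1 x.2.2 fun s w v hk => pairing_eq_zero hx s w v hk)
  let S : invOp 𝕜 n r →+ invOp 𝕜 n r →+ ℝ := AddMonoidHom.mk' (fun x => AddMonoidHom.mk'
    (fun y => pairing (r + 2 * n) x.1 y.1) (fun y z => map_add _ _ _)) (fun x y => by
      ext z
      exact LinearMap.congr_fun (map_add (pairing (r + 2 * n)) x.1 y.1) z.1)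
  obtain ⟨u, hu⟩ := exists_sub_invariant A (by
      intro i j k l x
      have key : glAd i j (glAd k l x.1) - glAd k l (glAd i j x.1) =
          (if j = k then glAd i l x.1 else 0) - if i = l then glAd k j x.1 else 0 := by
        refine LinearMap.ext fun η => ?_
        have h1 := gl_gl i j k l (x.1 η)
        have h2 := congrArg x.1 (gl_gl i j k l η)
        have e : ((if j = k then glAd i l x.1 else 0) - (if i = l then glAd k j x.1 else 0)) η =
            ((if j = k then gl i l (x.1 η) else 0) - if i = l then gl k j (x.1 η) else 0) -
            x.1 ((if j = k then gl i l η else 0) - if i = l then gl k j η else 0) := by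
          rw [map_sub]
          split_ifs <;> simp only [LinearMap.sub_apply, LinearMap.zero_apply, glAd_apply_apply,
            map_zero] <;> abel
        rw [e, ← h1, ← h2]
        simp only [LinearMap.sub_apply, glAd_apply_apply, map_sub]
        abel
      refine Subtype.ext ?_
      refine key.trans ?_
      split_ifs <;> rfl)
    S (fun i j x y => pairing_adjoint _ i j x.1 y.1) (fun x => pairing_nonneg _ x.1) hS
    (fun i j => ⟨c i j, hc i j⟩) (by
      intro i j k l
      refine Subtype.ext ((h i j k l).trans ?_)
      split_ifs <;> rfl)
  exact ⟨u.1, u.2, fun i j k l => congrArg Subtype.val (hu i j k l)⟩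

/-! ### Operators on the fibre -/

/-- Constant forms, as a linear map. -/
def cF : Fibre 𝕜 n →ₗ[𝕜] Form 𝕜 n where
  toFun := constForm
  map_add' _ _ := rfl
  map_smul' _ _ := rfl

/-- The value at the origin. -/
def e0 : Form 𝕜 n →ₗ[𝕜] Fibre 𝕜 n where
  toFun η := η.1 0
  map_add' _ _ := rfl
  map_smul' _ _ := rfl

theorem pd_cF (m : Fin n) (a : Fibre 𝕜 n) : pd m (cF a) = 0 := pd_constForm m a

theorem e0_coord (i : Fin n) (η : Form 𝕜 n) : e0 (mulF (coord i) η) = 0 := mulF_coord_apply_zero i η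

/-- The operator on the fibre obtained by restricting to constant forms and evaluating at the
origin. -/
def fib : Module.End 𝕜 (Form 𝕜 n) →ₗ[𝕜] Module.End 𝕜 (Fibre 𝕜 n) where
  toFun P := e0 ∘ₗ P ∘ₗ cF
  map_add' P Q := LinearMap.ext fun a => map_add e0 _ _
  map_smul' c P := LinearMap.ext fun a => map_smul e0 _ _

theorem fib_apply (P : Module.End 𝕜 (Form 𝕜 n)) (a : Fibre 𝕜 n) : fib P a = e0 (P (cF a)) := rfl

theorem TransInv.apply_cF {P : Module.End 𝕜 (Form 𝕜 n)} (hP : TransInv P) (a : Fibre 𝕜 n) :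
    P (cF a) = cF (fib P a) :=
  eq_constForm fun m => by rw [hP, pd_cF, map_zero]

/-- A translation-invariant operator sends constant forms to constant forms, so evaluating at the
origin in between loses nothing. -/
theorem fib_mul (P : Module.End 𝕜 (Form 𝕜 n)) {Q : Module.End 𝕜 (Form 𝕜 n)} (hQ : TransInv Q) :
    fib (P * Q) = fib P * fib Q := by
  refine LinearMap.ext fun a => ?_
  rw [Module.End.mul_apply, fib_apply, fib_apply, Module.End.mul_apply, hQ.apply_cF]

theorem fib_one : fib (1 : Module.End 𝕜 (Form 𝕜 n)) = 1 := rfl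

theorem fib_mul_local {P : Module.End 𝕜 (Form 𝕜 n)} (hP : LocalOp 0 P)
    (Q : Module.End 𝕜 (Form 𝕜 n)) : fib (P * Q) = fib P * fib Q := by
  refine LinearMap.ext fun a => ?_
  have h := hP 0 (Q (cF a) - cF (fib Q a)) (sub_self _)
  rw [map_sub] at h
  exact sub_eq_zero.1 h

/-- Exterior multiplication on the fibre. -/
def fw (i : Fin n) : Module.End 𝕜 (Fibre 𝕜 n) := fib (wedge i)

/-- Interior multiplication on the fibre. -/
def fi (i : Fin n) : Module.End 𝕜 (Fibre 𝕜 n) := fib (interior i)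

/-- Projection to a degree on the fibre. -/
def fd (k : ℕ) : Module.End 𝕜 (Fibre 𝕜 n) := fib (degProj k)

/-- The action of `gl` on the fibre. -/
def fg (i j : Fin n) : Module.End 𝕜 (Fibre 𝕜 n) := fw i * fi j

theorem fi_fw (i j : Fin n) :
    (fi j * fw i : Module.End 𝕜 (Fibre 𝕜 n)) = (if i = j then 1 else 0) - fw i * fi j := by
  rw [fi, fw, ← fib_mul _ (transInv_wedge i), ← fib_mul _ (transInv_interior j)]
  refine LinearMap.ext fun a => ?_
  rw [fib_apply, Module.End.mul_apply, interior_wedge_apply]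
  split_ifs <;> rfl

theorem fw_fw (i j : Fin n) : (fw i * fw j : Module.End 𝕜 (Fibre 𝕜 n)) = - (fw j * fw i) := by
  rw [fw, fw, ← fib_mul _ (transInv_wedge j), ← fib_mul _ (transInv_wedge i), ← map_neg]
  refine LinearMap.ext fun a => ?_
  exact congrArg e0 (wedge_anticomm i j _)

theorem fi_fi (i j : Fin n) : (fi i * fi j : Module.End 𝕜 (Fibre 𝕜 n)) = - (fi j * fi i) := by
  rw [fi, fi, ← fib_mul _ (transInv_interior j), ← fib_mul _ (transInv_interior i), ← map_neg]
  refine LinearMap.ext fun a => ?_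
  exact congrArg e0 (interior_anticomm i j _)

theorem fd_fw (k : ℕ) (i : Fin n) :
    (fd (k + 1) * fw i : Module.End 𝕜 (Fibre 𝕜 n)) = fw i * fd k := by
  rw [fd, fw, fd, ← fib_mul _ (transInv_wedge i), ← fib_mul _ (transInv_degProj k)]
  exact LinearMap.ext fun a => congrArg e0 (degProj_wedge_apply k i _)

theorem fd_zero_fw (i : Fin n) : (fd 0 * fw i : Module.End 𝕜 (Fibre 𝕜 n)) = 0 := by
  rw [fd, fw, ← fib_mul _ (transInv_wedge i)]
  exact LinearMap.ext fun a => congrArg e0 (degProj_zero_wedge_apply i _)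

theorem fd_fi (k : ℕ) (i : Fin n) :
    (fd k * fi i : Module.End 𝕜 (Fibre 𝕜 n)) = fi i * fd (k + 1) := by
  rw [fd, fi, fd, ← fib_mul _ (transInv_interior i), ← fib_mul _ (transInv_degProj (k + 1))]
  exact LinearMap.ext fun a => congrArg e0 (degProj_interior_apply k i _)

theorem fi_fd_zero (i : Fin n) : (fi i * fd 0 : Module.End 𝕜 (Fibre 𝕜 n)) = 0 := by
  rw [fd, fi, ← fib_mul _ (transInv_degProj 0)]
  exact LinearMap.ext fun a => congrArg e0 (interior_degProj_zero_apply i _)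

theorem fd_of_lt {k : ℕ} (h : n < k) : (fd k : Module.End 𝕜 (Fibre 𝕜 n)) = 0 := by
  rw [fd, degProj_of_lt h, map_zero]

theorem sum_fd : (∑ k : Fin (n + 1), fd k : Module.End 𝕜 (Fibre 𝕜 n)) = 1 := by
  simp only [fd]
  rw [← map_sum, sum_degProj, fib_one]

theorem sum_fg_fd (k : ℕ) :
    (∑ i, fg i i * fd k : Module.End 𝕜 (Fibre 𝕜 n)) = (k : 𝕜) • fd k := by
  have h : ∀ i : Fin n, (fg i i * fd k : Module.End 𝕜 (Fibre 𝕜 n)) =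
      fib (wedge i * interior i * degProj k) := fun i => by
    rw [fib_mul _ (transInv_degProj k), fib_mul _ (transInv_interior i)]; rfl
  simp only [h]
  rw [← map_sum]
  refine LinearMap.ext fun a => ?_
  have := congrArg e0 (sum_wedge_interior_degProj k (cF a))
  rw [map_smul] at this
  rw [fib_apply, LinearMap.sum_apply]
  exact this

/-- The commutation relation of a vector operator. -/
theorem fg_fw (i j m : Fin n) :
    (fg i j * fw m : Module.End 𝕜 (Fibre 𝕜 n)) = fw m * fg i j + if m = j then fw i else 0 := by
  rw [fg, mul_assoc, fi_fw, mul_sub, ← mul_assoc (fw i), fw_fw i m]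
  split_ifs <;> simp [mul_assoc]
  abel

theorem fg_fi (i j m : Fin n) :
    (fg i j * fi m : Module.End 𝕜 (Fibre 𝕜 n)) = fi m * fg i j - if i = m then fi j else 0 := by
  rw [fg, ← mul_assoc, fi_fw, sub_mul, mul_assoc, fi_fi j m, mul_assoc]
  split_ifs <;> simp

theorem fg_fd (i j : Fin n) (k : ℕ) :
    (fg i j * fd k : Module.End 𝕜 (Fibre 𝕜 n)) = fd k * fg i j := by
  cases k with
  | zero => rw [fg, mul_assoc, fi_fd_zero, ← mul_assoc, fd_zero_fw, mul_zero, zero_mul]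
  | succ k => rw [fg, mul_assoc, ← fd_fi, ← mul_assoc, ← fd_fw, mul_assoc]

theorem fw_mul_self (i : Fin n) : (fw i * fw i : Module.End 𝕜 (Fibre 𝕜 n)) = 0 := by
  have h := fw_fw (𝕜 := 𝕜) i i
  have h2 : (2 : 𝕜) • (fw i * fw i : Module.End 𝕜 (Fibre 𝕜 n)) = 0 := by
    rw [two_smul]; nth_rewrite 1 [h]; simp
  exact (smul_eq_zero.1 h2).resolve_left two_ne_zero

/-- `fg b b` projects onto the forms containing `dx_b`, so its only weights are `0` and `1`. This
limits the weights of operators on the fibre. -/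
theorem fg_mul_self (b : Fin n) : (fg b b * fg b b : Module.End 𝕜 (Fibre 𝕜 n)) = fg b b := by
  nth_rewrite 2 [fg]
  rw [← mul_assoc, fg_fw, if_pos rfl, add_mul, fg, ← mul_assoc, fw_mul_self]
  simp

/-- There are no operators of weight at least two. -/
theorem eq_zero_of_weight {X : Module.End 𝕜 (Fibre 𝕜 n)} (b : Fin n) (p : ℕ) (hp : 2 ≤ p)
    (h : fg b b * X = X * fg b b + (p : 𝕜) • X) : X = 0 := by
  -- Commutation with an idempotent has no eigenvalues besides `-1`, `0` and `1`; the idempotency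
  -- relation is expanded to exclude `p ≥ 2`.
  have hn := fg_mul_self (𝕜 := 𝕜) b
  set N : Module.End 𝕜 (Fibre 𝕜 n) := fg b b
  have h2 : N * X = N * (N * X) := by rw [← mul_assoc, hn]
  have h1 : N * (X * N) = X * N + (p : 𝕜) • (X * N) := by
    rw [← mul_assoc, h, add_mul, mul_assoc, hn, smul_mul_assoc]
  rw [h, mul_add, h1, mul_smul_comm, h, smul_add] at h2
  have h3 : (2 * (p : 𝕜)) • (X * N) + ((p : 𝕜) * p - p) • X = 0 := by
    have := sub_eq_zero.2 h2.symm
    rw [← this]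
    module
  have h4 := congrArg (· * N) h3
  simp only [add_mul, smul_mul_assoc, zero_mul, mul_assoc, hn] at h4
  have h5 : ((p : 𝕜) * (p + 1)) • (X * N) = 0 := by
    rw [← h4]; module
  have hp0 : (p : 𝕜) ≠ 0 := Nat.cast_ne_zero.2 (by omega)
  have hp1 : (p : 𝕜) + 1 ≠ 0 := by exact_mod_cast (by omega : p + 1 ≠ 0)
  have hXN : X * N = 0 := (smul_eq_zero.1 h5).resolve_left (mul_ne_zero hp0 hp1)
  rw [hXN, smul_zero, zero_add] at h3
  refine (smul_eq_zero.1 h3).resolve_left ?_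
  rw [← mul_sub_one]
  refine mul_ne_zero hp0 (sub_ne_zero.2 ?_)
  exact_mod_cast (by omega : p ≠ 1)

/-- The degree is the eigenvalue of the sum of the `fg i i`, so whatever commutes with `gl`
preserves it. -/
theorem fd_mul_of_commute {G : Module.End 𝕜 (Fibre 𝕜 n)} (h : ∀ i j, fg i j * G = G * fg i j)
    (k : ℕ) : fd k * (G * fd k) = G * fd k := by
  have hz : ∀ l : ℕ, l ≠ k → fd l * (G * fd k) = 0 := by
    intro l hl
    have e1 : (l : 𝕜) • (fd l * (G * fd k)) = (k : 𝕜) • (fd l * (G * fd k)) := by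
      calc (l : 𝕜) • (fd l * (G * fd k)) = (∑ i, fg i i * fd l) * (G * fd k) := by
            rw [sum_fg_fd, smul_mul_assoc]
        _ = fd l * (G * ∑ i, fg i i * fd k) := by
            rw [Finset.sum_mul, Finset.mul_sum, Finset.mul_sum]
            refine Finset.sum_congr rfl fun i _ => ?_
            rw [fg_fd, mul_assoc, ← mul_assoc _ G, h, mul_assoc]
        _ = (k : 𝕜) • (fd l * (G * fd k)) := by rw [sum_fg_fd, mul_smul_comm, mul_smul_comm]
    have e2 : ((l : 𝕜) - k) • (fd l * (G * fd k)) = 0 := by rw [sub_smul, e1, sub_self]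
    exact (smul_eq_zero.1 e2).resolve_left (sub_ne_zero.2 (by exact_mod_cast hl))
  by_cases hk : k < n + 1
  · conv_rhs => rw [← one_mul (G * fd k), ← sum_fd, Finset.sum_mul]
    rw [Finset.sum_eq_single (⟨k, hk⟩ : Fin (n + 1))]
    · intro l _ hl
      exact hz l fun h => hl (Fin.ext h)
    · simp
  · rw [fd_of_lt (by omega : n < k)]; simp

theorem fd_zero_eq (a : Fibre 𝕜 n) : fd 0 a = ev 𝕜 n (cF a) • e0 (vac 𝕜 n) := by
  refine fibre_ext fun j => ?_
  change (degProj 0 (cF a)).1 0 j = _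
  rw [degProj_apply]
  refine Fin.cases ?_ (fun j => ?_) j
  · ext v
    change a 0 v = a 0 0 • (1 : 𝕜)
    rw [smul_eq_mul, mul_one]
    congr 1
    exact Subsingleton.elim (α := Fin 0 → Rn n) _ _
  · rw [if_neg (by simp)]
    exact (smul_zero (ev 𝕜 n (cF a)) :
      ev 𝕜 n (cF a) • (0 : Rn n [⋀^Fin (j + 1)]→L[ℝ] 𝕜) = 0).symm

/-- Schur's lemma for the exterior powers of the standard representation. -/
theorem exists_scalar {G : Module.End 𝕜 (Fibre 𝕜 n)} (h : ∀ i j, fg i j * G = G * fg i j) :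
    ∃ c : ℕ → 𝕜, ∀ k, G * fd k = c k • fd k := by
  -- Here `G` varies in the induction on the degree, since the step replaces it by another operator
  -- commuting with `gl`.
  suffices H : ∀ (k : ℕ) (G : Module.End 𝕜 (Fibre 𝕜 n)), (∀ i j, fg i j * G = G * fg i j) →
      ∃ c : 𝕜, G * fd k = c • fd k by
    choose c hc using fun k => H k G h
    exact ⟨c, hc⟩
  intro k
  induction k with
  | zero =>
    intro G h
    refine ⟨ev 𝕜 n (cF (G (e0 (vac 𝕜 n)))), LinearMap.ext fun a => ?_⟩
    rw [← fd_mul_of_commute h, Module.End.mul_apply, Module.End.mul_apply, fd_zero_eq,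
      fd_zero_eq a, map_smul, map_smul, map_smul, LinearMap.smul_apply, fd_zero_eq a,
      smul_smul, smul_eq_mul, mul_comm]
  | succ k ih =>
    intro G h
    by_cases hk : n ≤ k
    · exact ⟨0, by rw [fd_of_lt (by omega : n < k + 1)]; simp⟩
    -- The scalar by which this operator acts in degree `k` determines the scalar of `G` in degree
    -- `k + 1`.
    let G' : Module.End 𝕜 (Fibre 𝕜 n) := ∑ m, fi m * G * fw m
    have hG' : ∀ i j, fg i j * G' = G' * fg i j := by
      intro i j
      have e : ∀ m, fg i j * (fi m * G * fw m) = fi m * G * fw m * fg i j +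
          ((if m = j then fi m * G * fw i else 0) - if m = i then fi j * G * fw m else 0) := by
        intro m
        rw [mul_assoc, ← mul_assoc, fg_fi, sub_mul, mul_assoc (fi m), ← mul_assoc (fg i j), h,
          mul_assoc G, fg_fw]
        have : (i = m) = (m = i) := propext eq_comm
        simp only [this]
        split_ifs <;> simp only [mul_add, mul_assoc, mul_zero, zero_mul] <;> abel
      simp only [G', Finset.mul_sum, Finset.sum_mul, e, Finset.sum_add_distrib,
        Finset.sum_sub_distrib, Finset.sum_ite_eq', Finset.mem_univ, if_true, sub_self, add_zero]
    obtain ⟨c, hc⟩ := ih G' hG'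
    -- `n - k` is the eigenvalue on `k`-forms of the sum of the contractions with `∂ₘ` after
    -- multiplication by `dxₘ`.
    have hnk : (n : 𝕜) - k ≠ 0 := sub_ne_zero.2 (by exact_mod_cast (by omega : n ≠ k))
    have h1 : ∀ i, G * fw i * fd k = (((n : 𝕜) - k)⁻¹ * c) • (fw i * fd k) := by
      intro i
      have e1 : (∑ m, fi m * fw m * fd k : Module.End 𝕜 (Fibre 𝕜 n)) = ((n : 𝕜) - k) • fd k := by
        simp only [fi_fw, if_true, sub_mul, Finset.sum_sub_distrib, one_mul]
        have := sum_fg_fd (𝕜 := 𝕜) (n := n) k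
        simp only [fg] at this
        rw [this, sub_smul]
        simp [← Nat.cast_smul_eq_nsmul 𝕜]
      have e2 : ((n : 𝕜) - k) • (G * fw i * fd k) = c • (fw i * fd k) := by
        rw [← mul_smul_comm, ← e1, ← mul_smul_comm, ← hc, Finset.mul_sum, Finset.sum_mul,
          Finset.mul_sum]
        refine Finset.sum_congr rfl fun m _ => ?_
        have := h i m
        rw [fg] at this
        calc G * fw i * (fi m * fw m * fd k) = G * (fw i * fi m) * (fw m * fd k) := by
              simp only [mul_assoc]
          _ = fw i * (fi m * G * fw m * fd k) := by rw [← this]; simp only [mul_assoc]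
      rw [mul_smul, ← e2, smul_smul, inv_mul_cancel₀ hnk, one_smul]
    refine ⟨((n : 𝕜) - k)⁻¹ * c, ?_⟩
    have hk1 : ((k + 1 : ℕ) : 𝕜) ≠ 0 := Nat.cast_ne_zero.2 (by omega)
    have e3 : (fd (k + 1) : Module.End 𝕜 (Fibre 𝕜 n)) =
        ((k + 1 : ℕ) : 𝕜)⁻¹ • ∑ i, fw i * fd k * fi i := by
      have := sum_fg_fd (𝕜 := 𝕜) (n := n) (k + 1)
      simp only [fg, mul_assoc, ← fd_fi] at this
      simp only [mul_assoc]
      rw [this, smul_smul, inv_mul_cancel₀ hk1, one_smul]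
    rw [e3, mul_smul_comm, Finset.mul_sum, smul_comm (_ * c)]
    congr 1
    rw [Finset.smul_sum]
    refine Finset.sum_congr rfl fun i _ => ?_
    rw [← mul_assoc, ← mul_assoc, h1, smul_mul_assoc]

/-- Vector operators are multiples of the exterior multiplications. -/
theorem exists_scalar_vector {K : Fin n → Module.End 𝕜 (Fibre 𝕜 n)}
    (h : ∀ i j m, fg i j * K m = K m * fg i j + if m = j then K i else 0) :
    ∃ c : ℕ → 𝕜, ∀ i k, K i * fd k = c k • (fw i * fd k) := by
  -- Both factors have weight one under `fg m m`, so the product has the excluded weight two. Acting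
  -- with `fg i m` polarizes this to antisymmetry.
  have hz : ∀ m, K m * fw m = 0 := by
    intro m
    refine eq_zero_of_weight m 2 le_rfl ?_
    rw [← mul_assoc, h, if_pos rfl, add_mul, mul_assoc, fg_fw, if_pos rfl, mul_add, mul_assoc]
    push_cast
    rw [two_smul, add_assoc]
  have ha : ∀ i m, K i * fw m = - (K m * fw i) := by
    intro i m
    by_cases him : m = i
    · subst him; simp [hz]
    have e1 : fg i m * (K m * fw m) = 0 := by rw [hz, mul_zero]
    rw [← mul_assoc, h, if_pos rfl, add_mul, mul_assoc, fg_fw, if_pos rfl, mul_add, ← mul_assoc,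
      hz, zero_mul, zero_add, add_comm] at e1
    exact eq_neg_of_add_eq_zero_left e1
  -- Contracting the index gives an operator commuting with `gl`, hence a scalar in each degree.
  -- Antisymmetry recovers `k + 1` times `K i` on `k`-forms from `G` after `dxᵢ`.
  let G : Module.End 𝕜 (Fibre 𝕜 n) := ∑ m, K m * fi m
  have hG : ∀ i j, fg i j * G = G * fg i j := by
    intro i j
    have e : ∀ m, fg i j * (K m * fi m) = K m * fi m * fg i j +
        ((if m = j then K i * fi m else 0) - if m = i then K m * fi j else 0) := by
      intro m
      rw [← mul_assoc, h, add_mul, mul_assoc, fg_fi]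
      have : (i = m) = (m = i) := propext eq_comm
      simp only [this]
      split_ifs <;> simp only [mul_sub, mul_assoc, mul_zero, zero_mul] <;> abel
    simp only [G, Finset.mul_sum, Finset.sum_mul, e, Finset.sum_add_distrib,
      Finset.sum_sub_distrib, Finset.sum_ite_eq', Finset.mem_univ, if_true, sub_self, add_zero]
  obtain ⟨c, hc⟩ := exists_scalar hG
  have h1 : ∀ i k, ((k + 1 : ℕ) : 𝕜) • (K i * fd k) = G * (fw i * fd k) := by
    intro i k
    have e : ∀ m, K m * fi m * (fw i * fd k) = (if i = m then K m * fd k else 0) +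
        K i * (fg m m * fd k) := by
      intro m
      rw [mul_assoc, ← mul_assoc (fi m), fi_fw, sub_mul, mul_sub, mul_assoc (fw i),
        ← mul_assoc (K m) (fw i), ha m i, fg]
      split_ifs <;> simp [mul_assoc]
    simp only [G, Finset.sum_mul, e, Finset.sum_add_distrib, Finset.sum_ite_eq, Finset.mem_univ,
      if_true]
    rw [← Finset.mul_sum, sum_fg_fd, mul_smul_comm]
    push_cast
    rw [add_smul, one_smul, add_comm]
  refine ⟨fun k => ((k + 1 : ℕ) : 𝕜)⁻¹ * c (k + 1), fun i k => ?_⟩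
  have hk1 : ((k + 1 : ℕ) : 𝕜) ≠ 0 := Nat.cast_ne_zero.2 (by omega)
  have e4 : K i * fd k = ((k + 1 : ℕ) : 𝕜)⁻¹ • ((k + 1 : ℕ) : 𝕜) • (K i * fd k) := by
    rw [smul_smul, inv_mul_cancel₀ hk1, one_smul]
  rw [e4, h1, ← fd_fw, ← mul_assoc, hc, mul_smul, smul_mul_assoc]

/-- Operators of type `V ⊗ V` are multiples of the products of exterior multiplications. -/
theorem exists_scalar_tensor {K : Fin n → Fin n → Module.End 𝕜 (Fibre 𝕜 n)}
    (h : ∀ i j a b, fg i j * K a b = K a b * fg i j + (if a = j then K i b else 0) +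
      if b = j then K a i else 0) :
    ∃ c : ℕ → 𝕜, ∀ a b k, K a b * fd k = c k • (fw a * fw b * fd k) := by
  -- The weight under `fg b b` is three if `a = b` and two otherwise, and both are excluded.
  have hz : ∀ a b, K a b * fw b = 0 := by
    intro a b
    have e : fg b b * (K a b * fw b) = K a b * fw b * fg b b +
        ((if a = b then K a b * fw b else 0) + (2 : 𝕜) • (K a b * fw b)) := by
      rw [← mul_assoc, h, if_pos rfl, add_mul, add_mul, mul_assoc, fg_fw, if_pos rfl, mul_add,
        mul_assoc, two_smul]
      split_ifs with hab
      · subst hab; abel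
      · rw [zero_mul]; abel
    by_cases hab : a = b
    · refine eq_zero_of_weight b 3 (by omega) ?_
      rw [e, if_pos hab]
      push_cast
      module
    · refine eq_zero_of_weight b 2 le_rfl ?_
      rw [e, if_neg hab, zero_add]
      push_cast
      rfl
  have ha : ∀ a i b, K a i * fw b = - (K a b * fw i) := by
    intro a i b
    by_cases hib : b = i
    · subst hib; simp [hz]
    have e1 : fg i b * (K a b * fw b) = 0 := by rw [hz, mul_zero]
    rw [← mul_assoc, h, if_pos rfl, add_mul, add_mul, mul_assoc, fg_fw, if_pos rfl, mul_add,
      ← mul_assoc, hz, zero_mul, zero_add] at e1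
    have e2 : (if a = b then K i b else 0) * fw b = 0 := by
      split_ifs
      · exact hz _ _
      · exact zero_mul _
    rw [e2, add_zero, add_comm] at e1
    exact eq_neg_of_add_eq_zero_left e1
  -- Contracting the last index leaves a vector operator, which is already classified.
  let K' : Fin n → Module.End 𝕜 (Fibre 𝕜 n) := fun a => ∑ m, K a m * fi m
  have hK' : ∀ i j a, fg i j * K' a = K' a * fg i j + if a = j then K' i else 0 := by
    intro i j a
    have e : ∀ m, fg i j * (K a m * fi m) = K a m * fi m * fg i j +
        (((if m = j then K a i * fi m else 0) - if m = i then K a m * fi j else 0) +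
          (if a = j then K i m else 0) * fi m) := by
      intro m
      rw [← mul_assoc, h, add_mul, add_mul, mul_assoc, fg_fi]
      have : (i = m) = (m = i) := propext eq_comm
      simp only [this]
      split_ifs <;> simp only [mul_sub, mul_assoc, mul_zero, zero_mul] <;> abel
    simp only [K', Finset.mul_sum, Finset.sum_mul, e, Finset.sum_add_distrib,
      Finset.sum_sub_distrib, Finset.sum_ite_eq', Finset.mem_univ, if_true, sub_self, zero_add]
    congr 1
    split_ifs <;> simp
  obtain ⟨c, hc⟩ := exists_scalar_vector hK'
  have h1 : ∀ a i k, ((k + 1 : ℕ) : 𝕜) • (K a i * fd k) = K' a * (fw i * fd k) := by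
    intro a i k
    have e : ∀ m, K a m * fi m * (fw i * fd k) = (if i = m then K a m * fd k else 0) +
        K a i * (fg m m * fd k) := by
      intro m
      rw [mul_assoc, ← mul_assoc (fi m), fi_fw, sub_mul, mul_sub, mul_assoc (fw i),
        ← mul_assoc (K a m) (fw i), ha a m i, fg]
      split_ifs <;> simp [mul_assoc]
    simp only [K', Finset.sum_mul, e, Finset.sum_add_distrib, Finset.sum_ite_eq, Finset.mem_univ,
      if_true]
    rw [← Finset.mul_sum, sum_fg_fd, mul_smul_comm]
    push_cast
    rw [add_smul, one_smul, add_comm]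
  refine ⟨fun k => ((k + 1 : ℕ) : 𝕜)⁻¹ * c (k + 1), fun a i k => ?_⟩
  have hk1 : ((k + 1 : ℕ) : 𝕜) ≠ 0 := Nat.cast_ne_zero.2 (by omega)
  have e4 : K a i * fd k = ((k + 1 : ℕ) : 𝕜)⁻¹ • ((k + 1 : ℕ) : 𝕜) • (K a i * fd k) := by
    rw [smul_smul, inv_mul_cancel₀ hk1, one_smul]
  rw [e4, h1, ← fd_fw, ← mul_assoc, hc, mul_smul, smul_mul_assoc, mul_assoc, fd_fw, mul_assoc]

/-! ### Invariant operators and vector operators on `Ω(ℝⁿ)` -/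

theorem fnPd_pow (m : Fin n) (s : ℕ) :
    fnPd m (coord m ^ (s + 1)) = ((s : ℝ) + 1) • (coord m ^ s : Fn n) := by
  induction s with
  | zero => simp [fnPd_coord]
  | succ s ih =>
    rw [pow_succ, fnPd_mul, ih, fnPd_coord, if_pos rfl, smul_mul_assoc, ← pow_succ, mul_one]
    push_cast
    module

theorem coord_mul_fnPd_mon (i m : Fin n) (w : List (Fin n)) :
    coord i * fnPd m (mon w) ∈ Submodule.span ℝ {g : Fn n | ∃ v : List (Fin n),
      v.length = w.length ∧ g = mon v} := by
  induction w with
  | nil => simp [fnPd_one]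
  | cons j w ih =>
    rw [mon_cons, fnPd_mul, fnPd_coord, mul_add]
    refine Submodule.add_mem _ ?_ ?_
    · rw [mul_left_comm]
      have h := Submodule.mem_map_of_mem (f := LinearMap.mulLeft ℝ (coord j : Fn n)) ih
      rw [Submodule.map_span] at h
      refine Submodule.span_mono ?_ h
      rintro _ ⟨_, ⟨v, hv, rfl⟩, rfl⟩
      exact ⟨j :: v, by simpa using hv, by simp⟩
    · split_ifs
      · rw [one_mul]
        exact Submodule.subset_span ⟨i :: w, by simp, by simp⟩
      · simp

/-- A `gl`-stable space of functions containing the powers of the coordinates contains all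
monomials. -/
theorem mon_mem_of_pow_mem (V : Submodule ℝ (Fn n))
    (hV : ∀ i m, ∀ g ∈ V, coord i * fnPd m g ∈ V) (p : ℕ) (hp : ∀ m, coord m ^ p ∈ V)
    (w : List (Fin n)) (hw : w.length = p) (hne : w ≠ []) : mon w ∈ V := by
  obtain ⟨m, w0, rfl⟩ := List.exists_cons_of_ne_nil hne
  -- Polarization: `xᵢ ∂ₘ` exchanges one factor `xₘ` of a pure power for `xᵢ`, and `q` counts the
  -- factors already exchanged. Its effect on the factors `v` keeps their number and is covered by
  -- the induction hypothesis.
  have key : ∀ q ≤ p, ∀ v : List (Fin n), v.length = q → coord m ^ (p - q) * mon v ∈ V := by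
    intro q
    induction q with
    | zero =>
      intro _ v hv
      rw [List.eq_nil_of_length_eq_zero hv]
      simpa using hp m
    | succ q ih =>
      intro hq v hv
      obtain ⟨i, v, rfl⟩ : ∃ i v', v = i :: v' := by
        cases v with
        | nil => simp at hv
        | cons i v => exact ⟨i, v, rfl⟩
      have hv' : v.length = q := by simpa using hv
      have h1 := hV i m _ (ih (by omega) v hv')
      have h2 : coord m ^ (p - q) * (coord i * fnPd m (mon v)) ∈ V := by
        have h := Submodule.mem_map_of_mem (f := LinearMap.mulLeft ℝ (coord m ^ (p - q) : Fn n))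
          (coord_mul_fnPd_mon i m v)
        rw [Submodule.map_span] at h
        refine (Submodule.span_le (p := V)).2 ?_ h
        rintro _ ⟨_, ⟨u, hu, rfl⟩, rfl⟩
        exact ih (by omega) u (by omega)
      obtain ⟨s, hs⟩ : ∃ s, p - q = s + 1 := ⟨p - q - 1, by omega⟩
      have hs' : p - (q + 1) = s := by omega
      rw [hs] at h1 h2
      rw [hs']
      have h3 : coord m ^ s * mon (i :: v) = ((s : ℝ) + 1)⁻¹ •
          (coord i * fnPd m (coord m ^ (s + 1) * mon v) -
            coord m ^ (s + 1) * (coord i * fnPd m (mon v))) := by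
        rw [fnPd_mul, fnPd_pow, mon_cons]
        rw [mul_add, mul_left_comm (coord i) (coord m ^ (s + 1)), add_sub_cancel_left, smul_mul_assoc,
          mul_smul_comm, smul_smul, inv_mul_cancel₀ (by positivity), one_smul]
        ring
      rw [h3]
      exact V.smul_mem _ (V.sub_mem h1 h2)
  have h := key p le_rfl (m :: w0) hw
  simpa using h

theorem fg_mul_fib (i j : Fin n) (Q : Module.End 𝕜 (Form 𝕜 n)) :
    fg i j * fib Q = fib (gl i j * Q) := by
  rw [gl, add_mul, map_add]
  have h1 : fib (mulF (coord i) * pd j * Q) = 0 :=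
    LinearMap.ext fun a => e0_coord i _
  have h2 : LocalOp 0 (wedge i * interior j : Module.End 𝕜 (Form 𝕜 n)) :=
    (localOp_wedge i).mul (localOp_interior j)
  rw [h1, zero_add, fib_mul_local h2, fg, fw, fi, fib_mul _ (transInv_interior j)]

theorem fib_mul_gl (i j : Fin n) (Q : Module.End 𝕜 (Form 𝕜 n)) :
    fib (Q * gl i j) = fib Q * fg i j := by
  have h : fib (Q * gl i j) = fib (Q * (wedge i * interior j)) := by
    refine LinearMap.ext fun a => ?_
    rw [fib_apply, Module.End.mul_apply, gl_apply, pd_cF, map_zero, zero_add]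
    rfl
  rw [h, fib_mul _ ((transInv_wedge i).mul (transInv_interior j)), fg, fw, fi,
    fib_mul _ (transInv_interior j)]

theorem gl_mulF (i j : Fin n) (g : Fn n) (η : Form 𝕜 n) :
    gl i j (mulF g η) = mulF g (gl i j η) + mulF (coord i * fnPd j g) η := by
  rw [gl_apply, gl_apply, pd_mulF_apply, interior_mulF_apply, wedge_mulF_apply, map_add, map_add,
    mulF_mulF_comm, mulF_mul_apply]
  abel

/-- A Leibniz rule: the weight of the fibre operator obtained from `P` and a polynomial `g` is the
sum of their weights. It reduces the classification of translation-invariant operators to weights on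
the fibre. -/
theorem fg_mul_fib_mulF (i j : Fin n) (P : Module.End 𝕜 (Form 𝕜 n)) (g : Fn n) :
    fg i j * fib (P * mulF g) = fib (P * mulF g) * fg i j + (fib (glAd i j P * mulF g) +
      fib (P * mulF (coord i * fnPd j g))) := by
  rw [fg_mul_fib, ← fib_mul_gl, ← map_add, ← map_add]
  congr 1
  refine LinearMap.ext fun η => ?_
  simp only [LinearMap.add_apply, Module.End.mul_apply, glAd_apply_apply, gl_mulF, map_add]
  abel

theorem fib_mulF_smul (P : Module.End 𝕜 (Form 𝕜 n)) (a : ℝ) (g : Fn n) :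
    fib (P * mulF (a • g)) = (a : 𝕜) • fib (P * mulF g) := by
  rw [mulF_rsmul, ← map_smul fib]
  congr 1
  refine LinearMap.ext fun η => ?_
  change P (a • mulF g η) = (a : 𝕜) • P (mulF g η)
  rw [LinearMap.map_smul_of_tower]
  exact (algebraMap_smul 𝕜 a _).symm

/-- The functions on which all of `S` gives zero form a `gl`-stable space, so only pure powers of
the coordinates, which are weight vectors, have to be tested. -/
theorem fib_mulF_mon_eq_zero (S : Set (Module.End 𝕜 (Form 𝕜 n)))
    (hS : ∀ i j, ∀ P ∈ S, glAd i j P ∈ S) (p : ℕ)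
    (h : ∀ m, ∀ P ∈ S, fib (P * mulF (coord m ^ p)) = 0) (w : List (Fin n)) (hw : w.length = p)
    (hne : w ≠ []) : ∀ P ∈ S, fib (P * mulF (mon w)) = 0 := by
  let V : Submodule ℝ (Fn n) :=
    { carrier := {g | ∀ P ∈ S, fib (P * mulF g) = 0}
      add_mem' := fun {f g} hf hg P hP => by
        rw [map_add, mul_add, map_add, hf P hP, hg P hP, add_zero]
      zero_mem' := fun P hP => by rw [map_zero, mul_zero, map_zero]
      smul_mem' := fun c g hg P hP => by rw [fib_mulF_smul, hg P hP, smul_zero] }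
  refine mon_mem_of_pow_mem V ?_ p h w hw hne
  intro i m g hg P hP
  have h1 := fg_mul_fib_mulF i m P g
  rw [hg P hP, hg _ (hS i m P hP)] at h1
  simpa using h1.symm

theorem eq_zero_of_fib {r : ℕ} {P : Module.End 𝕜 (Form 𝕜 n)} (hP : P ∈ invOp 𝕜 n r)
    (h : ∀ w, fib (P * mulF (mon w)) = 0) : P = 0 :=
  eq_zero_of_mon hP.1 hP.2 fun w a => LinearMap.congr_fun (h w) a

theorem coord_mul_fnPd_pow (m : Fin n) (p : ℕ) :
    coord m * fnPd m (coord m ^ p) = (p : ℝ) • (coord m ^ p : Fn n) := by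
  cases p with
  | zero => simp [fnPd_one]
  | succ p => rw [fnPd_pow, mul_smul_comm, ← pow_succ']; push_cast; rfl

/-- An invariant operator vanishes if it does so on polynomial forms of degree at most one. -/
theorem invariant_eq_zero {r : ℕ} {P : Module.End 𝕜 (Form 𝕜 n)} (hP : P ∈ invOp 𝕜 n r)
    (h : ∀ i j, glAd i j P = 0) (h0 : fib P = 0) (h1 : ∀ m, fib (P * mulF (coord m)) = 0) :
    P = 0 := by
  refine eq_zero_of_fib hP fun w => ?_
  by_cases hw : w.length ≤ 1
  · match w, hw with
    | [], _ => rw [mon_nil, map_one, mul_one, h0]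
    | [m], _ => simpa using h1 m
  refine fib_mulF_mon_eq_zero {P, 0} ?_ w.length ?_ w rfl (by rintro rfl; simp at hw) P (by simp)
  · rintro i j Q (rfl | rfl)
    · exact Or.inr (h i j)
    · exact Or.inr (map_zero _)
  · rintro m Q (rfl | rfl)
    -- The operator contributes weight zero and the power of `xₘ` its exponent, which is at least
    -- two here.
    · refine eq_zero_of_weight m w.length (by omega) ?_
      rw [fg_mul_fib_mulF, h, coord_mul_fnPd_pow, fib_mulF_smul, zero_mul, map_zero, zero_add]
      simp
    · rw [zero_mul, map_zero]

theorem sum_scalar_fd (X : Module.End 𝕜 (Fibre 𝕜 n)) (Y : Module.End 𝕜 (Fibre 𝕜 n)) (c : ℕ → 𝕜)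
    (h : ∀ k, X * fd k = c k • (Y * fd k)) : X = ∑ k : Fin (n + 1), c k • (Y * fd k) := by
  conv_lhs => rw [← mul_one X, ← sum_fd, Finset.mul_sum]
  exact Finset.sum_congr rfl fun k _ => h k

theorem glAd_mul_of_commute (i j : Fin n) (P : Module.End 𝕜 (Form 𝕜 n))
    {Q : Module.End 𝕜 (Form 𝕜 n)} (h : ∀ η, gl i j (Q η) = Q (gl i j η)) :
    glAd i j (P * Q) = glAd i j P * Q := by
  refine LinearMap.ext fun η => ?_
  simp only [glAd_apply_apply, Module.End.mul_apply, h]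

theorem gl_d (i j : Fin n) (η : Form 𝕜 n) : gl i j (d η) = d (gl i j η) := by
  rw [← lieDerivative_coord, lieDerivative_d]

theorem glAd_d (i j : Fin n) : glAd i j (d : Module.End 𝕜 (Form 𝕜 n)) = 0 :=
  LinearMap.ext fun η => by rw [glAd_apply_apply, gl_d, sub_self]; rfl

theorem glAd_degProj (i j : Fin n) (k : ℕ) :
    glAd i j (degProj k : Module.End 𝕜 (Form 𝕜 n)) = 0 :=
  LinearMap.ext fun η => by rw [glAd_apply_apply, gl_degProj, sub_self]; rfl

theorem glAd_wedge (i j m : Fin n) :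
    glAd i j (wedge m : Module.End 𝕜 (Form 𝕜 n)) = if m = j then wedge i else 0 :=
  LinearMap.ext fun η => by
    rw [glAd_apply_apply, gl_wedge]
    split_ifs <;> simp

theorem d_mul_mulF_cF (g : Fn n) (a : Fibre 𝕜 n) : d (mulF g (cF a)) = dmul g (cF a) := by
  have h : d (cF a) = 0 := by rw [d_eq]; simp [pd_cF]
  rw [d_mulF, h, map_zero, zero_add]

theorem fib_d : fib (d : Module.End 𝕜 (Form 𝕜 n)) = 0 := by
  refine LinearMap.ext fun a => ?_
  have h : d (cF a) = 0 := by rw [d_eq]; simp [pd_cF]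
  rw [fib_apply, h]; rfl

theorem fib_d_coord (m : Fin n) :
    fib (d * mulF (coord m) : Module.End 𝕜 (Form 𝕜 n)) = fw m := by
  refine LinearMap.ext fun a => ?_
  rw [fib_apply, Module.End.mul_apply, d_mul_mulF_cF, dmul_coord]; rfl

theorem fib_mul_coord {P : Module.End 𝕜 (Form 𝕜 n)} (hP : LocalOp 0 P) (m : Fin n) :
    fib (P * mulF (coord m)) = 0 := by
  rw [fib_mul_local hP]
  have : fib (mulF (coord m) : Module.End 𝕜 (Form 𝕜 n)) = 0 := LinearMap.ext fun a => e0_coord m _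
  rw [this, mul_zero]

theorem degProj_mul_mulF (k : ℕ) (g : Fn n) :
    (degProj k * mulF g : Module.End 𝕜 (Form 𝕜 n)) = mulF g * degProj k :=
  LinearMap.ext fun η => degProj_mulF_apply k g η

/-- Classification of the invariant operators. -/
theorem exists_eq_of_invariant {r : ℕ} {P : Module.End 𝕜 (Form 𝕜 n)} (hP : P ∈ invOp 𝕜 n r)
    (h : ∀ i j, glAd i j P = 0) : ∃ a b : ℕ → 𝕜,
      P = ∑ k : Fin (n + 1), (a k • degProj k + b k • (d * degProj k)) := by
  -- The values on constant forms are governed by Schur's lemma and give `a`; those on linear forms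
  -- make a vector operator and give `b`. After subtraction no degree at most one is left.
  obtain ⟨a, ha⟩ := exists_scalar (G := fib P) (fun i j => by
    have := fg_mul_fib_mulF i j P 1
    simpa [h, fnPd_one] using this)
  obtain ⟨b, hb⟩ := exists_scalar_vector (K := fun m => fib (P * mulF (coord m))) (fun i j m => by
    rw [fg_mul_fib_mulF, h, zero_mul, map_zero, zero_add, fnPd_coord]
    split_ifs <;> simp)
  refine ⟨a, b, ?_⟩
  rw [← sub_eq_zero]
  have hmem : ∀ k : ℕ, degProj k ∈ invOp 𝕜 n (r + 1) := fun k =>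
    ⟨(localOp_degProj k).mono (by omega), transInv_degProj k⟩
  have hmem' : ∀ k : ℕ, d * degProj k ∈ invOp 𝕜 n (r + 1) := fun k =>
    ⟨(localOp_d.mul (localOp_degProj k)).mono (by omega), transInv_d.mul (transInv_degProj k)⟩
  refine invariant_eq_zero (r := r + 1) (Submodule.sub_mem _ ⟨hP.1.mono (by omega), hP.2⟩
    (Submodule.sum_mem _ fun k _ => Submodule.add_mem _ (Submodule.smul_mem _ _ (hmem k))
      (Submodule.smul_mem _ _ (hmem' k)))) ?_ ?_ ?_
  · intro i j
    simp only [map_sub, h, map_sum, map_add, map_smul, glAd_degProj,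
      glAd_mul_of_commute i j d fun η => gl_degProj i j _ η, glAd_d, zero_mul, smul_zero, add_zero,
      Finset.sum_const_zero, sub_zero]
  · simp only [map_sub, map_sum, map_add, map_smul, fib_mul _ (transInv_degProj _), fib_d, zero_mul,
      smul_zero, add_zero]
    rw [sub_eq_zero]
    have := sum_scalar_fd (fib P) 1 a (fun k => by rw [ha, one_mul])
    simpa [fd] using this
  · intro m
    have e1 : ∀ k : ℕ, fib (d * degProj k * mulF (coord m) : Module.End 𝕜 (Form 𝕜 n)) =
        fw m * fd k := by
      intro k
      rw [mul_assoc, degProj_mul_mulF, ← mul_assoc, fib_mul _ (transInv_degProj k), fib_d_coord]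
      rfl
    simp only [sub_mul, Finset.sum_mul, add_mul, smul_mul_assoc, map_sub, map_sum, map_add, map_smul,
      fib_mul_coord (localOp_degProj _), e1, smul_zero, zero_add]
    rw [sub_eq_zero]
    exact sum_scalar_fd _ (fw m) b fun k => hb m k

/-- Classification of the vector operators. -/
theorem exists_eq_of_vector {r : ℕ} {K : Fin n → Module.End 𝕜 (Form 𝕜 n)}
    (hK : ∀ m, K m ∈ invOp 𝕜 n r) (h : ∀ i j m, glAd i j (K m) = if m = j then K i else 0) :
    ∃ a b : ℕ → 𝕜, ∀ m, K m =
      ∑ k : Fin (n + 1), (a k • (wedge m * degProj k) + b k • (wedge m * d * degProj k)) := by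
  obtain ⟨a, ha⟩ := exists_scalar_vector (K := fun m => fib (K m)) (fun i j m => by
    have := fg_mul_fib_mulF i j (K m) 1
    simp only [map_one, mul_one, fnPd_one, mul_zero, map_zero, add_zero, h] at this
    rw [this]
    split_ifs <;> simp)
  -- On linear forms a second index appears, from the coordinate.
  obtain ⟨b, hb⟩ := exists_scalar_tensor (K := fun m l => fib (K m * mulF (coord l)))
    (fun i j m l => by
      rw [fg_mul_fib_mulF, h, fnPd_coord, add_assoc]
      congr 2
      · split_ifs <;> simp
      · split_ifs <;> simp)
  refine ⟨a, b, ?_⟩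
  let K' : Fin n → Module.End 𝕜 (Form 𝕜 n) := fun m => K m -
      ∑ k : Fin (n + 1), (a k • (wedge m * degProj k) + b k • (wedge m * d * degProj k))
  have h0w : ∀ m, LocalOp 0 (wedge m : Module.End 𝕜 (Form 𝕜 n)) := fun m => localOp_wedge m
  have hmem : ∀ m, ∀ k : ℕ, wedge m * degProj k ∈ invOp 𝕜 n (r + 1) := fun m k =>
    ⟨((localOp_wedge m).mul (localOp_degProj k)).mono (by omega),
      (transInv_wedge m).mul (transInv_degProj k)⟩
  have hmem' : ∀ m, ∀ k : ℕ, wedge m * d * degProj k ∈ invOp 𝕜 n (r + 1) := fun m k =>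
    ⟨(((localOp_wedge m).mul localOp_d).mul (localOp_degProj k)).mono (by omega),
      ((transInv_wedge m).mul transInv_d).mul (transInv_degProj k)⟩
  have hK' : ∀ m, K' m ∈ invOp 𝕜 n (r + 1) := fun m =>
    Submodule.sub_mem _ ⟨(hK m).1.mono (by omega), (hK m).2⟩
    (Submodule.sum_mem _ fun k _ => Submodule.add_mem _ (Submodule.smul_mem _ _ (hmem m k))
      (Submodule.smul_mem _ _ (hmem' m k)))
  have hg : ∀ i j m, glAd i j (K' m) = if m = j then K' i else 0 := by
    intro i j m
    simp only [K', map_sub, h, map_sum, map_add, map_smul,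
      glAd_mul_of_commute i j _ fun η => gl_degProj i j _ η,
      glAd_mul_of_commute i j _ fun η => gl_d i j η, glAd_wedge]
    split_ifs <;> simp
  have hf0 : ∀ m, fib (K' m) = 0 := by
    intro m
    simp only [K', map_sub, map_sum, map_add, map_smul, fib_mul _ (transInv_degProj _),
      fib_mul _ transInv_d, fib_d, mul_zero, zero_mul, smul_zero, add_zero]
    rw [sub_eq_zero]
    exact sum_scalar_fd _ (fw m) a fun k => ha m k
  have hf1 : ∀ m l, fib (K' m * mulF (coord l)) = 0 := by
    intro m l
    have e1 : ∀ k : ℕ, fib (wedge m * d * degProj k * mulF (coord l) : Module.End 𝕜 (Form 𝕜 n)) =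
        fw m * fw l * fd k := by
      intro k
      rw [mul_assoc, degProj_mul_mulF, ← mul_assoc, fib_mul _ (transInv_degProj k), mul_assoc,
        fib_mul_local (localOp_wedge m), fib_d_coord]
      rfl
    have e2 : ∀ k : ℕ, fib (wedge m * degProj k * mulF (coord l) : Module.End 𝕜 (Form 𝕜 n)) = 0 :=
      fun k => fib_mul_coord ((localOp_wedge m).mul (localOp_degProj k)) l
    simp only [K', sub_mul, Finset.sum_mul, add_mul, smul_mul_assoc, map_sub, map_sum, map_add,
      map_smul, e1, e2, smul_zero, zero_add]
    rw [sub_eq_zero]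
    exact sum_scalar_fd _ (fw m * fw l) b fun k => hb m l k
  intro m
  rw [← sub_eq_zero]
  change K' m = 0
  refine eq_zero_of_fib (hK' m) fun w => ?_
  by_cases hw : w.length ≤ 1
  · match w, hw with
    | [], _ => rw [mon_nil, map_one, mul_one, hf0]
    | [l], _ => simpa using hf1 m l
  refine fib_mulF_mon_eq_zero {Q | Q = 0 ∨ ∃ m, Q = K' m} ?_ w.length ?_ w rfl
    (by rintro rfl; simp at hw) (K' m) (Or.inr ⟨m, rfl⟩)
  · rintro i j Q (rfl | ⟨l, rfl⟩)
    · exact Or.inl (map_zero _)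
    · rw [hg]
      split_ifs
      · exact Or.inr ⟨i, rfl⟩
      · exact Or.inl rfl
  · rintro l Q (rfl | ⟨q, rfl⟩)
    · rw [zero_mul, map_zero]
    -- The index of the operator adds one to the weight when it equals `l`. In either case the
    -- weight is at least the length of the monomial, which exceeds one.
    · by_cases hq : q = l
      · refine eq_zero_of_weight l (w.length + 1) (by omega) ?_
        rw [fg_mul_fib_mulF, hg, if_pos hq, coord_mul_fnPd_pow, fib_mulF_smul, hq]
        push_cast
        rw [add_smul, one_smul]
        congr 1
        rw [add_comm]
      · refine eq_zero_of_weight l w.length (by omega) ?_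
        rw [fg_mul_fib_mulF, hg, if_neg hq, coord_mul_fnPd_pow, fib_mulF_smul, zero_mul, map_zero,
          zero_add]
        simp

/-! ### The first cohomology -/

/-- The cocycle condition. -/
def IsCocycle (c : Vect n →ₗ[ℝ] Module.End 𝕜 (Form 𝕜 n)) : Prop :=
  ∀ X Y, c (bracket X Y) =
    (lieDerivative X * c Y - c Y * lieDerivative X) - (lieDerivative Y * c X - c X * lieDerivative Y)

/-- The coboundary of an operator. -/
def cobd (u : Module.End 𝕜 (Form 𝕜 n)) : Vect n →ₗ[ℝ] Module.End 𝕜 (Form 𝕜 n) :=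
  rmulC u (lieC 𝕜 n) - lmulC u (lieC 𝕜 n)

theorem cobd_apply (u : Module.End 𝕜 (Form 𝕜 n)) (X : Vect n) :
    cobd u X = lieDerivative X * u - u * lieDerivative X := rfl

theorem cobd_mem {u : Module.End 𝕜 (Form 𝕜 n)} (hu : u ∈ DiffOp 𝕜 n) : cobd u ∈ Cochain 𝕜 n :=
  Submodule.sub_mem _ (rmulC_mem hu lieC_mem) (lmulC_mem hu lieC_mem)

theorem isCocycle_cobd (u : Module.End 𝕜 (Form 𝕜 n)) : IsCocycle (cobd u) := by
  intro X Y
  simp only [cobd_apply, lieDerivative_bracket]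
  noncomm_ring

theorem IsCocycle.sub {c c' : Vect n →ₗ[ℝ] Module.End 𝕜 (Form 𝕜 n)} (hc : IsCocycle c)
    (hc' : IsCocycle c') : IsCocycle (c - c') := by
  intro X Y
  simp only [LinearMap.sub_apply, hc X Y, hc' X Y]
  noncomm_ring

theorem IsCocycle.add {c c' : Vect n →ₗ[ℝ] Module.End 𝕜 (Form 𝕜 n)} (hc : IsCocycle c)
    (hc' : IsCocycle c') : IsCocycle (c + c') := by
  intro X Y
  simp only [LinearMap.add_apply, hc X Y, hc' X Y]
  noncomm_ring

theorem IsCocycle.smul {c : Vect n →ₗ[ℝ] Module.End 𝕜 (Form 𝕜 n)} (hc : IsCocycle c) (a : 𝕜) :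
    IsCocycle (a • c) := by
  intro X Y
  simp only [LinearMap.smul_apply, hc X Y, mul_smul_comm, smul_mul_assoc, smul_sub]

theorem IsCocycle.sum {ι : Type*} (s : Finset ι)
    {c : ι → Vect n →ₗ[ℝ] Module.End 𝕜 (Form 𝕜 n)} (hc : ∀ i, IsCocycle (c i)) :
    IsCocycle (∑ i ∈ s, c i) := by
  classical
  induction s using Finset.induction_on with
  | empty => intro X Y; simp
  | insert i s hi ih => rw [Finset.sum_insert hi]; exact (hc i).add ih

theorem fld_add (f g : Fn n) (j : Fin n) : fld (f + g) j = fld f j + fld g j := by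
  ext1 i; simp only [comp_fld, comp_add]; split_ifs <;> simp

theorem fld_smul (a : ℝ) (f : Fn n) (j : Fin n) : fld (a • f) j = a • fld f j := by
  ext1 i; simp only [comp_fld, comp_smul]; split_ifs <;> simp

theorem fld_zero (j : Fin n) : fld (0 : Fn n) j = 0 := by
  ext1 i; simp only [comp_fld, comp_zero]; split_ifs <;> rfl

theorem fld_sum {ι : Type*} (s : Finset ι) (f : ι → Fn n) (j : Fin n) :
    fld (∑ i ∈ s, f i) j = ∑ i ∈ s, fld (f i) j := by
  ext1 i; simp only [comp_fld, comp_sum]; split_ifs <;> simp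

/-- Every cocycle is cohomologous to a cocycle vanishing on constant vector fields. -/
theorem IsCocycle.exists_const {c : Vect n →ₗ[ℝ] Module.End 𝕜 (Form 𝕜 n)} (hc : IsCocycle c)
    (hm : c ∈ Cochain 𝕜 n) : ∃ u ∈ DiffOp 𝕜 n, ∀ i, (c - cobd u) (fld 1 i) = 0 := by
  obtain ⟨r, hr⟩ := hm
  -- Constant fields commute, so on them the cocycle condition is precisely the compatibility
  -- condition of the Poincaré lemma.
  obtain ⟨u, hu, h⟩ := exists_commutator_pd (fun i => c (fld 1 i)) (fun i => hr.local_right _) (by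
    intro i k η
    have h1 := hc (fld 1 k) (fld 1 i)
    have h2 : bracket (fld 1 k : Vect n) (fld 1 i) = 0 := by
      rw [bracket_fld, fnPd_one, fnPd_one, mul_zero, fld_zero, fld_zero, sub_zero]
    rw [h2, map_zero, lieDerivative_one, lieDerivative_one] at h1
    exact LinearMap.congr_fun (sub_eq_zero.1 h1.symm) η)
  refine ⟨u, hu, fun i => ?_⟩
  rw [LinearMap.sub_apply, cobd_apply, lieDerivative_one, h, sub_self]

theorem bracket_one_fld (k : Fin n) (g : Fn n) (m : Fin n) :
    bracket (fld 1 k) (fld g m) = fld (fnPd k g) m := by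
  rw [bracket_fld, fnPd_one, mul_zero, fld_zero, sub_zero, one_mul]

theorem bracket_coord_fld (i j : Fin n) (g : Fn n) (m : Fin n) :
    bracket (fld (coord i) j) (fld g m) =
      fld (coord i * fnPd j g) m - if m = i then fld g j else 0 := by
  rw [bracket_fld, fnPd_coord]
  congr 1
  split_ifs with h1 h2 h2
  · rw [mul_one]
  · exact absurd h1.symm h2
  · exact absurd h2.symm h1
  · rw [mul_zero, fld_zero]

/-- The value of a cocycle vanishing on constant fields, on a field whose brackets with the constant
fields are annihilated, is translation invariant. -/
theorem IsCocycle.transInv {c : Vect n →ₗ[ℝ] Module.End 𝕜 (Form 𝕜 n)} (hc : IsCocycle c)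
    (h1 : ∀ i, c (fld 1 i) = 0) {X : Vect n} (hX : ∀ k, c (bracket (fld 1 k) X) = 0) :
    TransInv (c X) := by
  intro m η
  have h := hc (fld 1 m) X
  rw [hX, h1, lieDerivative_one, mul_zero, zero_mul, sub_zero, sub_zero] at h
  exact sub_eq_zero.1 (LinearMap.congr_fun h η).symm

theorem IsCocycle.glAd {c : Vect n →ₗ[ℝ] Module.End 𝕜 (Form 𝕜 n)} (hc : IsCocycle c)
    (X : Vect n) (i j : Fin n) :
    glAd i j (c X) = c (bracket (fld (coord i) j) X) +
      (lieDerivative X * c (fld (coord i) j) - c (fld (coord i) j) * lieDerivative X) := by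
  have h := hc (fld (coord i) j) X
  rw [lieDerivative_coord] at h
  rw [h, glAd_apply, sub_add_cancel]

/-- Every cocycle vanishing on constant fields is cohomologous to one whose value on linear fields
is a multiple, by the trace, of an invariant operator. -/
theorem IsCocycle.exists_linear {c : Vect n →ₗ[ℝ] Module.End 𝕜 (Form 𝕜 n)} (hc : IsCocycle c)
    (hm : c ∈ Cochain 𝕜 n) (h1 : ∀ i, c (fld 1 i) = 0) :
    ∃ u ∈ DiffOp 𝕜 n, (∀ i, (c - cobd u) (fld 1 i) = 0) ∧ ∃ a b : ℕ → 𝕜, ∀ i j,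
      (c - cobd u) (fld (coord i) j) = if i = j then
        ∑ k : Fin (n + 1), (a k • degProj k + b k • (d * degProj k)) else 0 := by
  obtain ⟨r, hr⟩ := hm
  -- Brackets of linear with constant fields are constant, so the values on linear fields are
  -- translation invariant.
  have hlin : ∀ i j, c (fld (coord i) j) ∈ invOp 𝕜 n r := fun i j =>
    ⟨hr.local_right _, hc.transInv h1 fun k => by
      rw [bracket_one_fld, fnPd_coord]
      split_ifs
      · exact h1 j
      · rw [fld_zero, map_zero]⟩
  have hbr : ∀ i j k l : Fin n, c (bracket (fld (coord i) j) (fld (coord k) l)) =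
      (if j = k then c (fld (coord i) l) else 0) - if i = l then c (fld (coord k) j) else 0 := by
    intro i j k l
    rw [bracket_coord_fld, map_sub, fnPd_coord]
    congr 1
    · by_cases h : k = j
      · rw [if_pos h, if_pos h.symm, mul_one]
      · rw [if_neg h, if_neg (Ne.symm h), mul_zero, fld_zero, map_zero]
    · by_cases h : l = i
      · rw [if_pos h, if_pos h.symm]
      · rw [if_neg h, if_neg (Ne.symm h), map_zero]
  obtain ⟨u, hu, h⟩ := exists_glAd_invariant (fun i j => c (fld (coord i) j)) hlin (by
    intro i j k l
    rw [← hbr, hc (fld (coord i) j) (fld (coord k) l), lieDerivative_coord, lieDerivative_coord]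
    rfl)
  have huD : u ∈ DiffOp 𝕜 n := ⟨r, hu.1⟩
  set c' := c - cobd u with hc'
  have hcoc : IsCocycle c' := hc.sub (isCocycle_cobd u)
  have h1' : ∀ i, c' (fld 1 i) = 0 := by
    intro i
    rw [hc', LinearMap.sub_apply, h1, cobd_apply, lieDerivative_one, zero_sub, neg_eq_zero,
      sub_eq_zero]
    exact LinearMap.ext fun η => hu.2 i η
  have hv : ∀ k l, c' (fld (coord k) l) = c (fld (coord k) l) - FormDeformation.glAd k l u := by
    intro k l
    rw [hc', LinearMap.sub_apply, cobd_apply, lieDerivative_coord]; rfl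
  have hinv : ∀ i j k l, FormDeformation.glAd i j (c' (fld (coord k) l)) = 0 := by
    intro i j k l
    rw [hv]; exact h i j k l
  -- A cocycle of `gl` with invariant values vanishes on brackets, hence factors through the trace.
  have hz : ∀ i j k l : Fin n, c' (bracket (fld (coord i) j) (fld (coord k) l)) = 0 := by
    intro i j k l
    have e := hcoc (fld (coord i) j) (fld (coord k) l)
    rw [lieDerivative_coord, lieDerivative_coord] at e
    rw [e]
    change FormDeformation.glAd i j _ - FormDeformation.glAd k l _ = 0
    rw [hinv, hinv, sub_zero]
  have hoff : ∀ i j, i ≠ j → c' (fld (coord i) j) = 0 := by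
    intro i j hij
    have e := hz i i i j
    rw [bracket_coord_fld, fnPd_coord, if_pos rfl, if_neg (Ne.symm hij), mul_one, sub_zero] at e
    exact e
  have hdiag : ∀ i j, c' (fld (coord i) i) = c' (fld (coord j) j) := by
    intro i j
    by_cases hij : i = j
    · rw [hij]
    have e := hz i j j i
    rw [bracket_coord_fld, fnPd_coord, if_pos rfl, if_pos rfl, mul_one, map_sub] at e
    exact sub_eq_zero.1 e
  refine ⟨u, huD, h1', ?_⟩
  by_cases hn : Nonempty (Fin n)
  · obtain ⟨i0⟩ := hn
    obtain ⟨a, b, hab⟩ := exists_eq_of_invariant (P := c' (fld (coord i0) i0)) (r := r)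
      (by rw [hv]; exact Submodule.sub_mem _ (hlin _ _) (glAd_mem hu _ _)) (fun i j => hinv i j i0 i0)
    refine ⟨a, b, fun i j => ?_⟩
    split_ifs with hij
    · rw [← hab, ← hij, hdiag i i0]
    · exact hoff i j hij
  · exact ⟨0, 0, fun i => absurd ⟨i⟩ hn⟩

/-- A cocycle vanishing on affine fields is determined by a vector operator. -/
theorem IsCocycle.quadratic {c : Vect n →ₗ[ℝ] Module.End 𝕜 (Form 𝕜 n)} (hc : IsCocycle c)
    (hm : c ∈ Cochain 𝕜 n) (h1 : ∀ i, c (fld 1 i) = 0) (h2 : ∀ i j, c (fld (coord i) j) = 0) :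
    (∀ a b m, a ≠ m → b ≠ m → c (fld (coord a * coord b) m) = 0) ∧
    (∀ a b, a ≠ b → c (fld (coord a * coord a) a) = (2 : 𝕜) • c (fld (coord a * coord b) b)) ∧
    ∃ x y : ℕ → 𝕜, ∀ m, c (fld (coord m * coord m) m) =
      ∑ k : Fin (n + 1), (x k • (wedge m * degProj k) + y k • (wedge m * d * degProj k)) := by
  obtain ⟨r, hr⟩ := hm
  have hq : ∀ a b m, c (fld (coord a * coord b) m) ∈ invOp 𝕜 n r := fun a b m =>
    ⟨hr.local_right _, hc.transInv h1 fun k => by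
      rw [bracket_one_fld, fnPd_mul, fnPd_coord, fnPd_coord, fld_add, map_add]
      split_ifs <;> simp [h2, fld_zero]⟩
  have hg : ∀ i j X, FormDeformation.glAd i j (c X) = c (bracket (fld (coord i) j) X) := by
    intro i j X
    rw [hc.glAd, h2, mul_zero, zero_mul, sub_zero, add_zero]
  -- This field has weight two under `xₐ ∂ₐ`, and a monomial in the argument can only add to it, so
  -- every fibre component of the value has an excluded weight.
  have hsq : ∀ a m, a ≠ m → c (fld (coord a * coord a) m) = 0 := by
    intro a m ham
    have e : FormDeformation.glAd a a (c (fld (coord a * coord a) m)) =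
        (2 : 𝕜) • c (fld (coord a * coord a) m) := by
      rw [hg, bracket_coord_fld, if_neg (Ne.symm ham), sub_zero, fnPd_mul, fnPd_coord, if_pos rfl,
        mul_one, one_mul, mul_add, fld_add, map_add, two_smul]
    refine eq_zero_of_fib (hq a a m) fun w => ?_
    have hw : ∃ s : ℕ, coord a * fnPd a (mon w) = (s : ℝ) • mon w := by
      induction w with
      | nil => exact ⟨0, by simp [fnPd_one]⟩
      | cons j w ih =>
        obtain ⟨s, hs⟩ := ih
        rw [mon_cons, fnPd_mul, fnPd_coord, mul_add, mul_left_comm, hs]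
        by_cases hj : j = a
        · subst hj
          refine ⟨s + 1, ?_⟩
          rw [if_pos rfl, one_mul, mul_smul_comm]
          push_cast
          rw [add_smul, one_smul]
        · exact ⟨s, by rw [if_neg hj, zero_mul, mul_zero, add_zero, mul_smul_comm]⟩
    obtain ⟨s, hs⟩ := hw
    refine eq_zero_of_weight a (2 + s) (by omega) ?_
    rw [fg_mul_fib_mulF, e, hs, fib_mulF_smul, smul_mul_assoc, map_smul, ← add_smul]
    push_cast
    rfl
  have hder : ∀ a b, coord b * fnPd a (coord a * coord a : Fn n) = (2 : ℝ) • (coord a * coord b) := by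
    intro a b
    rw [fnPd_mul, fnPd_coord, if_pos rfl, mul_one, one_mul, two_smul]
    ring
  have hr2 : ∀ Q : Module.End 𝕜 (Form 𝕜 n), (2 : ℝ) • Q = (2 : 𝕜) • Q := by
    intro Q; rw [two_smul, two_smul]
  -- Bracketing the field just treated with `x_b ∂ₐ` polarizes the vanishing and relates all the
  -- remaining quadratic fields.
  have hpol : ∀ a b m, a ≠ m → c (fld (coord b * fnPd a (coord a * coord a)) m) =
      if m = b then c (fld (coord a * coord a) a) else 0 := by
    intro a b m ham
    have e := hg b a (fld (coord a * coord a) m)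
    rw [hsq a m ham, map_zero, bracket_coord_fld, map_sub] at e
    rw [sub_eq_zero.1 e.symm]
    split_ifs <;> simp
  have hab : ∀ a b, a ≠ b → c (fld (coord a * coord a) a) =
      (2 : 𝕜) • c (fld (coord a * coord b) b) := by
    intro a b hab
    have e := hpol a b b hab
    rw [hder, if_pos rfl, fld_smul, map_smul] at e
    rw [← e, hr2]
  refine ⟨fun a b m ham hbm => ?_, hab, ?_⟩
  · by_cases h : b = a
    · subst h; exact hsq _ _ hbm
    have e := hpol a b m ham
    rw [hder, if_neg (Ne.symm hbm), fld_smul, map_smul] at e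
    exact (smul_eq_zero.1 e).resolve_left two_ne_zero
  -- By these relations the value on `xₘ² ∂ₘ` transforms under `gl` like `dxₘ`.
  · refine exists_eq_of_vector (r := r) (fun m => hq m m m) fun i j m => ?_
    rw [hg, bracket_coord_fld, map_sub]
    by_cases hmj : m = j
    · subst hmj
      rw [hder, if_pos rfl, fld_smul, map_smul, hr2]
      by_cases hmi : m = i
      · subst hmi
        rw [if_pos rfl, two_smul, add_sub_cancel_right]
      · rw [if_neg hmi, map_zero, sub_zero, hab i m (Ne.symm hmi), mul_comm]
    · rw [if_neg hmj, fnPd_mul, fnPd_coord, if_neg hmj]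
      simp only [mul_zero, zero_mul, add_zero, fld_zero, map_zero, zero_sub, neg_eq_zero]
      split_ifs
      · exact hsq _ _ hmj
      · exact map_zero _

theorem sum_coord_mul_fnPd (w : List (Fin n)) :
    ∑ j, coord j * fnPd j (mon w) = (w.length : ℝ) • mon w := by
  induction w with
  | nil => simp [fnPd_one]
  | cons i w ih =>
    have e : ∀ j, coord j * fnPd j (mon (i :: w)) =
        coord i * (coord j * fnPd j (mon w)) + if i = j then coord j * mon w else 0 := by
      intro j
      rw [mon_cons, fnPd_mul, fnPd_coord]
      split_ifs <;> ring
    rw [Finset.sum_congr rfl fun j _ => e j]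
    simp only [Finset.sum_add_distrib, ← Finset.mul_sum, ih, Finset.sum_ite_eq, Finset.mem_univ,
      if_true, mon_cons, mul_smul_comm, List.length_cons]
    push_cast
    rw [add_smul, one_smul]

/-- A cocycle vanishing on fields of degree at most two vanishes. -/
theorem IsCocycle.eq_zero (hn : 2 ≤ n) {c : Vect n →ₗ[ℝ] Module.End 𝕜 (Form 𝕜 n)}
    (hc : IsCocycle c) (hm : c ∈ Cochain 𝕜 n)
    (h : ∀ w : List (Fin n), w.length ≤ 2 → ∀ i, c (fld (mon w) i) = 0) : c = 0 := by
  refine cochain_eq_zero_of_mon hm ?_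
  suffices H : ∀ (D : ℕ) (w : List (Fin n)), w.length = D → ∀ i, c (fld (mon w) i) = 0 from
    fun w i => H _ w rfl i
  intro D
  induction D using Nat.strong_induction_on with
  | _ D ih =>
  intro w hw m
  by_cases hD : D ≤ 2
  · exact h w (by omega) m
  have hbr : ∀ X Y, c X = 0 → c Y = 0 → c (bracket X Y) = 0 := by
    intro X Y hX hY
    rw [hc X Y, hX, hY]; simp
  have key : ∀ (v : List (Fin n)) (i m : Fin n), v.length + 1 = D → i ≠ m →
      c (fld (coord i * mon v) m) = 0 := by
    intro v i m hv him
    -- The sum of the first fields is `xᵢ` times the Euler field. As `i ≠ m`, its bracket with `v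
    -- ∂ₘ` is `xᵢ v ∂ₘ` times the length of `v` minus one, a nonzero number here.
    have e1 : ∑ j, c (bracket (fld (coord i * coord j) j) (fld (mon v) m)) = 0 := by
      refine Finset.sum_eq_zero fun j _ => hbr _ _ ?_ (ih _ (by omega) v rfl m)
      have := ih 2 (by omega) [i, j] rfl j
      simpa using this
    have e2 : ∀ j, c (bracket (fld (coord i * coord j) j) (fld (mon v) m)) =
        c (fld (coord i * (coord j * fnPd j (mon v))) m) -
          if j = m then c (fld (coord i * mon v) m) else 0 := by
      intro j
      rw [bracket_fld, map_sub, fnPd_mul, fnPd_coord, fnPd_coord, if_neg him, zero_mul, add_zero,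
        mul_assoc]
      by_cases hj : j = m
      · rw [if_pos hj, if_pos hj, mul_one, mul_comm (mon v), hj]
      · rw [if_neg hj, if_neg hj, mul_zero, mul_zero, fld_zero, map_zero]
    simp only [e2, Finset.sum_sub_distrib, Finset.sum_ite_eq', Finset.mem_univ, if_true] at e1
    rw [← map_sum, ← fld_sum, ← Finset.mul_sum, sum_coord_mul_fnPd, mul_smul_comm, fld_smul,
      map_smul] at e1
    have e3 : ((v.length : ℝ) - 1) • c (fld (coord i * mon v) m) = 0 := by
      rw [sub_smul, one_smul]; exact e1
    refine (smul_eq_zero.1 e3).resolve_left (sub_ne_zero.2 ?_)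
    exact_mod_cast (by omega : v.length ≠ 1)
  by_cases hex : ∃ i ∈ w, i ≠ m
  · obtain ⟨i, hi, him⟩ := hex
    have e : mon w = coord i * mon (w.erase i) := by
      rw [← mon_cons]
      exact ((List.perm_cons_erase hi).map coord).prod_eq
    rw [e]
    refine key _ i m ?_ him
    rw [List.length_erase_of_mem hi]
    omega
  · push Not at hex
    have e : mon w = coord m ^ D := by
      rw [List.eq_replicate_of_mem hex, hw]
      simp [mon]
    obtain ⟨i, him⟩ : ∃ i : Fin n, i ≠ m := by
      have : Nontrivial (Fin n) := Fin.nontrivial_iff_two_le.2 hn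
      exact exists_ne m
    obtain ⟨s, rfl⟩ : ∃ s, D = s + 3 := ⟨D - 3, by omega⟩
    -- Only a pure power times `∂ₘ` is left. Up to a field of the kind treated in `key`, it is the
    -- bracket of these two fields; this needs a second index.
    have h1 := hbr (fld (coord m ^ (s + 2)) i) (fld (coord m * coord i) m)
      (by
        have := ih (s + 2) (by omega) (List.replicate (s + 2) m) (by simp) i
        simpa [mon] using this)
      (by
        have := ih 2 (by omega) [m, i] rfl m
        simpa using this)
    rw [bracket_fld, map_sub, fnPd_mul, fnPd_coord, fnPd_coord, if_pos rfl, if_neg (Ne.symm him),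
      zero_mul, add_zero, mul_one, fnPd_pow] at h1
    have h2 := key (i :: List.replicate (s + 1) m) m i (by simp) (Ne.symm him)
    have e1 : coord m * coord i * ((((s + 1 : ℕ) : ℝ) + 1) • coord m ^ (s + 1)) =
        (((s + 1 : ℕ) : ℝ) + 1) • (coord m * mon (i :: List.replicate (s + 1) m) : Fn n) := by
      rw [mul_smul_comm]
      simp [mon, mul_assoc]
    rw [e1, fld_smul, map_smul, h2, smul_zero, sub_zero, ← pow_succ] at h1
    rw [e]
    exact h1

/-! ### The first cohomology -/

/-- The parameters as a disjoint union. -/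
def paramEquiv (n : ℕ) : ((Fin (n + 1) ⊕ Fin n) ⊕ Fin n) ⊕ Fin (n - 1) ≃ Param n where
  toFun := Sum.elim (Sum.elim (Sum.elim .t0 .t1) .t1t) .t2
  invFun := fun p => match p with
    | .t0 k => .inl (.inl (.inl k))
    | .t1 k => .inl (.inl (.inr k))
    | .t1t k => .inl (.inr k)
    | .t2 k => .inr k
  left_inv := by rintro (((k | k) | k) | k) <;> rfl
  right_inv := by rintro (k | k | k | k) <;> rfl

instance : Fintype (Param n) := Fintype.ofEquiv _ (paramEquiv n)

theorem sum_param {M : Type*} [AddCommMonoid M] (f : Param n → M) :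
    ∑ p, f p = ∑ k, f (.t0 k) + ∑ k, f (.t1 k) + ∑ k, f (.t1t k) + ∑ k, f (.t2 k) := by
  rw [← Equiv.sum_comp (paramEquiv n) f]
  simp only [Fintype.sum_sum_type]
  rfl

/-- `X ↦ Div X` on the forms of degree `k`. -/
def K0 (k : ℕ) : Vect n →ₗ[ℝ] Module.End 𝕜 (Form 𝕜 n) := rmulC (degProj k) (divC 𝕜 n)

/-- `X ↦ d ∘ Div X` on the forms of degree `k`. -/
def K1 (k : ℕ) : Vect n →ₗ[ℝ] Module.End 𝕜 (Form 𝕜 n) := lmulC d (K0 k)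

/-- `X ↦ Div X ∘ d` on the forms of degree `k`. -/
def K1t (k : ℕ) : Vect n →ₗ[ℝ] Module.End 𝕜 (Form 𝕜 n) := rmulC (d * degProj k) (divC 𝕜 n)

/-- `X ↦ d ∘ Div X ∘ d` on the forms of degree `k`. -/
def K2 (k : ℕ) : Vect n →ₗ[ℝ] Module.End 𝕜 (Form 𝕜 n) := lmulC d (K1t k)

/-- The cocycle attached to a parameter. -/
def coc : Param n → (Vect n →ₗ[ℝ] Module.End 𝕜 (Form 𝕜 n))
  | .t0 k => K0 k
  | .t1 k => K1 k
  | .t1t k => K1t k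
  | .t2 k => K2 k

theorem K0_apply (k : ℕ) (X : Vect n) :
    (K0 k X : Module.End 𝕜 (Form 𝕜 n)) = mulF (divFn X) * degProj k := rfl

theorem K1_apply (k : ℕ) (X : Vect n) :
    (K1 k X : Module.End 𝕜 (Form 𝕜 n)) = d * (mulF (divFn X) * degProj k) := rfl

theorem K1t_apply (k : ℕ) (X : Vect n) :
    (K1t k X : Module.End 𝕜 (Form 𝕜 n)) = mulF (divFn X) * (d * degProj k) := rfl

theorem K2_apply (k : ℕ) (X : Vect n) :
    (K2 k X : Module.End 𝕜 (Form 𝕜 n)) = d * (mulF (divFn X) * (d * degProj k)) := rfl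

theorem firstOrder_eq {σ : Type} (t : Param n → MvPowerSeries σ 𝕜) (X : Vect n) :
    firstOrder t X = MvPowerSeries.C (lieDerivative X)
      + ∑ p, scalars (t p) * MvPowerSeries.C (coc p X) := by
  rw [firstOrder, sum_param, Finset.sum_add_distrib]
  have h0 : ∀ k : Fin (n + 1), (C0 k X : Module.End 𝕜 (Form 𝕜 n)) = coc (.t0 k) X := fun k => by
    rw [C0, restr_eq, divMul_eq]; rfl
  have h1 : ∀ k : Fin n, (C1 k X : Module.End 𝕜 (Form 𝕜 n)) = coc (.t1 k) X := fun k => by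
    rw [C1, restr_eq, divMul_eq, mul_assoc]; rfl
  have h1t : ∀ k : Fin n, (C1t k X : Module.End 𝕜 (Form 𝕜 n)) = coc (.t1t k) X := fun k => by
    rw [C1t, restr_eq, divMul_eq, mul_assoc]; rfl
  have h2 : ∀ k : Fin (n - 1), (C2 k X : Module.End 𝕜 (Form 𝕜 n)) = coc (.t2 k) X := fun k => by
    rw [C2, restr_eq, divMul_eq, mul_assoc, mul_assoc]; rfl
  simp only [h0, h1, h1t, h2]
  abel

theorem isCocycle_divC : IsCocycle (divC 𝕜 n) := by
  intro X Y
  refine LinearMap.ext fun η => ?_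
  change mulF (divFn (bracket X Y)) η =
    (lieDerivative X (mulF (divFn Y) η) - mulF (divFn Y) (lieDerivative X η)) -
      (lieDerivative Y (mulF (divFn X) η) - mulF (divFn X) (lieDerivative Y η))
  rw [divFn_bracket, lieDerivative_mulF, lieDerivative_mulF, map_sub, LinearMap.sub_apply]
  abel

theorem IsCocycle.lmulC {c : Vect n →ₗ[ℝ] Module.End 𝕜 (Form 𝕜 n)} (hc : IsCocycle c)
    {P : Module.End 𝕜 (Form 𝕜 n)} (hP : ∀ X, lieDerivative X * P = P * lieDerivative X) :
    IsCocycle (lmulC P c) := by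
  intro X Y
  simp only [lmulC_apply]
  rw [hc X Y, ← mul_assoc, ← mul_assoc, hP, hP]
  noncomm_ring

theorem IsCocycle.rmulC {c : Vect n →ₗ[ℝ] Module.End 𝕜 (Form 𝕜 n)} (hc : IsCocycle c)
    {P : Module.End 𝕜 (Form 𝕜 n)} (hP : ∀ X, lieDerivative X * P = P * lieDerivative X) :
    IsCocycle (rmulC P c) := by
  intro X Y
  simp only [rmulC_apply]
  rw [hc X Y, mul_assoc (c X), mul_assoc (c Y), ← hP, ← hP]
  noncomm_ring

theorem lieDerivative_mul_d (X : Vect n) :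
    lieDerivative X * (d : Module.End 𝕜 (Form 𝕜 n)) = d * lieDerivative X :=
  LinearMap.ext fun η => lieDerivative_d X η

theorem lieDerivative_mul_degProj (X : Vect n) (k : ℕ) :
    lieDerivative X * (degProj k : Module.End 𝕜 (Form 𝕜 n)) = degProj k * lieDerivative X :=
  LinearMap.ext fun η => lieDerivative_degProj X k η

theorem lieDerivative_mul_d_degProj (X : Vect n) (k : ℕ) :
    lieDerivative X * (d * degProj k : Module.End 𝕜 (Form 𝕜 n)) =
      d * degProj k * lieDerivative X := by
  rw [← mul_assoc, lieDerivative_mul_d, mul_assoc, lieDerivative_mul_degProj, mul_assoc]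

theorem isCocycle_K0 (k : ℕ) : IsCocycle (K0 k : Vect n →ₗ[ℝ] Module.End 𝕜 (Form 𝕜 n)) :=
  isCocycle_divC.rmulC fun X => lieDerivative_mul_degProj X k

theorem isCocycle_K1 (k : ℕ) : IsCocycle (K1 k : Vect n →ₗ[ℝ] Module.End 𝕜 (Form 𝕜 n)) :=
  (isCocycle_K0 k).lmulC lieDerivative_mul_d

theorem isCocycle_K1t (k : ℕ) : IsCocycle (K1t k : Vect n →ₗ[ℝ] Module.End 𝕜 (Form 𝕜 n)) :=
  isCocycle_divC.rmulC fun X => lieDerivative_mul_d_degProj X k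

theorem isCocycle_K2 (k : ℕ) : IsCocycle (K2 k : Vect n →ₗ[ℝ] Module.End 𝕜 (Form 𝕜 n)) :=
  (isCocycle_K1t k).lmulC lieDerivative_mul_d

theorem isCocycle_coc (p : Param n) :
    IsCocycle (coc p : Vect n →ₗ[ℝ] Module.End 𝕜 (Form 𝕜 n)) := by
  cases p
  exacts [isCocycle_K0 _, isCocycle_K1 _, isCocycle_K1t _, isCocycle_K2 _]

theorem K0_mem (k : ℕ) : (K0 k : Vect n →ₗ[ℝ] Module.End 𝕜 (Form 𝕜 n)) ∈ Cochain 𝕜 n :=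
  rmulC_mem (degProj_mem _) divC_mem

theorem K1_mem (k : ℕ) : (K1 k : Vect n →ₗ[ℝ] Module.End 𝕜 (Form 𝕜 n)) ∈ Cochain 𝕜 n :=
  lmulC_mem d_mem (K0_mem k)

theorem K1t_mem (k : ℕ) : (K1t k : Vect n →ₗ[ℝ] Module.End 𝕜 (Form 𝕜 n)) ∈ Cochain 𝕜 n :=
  rmulC_mem (mul_mem d_mem (degProj_mem _)) divC_mem

theorem K2_mem (k : ℕ) : (K2 k : Vect n →ₗ[ℝ] Module.End 𝕜 (Form 𝕜 n)) ∈ Cochain 𝕜 n :=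
  lmulC_mem d_mem (K1t_mem k)

theorem coc_mem (p : Param n) :
    (coc p : Vect n →ₗ[ℝ] Module.End 𝕜 (Form 𝕜 n)) ∈ Cochain 𝕜 n := by
  cases p
  exacts [K0_mem _, K1_mem _, K1t_mem _, K2_mem _]

theorem divFn_fld (f : Fn n) (j : Fin n) : divFn (fld f j) = fnPd j f := by
  rw [divFn, Finset.sum_eq_single j]
  · rw [comp_fld, if_pos rfl]
  · intro i _ h; rw [comp_fld, if_neg h, map_zero]
  · simp

theorem d_mul_d : (d * d : Module.End 𝕜 (Form 𝕜 n)) = 0 :=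
  LinearMap.ext fun η => d_d η

theorem d_mul_mulF (f : Fn n) :
    (d * mulF f : Module.End 𝕜 (Form 𝕜 n)) = mulF f * d + dmul f :=
  LinearMap.ext fun η => d_mulF f η

theorem degProj_succ_mul_d (k : ℕ) :
    (degProj (k + 1) * d : Module.End 𝕜 (Form 𝕜 n)) = d * degProj k :=
  LinearMap.ext fun η => degProj_d k η

theorem degProj_mul_mulF' (k : ℕ) (f : Fn n) :
    (degProj k * mulF f : Module.End 𝕜 (Form 𝕜 n)) = mulF f * degProj k :=
  LinearMap.ext fun η => degProj_mulF_apply k f η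

theorem d_mul_degProj_top : (d * degProj n : Module.End 𝕜 (Form 𝕜 n)) = 0 := by
  rw [← degProj_succ_mul_d, degProj_of_lt (Nat.lt_succ_self n), zero_mul]

/-- Vanishing for reasons of degree, here and in the next lemmas, accounts for the ranges of the
parameters. -/
theorem K1_top : (K1 n : Vect n →ₗ[ℝ] Module.End 𝕜 (Form 𝕜 n)) = 0 := by
  refine LinearMap.ext fun X => ?_
  rw [K1_apply, ← degProj_mul_mulF', ← mul_assoc, d_mul_degProj_top, zero_mul]; rfl

theorem K1t_top : (K1t n : Vect n →ₗ[ℝ] Module.End 𝕜 (Form 𝕜 n)) = 0 := by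
  refine LinearMap.ext fun X => ?_
  rw [K1t_apply, d_mul_degProj_top, mul_zero]; rfl

theorem K2_top : (K2 n : Vect n →ₗ[ℝ] Module.End 𝕜 (Form 𝕜 n)) = 0 := by
  rw [K2, K1t_top]
  refine LinearMap.ext fun X => ?_
  rw [lmulC_apply]; simp

theorem K2_pred {k : ℕ} (h : k + 1 = n) :
    (K2 k : Vect n →ₗ[ℝ] Module.End 𝕜 (Form 𝕜 n)) = 0 := by
  refine LinearMap.ext fun X => ?_
  rw [K2_apply, ← degProj_succ_mul_d, ← mul_assoc (mulF _), ← degProj_mul_mulF', h, mul_assoc,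
    ← mul_assoc, d_mul_degProj_top, zero_mul]; rfl

theorem sum_smul_K1 (b : ℕ → 𝕜) : (∑ k : Fin (n + 1), b k • K1 k :
    Vect n →ₗ[ℝ] Module.End 𝕜 (Form 𝕜 n)) = ∑ k : Fin n, b k • K1 k := by
  rw [Fin.sum_univ_castSucc, Fin.val_last, K1_top, smul_zero, add_zero]
  rfl

theorem sum_smul_K1t (b : ℕ → 𝕜) : (∑ k : Fin (n + 1), b k • K1t k :
    Vect n →ₗ[ℝ] Module.End 𝕜 (Form 𝕜 n)) = ∑ k : Fin n, b k • K1t k := by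
  rw [Fin.sum_univ_castSucc, Fin.val_last, K1t_top, smul_zero, add_zero]
  rfl

theorem sum_smul_K2 (hn : 1 ≤ n) (b : ℕ → 𝕜) : (∑ k : Fin (n + 1), b k • K2 k :
    Vect n →ₗ[ℝ] Module.End 𝕜 (Form 𝕜 n)) = ∑ k : Fin (n - 1), b k • K2 k := by
  obtain ⟨m, rfl⟩ : ∃ m, n = m + 1 := ⟨n - 1, by omega⟩
  rw [Fin.sum_univ_castSucc, Fin.val_last, K2_top, smul_zero, add_zero, Fin.sum_univ_castSucc]
  simp only [Fin.val_castSucc, Fin.val_last]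
  rw [K2_pred rfl, smul_zero, add_zero]
  rfl

theorem sum_smul_apply (a : ℕ → 𝕜) (K : ℕ → Vect n →ₗ[ℝ] Module.End 𝕜 (Form 𝕜 n)) (X : Vect n) :
    (∑ k : Fin (n + 1), a k • K k) X = ∑ k : Fin (n + 1), a k • K k X := by
  rw [LinearMap.sum_apply]; rfl

theorem isCocycle_sum_smul (a : ℕ → 𝕜) {K : ℕ → Vect n →ₗ[ℝ] Module.End 𝕜 (Form 𝕜 n)}
    (h : ∀ k, IsCocycle (K k)) : IsCocycle (∑ k : Fin (n + 1), a k • K k) :=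
  IsCocycle.sum _ fun k => IsCocycle.smul (h k) _

theorem sum_smul_mem (a : ℕ → 𝕜) {K : ℕ → Vect n →ₗ[ℝ] Module.End 𝕜 (Form 𝕜 n)}
    (h : ∀ k, K k ∈ Cochain 𝕜 n) : ∑ k : Fin (n + 1), a k • K k ∈ Cochain 𝕜 n :=
  Submodule.sum_mem _ fun k _ => Submodule.smul_mem _ _ (h k)

theorem divFn_fld_one (j : Fin n) : divFn (fld 1 j) = 0 := by rw [divFn_fld, fnPd_one]

theorem divFn_fld_coord (i j : Fin n) : divFn (fld (coord i) j) = if i = j then 1 else 0 := by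
  rw [divFn_fld, fnPd_coord]

theorem dmul_one : (dmul (1 : Fn n) : Module.End 𝕜 (Form 𝕜 n)) = 0 := by simp [dmul, fnPd_one]

theorem dmul_zero : (dmul (0 : Fn n) : Module.End 𝕜 (Form 𝕜 n)) = 0 := by simp [dmul]

theorem dmul_divFn_sq (m : Fin n) :
    (dmul (divFn (fld (coord m * coord m) m)) : Module.End 𝕜 (Form 𝕜 n)) = (2 : 𝕜) • wedge m := by
  refine LinearMap.ext fun η => ?_
  rw [divFn_fld, fnPd_mul, fnPd_coord, if_pos rfl, mul_one, one_mul, dmul_apply]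
  simp only [map_add, LinearMap.add_apply, Finset.sum_add_distrib]
  rw [← dmul_apply, dmul_coord, LinearMap.smul_apply, two_smul]

/-- `X ↦ d(Div X) ∧` on the forms of degree `k`. -/
theorem K1_sub_K1t_apply (k : ℕ) (X : Vect n) :
    (K1 k - K1t k : Vect n →ₗ[ℝ] Module.End 𝕜 (Form 𝕜 n)) X = dmul (divFn X) * degProj k := by
  rw [LinearMap.sub_apply, K1_apply, K1t_apply, ← mul_assoc, d_mul_mulF, add_mul, mul_assoc,
    add_sub_cancel_left]

/-- Because `d² = 0`, only the differential of the divergence enters. So these cocycles, like the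
differences of `K1` and `K1t`, vanish on affine fields. -/
theorem K2_apply' (k : ℕ) (X : Vect n) :
    (K2 k X : Module.End 𝕜 (Form 𝕜 n)) = dmul (divFn X) * d * degProj k := by
  rw [K2_apply, ← mul_assoc, d_mul_mulF, add_mul, mul_assoc, ← mul_assoc d, d_mul_d, zero_mul,
    mul_zero, zero_add, mul_assoc]

/-- Cocycles vanishing on the affine fields. -/
theorem IsCocycle.eq_of_affine (hn : 2 ≤ n) {c : Vect n →ₗ[ℝ] Module.End 𝕜 (Form 𝕜 n)}
    (hc : IsCocycle c) (hm : c ∈ Cochain 𝕜 n) (h1 : ∀ i, c (fld 1 i) = 0)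
    (h2 : ∀ i j, c (fld (coord i) j) = 0) :
    ∃ x y : ℕ → 𝕜, c = ∑ k : Fin (n + 1), x k • (K1 k - K1t k) +
      ∑ k : Fin (n + 1), y k • K2 k := by
  obtain ⟨-, -, x, y, hxy⟩ := hc.quadratic hm h1 h2
  -- The halves compensate the divergence `2 xₘ` of `xₘ² ∂ₘ`.
  refine ⟨fun k => x k / 2, fun k => y k / 2, ?_⟩
  set s := ∑ k : Fin (n + 1), (x k / 2) • (K1 k - K1t k : Vect n →ₗ[ℝ] Module.End 𝕜 (Form 𝕜 n))
  set s' := ∑ k : Fin (n + 1), (y k / 2) • (K2 k : Vect n →ₗ[ℝ] Module.End 𝕜 (Form 𝕜 n))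
  have hs : ∀ X, s X = ∑ k : Fin (n + 1), (x k / 2) • (dmul (divFn X) * degProj k) := fun X =>
    (sum_smul_apply (fun k => x k / 2) (fun k => K1 k - K1t k) X).trans
      (Finset.sum_congr rfl fun k _ => by rw [K1_sub_K1t_apply])
  have hs' : ∀ X, s' X = ∑ k : Fin (n + 1), (y k / 2) • (dmul (divFn X) * d * degProj k) :=
    fun X => (sum_smul_apply (fun k => y k / 2) K2 X).trans
      (Finset.sum_congr rfl fun k _ => by rw [K2_apply'])
  have hsc : IsCocycle s := isCocycle_sum_smul (fun k => x k / 2) (K := fun k => K1 k - K1t k)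
    fun k => (isCocycle_K1 k).sub (isCocycle_K1t k)
  have hsc' : IsCocycle s' := isCocycle_sum_smul (fun k => y k / 2) (K := K2) isCocycle_K2
  have hsm : s ∈ Cochain 𝕜 n := sum_smul_mem (fun k => x k / 2) (K := fun k => K1 k - K1t k)
    fun k => Submodule.sub_mem _ (K1_mem k) (K1t_mem k)
  have hsm' : s' ∈ Cochain 𝕜 n := sum_smul_mem (fun k => y k / 2) (K := K2) K2_mem
  clear_value s s'
  have hc' : IsCocycle (c - (s + s')) := hc.sub (hsc.add hsc')
  have hm' : c - (s + s') ∈ Cochain 𝕜 n := Submodule.sub_mem _ hm (Submodule.add_mem _ hsm hsm')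
  have e : ∀ X, (c - (s + s')) X = c X - (s X + s' X) := fun X => rfl
  generalize hC : c - (s + s') = C at hc' hm' e
  have h41 : ∀ i, C (fld 1 i) = 0 := by
    intro i
    rw [e, h1, hs, hs', divFn_fld_one, dmul_zero]; simp
  have h42 : ∀ i j, C (fld (coord i) j) = 0 := by
    intro i j
    rw [e, h2, hs, hs', divFn_fld_coord]
    split_ifs <;> simp [dmul_one, dmul_zero]
  obtain ⟨r1, r2, -⟩ := hc'.quadratic hm' h41 h42
  have h43 : ∀ m, C (fld (coord m * coord m) m) = 0 := by
    intro m
    rw [e, hxy, hs, hs', dmul_divFn_sq, sub_eq_zero, ← Finset.sum_add_distrib]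
    refine Finset.sum_congr rfl fun k _ => ?_
    rw [smul_mul_assoc, smul_mul_assoc, smul_mul_assoc, smul_smul, smul_smul,
      div_mul_cancel₀ _ two_ne_zero, div_mul_cancel₀ _ two_ne_zero]
  have h44 : ∀ i m, C (fld (coord i * coord m) m) = 0 := by
    intro i m
    by_cases h : i = m
    · rw [h, h43]
    · have e := r2 i m h
      rw [h43] at e
      exact (smul_eq_zero.1 e.symm).resolve_left two_ne_zero
  have h0 : C = 0 := by
    refine hc'.eq_zero hn hm' fun w hw m => ?_
    match w, hw with
    | [], _ => exact h41 m
    | [i], _ => simpa using h42 i m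
    | [i, j], _ =>
      rw [mon_cons, mon_cons, mon_nil, mul_one]
      by_cases hj : j = m
      · rw [hj, h44]
      by_cases hi : i = m
      · rw [hi, mul_comm, h44]
      exact r1 i j m hi hj
  exact sub_eq_zero.1 (hC.trans h0)

/-- The first cohomology of `Vect(ℝⁿ)` with values in the differential operators on forms. -/
theorem IsCocycle.exists_cobd (hn : 2 ≤ n) {c : Vect n →ₗ[ℝ] Module.End 𝕜 (Form 𝕜 n)}
    (hc : IsCocycle c) (hm : c ∈ Cochain 𝕜 n) :
    ∃ u ∈ DiffOp 𝕜 n, ∃ t : Param n → 𝕜, c = cobd u + ∑ p, t p • coc p := by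
  obtain ⟨u₁, hu₁, h₁⟩ := hc.exists_const hm
  have hc₁ := hc.sub (isCocycle_cobd u₁)
  have hm₁ := Submodule.sub_mem _ hm (cobd_mem hu₁)
  obtain ⟨u₂, hu₂, h₂, a, b, hab⟩ := hc₁.exists_linear hm₁ h₁
  have hc₂ := hc₁.sub (isCocycle_cobd u₂)
  have hm₂ := Submodule.sub_mem _ hm₁ (cobd_mem hu₂)
  -- On linear fields the divergence is the trace, so `K0` and `K1` take there the two kinds of
  -- invariant values.
  have hc₃ := hc₂.sub ((isCocycle_sum_smul a isCocycle_K0).add (isCocycle_sum_smul b isCocycle_K1))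
  have hm₃ := Submodule.sub_mem _ hm₂
    (Submodule.add_mem _ (sum_smul_mem a K0_mem) (sum_smul_mem b K1_mem))
  have e : ∀ X, (c - cobd u₁ - cobd u₂ - (∑ k : Fin (n + 1), a k • K0 k +
      ∑ k : Fin (n + 1), b k • K1 k) : Vect n →ₗ[ℝ] Module.End 𝕜 (Form 𝕜 n)) X = (c - cobd u₁ - cobd u₂) X -
      (∑ k : Fin (n + 1), a k • K0 k X + ∑ k : Fin (n + 1), b k • K1 k X) := fun X => by
    rw [LinearMap.sub_apply, LinearMap.add_apply, sum_smul_apply a, sum_smul_apply b]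
  obtain ⟨x, y, hxy⟩ := hc₃.eq_of_affine hn hm₃
    (fun i => by
      rw [e, h₂]
      simp [K0_apply, K1_apply, divFn_fld_one])
    (fun i j => by
      rw [e, hab]
      simp only [K0_apply, K1_apply, divFn_fld_coord]
      split_ifs
      · simp only [map_one, one_mul, Finset.sum_add_distrib]
        abel
      · simp)
  -- The coefficient `x` belongs to the difference of `K1` and `K1t`, hence enters both parameters
  -- with opposite signs.
  refine ⟨u₁ + u₂, add_mem hu₁ hu₂, fun p => match p with
    | .t0 k => a k
    | .t1 k => b k + x k
    | .t1t k => - x k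
    | .t2 k => y k, ?_⟩
  have hadd : (cobd (u₁ + u₂) : Vect n →ₗ[ℝ] Module.End 𝕜 (Form 𝕜 n)) = cobd u₁ + cobd u₂ := by
    refine LinearMap.ext fun X => ?_
    rw [LinearMap.add_apply, cobd_apply, cobd_apply, cobd_apply]
    noncomm_ring
  simp only [smul_sub, Finset.sum_sub_distrib] at hxy
  rw [sum_smul_K1, sum_smul_K1, sum_smul_K1t, sum_smul_K2 (by omega)] at hxy
  rw [sum_param, hadd]
  have hneg : ∑ k : Fin n, (-x k) • (K1t k : Vect n →ₗ[ℝ] Module.End 𝕜 (Form 𝕜 n)) =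
      -∑ k : Fin n, x k • K1t k := by
    rw [← Finset.sum_neg_distrib]
    refine Finset.sum_congr rfl fun k _ => LinearMap.ext fun X => ?_
    exact neg_smul (x k) (K1t k X : Module.End 𝕜 (Form 𝕜 n))
  simp only [coc, add_smul, Finset.sum_add_distrib]
  rw [hneg]
  rw [sub_eq_iff_eq_add, sub_eq_iff_eq_add, sub_eq_iff_eq_add] at hxy
  rw [hxy]
  abel

/-! ### Functionals detecting the relations and the parameters -/

instance : DecidableEq (Param n) := Classical.decEq _

instance : DecidableEq (Rel n) := Classical.decEq _

/-- The constant form `dx_{v₁} ∧ ⋯ ∧ dx_{v_k}`. -/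
def vs (𝕜 : Type) [RCLike 𝕜] {n : ℕ} (v : List (Fin n)) : Form 𝕜 n := wedges v (vac 𝕜 n)

theorem vs_cons (a : Fin n) (v : List (Fin n)) : vs 𝕜 (a :: v) = wedge a (vs 𝕜 v) := by
  rw [vs, wedges_cons]; rfl

/-- The coefficients at the origin. -/
def phi (s : List (Fin n)) : Form 𝕜 n →ₗ[𝕜] 𝕜 := ev 𝕜 n ∘ₗ interiors s

theorem phi_apply (s : List (Fin n)) (η : Form 𝕜 n) : phi s η = ev 𝕜 n (interiors s η) := rfl

theorem phi_append_singleton (s : List (Fin n)) (a : Fin n) (η : Form 𝕜 n) :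
    phi (s ++ [a]) η = phi s (interior a η) := by
  rw [phi_apply, interiors_append]
  simp [interiors, phi_apply]

theorem phi_coord (s : List (Fin n)) (i : Fin n) (η : Form 𝕜 n) :
    phi s (mulF (coord i) η) = 0 := by
  induction s using List.reverseRecOn generalizing η with
  | nil => exact ev_coord i η
  | append_singleton s a ih => rw [phi_append_singleton, interior_mulF_apply, ih]

theorem interior_vs {j : Fin n} {v : List (Fin n)} (h : j ∉ v) : interior j (vs 𝕜 v) = 0 := by
  induction v with
  | nil => exact interior_vac j
  | cons a v ih =>
    rw [List.mem_cons, not_or] at h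
    rw [vs_cons, interior_wedge_apply, if_neg (Ne.symm h.1), ih h.2, map_zero, sub_zero]

theorem phi_vs {v : List (Fin n)} (h : v.Nodup) : phi v.reverse (vs 𝕜 v) = 1 := by
  induction v with
  | nil =>
    change (vac 𝕜 n).1 0 0 0 = 1
    rfl
  | cons a v ih =>
    rw [List.nodup_cons] at h
    rw [List.reverse_cons, phi_append_singleton, vs_cons, interior_wedge_apply, if_pos rfl,
      interior_vs h.1, map_zero, sub_zero, ih h.2]

theorem ev_degProj (m : ℕ) (η : Form 𝕜 n) :
    ev 𝕜 n (degProj m η) = if m = 0 then ev 𝕜 n η else 0 := by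
  change (degProj m η).1 0 0 0 = if m = 0 then η.1 0 0 0 else 0
  rw [degProj_apply]
  rcases m with _ | m
  · simp
  · rw [if_neg (by simp), if_neg (by simp)]; rfl

theorem phi_degProj (s : List (Fin n)) (m : ℕ) (η : Form 𝕜 n) :
    phi s (degProj m η) = if m = s.length then phi s η else 0 := by
  induction s using List.reverseRecOn generalizing η m with
  | nil => exact ev_degProj m η
  | append_singleton s a ih =>
    rw [phi_append_singleton, phi_append_singleton, List.length_append, List.length_singleton]
    rcases m with _ | m
    · rw [interior_degProj_zero_apply, map_zero, if_neg (by omega)]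
    · rw [← degProj_interior_apply, ih]
      simp

theorem degProj_succ_vac (m : ℕ) : degProj (m + 1) (vac 𝕜 n) = 0 := by
  have hk := sum_wedge_interior_degProj (m + 1) (vac 𝕜 n)
  have h0 : ∀ i : Fin n, wedge i (interior i (degProj (m + 1) (vac 𝕜 n))) = 0 := fun i => by
    rw [← degProj_wedge_interior, interior_vac, map_zero, map_zero]
  rw [Finset.sum_eq_zero fun i _ => h0 i] at hk
  exact (smul_eq_zero.1 hk.symm).resolve_left (by exact_mod_cast Nat.succ_ne_zero m)

theorem degProj_vac (m : ℕ) : degProj m (vac 𝕜 n) = if m = 0 then vac 𝕜 n else 0 := by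
  rcases m with _ | m
  · have h := LinearMap.congr_fun (sum_degProj (𝕜 := 𝕜) (n := n)) (vac 𝕜 n)
    rw [LinearMap.sum_apply, Fin.sum_univ_succ, Module.End.one_apply] at h
    have h0 : ∑ i : Fin n, (degProj (i.succ : ℕ) : Module.End 𝕜 (Form 𝕜 n)) (vac 𝕜 n) = 0 :=
      Finset.sum_eq_zero fun k _ => degProj_succ_vac (k : ℕ)
    rw [h0, add_zero] at h
    exact h
  · rw [degProj_succ_vac, if_neg (by simp)]

theorem degProj_vs (m : ℕ) (v : List (Fin n)) :
    degProj m (vs 𝕜 v) = if m = v.length then vs 𝕜 v else 0 := by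
  induction v generalizing m with
  | nil => exact degProj_vac m
  | cons a v ih =>
    rw [vs_cons, List.length_cons]
    rcases m with _ | m
    · rw [degProj_zero_wedge_apply, if_neg (by omega)]
    · rw [degProj_wedge_apply, ih]
      by_cases h : m = v.length
      · rw [if_pos h, if_pos (by omega)]
      · rw [if_neg h, if_neg (by omega), map_zero]

theorem pd_vs (i : Fin n) (v : List (Fin n)) : pd i (vs 𝕜 v) = 0 := pd_wedges_vac i v

theorem d_vs (v : List (Fin n)) : d (vs 𝕜 v) = 0 := by
  rw [d_eq]
  exact Finset.sum_eq_zero fun i _ => by rw [pd_vs, map_zero]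

theorem d_coord_vs (a : Fin n) (v : List (Fin n)) :
    d (mulF (coord a) (vs 𝕜 v)) = vs 𝕜 (a :: v) := by
  rw [d_mulF, d_vs, map_zero, zero_add, dmul_coord, vs_cons]

theorem vs_swap (a b : Fin n) (v : List (Fin n)) : vs 𝕜 (b :: a :: v) = - vs 𝕜 (a :: b :: v) := by
  rw [vs_cons, vs_cons, wedge_anticomm, vs_cons, vs_cons]

/-! ### The Euler field and the fields `xᵢ² ∂ᵢ` -/

/-- The Euler field `∑ xⱼ ∂ⱼ`. -/
def euler (n : ℕ) : Vect n := ∑ j, fld (coord j) j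

/-- The field `xᵢ² ∂ᵢ`. -/
def quad (i : Fin n) : Vect n := fld (coord i * coord i) i

theorem lieDerivative_euler (η : Form 𝕜 n) : lieDerivative (euler n) η = ∑ j, gl j j η := by
  rw [euler, lieDerivative_sum, LinearMap.sum_apply]
  simp only [lieDerivative_coord]

theorem interior_euler (i : Fin n) (η : Form 𝕜 n) : interior i (lieDerivative (euler n) η) =
    lieDerivative (euler n) (interior i η) + interior i η := by
  simp only [lieDerivative_euler, map_sum, gl_interior, Finset.sum_add_distrib]
  simp

theorem phi_euler (s : List (Fin n)) (η : Form 𝕜 n) :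
    phi s (lieDerivative (euler n) η) = (s.length : 𝕜) * phi s η := by
  induction s using List.reverseRecOn generalizing η with
  | nil =>
    rw [lieDerivative_euler, map_sum, List.length_nil, Nat.cast_zero, zero_mul]
    exact Finset.sum_eq_zero fun j _ => ev_gl j j η
  | append_singleton s a ih =>
    rw [phi_append_singleton, phi_append_singleton, interior_euler, map_add, ih]
    simp; ring

theorem euler_vs (v : List (Fin n)) :
    lieDerivative (euler n) (vs 𝕜 v) = (v.length : 𝕜) • vs 𝕜 v := by
  rw [lieDerivative_euler]
  simp only [gl_apply, pd_vs, map_zero, zero_add]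
  have h := sum_wedge_interior_degProj v.length (vs 𝕜 v)
  rwa [degProj_vs, if_pos rfl] at h

theorem euler_coord (a : Fin n) (η : Form 𝕜 n) : lieDerivative (euler n) (mulF (coord a) η) =
    mulF (coord a) (lieDerivative (euler n) η) + mulF (coord a) η := by
  simp only [lieDerivative_euler, map_sum, gl_coord, Finset.sum_add_distrib]
  simp

/-- The coefficients of the field vanish to second order at the origin, so its Lie derivative has no
value there. -/
theorem phi_quad (s : List (Fin n)) (i : Fin n) (η : Form 𝕜 n) :
    phi s (lieDerivative (quad i) η) = 0 := by
  rw [quad, lieDerivative_fld, dmul_mul, mulF_mul_apply, map_add, map_add, phi_coord, phi_coord]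
  simp

theorem quad_eq_zero {i : Fin n} {η : Form 𝕜 n} (h : pd i η = 0) (h' : interior i η = 0) :
    lieDerivative (quad i) η = 0 := by
  rw [quad, lieDerivative_fld, h, h', map_zero, map_zero, add_zero]

theorem quad_vs {i : Fin n} {v : List (Fin n)} (h : i ∉ v) : lieDerivative (quad i) (vs 𝕜 v) = 0 :=
  quad_eq_zero (pd_vs _ _) (interior_vs h)

theorem quad_coord_vs {i a : Fin n} {v : List (Fin n)} (h : i ∉ a :: v) :
    lieDerivative (quad i) (mulF (coord a) (vs 𝕜 v)) = 0 := by
  rw [List.mem_cons, not_or] at h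
  refine quad_eq_zero ?_ ?_
  · rw [pd_coord_mul, pd_vs, map_zero, zero_add, if_neg (Ne.symm h.1)]
  · rw [interior_mulF_apply, interior_vs h.2, map_zero]

theorem divFn_euler : divFn (euler n) = (n : Fn n) := by
  change divL n (euler n) = _
  rw [euler, map_sum]
  change ∑ j, divFn (fld (coord j) j) = _
  simp [divFn_fld_coord]

theorem mulF_divFn_euler (η : Form 𝕜 n) : mulF (divFn (euler n)) η = (n : 𝕜) • η := by
  rw [divFn_euler, map_natCast]
  simp [Nat.cast_smul_eq_nsmul]

theorem mulF_divFn_quad (i : Fin n) (η : Form 𝕜 n) :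
    mulF (divFn (quad i)) η = (2 : 𝕜) • mulF (coord i) η := by
  rw [quad, divFn_fld, fnPd_mul, fnPd_coord, if_pos rfl, mul_one, one_mul, mulF_add_apply, two_smul]

theorem bracket_euler_quad (i : Fin n) : bracket (euler n) (quad i) = quad i := by
  refine vect_ext fun m => ?_
  rw [comp_bracket, euler, quad]
  simp only [comp_sum, comp_fld, Finset.sum_ite_eq, Finset.mem_univ, if_true]
  by_cases h : m = i
  · subst h
    simp only [if_true, fnPd_mul, fnPd_coord]
    rw [Finset.sum_eq_single m]
    · simp only [if_true]
      ring
    · intro j _ hj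
      simp [hj, Ne.symm hj]
    · simp
  · simp only [if_neg h, map_zero, mul_zero, fnPd_coord, zero_sub]
    refine Finset.sum_eq_zero fun j _ => ?_
    split_ifs with h1 h2
    · exact absurd (h2.trans h1) h
    all_goals simp

theorem bracket_quad_quad {i j : Fin n} (h : i ≠ j) : bracket (quad i) (quad j) = 0 := by
  rw [quad, quad, bracket_fld, fnPd_mul, fnPd_mul, fnPd_coord, fnPd_coord, if_neg h,
    if_neg (Ne.symm h)]
  simp [fld_zero]

/-! ### Evaluations that annihilate coboundaries -/

/-- The coboundary of a `1`-cochain. -/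
def cobd₂ (b : Vect n → Module.End 𝕜 (Form 𝕜 n)) (X Y : Vect n) : Module.End 𝕜 (Form 𝕜 n) :=
  (lieDerivative X * b Y - b Y * lieDerivative X) -
    (lieDerivative Y * b X - b X * lieDerivative Y) - b (bracket X Y)

/-- The components of the curvature of a first-order deformation. -/
def curvRel (X Y : Vect n) : Rel n → Module.End 𝕜 (Form 𝕜 n)
  | .R1 k => (mulF (divFn X) * d * mulF (divFn Y) - mulF (divFn Y) * d * mulF (divFn X)) * degProj k
  | .R2 k => (d * mulF (divFn X) * d * mulF (divFn Y) -
      d * mulF (divFn Y) * d * mulF (divFn X)) * degProj k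
  | .R2t k => (mulF (divFn X) * d * mulF (divFn Y) * d -
      mulF (divFn Y) * d * mulF (divFn X) * d) * degProj k
  | .R3 k => (d * mulF (divFn X) * d * mulF (divFn Y) * d -
      d * mulF (divFn Y) * d * mulF (divFn X) * d) * degProj k

/-- The functional `A ↦ φ_s(A η)`. -/
def lam (s : List (Fin n)) (η : Form 𝕜 n) : Module.End 𝕜 (Form 𝕜 n) →ₗ[𝕜] 𝕜 :=
  phi s ∘ₗ LinearMap.applyₗ η

theorem lam_apply (s : List (Fin n)) (η : Form 𝕜 n) (A : Module.End 𝕜 (Form 𝕜 n)) :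
    lam s η A = phi s (A η) := rfl

/-- The quadratic field has Euler weight one. The weights of the functional, of `η` and of the field
cancel under the stated numerical condition, while both terms with `L` along the quadratic field
vanish, one at the origin and one on `η`. -/
theorem lam_cobd₂_euler_quad (b : Vect n → Module.End 𝕜 (Form 𝕜 n)) (s : List (Fin n)) (i : Fin n)
    (η : Form 𝕜 n) (w : ℕ) (hη : lieDerivative (euler n) η = (w : 𝕜) • η)
    (hw : s.length = w + 1) (hq : lieDerivative (quad i) η = 0) :
    lam s η (cobd₂ b (euler n) (quad i)) = 0 := by
  rw [lam_apply, cobd₂, bracket_euler_quad]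
  simp only [LinearMap.sub_apply, Module.End.mul_apply, map_sub, phi_euler, phi_quad, hη, hq,
    map_smul, map_zero, hw, smul_eq_mul]
  push_cast
  ring

/-- The two fields commute, their Lie derivatives kill `η`, and what they produce vanishes at the
origin. -/
theorem lam_cobd₂_quad_quad (b : Vect n → Module.End 𝕜 (Form 𝕜 n)) (hb : b 0 = 0)
    (s : List (Fin n)) {i j : Fin n}
    (hij : i ≠ j) (η : Form 𝕜 n) (hi : lieDerivative (quad i) η = 0)
    (hj : lieDerivative (quad j) η = 0) : lam s η (cobd₂ b (quad i) (quad j)) = 0 := by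
  rw [lam_apply, cobd₂, bracket_quad_quad hij, hb]
  simp only [LinearMap.sub_apply, Module.End.mul_apply, map_sub, phi_quad, hi, hj,
    map_zero, sub_zero]

theorem lam_cobd_euler (u : Module.End 𝕜 (Form 𝕜 n)) (s : List (Fin n)) (η : Form 𝕜 n)
    (hη : lieDerivative (euler n) η = (s.length : 𝕜) • η) : lam s η (cobd u (euler n)) = 0 := by
  rw [lam_apply, cobd_apply]
  simp only [LinearMap.sub_apply, Module.End.mul_apply, map_sub, phi_euler, hη, map_smul,
    smul_eq_mul, sub_self]

theorem lam_cobd_quad (u : Module.End 𝕜 (Form 𝕜 n)) (s : List (Fin n)) (i : Fin n) (η : Form 𝕜 n)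
    (hη : lieDerivative (quad i) η = 0) : lam s η (cobd u (quad i)) = 0 := by
  rw [lam_apply, cobd_apply]
  simp only [LinearMap.sub_apply, Module.End.mul_apply, map_sub, phi_quad, hη, map_zero, sub_self]

theorem exists_nodup {L : ℕ} (h : L ≤ n) : ∃ v : List (Fin n), v.Nodup ∧ v.length = L :=
  ⟨(List.finRange n).take L, (List.nodup_finRange n).sublist (List.take_sublist _ _), by simp [h]⟩

theorem exists_nodup_cons {L : ℕ} (h : L + 1 ≤ n) :
    ∃ (a : Fin n) (v : List (Fin n)), (a :: v).Nodup ∧ v.length = L := by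
  obtain ⟨v, hv, hl⟩ := exists_nodup h
  match v, hv, hl with
  | a :: v, hv, hl => exact ⟨a, v, hv, by simpa using hl⟩

theorem exists_nodup_cons₂ {L : ℕ} (h : L + 2 ≤ n) :
    ∃ (a b : Fin n) (v : List (Fin n)), (a :: b :: v).Nodup ∧ v.length = L := by
  obtain ⟨v, hv, hl⟩ := exists_nodup h
  match v, hv, hl with
  | a :: b :: v, hv, hl => exact ⟨a, b, v, hv, by simpa using hl⟩

theorem exists_nodup_cons₃ {L : ℕ} (h : L + 3 ≤ n) :
    ∃ (a b c : Fin n) (v : List (Fin n)), (a :: b :: c :: v).Nodup ∧ v.length = L := by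
  obtain ⟨v, hv, hl⟩ := exists_nodup h
  match v, hv, hl with
  | a :: b :: c :: v, hv, hl => exact ⟨a, b, c, v, hv, by simpa using hl⟩

/-- Homogeneity in the degree leaves at most one relation or parameter of each kind to compute in
the evaluations below. -/
theorem lam_mul_degProj {s : List (Fin n)} {η : Form 𝕜 n} {m e : ℕ}
    (hη : ∀ k, degProj k η = if k = m then η else 0) {B : Module.End 𝕜 (Form 𝕜 n)}
    (hB : ∀ k, degProj (k + e) * B = B * degProj k) (k : ℕ) :
    lam s η (B * degProj k) = if k = m ∧ k + e = s.length then phi s (B η) else 0 := by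
  have h : phi s (B (degProj k η)) = if k + e = s.length then phi s (B η) else 0 := by
    have := phi_degProj s (k + e) (B η)
    rwa [← Module.End.mul_apply, hB, Module.End.mul_apply] at this
  rw [lam_apply, Module.End.mul_apply]
  by_cases h1 : k = m
  · rw [h]
    simp [h1]
  · rw [hη, if_neg h1, map_zero, map_zero, if_neg fun h => h1 h.1]

theorem degProj_mul_mulF_mul {e k : ℕ} {B : Module.End 𝕜 (Form 𝕜 n)}
    (hB : degProj (k + e) * B = B * degProj k) (f : Fn n) :
    degProj (k + e) * (mulF f * B) = mulF f * B * degProj k := by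
  rw [← mul_assoc, degProj_mul_mulF', mul_assoc, hB, mul_assoc]

theorem degProj_mul_d_mul {e k : ℕ} {B : Module.End 𝕜 (Form 𝕜 n)}
    (hB : degProj (k + e) * B = B * degProj k) :
    degProj (k + (e + 1)) * (d * B) = d * B * degProj k := by
  rw [← mul_assoc, ← add_assoc, degProj_succ_mul_d, mul_assoc, hB, mul_assoc]

theorem degProj_mul_sub {e k : ℕ} {B B' : Module.End 𝕜 (Form 𝕜 n)}
    (hB : degProj (k + e) * B = B * degProj k) (hB' : degProj (k + e) * B' = B' * degProj k) :
    degProj (k + e) * (B - B') = (B - B') * degProj k := by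
  rw [mul_sub, hB, hB', sub_mul]

theorem degProj_mul_d (k : ℕ) : (degProj (k + 1) * d : Module.End 𝕜 (Form 𝕜 n)) = d * degProj k :=
  degProj_succ_mul_d k

theorem degProj_mul_mulF_zero (f : Fn n) (k : ℕ) :
    (degProj (k + 0) * mulF f : Module.End 𝕜 (Form 𝕜 n)) = mulF f * degProj k :=
  degProj_mul_mulF' k f

theorem lam_curvRel {s : List (Fin n)} {η : Form 𝕜 n} {m : ℕ}
    (hη : ∀ k, degProj k η = if k = m then η else 0) (X Y : Vect n) (r : Rel n) :
    lam s η (curvRel X Y r) = match r with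
      | .R1 k => if (k : ℕ) = m ∧ (k : ℕ) + 1 = s.length then
          phi s (mulF (divFn X) (d (mulF (divFn Y) η)) - mulF (divFn Y) (d (mulF (divFn X) η)))
          else 0
      | .R2 k => if (k : ℕ) = m ∧ (k : ℕ) + 2 = s.length then
          phi s (d (mulF (divFn X) (d (mulF (divFn Y) η))) -
            d (mulF (divFn Y) (d (mulF (divFn X) η)))) else 0
      | .R2t k => if (k : ℕ) = m ∧ (k : ℕ) + 2 = s.length then
          phi s (mulF (divFn X) (d (mulF (divFn Y) (d η))) -
            mulF (divFn Y) (d (mulF (divFn X) (d η)))) else 0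
      | .R3 k => if (k : ℕ) = m ∧ (k : ℕ) + 3 = s.length then
          phi s (d (mulF (divFn X) (d (mulF (divFn Y) (d η)))) -
            d (mulF (divFn Y) (d (mulF (divFn X) (d η))))) else 0 := by
  cases r with
  | R1 k =>
    refine lam_mul_degProj (e := 1) hη (fun k => degProj_mul_sub ?_ ?_) k <;>
    · rw [mul_assoc]
      exact degProj_mul_mulF_mul (degProj_mul_d_mul (degProj_mul_mulF_zero _ _)) _
  | R2 k =>
    refine lam_mul_degProj (e := 2) hη (fun k => degProj_mul_sub ?_ ?_) k <;>
    · rw [mul_assoc, mul_assoc]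
      exact degProj_mul_d_mul (degProj_mul_mulF_mul (degProj_mul_d_mul
        (degProj_mul_mulF_zero _ _)) _)
  | R2t k =>
    refine lam_mul_degProj (e := 2) hη (fun k => degProj_mul_sub ?_ ?_) k <;>
    · rw [mul_assoc, mul_assoc]
      exact degProj_mul_mulF_mul (degProj_mul_d_mul (degProj_mul_mulF_mul (degProj_mul_d _) _)) _
  | R3 k =>
    refine lam_mul_degProj (e := 3) hη (fun k => degProj_mul_sub ?_ ?_) k <;>
    · rw [mul_assoc, mul_assoc, mul_assoc]
      exact degProj_mul_d_mul (degProj_mul_mulF_mul (degProj_mul_d_mul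
        (degProj_mul_mulF_mul (degProj_mul_d _) _)) _)

theorem lam_coc {s : List (Fin n)} {η : Form 𝕜 n} {m : ℕ}
    (hη : ∀ k, degProj k η = if k = m then η else 0) (X : Vect n) (p : Param n) :
    lam s η (coc p X) = match p with
      | .t0 k => if (k : ℕ) = m ∧ (k : ℕ) + 0 = s.length then phi s (mulF (divFn X) η) else 0
      | .t1 k => if (k : ℕ) = m ∧ (k : ℕ) + 1 = s.length then
          phi s (d (mulF (divFn X) η)) else 0
      | .t1t k => if (k : ℕ) = m ∧ (k : ℕ) + 1 = s.length then
          phi s (mulF (divFn X) (d η)) else 0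
      | .t2 k => if (k : ℕ) = m ∧ (k : ℕ) + 2 = s.length then
          phi s (d (mulF (divFn X) (d η))) else 0 := by
  cases p with
  | t0 k => exact lam_mul_degProj (e := 0) hη (fun k => degProj_mul_mulF_zero _ _) k
  | t1 k =>
    have := lam_mul_degProj (s := s) (e := 1) hη
      (fun k => degProj_mul_d_mul (degProj_mul_mulF_zero (divFn X) k)) k
    rwa [mul_assoc] at this
  | t1t k =>
    have := lam_mul_degProj (s := s) (e := 1) hη
      (fun k => degProj_mul_mulF_mul (degProj_mul_d k) (divFn X)) k
    rwa [mul_assoc] at this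
  | t2 k =>
    have := lam_mul_degProj (s := s) (e := 2) hη
      (fun k => degProj_mul_d_mul (degProj_mul_mulF_mul (degProj_mul_d k) (divFn X))) k
    rwa [mul_assoc, mul_assoc] at this

theorem degProj_coord_vs (k : ℕ) (a : Fin n) (v : List (Fin n)) :
    degProj k (mulF (coord a) (vs 𝕜 v)) =
      if k = v.length then mulF (coord a) (vs 𝕜 v) else 0 := by
  rw [degProj_mulF_apply, degProj_vs]
  split_ifs <;> simp

theorem euler_coord_vs (a : Fin n) (v : List (Fin n)) :
    lieDerivative (euler n) (mulF (coord a) (vs 𝕜 v)) =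
      ((v.length + 1 : ℕ) : 𝕜) • mulF (coord a) (vs 𝕜 v) := by
  rw [euler_coord, euler_vs, map_smul]
  push_cast
  rw [add_smul, one_smul]

/-- Evaluations detecting each relation in the curvature and vanishing on coboundaries. -/
theorem exists_relTest (hn : 2 ≤ n) (r : Rel n) :
    ∃ (X Y : Fin 2 → Vect n) (l : Fin 2 → (Module.End 𝕜 (Form 𝕜 n) →ₗ[𝕜] 𝕜)),
      (∀ b : Vect n → Module.End 𝕜 (Form 𝕜 n), b 0 = 0 → ∑ i, l i (cobd₂ b (X i) (Y i)) = 0) ∧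
      ∀ r', ∑ i, l i (curvRel (X i) (Y i) r') = if r' = r then 1 else 0 := by
  have hn0 : (n : 𝕜) ≠ 0 := Nat.cast_ne_zero.2 (by omega)
  cases r with
  | R1 k =>
    obtain ⟨a, v, hv, hl⟩ := exists_nodup_cons k.2
    -- The constant `2 n` is the product of the divergence `n` of the Euler field and the factor `2`
    -- in the divergence `2 xₐ`.
    refine ⟨fun _ => euler n, fun _ => quad a,
      ![(2 * n : 𝕜)⁻¹ • lam (a :: v).reverse (vs 𝕜 v), 0], fun b hb => ?_, fun r' => ?_⟩
    · rw [Fin.sum_univ_two]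
      simp only [Matrix.cons_val_zero, Matrix.cons_val_one, LinearMap.smul_apply,
        LinearMap.zero_apply, add_zero]
      rw [lam_cobd₂_euler_quad b _ a _ v.length (euler_vs v) (by simp)
        (quad_vs (List.nodup_cons.1 hv).1), smul_zero]
    · rw [Fin.sum_univ_two]
      simp only [Matrix.cons_val_zero, Matrix.cons_val_one, LinearMap.smul_apply,
        LinearMap.zero_apply, add_zero]
      rw [lam_curvRel (degProj_vs · v)]
      cases r' with
      | R1 k' =>
        simp only [Rel.R1.injEq, List.length_reverse, List.length_cons, hl, Fin.ext_iff]
        by_cases h : (k' : ℕ) = k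
        · rw [if_pos (by omega), if_pos h]
          simp only [mulF_divFn_euler, mulF_divFn_quad, map_smul, d_vs, d_coord_vs, map_zero,
            smul_zero, sub_zero, phi_vs hv, smul_eq_mul]
          field_simp
        · rw [if_neg (by omega), if_neg h, smul_zero]
      | R2 k' =>
        simp only [List.length_reverse, List.length_cons]
        rw [if_neg (by omega), if_neg (by simp), smul_zero]
      | R2t k' =>
        simp only [List.length_reverse, List.length_cons]
        rw [if_neg (by omega), if_neg (by simp), smul_zero]
      | R3 k' =>
        simp only [List.length_reverse, List.length_cons]
        rw [if_neg (by omega), if_neg (by simp), smul_zero]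
  | R2 k =>
    obtain ⟨a, b, v, hv, hl⟩ := exists_nodup_cons₂ (L := k) (n := n) (by omega)
    have hm := hv
    simp only [List.nodup_cons, List.mem_cons, not_or] at hm
    -- The constant `8` collects the factors `2` of the two divergences and the two equal terms of
    -- the antisymmetrization. The relations of type `R2t` are not seen because `η` is closed.
    refine ⟨fun _ => quad a, fun _ => quad b,
      ![(8 : 𝕜)⁻¹ • lam (a :: b :: v).reverse (vs 𝕜 v), 0], fun c hc => ?_, fun r' => ?_⟩
    · rw [Fin.sum_univ_two]
      simp only [Matrix.cons_val_zero, Matrix.cons_val_one, LinearMap.smul_apply,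
        LinearMap.zero_apply, add_zero]
      rw [lam_cobd₂_quad_quad c hc _ hm.1.1 _ (quad_vs hm.1.2) (quad_vs hm.2.1), smul_zero]
    · rw [Fin.sum_univ_two]
      simp only [Matrix.cons_val_zero, Matrix.cons_val_one, LinearMap.smul_apply,
        LinearMap.zero_apply, add_zero]
      rw [lam_curvRel (degProj_vs · v)]
      cases r' with
      | R1 k' =>
        simp only [List.length_reverse, List.length_cons]
        rw [if_neg (by omega), if_neg (by simp), smul_zero]
      | R2 k' =>
        simp only [Rel.R2.injEq, List.length_reverse, List.length_cons, hl, Fin.ext_iff]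
        by_cases h : (k' : ℕ) = k
        · rw [if_pos (by omega), if_pos h]
          simp only [mulF_divFn_quad, map_smul, d_coord_vs, vs_swap a b v, map_neg, map_sub,
            phi_vs hv, smul_eq_mul]
          norm_num
        · rw [if_neg (by omega), if_neg h, smul_zero]
      | R2t k' =>
        simp only [d_vs, map_zero, sub_zero, ite_self, smul_zero]
        rw [if_neg (by simp)]
      | R3 k' =>
        simp only [List.length_reverse, List.length_cons]
        rw [if_neg (by omega), if_neg (by simp), smul_zero]
  | R2t k =>
    obtain ⟨a, b, v, hv, hl⟩ := exists_nodup_cons₂ (L := k) (n := n) (by omega)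
    have hm := hv
    simp only [List.nodup_cons, List.mem_cons, not_or] at hm
    -- The linear coefficient `x_b` makes the innermost `d` visible. The first evaluation also takes
    -- the value `-1` on the relation `R2` of the same degree; the second, which is the test for
    -- `R2`, corrects this.
    refine ⟨![euler n, quad a], ![quad a, quad b],
      ![(2 * n : 𝕜)⁻¹ • lam (a :: b :: v).reverse (mulF (coord b) (vs 𝕜 v)),
        (8 : 𝕜)⁻¹ • lam (a :: b :: v).reverse (vs 𝕜 v)], fun c hc => ?_, fun r' => ?_⟩
    · rw [Fin.sum_univ_two]
      simp only [Matrix.cons_val_zero, Matrix.cons_val_one, LinearMap.smul_apply]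
      rw [lam_cobd₂_quad_quad c hc _ hm.1.1 _ (quad_vs hm.1.2) (quad_vs hm.2.1), smul_zero,
        lam_cobd₂_euler_quad c _ a _ (v.length + 1) (euler_coord_vs b v) (by simp)
        (quad_coord_vs (List.nodup_cons.1 hv).1), smul_zero, add_zero]
    · rw [Fin.sum_univ_two]
      simp only [Matrix.cons_val_zero, Matrix.cons_val_one, LinearMap.smul_apply]
      rw [lam_curvRel (degProj_vs · v), lam_curvRel (degProj_coord_vs · b v)]
      cases r' with
      | R1 k' =>
        simp only [List.length_reverse, List.length_cons]
        rw [if_neg (by omega), if_neg (by omega), if_neg (by simp), smul_zero, smul_zero, add_zero]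
      | R2 k' =>
        simp only [List.length_reverse, List.length_cons, hl]
        rw [if_neg (c := (Rel.R2 k' = Rel.R2t k)) (by simp)]
        by_cases h : (k' : ℕ) = k
        · rw [if_pos (by omega), if_pos (by omega)]
          simp only [mulF_divFn_euler, mulF_divFn_quad, map_smul, d_d, d_coord_vs, vs_swap a b v,
            map_neg, map_sub, phi_vs hv, smul_eq_mul, smul_zero, map_zero]
          field_simp
          ring
        · rw [if_neg (by omega), if_neg (by omega), smul_zero, smul_zero, add_zero]
      | R2t k' =>
        simp only [Rel.R2t.injEq, List.length_reverse, List.length_cons, hl, Fin.ext_iff]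
        by_cases h : (k' : ℕ) = k
        · rw [if_pos (by omega), if_pos (by omega), if_pos h]
          simp only [mulF_divFn_euler, mulF_divFn_quad, map_smul, d_vs, d_coord_vs,
            phi_vs hv, smul_eq_mul, smul_zero, map_zero, sub_zero]
          field_simp
          norm_num
        · rw [if_neg (by omega), if_neg (by omega), if_neg h, smul_zero, smul_zero, add_zero]
      | R3 k' =>
        simp only [List.length_reverse, List.length_cons]
        rw [if_neg (by omega), if_neg (by omega), if_neg (by simp), smul_zero, smul_zero, add_zero]
  | R3 k =>
    obtain ⟨a, b, c, v, hv, hl⟩ := exists_nodup_cons₃ (L := k) (n := n) (by omega)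
    have hm := hv
    simp only [List.nodup_cons, List.mem_cons, not_or] at hm
    -- The coefficient `x_c` feeds the innermost `d`; the constant arises as for `R2`.
    refine ⟨fun _ => quad a, fun _ => quad b,
      ![(8 : 𝕜)⁻¹ • lam (a :: b :: c :: v).reverse (mulF (coord c) (vs 𝕜 v)), 0],
      fun e he => ?_, fun r' => ?_⟩
    · rw [Fin.sum_univ_two]
      simp only [Matrix.cons_val_zero, Matrix.cons_val_one, LinearMap.smul_apply,
        LinearMap.zero_apply, add_zero]
      rw [lam_cobd₂_quad_quad e he _ hm.1.1 _ (quad_coord_vs (by simp [hm.1]))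
        (quad_coord_vs (by simp [hm.2.1])), smul_zero]
    · rw [Fin.sum_univ_two]
      simp only [Matrix.cons_val_zero, Matrix.cons_val_one, LinearMap.smul_apply,
        LinearMap.zero_apply, add_zero]
      rw [lam_curvRel (degProj_coord_vs · c v)]
      cases r' with
      | R3 k' =>
        simp only [Rel.R3.injEq, List.length_reverse, List.length_cons, hl, Fin.ext_iff]
        by_cases h : (k' : ℕ) = k
        · rw [if_pos (by omega), if_pos h]
          simp only [mulF_divFn_quad, map_smul, d_coord_vs, vs_swap a b (c :: v), map_neg, map_sub,
            phi_vs hv, smul_eq_mul]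
          norm_num
        · rw [if_neg (by omega), if_neg h, smul_zero]
      | R1 k' =>
        simp only [List.length_reverse, List.length_cons]
        rw [if_neg (by omega), if_neg (by simp), smul_zero]
      | R2 k' =>
        simp only [List.length_reverse, List.length_cons]
        rw [if_neg (by omega), if_neg (by simp), smul_zero]
      | R2t k' =>
        simp only [List.length_reverse, List.length_cons]
        rw [if_neg (by omega), if_neg (by simp), smul_zero]

/-- Evaluations detecting each parameter and vanishing on coboundaries. -/
theorem exists_paramTest (hn : 2 ≤ n) (p : Param n) :
    ∃ (X : Fin 2 → Vect n) (l : Fin 2 → (Module.End 𝕜 (Form 𝕜 n) →ₗ[𝕜] 𝕜)),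
      (∀ u, ∑ i, l i (cobd u (X i)) = 0) ∧
      ∀ p', ∑ i, l i (coc p' (X i)) = if p' = p then 1 else 0 := by
  have hn0 : (n : 𝕜) ≠ 0 := Nat.cast_ne_zero.2 (by omega)
  cases p with
  | t0 k =>
    obtain ⟨v, hv, hl⟩ := exists_nodup (n := n) (L := k) (by omega)
    refine ⟨fun _ => euler n, ![(n : 𝕜)⁻¹ • lam v.reverse (vs 𝕜 v), 0], fun b => ?_, fun p' => ?_⟩
    · rw [Fin.sum_univ_two]
      simp only [Matrix.cons_val_zero, Matrix.cons_val_one, LinearMap.smul_apply,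
        LinearMap.zero_apply, add_zero]
      rw [lam_cobd_euler b _ _ (by rw [euler_vs]; simp), smul_zero]
    · rw [Fin.sum_univ_two]
      simp only [Matrix.cons_val_zero, Matrix.cons_val_one, LinearMap.smul_apply,
        LinearMap.zero_apply, add_zero]
      rw [lam_coc (degProj_vs · v)]
      cases p' with
      | t0 k' =>
        simp only [Param.t0.injEq, List.length_reverse, hl, Fin.ext_iff]
        by_cases h : (k' : ℕ) = k
        · rw [if_pos (by omega), if_pos h]
          simp only [mulF_divFn_euler, map_smul, phi_vs hv, smul_eq_mul]
          field_simp
        · rw [if_neg (by omega), if_neg h, smul_zero]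
      | t1 k' =>
        simp only [List.length_reverse]
        rw [if_neg (by omega), if_neg (by simp), smul_zero]
      | t1t k' =>
        simp only [List.length_reverse]
        rw [if_neg (by omega), if_neg (by simp), smul_zero]
      | t2 k' =>
        simp only [List.length_reverse]
        rw [if_neg (by omega), if_neg (by simp), smul_zero]
  | t1 k =>
    obtain ⟨a, v, hv, hl⟩ := exists_nodup_cons k.2
    refine ⟨fun _ => quad a,
      ![(2 : 𝕜)⁻¹ • lam (a :: v).reverse (vs 𝕜 v), 0], fun b => ?_, fun p' => ?_⟩
    · rw [Fin.sum_univ_two]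
      simp only [Matrix.cons_val_zero, Matrix.cons_val_one, LinearMap.smul_apply,
        LinearMap.zero_apply, add_zero]
      rw [lam_cobd_quad b _ a _ (quad_vs (List.nodup_cons.1 hv).1), smul_zero]
    · rw [Fin.sum_univ_two]
      simp only [Matrix.cons_val_zero, Matrix.cons_val_one, LinearMap.smul_apply,
        LinearMap.zero_apply, add_zero]
      rw [lam_coc (degProj_vs · v)]
      cases p' with
      | t0 k' =>
        simp only [List.length_reverse, List.length_cons]
        rw [if_neg (by omega), if_neg (by simp), smul_zero]
      | t1 k' =>
        simp only [Param.t1.injEq, List.length_reverse, List.length_cons, hl, Fin.ext_iff]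
        by_cases h : (k' : ℕ) = k
        · rw [if_pos (by omega), if_pos h]
          simp only [mulF_divFn_quad, map_smul, d_coord_vs, phi_vs hv, smul_eq_mul]
          field_simp
        · rw [if_neg (by omega), if_neg h, smul_zero]
      | t1t k' =>
        simp only [d_vs, map_zero, ite_self, smul_zero]
        rw [if_neg (by simp)]
      | t2 k' =>
        simp only [List.length_reverse, List.length_cons]
        rw [if_neg (by omega), if_neg (by simp), smul_zero]
  | t1t k =>
    obtain ⟨a, v, hv, hl⟩ := exists_nodup_cons k.2
    -- For the Euler field, with constant divergence, `K1` and `K1t` coincide on this form. The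
    -- second evaluation removes the contribution of `K1`.
    refine ⟨![euler n, quad a],
      ![(n : 𝕜)⁻¹ • lam (a :: v).reverse (mulF (coord a) (vs 𝕜 v)),
        -(2 : 𝕜)⁻¹ • lam (a :: v).reverse (vs 𝕜 v)], fun b => ?_, fun p' => ?_⟩
    · rw [Fin.sum_univ_two]
      simp only [Matrix.cons_val_zero, Matrix.cons_val_one, LinearMap.smul_apply]
      rw [lam_cobd_quad b _ a _ (quad_vs (List.nodup_cons.1 hv).1), smul_zero,
        lam_cobd_euler b _ _ (by rw [euler_coord_vs]; simp), smul_zero, add_zero]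
    · rw [Fin.sum_univ_two]
      simp only [Matrix.cons_val_zero, Matrix.cons_val_one, LinearMap.smul_apply]
      rw [lam_coc (degProj_vs · v), lam_coc (degProj_coord_vs · a v)]
      cases p' with
      | t0 k' =>
        simp only [List.length_reverse, List.length_cons]
        rw [if_neg (by omega), if_neg (by omega), if_neg (by simp), smul_zero, smul_zero, add_zero]
      | t1 k' =>
        simp only [List.length_reverse, List.length_cons, hl]
        rw [if_neg (c := (Param.t1 k' = Param.t1t k)) (by simp)]
        by_cases h : (k' : ℕ) = k
        · rw [if_pos (by omega), if_pos (by omega)]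
          simp only [mulF_divFn_euler, mulF_divFn_quad, map_smul, d_coord_vs, phi_vs hv,
            smul_eq_mul]
          field_simp
          norm_num
        · rw [if_neg (by omega), if_neg (by omega), smul_zero, smul_zero, add_zero]
      | t1t k' =>
        simp only [Param.t1t.injEq, List.length_reverse, List.length_cons, hl, Fin.ext_iff]
        by_cases h : (k' : ℕ) = k
        · rw [if_pos (by omega), if_pos (by omega), if_pos h]
          simp only [mulF_divFn_euler, d_vs, map_smul, d_coord_vs, phi_vs hv, smul_eq_mul,
            map_zero]
          field_simp
          norm_num
        · rw [if_neg (by omega), if_neg (by omega), if_neg h, smul_zero, smul_zero, add_zero]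
      | t2 k' =>
        simp only [List.length_reverse, List.length_cons]
        rw [if_neg (by omega), if_neg (by omega), if_neg (by simp), smul_zero, smul_zero, add_zero]
  | t2 k =>
    obtain ⟨a, b, v, hv, hl⟩ := exists_nodup_cons₂ (L := k) (n := n) (by omega)
    refine ⟨fun _ => quad a,
      ![(2 : 𝕜)⁻¹ • lam (a :: b :: v).reverse (mulF (coord b) (vs 𝕜 v)), 0],
      fun u => ?_, fun p' => ?_⟩
    · rw [Fin.sum_univ_two]
      simp only [Matrix.cons_val_zero, Matrix.cons_val_one, LinearMap.smul_apply,
        LinearMap.zero_apply, add_zero]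
      rw [lam_cobd_quad u _ a _ (quad_coord_vs (List.nodup_cons.1 hv).1), smul_zero]
    · rw [Fin.sum_univ_two]
      simp only [Matrix.cons_val_zero, Matrix.cons_val_one, LinearMap.smul_apply,
        LinearMap.zero_apply, add_zero]
      rw [lam_coc (degProj_coord_vs · b v)]
      cases p' with
      | t0 k' =>
        simp only [List.length_reverse, List.length_cons]
        rw [if_neg (by omega), if_neg (by simp), smul_zero]
      | t1 k' =>
        simp only [List.length_reverse, List.length_cons]
        rw [if_neg (by omega), if_neg (by simp), smul_zero]
      | t1t k' =>
        simp only [List.length_reverse, List.length_cons]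
        rw [if_neg (by omega), if_neg (by simp), smul_zero]
      | t2 k' =>
        simp only [Param.t2.injEq, List.length_reverse, List.length_cons, hl, Fin.ext_iff]
        by_cases h : (k' : ℕ) = k
        · rw [if_pos (by omega), if_pos h]
          simp only [mulF_divFn_quad, map_smul, d_coord_vs, phi_vs hv, smul_eq_mul]
          field_simp
        · rw [if_neg (by omega), if_neg h, smul_zero]

/-! ### Operator-valued series -/

section Series

variable {σ : Type}

theorem coeff_scalars (f : MvPowerSeries σ 𝕜) (α : σ →₀ ℕ) :
    MvPowerSeries.coeff α (scalars f : OpSeries σ 𝕜 n) =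
      algebraMap 𝕜 (Module.End 𝕜 (Form 𝕜 n)) (MvPowerSeries.coeff α f) := by
  rw [scalars, MvPowerSeries.coeff_map]

theorem coeff_scalars_mul [DecidableEq σ] (f : MvPowerSeries σ 𝕜) (g : OpSeries σ 𝕜 n) (α : σ →₀ ℕ) :
    MvPowerSeries.coeff α (scalars f * g) =
      ∑ x ∈ Finset.HasAntidiagonal.antidiagonal α,
        MvPowerSeries.coeff x.1 f • MvPowerSeries.coeff x.2 g := by
  rw [MvPowerSeries.coeff_mul]
  exact Finset.sum_congr rfl fun x _ => by rw [coeff_scalars, Algebra.smul_def]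

theorem scalars_mul_comm (f : MvPowerSeries σ 𝕜) (g : OpSeries σ 𝕜 n) :
    scalars f * g = g * scalars f := by
  classical
  ext1 α
  rw [MvPowerSeries.coeff_mul, MvPowerSeries.coeff_mul,
    Finsupp.sum_antidiagonal_swap α fun a b =>
      MvPowerSeries.coeff a (scalars f : OpSeries σ 𝕜 n) * MvPowerSeries.coeff b g]
  refine Finset.sum_congr rfl fun x _ => ?_
  rw [coeff_scalars, Algebra.commutes]

theorem coeff_scalars_mul_C (f : MvPowerSeries σ 𝕜) (A : Module.End 𝕜 (Form 𝕜 n)) (α : σ →₀ ℕ) :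
    MvPowerSeries.coeff α (scalars f * MvPowerSeries.C A) = MvPowerSeries.coeff α f • A := by
  rw [MvPowerSeries.coeff_mul_C, coeff_scalars, Algebra.smul_def]

theorem scalars_mem {J : Ideal (MvPowerSeries σ 𝕜)} {f : MvPowerSeries σ 𝕜} (h : f ∈ J) :
    (scalars f : OpSeries σ 𝕜 n) ∈ J.map scalars := Ideal.mem_map_of_mem _ h

theorem scalars_mul_mem {J : Ideal (MvPowerSeries σ 𝕜)} {f : MvPowerSeries σ 𝕜} (h : f ∈ J)
    (g : OpSeries σ 𝕜 n) : scalars f * g ∈ J.map scalars := by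
  rw [scalars_mul_comm]
  exact Ideal.mul_mem_left _ _ (scalars_mem h)

/-- The scalar series are central, so the left ideal generated by `J` consists of finite sums of
products of elements of `J` with operator series; in particular it is two-sided. -/
theorem map_induction {J : Ideal (MvPowerSeries σ 𝕜)} {p : OpSeries σ 𝕜 n → Prop}
    (h : ∀ f ∈ J, ∀ g, p (scalars f * g)) (h0 : p 0) (hadd : ∀ a b, p a → p b → p (a + b))
    {a : OpSeries σ 𝕜 n} (ha : a ∈ J.map scalars) : p a := by
  refine Submodule.span_induction (p := fun a _ => ∀ g : OpSeries σ 𝕜 n, p (g * a)) ?_ ?_ ?_ ?_ ha 1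
    |> fun h => by rwa [one_mul] at h
  · rintro _ ⟨f, hf, rfl⟩ g
    rw [← scalars_mul_comm]
    exact h f hf g
  · intro g; rwa [mul_zero]
  · intro x y _ _ hx hy g
    rw [mul_add]
    exact hadd _ _ (hx g) (hy g)
  · intro c x _ hx g
    rw [smul_eq_mul, ← mul_assoc]
    exact hx _

theorem map_mul_mem {J : Ideal (MvPowerSeries σ 𝕜)} {a : OpSeries σ 𝕜 n}
    (ha : a ∈ J.map scalars) (b : OpSeries σ 𝕜 n) : a * b ∈ J.map scalars :=
  map_induction (p := fun a => a * b ∈ J.map scalars)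
    (fun f hf g => by rw [mul_assoc]; exact scalars_mul_mem hf _)
    (by rw [zero_mul]; exact zero_mem _)
    (fun x y hx hy => by rw [add_mul]; exact add_mem hx hy) ha

/-- A functional applied coefficientwise. -/
def serL (l : Module.End 𝕜 (Form 𝕜 n) →ₗ[𝕜] 𝕜) : OpSeries σ 𝕜 n →+ MvPowerSeries σ 𝕜 where
  toFun g := fun α => l (MvPowerSeries.coeff α g)
  map_zero' := funext fun α => by rw [map_zero, map_zero]; rfl
  map_add' g h := funext fun α => by rw [map_add, map_add]; rfl

theorem coeff_serL (l : Module.End 𝕜 (Form 𝕜 n) →ₗ[𝕜] 𝕜) (g : OpSeries σ 𝕜 n) (α : σ →₀ ℕ) :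
    MvPowerSeries.coeff α (serL l g) = l (MvPowerSeries.coeff α g) := rfl

theorem serL_scalars_mul (l : Module.End 𝕜 (Form 𝕜 n) →ₗ[𝕜] 𝕜) (f : MvPowerSeries σ 𝕜)
    (g : OpSeries σ 𝕜 n) : serL l (scalars f * g) = f * serL l g := by
  classical
  ext α
  rw [coeff_serL, coeff_scalars_mul, MvPowerSeries.coeff_mul, map_sum]
  exact Finset.sum_congr rfl fun x _ => by rw [map_smul, coeff_serL, smul_eq_mul]

theorem serL_C (l : Module.End 𝕜 (Form 𝕜 n) →ₗ[𝕜] 𝕜) (A : Module.End 𝕜 (Form 𝕜 n)) :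
    serL l (MvPowerSeries.C A : OpSeries σ 𝕜 n) = MvPowerSeries.C (l A) := by
  classical
  ext α
  rw [coeff_serL, MvPowerSeries.coeff_C, MvPowerSeries.coeff_C]
  split_ifs
  · rfl
  · exact map_zero _

/-- A functional applied coefficientwise is linear over the power series. This brings congruences
between operator series back to the ideal `J`. -/
theorem serL_mem (l : Module.End 𝕜 (Form 𝕜 n) →ₗ[𝕜] 𝕜) {J : Ideal (MvPowerSeries σ 𝕜)}
    {a : OpSeries σ 𝕜 n} (ha : a ∈ J.map scalars) : serL l a ∈ J :=
  map_induction (p := fun a => serL l a ∈ J)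
    (fun f hf g => by rw [serL_scalars_mul]; exact J.mul_mem_right _ hf)
    (by rw [map_zero]; exact zero_mem _)
    (fun x y hx hy => by rw [map_add]; exact add_mem hx hy) ha

end Series

/-! ### Curvature -/

section Curvature

/-- Here `T a` acts by `a k` in degree `k`, `D` is the differential, and `F`, `G` are the two
divergences. Moving every `T` to the right shifts its sequence once for each `D` it crosses. Words
containing `D * D` vanish, words with adjacent `F` and `G` cancel in the commutator, and the four
surviving words carry the four kinds of relations. -/
theorem curvature_algebra {R S : Type*} [Ring R] [CommRing S] (T : (ℕ → S) → R) (D F G : R)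
    (hadd : ∀ a b, T (a + b) = T a + T b) (hmul : ∀ a b, T a * T b = T (a * b))
    (hF : ∀ a, T a * F = F * T a) (hG : ∀ a, T a * G = G * T a)
    (hD : ∀ a, T a * D = D * T fun k => a (k + 1)) (hDD : D * D = 0) (hFG : G * F = F * G)
    (x y z w : ℕ → S) :
    (F * T x + D * F * T y + F * D * T z + D * F * D * T w) *
        (G * T x + D * G * T y + G * D * T z + D * G * D * T w) -
      (G * T x + D * G * T y + G * D * T z + D * G * D * T w) *
        (F * T x + D * F * T y + F * D * T z + D * F * D * T w) =
    (F * D * G - G * D * F) * T (fun k => x k * z k + x (k + 1) * y k) +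
    (D * F * D * G - D * G * D * F) * T (fun k => x k * w k + y (k + 1) * y k) +
    (F * D * G * D - G * D * F * D) * T (fun k => x (k + 2) * w k + z (k + 1) * z k) +
    (D * F * D * G * D - D * G * D * F * D) *
      T (fun k => y (k + 2) * w k + z k * w (k + 1)) := by
  have e1 : T (fun k => x k * z k + x (k + 1) * y k) =
      T (z * x) + T ((fun k => x (k + 1)) * y) := by
    rw [← hadd]; congr 1; funext k; simp [mul_comm]
  have e2 : T (fun k => x k * w k + y (k + 1) * y k) =
      T (w * x) + T ((fun k => y (k + 1)) * y) := by
    rw [← hadd]; congr 1; funext k; simp [mul_comm]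
  have e3 : T (fun k => x (k + 2) * w k + z (k + 1) * z k) =
      T ((fun k => x (k + 1 + 1)) * w) + T ((fun k => z (k + 1)) * z) := by
    rw [← hadd]; rfl
  have e4 : T (fun k => y (k + 2) * w k + z k * w (k + 1)) =
      T ((fun k => y (k + 1 + 1)) * w) + T ((fun k => w (k + 1)) * z) := by
    rw [← hadd]; congr 1; funext k; simp [mul_comm]
  have hF' : ∀ a q, T a * (F * q) = F * (T a * q) := fun a q => by
    rw [← mul_assoc, hF, mul_assoc]
  have hG' : ∀ a q, T a * (G * q) = G * (T a * q) := fun a q => by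
    rw [← mul_assoc, hG, mul_assoc]
  have hD' : ∀ a q, T a * (D * q) = D * (T (fun k => a (k + 1)) * q) := fun a q => by
    rw [← mul_assoc, hD, mul_assoc]
  have hDD' : ∀ q, D * (D * q) = 0 := fun q => by rw [← mul_assoc, hDD, zero_mul]
  have hFG' : ∀ q, G * (F * q) = F * (G * q) := fun q => by rw [← mul_assoc, hFG, mul_assoc]
  rw [e1, e2, e3, e4]
  simp only [mul_add, add_mul, sub_mul, mul_assoc, hF', hG', hD', hDD', hFG', hmul, mul_zero]
  abel

variable {σ : Type}

/-- The operator acting as the scalar series `a k` on the forms of degree `k`. -/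
def tauS (a : ℕ → MvPowerSeries σ 𝕜) : OpSeries σ 𝕜 n :=
  ∑ k ∈ Finset.range (n + 1), scalars (a k) * MvPowerSeries.C (degProj k)

/-- Extension of a finite sequence by zero. -/
def ext0 {m : ℕ} (u : Fin m → MvPowerSeries σ 𝕜) (k : ℕ) : MvPowerSeries σ 𝕜 :=
  if h : k < m then u ⟨k, h⟩ else 0

theorem ext0_of_lt {m : ℕ} (u : Fin m → MvPowerSeries σ 𝕜) {k : ℕ} (h : k < m) :
    ext0 u k = u ⟨k, h⟩ := dif_pos h

theorem ext0_of_le {m : ℕ} (u : Fin m → MvPowerSeries σ 𝕜) {k : ℕ} (h : m ≤ k) :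
    ext0 u k = 0 := dif_neg (by omega)

theorem mul_tauS {m : ℕ} (hm : m ≤ n + 1) (u : Fin m → MvPowerSeries σ 𝕜)
    (a : ℕ → MvPowerSeries σ 𝕜) (ha : ∀ k : Fin m, a k = u k) (ha' : ∀ k, m ≤ k → a k = 0)
    (A : Module.End 𝕜 (Form 𝕜 n)) :
    MvPowerSeries.C A * tauS a =
      ∑ k : Fin m, scalars (u k) * MvPowerSeries.C (A * degProj k) := by
  rw [tauS, Finset.mul_sum]
  have e : ∀ k, MvPowerSeries.C A * (scalars (a k) * MvPowerSeries.C (degProj k)) =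
      (scalars (a k) * MvPowerSeries.C (A * degProj k) : OpSeries σ 𝕜 n) := fun k => by
    rw [← mul_assoc, ← scalars_mul_comm, mul_assoc, map_mul]
  rw [Finset.sum_congr rfl fun k _ => e k,
    ← Finset.sum_subset (Finset.range_mono hm) (fun k _ hk => by
      rw [ha' k (by simpa using hk), map_zero, zero_mul]), Finset.sum_range]
  exact Finset.sum_congr rfl fun k _ => by rw [ha]

theorem mul_tauS_ext0 {m : ℕ} (hm : m ≤ n + 1) (u : Fin m → MvPowerSeries σ 𝕜)
    (A : Module.End 𝕜 (Form 𝕜 n)) :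
    MvPowerSeries.C A * tauS (ext0 u) =
      ∑ k : Fin m, scalars (u k) * MvPowerSeries.C (A * degProj k) :=
  mul_tauS hm u _ (fun k => ext0_of_lt u k.2) (fun k => ext0_of_le u) A

theorem tauS_add (a b : ℕ → MvPowerSeries σ 𝕜) :
    (tauS (a + b) : OpSeries σ 𝕜 n) = tauS a + tauS b := by
  simp only [tauS, Pi.add_apply, map_add, add_mul, Finset.sum_add_distrib]

theorem tauS_mul (a b : ℕ → MvPowerSeries σ 𝕜) :
    (tauS a * tauS b : OpSeries σ 𝕜 n) = tauS (a * b) := by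
  rw [tauS, Finset.sum_mul, tauS, tauS]
  refine Finset.sum_congr rfl fun k hk => ?_
  rw [Finset.mul_sum, Finset.sum_eq_single_of_mem k hk]
  · rw [mul_assoc, ← mul_assoc (MvPowerSeries.C _), ← scalars_mul_comm, mul_assoc, ← map_mul,
      degProj_mul_self, Pi.mul_apply, map_mul, mul_assoc]
  · intro l _ hl
    rw [mul_assoc, ← mul_assoc (MvPowerSeries.C _), ← scalars_mul_comm, mul_assoc, ← map_mul,
      degProj_mul_ne (Ne.symm hl), map_zero, mul_zero, mul_zero]

theorem tauS_mul_C (a : ℕ → MvPowerSeries σ 𝕜) (f : Fn n) :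
    (tauS a * MvPowerSeries.C (mulF f) : OpSeries σ 𝕜 n) = MvPowerSeries.C (mulF f) * tauS a := by
  rw [tauS, Finset.mul_sum, Finset.sum_mul]
  refine Finset.sum_congr rfl fun k _ => ?_
  rw [mul_assoc, ← map_mul, degProj_mul_mulF', map_mul, ← mul_assoc, scalars_mul_comm, mul_assoc]

theorem tauS_mul_d (a : ℕ → MvPowerSeries σ 𝕜) :
    (tauS a * MvPowerSeries.C d : OpSeries σ 𝕜 n) =
      MvPowerSeries.C d * tauS fun k => a (k + 1) := by
  have e0 : (degProj 0 * d : Module.End 𝕜 (Form 𝕜 n)) = 0 := LinearMap.ext degProj_zero_d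
  have h1 : ∀ k, scalars (a k) * MvPowerSeries.C (degProj k) * MvPowerSeries.C d =
      (scalars (a k) * MvPowerSeries.C (degProj k * d) : OpSeries σ 𝕜 n) := fun k => by
    rw [mul_assoc, map_mul]
  have h2 : ∀ k, MvPowerSeries.C d * (scalars (a (k + 1)) * MvPowerSeries.C (degProj k)) =
      (scalars (a (k + 1)) * MvPowerSeries.C (d * degProj k) : OpSeries σ 𝕜 n) := fun k => by
    rw [← mul_assoc, ← scalars_mul_comm, mul_assoc, map_mul]
  rw [tauS, tauS, Finset.mul_sum, Finset.sum_mul, Finset.sum_congr rfl fun k _ => h1 k,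
    Finset.sum_congr rfl fun k _ => h2 k, Finset.sum_range_succ', Finset.sum_range_succ, e0,
    d_mul_degProj_top, map_zero, mul_zero, mul_zero]
  congr 1
  exact Finset.sum_congr rfl fun k _ => by rw [degProj_succ_mul_d]

/-- The relations as a disjoint union. -/
def relEquiv (n : ℕ) : ((Fin n ⊕ Fin (n - 1)) ⊕ Fin (n - 1)) ⊕ Fin (n - 2) ≃ Rel n where
  toFun := Sum.elim (Sum.elim (Sum.elim .R1 .R2) .R2t) .R3
  invFun := fun p => match p with
    | .R1 k => .inl (.inl (.inl k))
    | .R2 k => .inl (.inl (.inr k))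
    | .R2t k => .inl (.inr k)
    | .R3 k => .inr k
  left_inv := by rintro (((k | k) | k) | k) <;> rfl
  right_inv := by rintro (k | k | k | k) <;> rfl

instance : Fintype (Rel n) := Fintype.ofEquiv _ (relEquiv n)

theorem sum_rel {M : Type*} [AddCommMonoid M] (f : Rel n → M) :
    ∑ p, f p = ∑ k, f (.R1 k) + ∑ k, f (.R2 k) + ∑ k, f (.R2t k) + ∑ k, f (.R3 k) := by
  rw [← Equiv.sum_comp (relEquiv n) f]
  simp only [Fintype.sum_sum_type]
  rfl

/-- The terms of positive order of a first-order deformation. -/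
def orderOne (t : Param n → MvPowerSeries σ 𝕜) (X : Vect n) : OpSeries σ 𝕜 n :=
  ∑ p, scalars (t p) * MvPowerSeries.C (coc p X)

theorem orderOne_eq (t : Param n → MvPowerSeries σ 𝕜) (X : Vect n) :
    orderOne t X = MvPowerSeries.C (mulF (divFn X)) * tauS (ext0 fun k => t (.t0 k)) +
      MvPowerSeries.C d * MvPowerSeries.C (mulF (divFn X)) * tauS (ext0 fun k => t (.t1 k)) +
      MvPowerSeries.C (mulF (divFn X)) * MvPowerSeries.C d * tauS (ext0 fun k => t (.t1t k)) +
      MvPowerSeries.C d * MvPowerSeries.C (mulF (divFn X)) * MvPowerSeries.C d *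
        tauS (ext0 fun k => t (.t2 k)) := by
  simp only [← map_mul]
  rw [mul_tauS_ext0 le_rfl, mul_tauS_ext0 (Nat.le_succ n), mul_tauS_ext0 (Nat.le_succ n),
    mul_tauS_ext0 (by omega), orderOne, sum_param]
  simp only [coc, K0_apply, K1_apply, K1t_apply, K2_apply, mul_assoc]

theorem commutator_orderOne (t : Param n → MvPowerSeries σ 𝕜) (X Y : Vect n) :
    orderOne t X * orderOne t Y - orderOne t Y * orderOne t X =
      ∑ r, scalars (relation t r) * MvPowerSeries.C (curvRel X Y r) := by
  rw [orderOne_eq, orderOne_eq, curvature_algebra (tauS (𝕜 := 𝕜) (n := n) (σ := σ)) _ _ _ tauS_add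
    tauS_mul (fun a => tauS_mul_C a _) (fun a => tauS_mul_C a _) tauS_mul_d
    (by rw [← map_mul, d_mul_d, map_zero])
    (by rw [← map_mul, ← map_mul, ← map_mul, ← map_mul, mul_comm])]
  simp only [← map_mul, ← map_sub]
  rw [sum_rel]
  congr 1
  · congr 1
    · congr 1
      · refine mul_tauS (Nat.le_succ n) (fun k => relation t (.R1 k)) _ (fun k => ?_)
          (fun k hk => ?_) _
        · rw [ext0_of_lt _ (by omega), ext0_of_lt _ k.2, ext0_of_lt _ (by omega),
            ext0_of_lt _ k.2]
          rfl
        · rw [ext0_of_le (fun k => t (.t1t k)) hk, ext0_of_le (fun k => t (.t1 k)) hk, mul_zero,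
            mul_zero, add_zero]
      · refine mul_tauS (by omega) (fun k => relation t (.R2 k)) _ (fun k => ?_)
          (fun k hk => ?_) _
        · rw [ext0_of_lt _ (by omega), ext0_of_lt _ k.2, ext0_of_lt _ (by omega),
            ext0_of_lt _ (by omega)]
          rfl
        · rw [ext0_of_le (fun k => t (.t2 k)) hk,
            ext0_of_le (fun k => t (.t1 k)) (k := k + 1) (by omega), mul_zero, zero_mul, add_zero]
    · refine mul_tauS (by omega) (fun k => relation t (.R2t k)) _ (fun k => ?_)
          (fun k hk => ?_) _
      · rw [ext0_of_lt _ (by omega), ext0_of_lt _ k.2, ext0_of_lt _ (by omega),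
          ext0_of_lt _ (by omega)]
        rfl
      · rw [ext0_of_le (fun k => t (.t2 k)) hk,
          ext0_of_le (fun k => t (.t1t k)) (k := k + 1) (by omega), mul_zero, zero_mul, add_zero]
  · refine mul_tauS (by omega) (fun k => relation t (.R3 k)) _ (fun k => ?_)
          (fun k hk => ?_) _
    · rw [ext0_of_lt _ (by omega), ext0_of_lt _ (by omega), ext0_of_lt _ (by omega),
        ext0_of_lt _ (by omega)]
      rfl
    · rw [ext0_of_le (fun k => t (.t1 k)) (k := k + 2) (by omega),
        ext0_of_le (fun k => t (.t2 k)) (k := k + 1) (by omega), mul_zero, zero_mul, add_zero]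

theorem firstOrder_eq_add (t : Param n → MvPowerSeries σ 𝕜) (X : Vect n) :
    firstOrder t X = MvPowerSeries.C (lieDerivative X) + orderOne t X := firstOrder_eq t X

/-- The curvature of a first-order deformation. -/
theorem curvature_firstOrder (t : Param n → MvPowerSeries σ 𝕜) (X Y : Vect n) :
    firstOrder t X * firstOrder t Y - firstOrder t Y * firstOrder t X -
      firstOrder t (bracket X Y) =
      ∑ r, scalars (relation t r) * MvPowerSeries.C (curvRel X Y r) := by
  rw [← commutator_orderOne, firstOrder_eq_add, firstOrder_eq_add, firstOrder_eq_add,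
    lieDerivative_bracket]
  -- The linear part of the curvature vanishes because the `coc p` are cocycles and the parameters
  -- are central.
  have h : orderOne t (bracket X Y) =
      (MvPowerSeries.C (lieDerivative X) * orderOne t Y -
        orderOne t Y * MvPowerSeries.C (lieDerivative X)) -
      (MvPowerSeries.C (lieDerivative Y) * orderOne t X -
        orderOne t X * MvPowerSeries.C (lieDerivative Y)) := by
    simp only [orderOne, Finset.mul_sum, Finset.sum_mul, ← Finset.sum_sub_distrib]
    refine Finset.sum_congr rfl fun p _ => ?_
    rw [isCocycle_coc p X Y, ← mul_assoc, ← mul_assoc, ← scalars_mul_comm, ← scalars_mul_comm]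
    simp only [map_sub, map_mul, mul_sub, mul_assoc]
  rw [h, map_sub, map_mul, map_mul]
  noncomm_ring

theorem coeff_firstOrder (t : Param n → MvPowerSeries σ 𝕜) (X : Vect n) (α : σ →₀ ℕ) :
    MvPowerSeries.coeff α (firstOrder t X) =
      MvPowerSeries.coeff α (MvPowerSeries.C (lieDerivative X) : OpSeries σ 𝕜 n) +
        ∑ p, MvPowerSeries.coeff α (t p) • coc p X := by
  rw [firstOrder_eq, map_add, map_sum]
  simp only [coeff_scalars_mul_C]

end Curvature

/-! ### Integrability of the infinitesimal deformation -/

/-! ### Leading coefficients of products, powers of the maximal ideal, homogeneous ideals -/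

section PowerSeries

variable {σ : Type} {R : Type*} [Semiring R]

theorem coeff_mul_of_right {f g : MvPowerSeries σ R} {α : σ →₀ ℕ}
    (h : ∀ β < α, MvPowerSeries.coeff β g = 0) :
    MvPowerSeries.coeff α (f * g) =
      MvPowerSeries.constantCoeff f * MvPowerSeries.coeff α g := by
  classical
  rw [MvPowerSeries.coeff_mul, Finset.sum_eq_single (0, α)]
  · rw [MvPowerSeries.coeff_zero_eq_constantCoeff_apply]
  · rintro ⟨a, b⟩ hab hne
    rw [Finset.HasAntidiagonal.mem_antidiagonal] at hab
    by_cases hb : b = α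
    · subst hb
      rw [add_eq_right] at hab
      exact (hne (Prod.ext hab rfl)).elim
    · rw [h b (lt_of_le_of_ne (hab ▸ le_add_self) hb), mul_zero]
  · intro h; simp at h

theorem coeff_mul_of_left {f g : MvPowerSeries σ R} {α : σ →₀ ℕ}
    (h : ∀ β < α, MvPowerSeries.coeff β f = 0) :
    MvPowerSeries.coeff α (f * g) =
      MvPowerSeries.coeff α f * MvPowerSeries.constantCoeff g := by
  classical
  rw [MvPowerSeries.coeff_mul, Finset.sum_eq_single (α, 0)]
  · rw [MvPowerSeries.coeff_zero_eq_constantCoeff_apply]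
  · rintro ⟨a, b⟩ hab hne
    rw [Finset.HasAntidiagonal.mem_antidiagonal] at hab
    by_cases ha : a = α
    · subst ha
      rw [add_eq_left] at hab
      exact (hne (Prod.ext rfl hab)).elim
    · rw [h a (lt_of_le_of_ne (hab ▸ le_self_add) ha), zero_mul]
  · intro h; simp at h

/-- Every nonconstant monomial is assigned to one chosen variable dividing it. The last clause
records that the quotients only contain shifted coefficients of `f`, so that their order drops by at
most one. -/
theorem exists_eq_sum_X_mul [Fintype σ] (f : MvPowerSeries σ 𝕜)
    (hf : MvPowerSeries.constantCoeff f = 0) :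
    ∃ g : σ → MvPowerSeries σ 𝕜, f = ∑ i, MvPowerSeries.X i * g i ∧
      ∀ i β, MvPowerSeries.coeff (β + Finsupp.single i 1) f = 0 →
        MvPowerSeries.coeff β (g i) = 0 := by
  classical
  have hi : ∀ α : σ →₀ ℕ, α ≠ 0 → ∃ i : σ, α i ≠ 0 := fun α h => Finsupp.ne_iff.1 h
  choose ι hι using hi
  let g : σ → MvPowerSeries σ 𝕜 := fun i β =>
    if h : ∃ h, ι (β + Finsupp.single i 1) h = i then
      MvPowerSeries.coeff (β + Finsupp.single i 1) f else 0
  have hg : ∀ i β, MvPowerSeries.coeff β (g i) =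
    if h : ∃ h, ι (β + Finsupp.single i 1) h = i then
      MvPowerSeries.coeff (β + Finsupp.single i 1) f else 0 := fun i β => rfl
  refine ⟨g, ?_, fun i β h => ?_⟩
  · ext α
    rw [map_sum]
    by_cases h : α = 0
    · subst h
      rw [MvPowerSeries.coeff_zero_eq_constantCoeff_apply, hf]
      symm
      exact Finset.sum_eq_zero fun i _ => by
        rw [MvPowerSeries.coeff_zero_eq_constantCoeff_apply]; simp
    · rw [Finset.sum_eq_single (ι α h)]
      · rw [MvPowerSeries.X, MvPowerSeries.coeff_monomial_mul,
          if_pos (by simpa [Finsupp.single_le_iff] using Nat.one_le_iff_ne_zero.2 (hι α h)),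
          one_mul, hg]
        have e : α - Finsupp.single (ι α h) 1 + Finsupp.single (ι α h) 1 = α :=
          tsub_add_cancel_of_le
            (by simpa [Finsupp.single_le_iff] using Nat.one_le_iff_ne_zero.2 (hι α h))
        simp only [e]
        rw [dif_pos ⟨h, trivial⟩]
      · intro i _ hi
        rw [MvPowerSeries.X, MvPowerSeries.coeff_monomial_mul]
        split_ifs with h'
        · rw [one_mul, hg]
          simp only [tsub_add_cancel_of_le h']
          rw [dif_neg]
          rintro ⟨h1, h2⟩
          exact hi h2.symm
        · rfl
      · simp
  · rw [hg, h]; simp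

theorem degree_lt_of_lt {α β : σ →₀ ℕ} (h : β < α) : β.degree < α.degree := by
  obtain ⟨γ, rfl⟩ := exists_add_of_le h.le
  have : γ ≠ 0 := by rintro rfl; simp at h
  rw [map_add]
  have := Nat.pos_iff_ne_zero.2 (mt (Finsupp.degree_eq_zero_iff γ).1 this)
  omega

theorem mem_maxIdeal {f : MvPowerSeries σ 𝕜} :
    f ∈ maxIdeal σ 𝕜 ↔ MvPowerSeries.constantCoeff f = 0 := RingHom.mem_ker

theorem mem_maxIdeal_pow [Finite σ] (p : ℕ) (f : MvPowerSeries σ 𝕜)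
    (h : ∀ α : σ →₀ ℕ, α.degree < p → MvPowerSeries.coeff α f = 0) :
    f ∈ maxIdeal σ 𝕜 ^ p := by
  have := Fintype.ofFinite σ
  induction p generalizing f with
  | zero => simp
  | succ p ih =>
    obtain ⟨g, hg, hg'⟩ := exists_eq_sum_X_mul f (by
      rw [← MvPowerSeries.coeff_zero_eq_constantCoeff_apply]
      exact h 0 (by simp))
    rw [hg, pow_succ']
    refine sum_mem fun i _ => Ideal.mul_mem_mul ?_ (ih _ fun β hβ => hg' i β (h _ ?_))
    · rw [mem_maxIdeal, MvPowerSeries.constantCoeff_X]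
    · rw [map_add, Finsupp.degree_single]; omega

theorem coeff_eq_zero_of_mem_maxIdeal_pow (p : ℕ) {f : MvPowerSeries σ 𝕜}
    (hf : f ∈ maxIdeal σ 𝕜 ^ p) {α : σ →₀ ℕ} (h : α.degree < p) :
    MvPowerSeries.coeff α f = 0 := by
  classical
  induction p generalizing f α with
  | zero => omega
  | succ p ih =>
    rw [pow_succ'] at hf
    refine Submodule.mul_induction_on hf (fun a ha b hb => ?_) (fun x y hx hy => ?_)
    · rw [MvPowerSeries.coeff_mul]
      refine Finset.sum_eq_zero fun x hx => ?_
      rw [Finset.HasAntidiagonal.mem_antidiagonal] at hx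
      by_cases h1 : x.1 = 0
      · rw [h1, MvPowerSeries.coeff_zero_eq_constantCoeff_apply, mem_maxIdeal.1 ha, zero_mul]
      · have h2 : 0 < x.1.degree := by
          rw [Nat.pos_iff_ne_zero, Ne, Finsupp.degree_eq_zero_iff]; exact h1
        have h3 := congrArg Finsupp.degree hx
        rw [map_add] at h3
        rw [ih hb (by omega), mul_zero]
    · rw [map_add, hx, hy, add_zero]

theorem homogeneousComponent_mem {I : Ideal (MvPowerSeries σ 𝕜)} (hI : IsHomogeneousIdeal I)
    {f : MvPowerSeries σ 𝕜} (hf : f ∈ I) (q : ℕ) :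
    MvPowerSeries.homogeneousComponent q f ∈ I := by
  classical
  obtain ⟨S, hS, rfl⟩ := hI
  have key : ∀ a s : MvPowerSeries σ 𝕜, s ∈ S →
      MvPowerSeries.homogeneousComponent q (a * s) ∈ Ideal.span S := by
    intro a s hs
    obtain ⟨p, hp⟩ := hS s hs
    -- A generator of degree `p` selects the component of `a` of degree `q - p`; the case
    -- distinction guards against truncated subtraction.
    have e : MvPowerSeries.homogeneousComponent q (a * s) =
        (if p ≤ q then MvPowerSeries.homogeneousComponent (q - p) a else 0) * s := by
      ext α
      rw [MvPowerSeries.coeff_homogeneousComponent, MvPowerSeries.coeff_mul,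
        MvPowerSeries.coeff_mul]
      have hx : ∀ x ∈ Finset.HasAntidiagonal.antidiagonal α, MvPowerSeries.coeff x.1
          (if p ≤ q then MvPowerSeries.homogeneousComponent (q - p) a else 0) *
            MvPowerSeries.coeff x.2 s =
          if α.degree = q then MvPowerSeries.coeff x.1 a * MvPowerSeries.coeff x.2 s else 0 := by
        intro x hx
        rw [Finset.HasAntidiagonal.mem_antidiagonal] at hx
        have hd := congrArg Finsupp.degree hx
        rw [map_add] at hd
        by_cases h2 : x.2.degree = p
        · by_cases h1 : p ≤ q
          · rw [if_pos h1, MvPowerSeries.coeff_homogeneousComponent]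
            by_cases h3 : α.degree = q
            · rw [if_pos h3, if_pos (by omega)]
            · rw [if_neg h3, if_neg (by omega), zero_mul]
          · rw [if_neg h1, if_neg (by omega), map_zero, zero_mul]
        · rw [hp.coeff_eq_zero h2, mul_zero, mul_zero, ite_self]
      rw [Finset.sum_congr rfl hx]
      split_ifs
      · rfl
      · rw [Finset.sum_const_zero]
    rw [e]
    exact Ideal.mul_mem_left _ _ (Ideal.subset_span hs)
  refine Submodule.span_induction (p := fun f _ => ∀ a,
    MvPowerSeries.homogeneousComponent q (a * f) ∈ Ideal.span S) ?_ ?_ ?_ ?_ hf 1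
    |> fun h => by rwa [one_mul] at h
  · exact fun s hs a => key a s hs
  · intro a; rw [mul_zero, map_zero]; exact zero_mem _
  · intro x y _ _ hx hy a
    rw [mul_add, map_add]
    exact add_mem (hx a) (hy a)
  · intro c x _ hx a
    rw [smul_eq_mul, ← mul_assoc]
    exact hx _

end PowerSeries

/-! ### Necessity and sufficiency of the relations -/

section Integrability

variable {σ : Type}

/-- The failure of the homomorphism condition. -/
def curvature (ρ : Vect n → OpSeries σ 𝕜 n) (X Y : Vect n) : OpSeries σ 𝕜 n :=
  ρ X * ρ Y - ρ Y * ρ X - ρ (bracket X Y)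

theorem constantCoeff_firstOrder {t : Param n → MvPowerSeries σ 𝕜}
    (ht : ∀ p, MvPowerSeries.constantCoeff (t p) = 0) (X : Vect n) :
    MvPowerSeries.constantCoeff (firstOrder t X) = lieDerivative X := by
  classical
  rw [← MvPowerSeries.coeff_zero_eq_constantCoeff_apply, coeff_firstOrder,
    MvPowerSeries.coeff_zero_C]
  simp [MvPowerSeries.coeff_zero_eq_constantCoeff_apply, ht]

theorem exists_cochain_firstOrder (t : Param n → MvPowerSeries σ 𝕜) (α : σ →₀ ℕ) :
    ∃ c ∈ Cochain 𝕜 n, ∀ X, MvPowerSeries.coeff α (firstOrder t X) = c X := by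
  classical
  refine ⟨(if α = 0 then lieC 𝕜 n else 0) + ∑ p, MvPowerSeries.coeff α (t p) • coc p,
    add_mem ?_ (Submodule.sum_mem _ fun p _ => Submodule.smul_mem _ _ (coc_mem p)), fun X => ?_⟩
  · split_ifs
    · exact lieC_mem
    · exact zero_mem _
  · rw [coeff_firstOrder, MvPowerSeries.coeff_C, LinearMap.add_apply, LinearMap.sum_apply]
    congr 1
    split_ifs <;> rfl

theorem isDiffCochain_firstOrder (t : Param n → MvPowerSeries σ 𝕜) (α : σ →₀ ℕ) :
    IsDiffCochain fun X : Vect n => MvPowerSeries.coeff α (firstOrder t X) := by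
  obtain ⟨c, hc, h⟩ := exists_cochain_firstOrder (n := n) t α
  rw [show (fun X : Vect n => MvPowerSeries.coeff α (firstOrder t X)) = c from funext h]
  exact isDiffCochain_of_mem hc

theorem isDeformation_firstOrder {J : Ideal (MvPowerSeries σ 𝕜)} {t : Param n → MvPowerSeries σ 𝕜}
    (ht : ∀ p, MvPowerSeries.constantCoeff (t p) = 0) (h : ∀ r, relation t r ∈ J) :
    IsDeformation J (firstOrder (n := n) t) where
  differentiable := isDiffCochain_firstOrder t
  constantCoeff_eq := constantCoeff_firstOrder ht
  hom X Y := by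
    rw [CongrMod, curvature_firstOrder]
    exact sum_mem fun r _ => scalars_mul_mem (h r) _

theorem sum_serL_curvature_firstOrder (t : Param n → MvPowerSeries σ 𝕜) {r : Rel n}
    {X Y : Fin 2 → Vect n} {l : Fin 2 → (Module.End 𝕜 (Form 𝕜 n) →ₗ[𝕜] 𝕜)}
    (hl : ∀ r', ∑ i, l i (curvRel (X i) (Y i) r') = if r' = r then 1 else 0) :
    ∑ i, serL (l i) (curvature (firstOrder t) (X i) (Y i)) = relation t r := by
  have e : ∀ i, serL (l i) (curvature (firstOrder t) (X i) (Y i)) =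
      ∑ r', relation t r' * MvPowerSeries.C (l i (curvRel (X i) (Y i) r')) := fun i => by
    rw [curvature, curvature_firstOrder, map_sum]
    simp only [serL_scalars_mul, serL_C]
  rw [Finset.sum_congr rfl fun i _ => e i, Finset.sum_comm]
  simp only [← Finset.mul_sum, ← map_sum, hl]
  rw [Finset.sum_eq_single r]
  · simp
  · intro r' _ h; simp [h]
  · simp

theorem isDeformation_firstOrder_iff (hn : 2 ≤ n) {J : Ideal (MvPowerSeries σ 𝕜)}
    {t : Param n → MvPowerSeries σ 𝕜} (ht : ∀ p, MvPowerSeries.constantCoeff (t p) = 0) :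
    IsDeformation J (firstOrder (n := n) t) ↔ ∀ r, relation t r ∈ J := by
  refine ⟨fun h r => ?_, isDeformation_firstOrder ht⟩
  obtain ⟨X, Y, l, -, hl⟩ := exists_relTest (𝕜 := 𝕜) hn r
  rw [← sum_serL_curvature_firstOrder t hl]
  exact sum_mem fun i _ => serL_mem _ (h.hom _ _)

theorem IsDiffCochain.map_zero {c : Vect n → Module.End 𝕜 (Form 𝕜 n)} (hc : IsDiffCochain c) :
    c 0 = 0 := by
  obtain ⟨c', -, h⟩ := hc.exists_mem
  rw [h, _root_.map_zero]

/-- The leading term of the difference of the curvatures of two families. -/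
theorem coeff_curvature_sub {ρ ρ' : Vect n → OpSeries σ 𝕜 n}
    (hρ : ∀ X, MvPowerSeries.constantCoeff (ρ X) = lieDerivative X)
    (hρ' : ∀ X, MvPowerSeries.constantCoeff (ρ' X) = lieDerivative X) {α : σ →₀ ℕ}
    (h : ∀ X, ∀ β < α, MvPowerSeries.coeff β (ρ X - ρ' X) = 0) (X Y : Vect n) :
    MvPowerSeries.coeff α (curvature ρ X Y - curvature ρ' X Y) =
      cobd₂ (fun X => MvPowerSeries.coeff α (ρ X - ρ' X)) X Y := by
  -- Regrouped so that every product contains one difference of the families; at its leading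
  -- exponent only the constant term of the other factor counts, and that is a Lie derivative.
  have e : curvature ρ X Y - curvature ρ' X Y =
      (ρ X * (ρ Y - ρ' Y) - (ρ Y - ρ' Y) * ρ' X) -
      (ρ Y * (ρ X - ρ' X) - (ρ X - ρ' X) * ρ' Y) - (ρ (bracket X Y) - ρ' (bracket X Y)) := by
    rw [curvature, curvature]; noncomm_ring
  rw [e, map_sub, map_sub, map_sub, map_sub, coeff_mul_of_right (h Y), coeff_mul_of_left (h Y),
    coeff_mul_of_right (h X), coeff_mul_of_left (h X), hρ, hρ, hρ', hρ']
  rfl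

/-- Through total degree two the curvature differs from that of the family of order one only by the
coboundary of a coefficient, which the evaluations do not see. -/
theorem coeff_sum_serL_curvature {ρ : Vect n → OpSeries σ 𝕜 n} {J : Ideal (MvPowerSeries σ 𝕜)}
    (hρ : IsDeformation J ρ) {t : Param n → MvPowerSeries σ 𝕜}
    (ht : ∀ p, MvPowerSeries.constantCoeff (t p) = 0)
    (h : ∀ X (α : σ →₀ ℕ), α.degree ≤ 1 →
      MvPowerSeries.coeff α (ρ X) = MvPowerSeries.coeff α (firstOrder t X)) {r : Rel n}
    {X Y : Fin 2 → Vect n} {l : Fin 2 → (Module.End 𝕜 (Form 𝕜 n) →ₗ[𝕜] 𝕜)}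
    (hb : ∀ b : Vect n → Module.End 𝕜 (Form 𝕜 n), b 0 = 0 → ∑ i, l i (cobd₂ b (X i) (Y i)) = 0)
    (hl : ∀ r', ∑ i, l i (curvRel (X i) (Y i) r') = if r' = r then 1 else 0) {α : σ →₀ ℕ}
    (hα : α.degree < 3) :
    MvPowerSeries.coeff α (∑ i, serL (l i) (curvature ρ (X i) (Y i))) =
      MvPowerSeries.coeff α (relation t r) := by
  rw [← sum_serL_curvature_firstOrder t hl, ← sub_eq_zero, ← map_sub, ← Finset.sum_sub_distrib,
    map_sum]
  have h' : ∀ X, ∀ β < α, MvPowerSeries.coeff β (ρ X - firstOrder t X) = 0 := by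
    intro X β hβ
    rw [map_sub, h X β, sub_self]
    have := degree_lt_of_lt hβ
    omega
  simp only [← map_sub, coeff_serL]
  simp only [coeff_curvature_sub hρ.constantCoeff_eq (constantCoeff_firstOrder ht) h']
  refine hb _ ?_
  rw [map_sub, (hρ.differentiable α).map_zero, (isDiffCochain_firstOrder t α).map_zero, sub_zero]

theorem constantCoeff_X' (p : Param n) :
    MvPowerSeries.constantCoeff (MvPowerSeries.X p : MvPowerSeries (Param n) 𝕜) = 0 :=
  MvPowerSeries.constantCoeff_X p

/-- The evaluated curvature lies in `I` and agrees with the relation up to cubic terms. -/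
theorem Integrates.quadRel_mem (hn : 2 ≤ n) {I : Ideal (MvPowerSeries (Param n) 𝕜)}
    (h : Integrates I (infDeformation 𝕜 n)) (r : Rel n) :
    quadRel 𝕜 n r ∈ I ⊔ maxIdeal (Param n) 𝕜 ^ 3 := by
  obtain ⟨ρ, hρ, hle⟩ := h
  obtain ⟨X, Y, l, hb, hl⟩ := exists_relTest (𝕜 := 𝕜) hn r
  have h1 : ∑ i, serL (l i) (curvature ρ (X i) (Y i)) ∈ I :=
    sum_mem fun i _ => serL_mem _ (hρ.hom _ _)
  rw [← sub_sub_cancel (∑ i, serL (l i) (curvature ρ (X i) (Y i))) (quadRel 𝕜 n r)]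
  refine sub_mem (Ideal.mem_sup_left h1) (Ideal.mem_sup_right (mem_maxIdeal_pow _ _ fun α hα => ?_))
  rw [map_sub, coeff_sum_serL_curvature hρ constantCoeff_X' hle hb hl hα]
  exact sub_self _

theorem isHomogeneous_quadRel (r : Rel n) : (quadRel 𝕜 n r).IsHomogeneous 2 := by
  have hX : ∀ p : Param n, (MvPowerSeries.X p : MvPowerSeries (Param n) 𝕜).IsHomogeneous 1 := by
    classical
    intro p α hα
    rw [MvPowerSeries.coeff_X] at hα
    have : α = Finsupp.single p 1 := by by_contra h; exact hα (if_neg h)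
    rw [this]; simp [Finsupp.weight_single]
  have hm : ∀ p q p' q' : Param n, (MvPowerSeries.X p * MvPowerSeries.X q +
      MvPowerSeries.X p' * MvPowerSeries.X q' : MvPowerSeries (Param n) 𝕜).IsHomogeneous 2 :=
    fun p q p' q' => MvPowerSeries.IsHomogeneous.add
      (MvPowerSeries.IsHomogeneous.mul (@hX p) (@hX q))
      (MvPowerSeries.IsHomogeneous.mul (@hX p') (@hX q'))
  cases r <;> exact @hm _ _ _ _

theorem integrates_iff_of_homogeneous (hn : 2 ≤ n) {I : Ideal (MvPowerSeries (Param n) 𝕜)}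
    (hI : IsHomogeneousIdeal I) :
    Integrates I (infDeformation 𝕜 n) ↔ ∀ r, quadRel 𝕜 n r ∈ I := by
  refine ⟨fun h r => ?_, fun h => ⟨_, isDeformation_firstOrder constantCoeff_X' h,
    fun _ _ _ => rfl⟩⟩
  obtain ⟨a, ha, b, hb, hab⟩ := Submodule.mem_sup.1 (h.quadRel_mem hn r)
  -- The relation is its own component of degree two. The cubic part contributes nothing to it, and
  -- homogeneity of `I` keeps the rest inside `I`.
  rw [MvPowerSeries.isHomogeneous_iff_eq_homogeneousComponent.1 (isHomogeneous_quadRel r), ← hab,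
    map_add]
  have : MvPowerSeries.homogeneousComponent 2 b = 0 := by
    ext α
    rw [MvPowerSeries.coeff_homogeneousComponent]
    split_ifs with h2
    · exact coeff_eq_zero_of_mem_maxIdeal_pow 3 hb (by omega)
    · rfl
  rw [this, add_zero]
  exact homogeneousComponent_mem hI ha 2

theorem relation_C_mul (c : Param n → 𝕜) (f : MvPowerSeries σ 𝕜) (r : Rel n) :
    relation (fun p => MvPowerSeries.C (c p) * f) r =
      MvPowerSeries.C (relation c r) * (f * f) := by
  cases r <;> simp only [relation, map_add, map_mul] <;> ring

theorem integrates_line_iff (hn : 2 ≤ n) (c : Param n → 𝕜) :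
    Integrates (⊥ : Ideal (MvPowerSeries Unit 𝕜))
      (firstOrder (n := n) fun p => MvPowerSeries.C (c p) * MvPowerSeries.X ()) ↔
      ∀ r, relation c r = 0 := by
  classical
  have ht : ∀ p, MvPowerSeries.constantCoeff
      (MvPowerSeries.C (c p) * MvPowerSeries.X () : MvPowerSeries Unit 𝕜) = 0 := fun p => by simp
  refine ⟨?_, fun h => ⟨_, isDeformation_firstOrder ht fun r => ?_, fun _ _ _ => rfl⟩⟩
  · rintro ⟨ρ, hρ, hle⟩ r
    obtain ⟨X, Y, l, hb, hl⟩ := exists_relTest (𝕜 := 𝕜) hn r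
    have h1 : ∑ i, serL (l i) (curvature ρ (X i) (Y i)) ∈ (⊥ : Ideal (MvPowerSeries Unit 𝕜)) :=
      sum_mem fun i _ => serL_mem _ (hρ.hom _ _)
    -- Along a line the relation is its value at `c` times `h²`, so this single coefficient decides.
    have h2 := coeff_sum_serL_curvature hρ ht hle hb hl (α := Finsupp.single () 2) (by simp)
    rw [Ideal.mem_bot.1 h1, relation_C_mul, MvPowerSeries.coeff_C_mul, ← pow_two,
      MvPowerSeries.coeff_X_pow, if_pos rfl, mul_one, map_zero] at h2
    exact h2.symm
  · rw [relation_C_mul, h, map_zero, zero_mul]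
    exact zero_mem _

end Integrability

/-! ### Leading exponents and division -/

/-- Choice by well-founded recursion: a condition depends only on the values up to its index, so it
survives the later choices. -/
theorem exists_of_wellFounded {ι W D : Type*} [Inhabited D] [LinearOrder W] [WellFoundedLT W]
    {o : ι → W} (ho : Function.Injective o) [DecidableEq ι] (P : ι → (ι → D) → Prop)
    (hloc : ∀ a z z', (∀ b, o b ≤ o a → z b = z' b) → P a z → P a z')
    (hstep : ∀ a z, (∀ b, o b < o a → P b z) → ∃ v, P a (Function.update z a v)) :
    ∃ z, ∀ a, P a z := by
  classical
  have wf : WellFounded fun a b : ι => o a < o b := InvImage.wf o wellFounded_lt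
  -- Values not yet chosen are filled with a default, which no condition at an earlier index can
  -- notice.
  let F : ∀ a : ι, (∀ b, o b < o a → D) → D := fun a x =>
    if hv : ∃ v, P a (Function.update (fun b => if h : o b < o a then x b h else default) a v) then
      hv.choose else default
  let z : ι → D := wf.fix F
  have hz : ∀ a, z a = F a fun b _ => z b := fun a => wf.fix_eq F a
  refine ⟨z, fun a => ?_⟩
  induction a using wf.induction with
  | _ a ih =>
  have hex : ∃ v, P a (Function.update (fun b => if h : o b < o a then z b else default) a v) := by
    refine hstep a _ fun b hb => hloc b z _ (fun b' hb' => ?_) (ih b hb)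
    rw [dif_pos (hb'.trans_lt hb)]
  have hza : z a = hex.choose := by
    rw [hz]
    exact dif_pos hex
  refine hloc a _ z (fun b hb => ?_) hex.choose_spec
  by_cases hba : b = a
  · rw [hba, Function.update_self, hza]
  · rw [Function.update_of_ne hba, dif_pos (lt_of_le_of_ne hb fun h => hba (ho h))]

theorem eq_zero_of_forall_linearMap {V : Type*} [AddCommGroup V] [Module 𝕜 V] {v : V}
    (h : ∀ l : V →ₗ[𝕜] 𝕜, l v = 0) : v = 0 :=
  (Module.forall_dual_apply_eq_zero_iff 𝕜 v).1 h

section Division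

/-- The formal power series with given coefficients. -/
def opSeries {σ : Type} (p : (σ →₀ ℕ) → Module.End 𝕜 (Form 𝕜 n)) : OpSeries σ 𝕜 n := p

theorem coeff_opSeries {σ : Type} (p : (σ →₀ ℕ) → Module.End 𝕜 (Form 𝕜 n)) (α : σ →₀ ℕ) :
    MvPowerSeries.coeff α (opSeries p) = p α := rfl

variable {σ : Type} (mo : MonomialOrder σ) (J : Ideal (MvPowerSeries σ 𝕜))

/-- The leading exponents of the elements of an ideal of formal power series. -/
def leadSet : Set (σ →₀ ℕ) :=
  {α | ∃ f ∈ J, MvPowerSeries.coeff α f = 1 ∧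
    ∀ β, mo.toSyn β < mo.toSyn α → MvPowerSeries.coeff β f = 0}

variable {mo J}

theorem mem_leadSet {f : MvPowerSeries σ 𝕜} (hf : f ∈ J) {α : σ →₀ ℕ}
    (h : MvPowerSeries.coeff α f ≠ 0)
    (h' : ∀ β, mo.toSyn β < mo.toSyn α → MvPowerSeries.coeff β f = 0) : α ∈ leadSet mo J :=
  ⟨MvPowerSeries.C (MvPowerSeries.coeff α f)⁻¹ * f, J.mul_mem_left _ hf,
    by rw [MvPowerSeries.coeff_C_mul, inv_mul_cancel₀ h],
    fun β hβ => by rw [MvPowerSeries.coeff_C_mul, h' β hβ, mul_zero]⟩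

/-- If a functional detected the coefficient, it would carry the series to an element of `J` with
leading exponent `α`. So operator coefficients create no new leading exponents. -/
theorem coeff_eq_zero_of_notMem_leadSet {a : OpSeries σ 𝕜 n} (ha : a ∈ J.map scalars)
    {α : σ →₀ ℕ} (hα : α ∉ leadSet mo J)
    (h : ∀ β, mo.toSyn β < mo.toSyn α → MvPowerSeries.coeff β a = 0) :
    MvPowerSeries.coeff α a = 0 := by
  refine eq_zero_of_forall_linearMap (𝕜 := 𝕜) fun l => ?_
  by_contra hl
  exact hα (mem_leadSet (serL_mem l ha) hl fun β hβ => by rw [coeff_serL, h β hβ, map_zero])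

variable (mo J)

/-- A standard basis in parametrized form: any family `p` of operators is turned, by a triangular
rule, into a series in `J` times operators, and at each leading exponent `α` the value of `p` at `α`
enters with coefficient one. Coefficients at leading exponents can therefore be prescribed one after
the other. Only finitely many generators are used, so the series lies in the generated ideal
although the operators form an infinite-dimensional space. -/
theorem exists_division (n : ℕ) [Finite σ] : ∃ c : (σ →₀ ℕ) → (σ →₀ ℕ) →₀ 𝕜,
    (∀ α β, c α β ≠ 0 → mo.toSyn β ≤ mo.toSyn α) ∧ (∀ α ∈ leadSet mo J, c α α = 1) ∧
    ∀ p : (σ →₀ ℕ) → Module.End 𝕜 (Form 𝕜 n),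
      opSeries (fun α => Finsupp.linearCombination 𝕜 p (c α)) ∈ J.map scalars := by
  classical
  -- Dickson's lemma: the minimal leading exponents are finitely many, and every leading exponent
  -- lies above one of them.
  set M : Set (σ →₀ ℕ) := {μ | Minimal (· ∈ leadSet mo J) μ} with hM
  have hfin : M.Finite := by
    have hac : IsAntichain (· ≤ ·) M := setOfPred_minimal_antichain _
    exact hac.finite_of_partiallyWellOrderedOn (Set.isPWO_of_wellQuasiOrderedLE M)
  have hidx : ∀ α : σ →₀ ℕ, ∃ μ : σ →₀ ℕ, α ∈ leadSet mo J → μ ∈ M ∧ μ ≤ α := by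
    intro α
    by_cases hα : α ∈ leadSet mo J
    · obtain ⟨μ, h1, h2⟩ := (Set.isPWO_of_wellQuasiOrderedLE (leadSet mo J)).exists_le_minimal hα
      exact ⟨μ, fun _ => ⟨h2, h1⟩⟩
    · exact ⟨0, fun h => absurd h hα⟩
  choose idx hidx using hidx
  have hf : ∀ μ : σ →₀ ℕ, ∃ f ∈ J, μ ∈ M → MvPowerSeries.coeff μ f = 1 ∧
      ∀ β, mo.toSyn β < mo.toSyn μ → MvPowerSeries.coeff β f = 0 := by
    intro μ
    by_cases hμ : μ ∈ M
    · obtain ⟨f, h1, h2⟩ := hμ.prop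
      exact ⟨f, h1, fun _ => h2⟩
    · exact ⟨0, zero_mem _, fun h => absurd h hμ⟩
  choose f hfJ hf using hf
  -- These are the coefficients of the sum of the generators `f μ`, each multiplied by the terms of
  -- `p` whose exponent is assigned to `μ`.
  let c : (σ →₀ ℕ) → (σ →₀ ℕ) →₀ 𝕜 := fun α =>
    ∑ μ ∈ hfin.toFinset, ∑ x ∈ Finset.HasAntidiagonal.antidiagonal α,
      if idx (x.2 + μ) = μ then Finsupp.single (x.2 + μ) (MvPowerSeries.coeff x.1 (f μ)) else 0
  have hc : ∀ α β, c α β = ∑ μ ∈ hfin.toFinset, ∑ x ∈ Finset.HasAntidiagonal.antidiagonal α,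
      if idx (x.2 + μ) = μ ∧ x.2 + μ = β then MvPowerSeries.coeff x.1 (f μ) else 0 := by
    intro α β
    simp only [c, Finsupp.finsetSum_apply]
    refine Finset.sum_congr rfl fun μ _ => Finset.sum_congr rfl fun x _ => ?_
    by_cases h1 : idx (x.2 + μ) = μ
    · simp only [h1, if_true, true_and, Finsupp.single_apply]
    · simp only [h1, if_false, false_and, Finsupp.zero_apply]
  refine ⟨c, fun α β h => ?_, fun α hα => ?_, fun p => ?_⟩
  · rw [hc] at h
    obtain ⟨μ, hμ, h⟩ := Finset.exists_ne_zero_of_sum_ne_zero h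
    obtain ⟨x, hx, h⟩ := Finset.exists_ne_zero_of_sum_ne_zero h
    rw [Finset.HasAntidiagonal.mem_antidiagonal] at hx
    have h1 : idx (x.2 + μ) = μ ∧ x.2 + μ = β := by by_contra h'; exact h (if_neg h')
    rw [if_pos h1] at h
    have h2 : mo.toSyn μ ≤ mo.toSyn x.1 := by
      by_contra h'
      exact h ((hf μ (hfin.mem_toFinset.1 hμ)).2 _ (not_le.1 h'))
    rw [← h1.2, ← hx, map_add, map_add, add_comm]
    exact add_le_add_left h2 _
  · obtain ⟨h1, h2⟩ := hidx α hα
    -- On the diagonal only the generator assigned to `α` contributes, through its leading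
    -- coefficient.
    rw [hc, Finset.sum_eq_single (idx α), Finset.sum_eq_single (idx α, α - idx α)]
    · simp only [tsub_add_cancel_of_le h2, and_self, if_true]
      exact (hf _ h1).1
    · rintro ⟨a, b⟩ hx hne
      rw [Finset.HasAntidiagonal.mem_antidiagonal] at hx
      refine if_neg fun h => hne ?_
      have hb : b + idx α = α := h.2
      have hab : a + b = α := hx
      have hb' : b = α - idx α := (tsub_eq_of_eq_add hb.symm).symm
      have ha : a = idx α := by
        have : a + b = idx α + b := by rw [hab, add_comm, hb]
        exact add_right_cancel this
      rw [ha, hb']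
    · intro h
      exact absurd (Finset.HasAntidiagonal.mem_antidiagonal.2 (add_tsub_cancel_of_le h2)) h
    · intro μ _ hμ
      refine Finset.sum_eq_zero fun x _ => if_neg fun h => hμ ?_
      rw [← h.1, h.2]
    · intro h
      exact absurd (hfin.mem_toFinset.2 h1) h
  · have e : opSeries (fun α => Finsupp.linearCombination 𝕜 p (c α)) =
        ∑ μ ∈ hfin.toFinset, scalars (f μ) *
          opSeries (fun b => if idx (b + μ) = μ then p (b + μ) else 0) := by
      ext1 α
      rw [map_sum, coeff_opSeries]
      simp only [c, map_sum]
      refine Finset.sum_congr rfl fun μ _ => ?_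
      rw [coeff_scalars_mul]
      refine Finset.sum_congr rfl fun x _ => ?_
      rw [coeff_opSeries]
      split_ifs
      · rw [Finsupp.linearCombination_single]
      · rw [map_zero, smul_zero]
    rw [e]
    exact sum_mem fun μ _ => scalars_mul_mem (hfJ μ) _

end Division

/-! ### Congruence and conjugation of curvatures -/

section CoeffLemmas

variable {σ : Type}

theorem coeff_mul_congr {R : Type*} [Semiring R] {f f' g g' : MvPowerSeries σ R} {α : σ →₀ ℕ}
    (hf : ∀ β ≤ α, MvPowerSeries.coeff β f = MvPowerSeries.coeff β f')
    (hg : ∀ β ≤ α, MvPowerSeries.coeff β g = MvPowerSeries.coeff β g') :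
    MvPowerSeries.coeff α (f * g) = MvPowerSeries.coeff α (f' * g') := by
  classical
  rw [MvPowerSeries.coeff_mul, MvPowerSeries.coeff_mul]
  refine Finset.sum_congr rfl fun x hx => ?_
  rw [Finset.HasAntidiagonal.mem_antidiagonal] at hx
  rw [hf _ (hx ▸ le_self_add), hg _ (hx ▸ le_add_self)]

theorem curvature_congr {J : Ideal (MvPowerSeries σ 𝕜)} {ρ ρ' : Vect n → OpSeries σ 𝕜 n}
    (h : ∀ X, CongrMod J (ρ X) (ρ' X)) (X Y : Vect n) :
    CongrMod J (curvature ρ X Y) (curvature ρ' X Y) := by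
  have e : curvature ρ X Y - curvature ρ' X Y =
      (ρ X * (ρ Y - ρ' Y) - (ρ Y - ρ' Y) * ρ' X) -
      (ρ Y * (ρ X - ρ' X) - (ρ X - ρ' X) * ρ' Y) - (ρ (bracket X Y) - ρ' (bracket X Y)) := by
    rw [curvature, curvature]; noncomm_ring
  rw [CongrMod, e]
  exact sub_mem (sub_mem (sub_mem (Ideal.mul_mem_left _ _ (h Y)) (map_mul_mem (h Y) _))
    (sub_mem (Ideal.mul_mem_left _ _ (h X)) (map_mul_mem (h X) _))) (h _)

theorem curvature_conj (ρ : Vect n → OpSeries σ 𝕜 n) {U V : OpSeries σ 𝕜 n} (h : V * U = 1)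
    (X Y : Vect n) : curvature (fun X => U * ρ X * V) X Y = U * curvature ρ X Y * V := by
  have e : ∀ a b, U * a * V * (U * b * V) = U * (a * b) * V := fun a b => by
    calc U * a * V * (U * b * V) = U * a * (V * U) * b * V := by simp only [mul_assoc]
      _ = U * (a * b) * V := by rw [h]; simp only [mul_assoc, mul_one]
  simp only [curvature, e, mul_sub, sub_mul]

theorem curvature_mem {J : Ideal (MvPowerSeries σ 𝕜)} {ρ : Vect n → OpSeries σ 𝕜 n}
    (h : IsDeformation J ρ) (X Y : Vect n) : curvature ρ X Y ∈ J.map scalars := h.hom X Y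

end CoeffLemmas

/-! ### Reduction of a deformation to order one -/

/-! ### Closure properties of differentiable cochains -/

section CochainClosure

theorem isDiffCochain_iff {c : Vect n → Module.End 𝕜 (Form 𝕜 n)} :
    IsDiffCochain c ↔ ∃ c' ∈ Cochain 𝕜 n, ∀ X, c X = c' X := by
  refine ⟨IsDiffCochain.exists_mem, fun ⟨c', h, e⟩ => ?_⟩
  rw [show c = c' from funext e]
  exact isDiffCochain_of_mem h

theorem IsDiffCochain.sub {c c' : Vect n → Module.End 𝕜 (Form 𝕜 n)} (hc : IsDiffCochain c)
    (hc' : IsDiffCochain c') : IsDiffCochain fun X => c X - c' X := by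
  obtain ⟨a, ha, h⟩ := hc.exists_mem
  obtain ⟨a', ha', h'⟩ := hc'.exists_mem
  exact isDiffCochain_iff.2 ⟨a - a', sub_mem ha ha', fun X => by rw [h, h']; rfl⟩

theorem isDiffCochain_zero : IsDiffCochain fun _ : Vect n => (0 : Module.End 𝕜 (Form 𝕜 n)) :=
  isDiffCochain_iff.2 ⟨0, zero_mem _, fun _ => rfl⟩

theorem IsDiffCochain.smul {c : Vect n → Module.End 𝕜 (Form 𝕜 n)} (hc : IsDiffCochain c) (k : 𝕜) :
    IsDiffCochain fun X => k • c X := by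
  obtain ⟨a, ha, h⟩ := hc.exists_mem
  exact isDiffCochain_iff.2 ⟨k • a, Submodule.smul_mem _ _ ha, fun X => by rw [h]; rfl⟩

theorem IsDiffCochain.sum {ι : Type*} {s : Finset ι} {c : ι → Vect n → Module.End 𝕜 (Form 𝕜 n)}
    (hc : ∀ i ∈ s, IsDiffCochain (c i)) : IsDiffCochain fun X => ∑ i ∈ s, c i X := by
  classical
  induction s using Finset.induction_on with
  | empty => simpa using isDiffCochain_zero
  | insert i s hi ih =>
    obtain ⟨a, ha, h⟩ := (hc i (Finset.mem_insert_self i s)).exists_mem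
    obtain ⟨a', ha', h'⟩ := (ih fun j hj => hc j (Finset.mem_insert_of_mem hj)).exists_mem
    exact isDiffCochain_iff.2 ⟨a + a', add_mem ha ha', fun X => by
      rw [Finset.sum_insert hi, h, h']; rfl⟩

theorem IsDiffCochain.mul_left {c : Vect n → Module.End 𝕜 (Form 𝕜 n)} (hc : IsDiffCochain c)
    {P : Module.End 𝕜 (Form 𝕜 n)} (hP : P ∈ DiffOp 𝕜 n) : IsDiffCochain fun X => P * c X := by
  obtain ⟨a, ha, h⟩ := hc.exists_mem
  exact isDiffCochain_iff.2 ⟨lmulC P a, lmulC_mem hP ha, fun X => by rw [h]; rfl⟩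

theorem IsDiffCochain.mul_right {c : Vect n → Module.End 𝕜 (Form 𝕜 n)} (hc : IsDiffCochain c)
    {P : Module.End 𝕜 (Form 𝕜 n)} (hP : P ∈ DiffOp 𝕜 n) : IsDiffCochain fun X => c X * P := by
  obtain ⟨a, ha, h⟩ := hc.exists_mem
  exact isDiffCochain_iff.2 ⟨rmulC P a, rmulC_mem hP ha, fun X => by rw [h]; rfl⟩

theorem IsDiffCochain.exists_cobd (hn : 2 ≤ n) {c : Vect n → Module.End 𝕜 (Form 𝕜 n)}
    (hc : IsDiffCochain c) (h : ∀ X Y, cobd₂ c X Y = 0) :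
    ∃ u ∈ DiffOp 𝕜 n, ∃ t : Param n → 𝕜, ∀ X, c X = cobd u X + ∑ p, t p • coc p X := by
  obtain ⟨a, ha, e⟩ := hc.exists_mem
  obtain ⟨u, hu, t, h'⟩ := IsCocycle.exists_cobd hn (c := a) (fun X Y => by
    have := h X Y
    rw [cobd₂, e, e, e, sub_eq_zero] at this
    exact this.symm) ha
  refine ⟨u, hu, t, fun X => ?_⟩
  rw [e, h', LinearMap.add_apply, LinearMap.sum_apply]
  rfl

end CochainClosure

/-! ### Simultaneous construction of the conjugation, the parameters and the error -/

section Reduction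

variable {σ : Type}

/-- The coefficients of a conjugating operator, of the parameters, and of an error term. -/
structure ReductionCoeff (𝕜 : Type) [RCLike 𝕜] (n : ℕ) where
  /-- The coefficient of the conjugating operator. -/
  u : Module.End 𝕜 (Form 𝕜 n)
  /-- The coefficients of the parameters. -/
  t : Param n → 𝕜
  /-- The coefficient of the error term. -/
  q : Vect n → Module.End 𝕜 (Form 𝕜 n)

/-- The conjugating series. -/
def opSer (z : (σ →₀ ℕ) → ReductionCoeff 𝕜 n) : OpSeries σ 𝕜 n := opSeries fun β => (z β).u

/-- The values of the parameters. -/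
def parSer (z : (σ →₀ ℕ) → ReductionCoeff 𝕜 n) (p : Param n) : MvPowerSeries σ 𝕜 :=
  fun β => (z β).t p

/-- The error term, a combination of the elements of an ideal. -/
def errSer (c : (σ →₀ ℕ) → (σ →₀ ℕ) →₀ 𝕜) (z : (σ →₀ ℕ) → ReductionCoeff 𝕜 n) (X : Vect n) :
    OpSeries σ 𝕜 n :=
  opSeries fun α => Finsupp.linearCombination 𝕜 (fun β => (z β).q X) (c α)

theorem coeff_opSer (z : (σ →₀ ℕ) → ReductionCoeff 𝕜 n) (α : σ →₀ ℕ) :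
    MvPowerSeries.coeff α (opSer z) = (z α).u := rfl

theorem coeff_parSer (z : (σ →₀ ℕ) → ReductionCoeff 𝕜 n) (p : Param n) (α : σ →₀ ℕ) :
    MvPowerSeries.coeff α (parSer z p) = (z α).t p := rfl

theorem coeff_errSer (c : (σ →₀ ℕ) → (σ →₀ ℕ) →₀ 𝕜) (z : (σ →₀ ℕ) → ReductionCoeff 𝕜 n)
    (X : Vect n) (α : σ →₀ ℕ) :
    MvPowerSeries.coeff α (errSer c z X) = ∑ β ∈ (c α).support, c α β • (z β).q X := rfl

/-- The failure of the conjugating series to intertwine. -/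
def defect (c : (σ →₀ ℕ) → (σ →₀ ℕ) →₀ 𝕜) (ρ : Vect n → OpSeries σ 𝕜 n)
    (z : (σ →₀ ℕ) → ReductionCoeff 𝕜 n) (X : Vect n) : OpSeries σ 𝕜 n :=
  opSer z * ρ X - firstOrder (parSer z) X * opSer z - errSer c z X

variable {mo : MonomialOrder σ} {c : (σ →₀ ℕ) → (σ →₀ ℕ) →₀ 𝕜} {ρ : Vect n → OpSeries σ 𝕜 n}

theorem coeff_firstOrder_congr {t t' : Param n → MvPowerSeries σ 𝕜} {α : σ →₀ ℕ}
    (h : ∀ p, MvPowerSeries.coeff α (t p) = MvPowerSeries.coeff α (t' p)) (X : Vect n) :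
    MvPowerSeries.coeff α (firstOrder t X) = MvPowerSeries.coeff α (firstOrder t' X) := by
  simp only [coeff_firstOrder, h]

theorem coeff_defect_congr (hc : ∀ α β, c α β ≠ 0 → mo.toSyn β ≤ mo.toSyn α)
    {z z' : (σ →₀ ℕ) → ReductionCoeff 𝕜 n} {α : σ →₀ ℕ}
    (h : ∀ β, mo.toSyn β ≤ mo.toSyn α → z β = z' β) (X : Vect n) :
    MvPowerSeries.coeff α (defect c ρ z X) = MvPowerSeries.coeff α (defect c ρ z' X) := by
  have h' : ∀ β ≤ α, z β = z' β := fun β hβ => h β (mo.toSyn_monotone hβ)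
  rw [defect, defect, map_sub, map_sub, map_sub, map_sub, coeff_errSer, coeff_errSer]
  congr 1
  · congr 1
    · exact coeff_mul_congr (fun β hβ => by rw [coeff_opSer, coeff_opSer, h' β hβ])
        fun _ _ => rfl
    · exact coeff_mul_congr (fun β hβ => coeff_firstOrder_congr (fun p => by
        rw [coeff_parSer, coeff_parSer, h' β hβ]) X)
        (fun β hβ => by rw [coeff_opSer, coeff_opSer, h' β hβ])
  · exact Finset.sum_congr rfl fun β hβ => by rw [h β (hc _ _ (Finsupp.mem_support_iff.1 hβ))]

theorem isDiffCochain_coeff_defect (hc : ∀ α β, c α β ≠ 0 → mo.toSyn β ≤ mo.toSyn α)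
    (hρ : ∀ α, IsDiffCochain fun X => MvPowerSeries.coeff α (ρ X))
    {z : (σ →₀ ℕ) → ReductionCoeff 𝕜 n} {α : σ →₀ ℕ}
    (hu : ∀ β, mo.toSyn β ≤ mo.toSyn α → (z β).u ∈ DiffOp 𝕜 n)
    (hq : ∀ β, mo.toSyn β ≤ mo.toSyn α → IsDiffCochain (z β).q) :
    IsDiffCochain fun X => MvPowerSeries.coeff α (defect c ρ z X) := by
  classical
  have hu' : ∀ β ≤ α, (z β).u ∈ DiffOp 𝕜 n := fun β hβ => hu β (mo.toSyn_monotone hβ)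
  simp only [defect, map_sub, coeff_errSer, MvPowerSeries.coeff_mul, coeff_opSer]
  refine ((IsDiffCochain.sum fun x hx => ?_).sub (IsDiffCochain.sum fun x hx => ?_)).sub
    (IsDiffCochain.sum fun β hβ => ?_)
  · rw [Finset.HasAntidiagonal.mem_antidiagonal] at hx
    exact (hρ x.2).mul_left (hu' _ (hx ▸ le_self_add))
  · rw [Finset.HasAntidiagonal.mem_antidiagonal] at hx
    exact (isDiffCochain_firstOrder _ x.1).mul_right (hu' _ (hx ▸ le_add_self))
  · exact (hq β (hc _ _ (Finsupp.mem_support_iff.1 hβ))).smul _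

theorem constantCoeff_opSer {z : (σ →₀ ℕ) → ReductionCoeff 𝕜 n} (h : (z 0).u = 1) :
    MvPowerSeries.constantCoeff (opSer z) = 1 := by
  rw [← MvPowerSeries.coeff_zero_eq_constantCoeff_apply, coeff_opSer, h]

theorem constantCoeff_parSer {z : (σ →₀ ℕ) → ReductionCoeff 𝕜 n} (h : (z 0).t = 0)
    (p : Param n) : MvPowerSeries.constantCoeff (parSer z p) = 0 := by
  rw [← MvPowerSeries.coeff_zero_eq_constantCoeff_apply, coeff_parSer, h, Pi.zero_apply]

/-- The effect of changing one coefficient. -/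
theorem coeff_defect_update [DecidableEq (σ →₀ ℕ)]
    (hρ : ∀ X, MvPowerSeries.constantCoeff (ρ X) = lieDerivative X)
    {z : (σ →₀ ℕ) → ReductionCoeff 𝕜 n} {α : σ →₀ ℕ} (hα : α ≠ 0) (h0 : (z 0).u = 1)
    (h0' : (z 0).t = 0) (hz : z α = ⟨0, 0, 0⟩) (v : ReductionCoeff 𝕜 n) (X : Vect n) :
    MvPowerSeries.coeff α (defect c ρ (Function.update z α v) X) =
      MvPowerSeries.coeff α (defect c ρ z X) - cobd v.u X - ∑ p, v.t p • coc p X -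
        c α α • v.q X := by
  set z' := Function.update z α v with hz'
  have hne : ∀ β, β ≠ α → z' β = z β := fun β h => Function.update_of_ne h _ _
  have heq : z' α = v := Function.update_self _ _ _
  have hU : ∀ β < α, MvPowerSeries.coeff β (opSer z' - opSer z) = 0 := fun β hβ => by
    rw [map_sub, coeff_opSer, coeff_opSer, hne β hβ.ne, sub_self]
  have hL : ∀ β < α, MvPowerSeries.coeff β
      (firstOrder (parSer z') X - firstOrder (parSer z) X) = 0 := fun β hβ => by
    rw [map_sub, coeff_firstOrder_congr (fun p => ?_) X, sub_self]
    rw [coeff_parSer, coeff_parSer, hne β hβ.ne]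
  -- The changes start at exponent `α`, so they meet only the constant terms of their cofactors, the
  -- identity or a Lie derivative.
  have e : defect c ρ z' X = defect c ρ z X + (opSer z' - opSer z) * ρ X -
      (firstOrder (parSer z') X * (opSer z' - opSer z) +
        (firstOrder (parSer z') X - firstOrder (parSer z) X) * opSer z) -
      (errSer c z' X - errSer c z X) := by
    rw [defect, defect]; noncomm_ring
  have hE : MvPowerSeries.coeff α (errSer c z' X - errSer c z X) = c α α • v.q X := by
    rw [map_sub, coeff_errSer, coeff_errSer, ← Finset.sum_sub_distrib, Finset.sum_eq_single α]
    · have hq : (z α).q X = 0 := by rw [hz]; rfl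
      rw [heq, hq, smul_zero, sub_zero]
    · intro β _ h
      rw [hne β h, sub_self]
    · intro h
      rw [Finsupp.notMem_support_iff.1 h, zero_smul, zero_smul, sub_self]
  have hz0 : z' 0 = z 0 := hne 0 hα.symm
  rw [e, map_sub, hE, map_sub, map_add, map_add, coeff_mul_of_left hU, coeff_mul_of_right hU,
    coeff_mul_of_left hL, hρ, constantCoeff_firstOrder
      (constantCoeff_parSer (by rw [hz0, h0'])), constantCoeff_opSer h0, map_sub, map_sub,
    coeff_opSer, coeff_opSer, coeff_firstOrder, coeff_firstOrder, heq, hz, cobd_apply]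
  simp only [coeff_parSer, heq, hz, Pi.zero_apply, zero_smul, Finset.sum_const_zero, sub_zero,
    add_zero, mul_one, add_sub_cancel_left]
  abel

/-- Outside of the leading exponents of the ideal, the obstruction is a cocycle. -/
theorem cobd₂_coeff_defect (hn : 2 ≤ n) {J : Ideal (MvPowerSeries σ 𝕜)} (hρ : IsDeformation J ρ)
    (hcJ : ∀ p : (σ →₀ ℕ) → Module.End 𝕜 (Form 𝕜 n),
      opSeries (fun α => Finsupp.linearCombination 𝕜 p (c α)) ∈ J.map scalars)
    {z : (σ →₀ ℕ) → ReductionCoeff 𝕜 n} {α : σ →₀ ℕ} (hα : α ≠ 0) (hαJ : α ∉ leadSet mo J)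
    (h0 : (z 0).u = 1) (h0' : (z 0).t = 0)
    (h : ∀ β, mo.toSyn β < mo.toSyn α → ∀ X, MvPowerSeries.coeff β (defect c ρ z X) = 0)
    (hd : MvPowerSeries.coeff α (defect c ρ z 0) = 0) (X Y : Vect n) :
    cobd₂ (fun X => MvPowerSeries.coeff α (defect c ρ z X)) X Y = 0 := by
  classical
  have hU0 : MvPowerSeries.constantCoeff (opSer z) = 1 := constantCoeff_opSer h0
  have hlt : ∀ {β γ : σ →₀ ℕ}, β < γ → mo.toSyn β < mo.toSyn γ := fun h =>
    mo.toSyn_strictMono h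
  set V : OpSeries σ 𝕜 n := MvPowerSeries.invOfUnit (opSer z) 1 with hV
  have hUV : opSer z * V = 1 := MvPowerSeries.mul_invOfUnit _ 1 (by rw [hU0]; rfl)
  have hVU : V * opSer z = 1 := MvPowerSeries.invOfUnit_mul _ 1 (by rw [hU0]; rfl)
  have hV0 : MvPowerSeries.constantCoeff V = 1 := by
    rw [hV, MvPowerSeries.constantCoeff_invOfUnit]; rfl
  set L : Vect n → OpSeries σ 𝕜 n := firstOrder (parSer z) with hL
  -- Modulo `J` this is the conjugate of `ρ` by the current series, hence has curvature zero there.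
  -- Compared with the family `L` of order one, it first differs at `α`, by the defect.
  set M : Vect n → OpSeries σ 𝕜 n := fun X => L X + defect c ρ z X * V with hM
  have hML : ∀ X, M X - L X = defect c ρ z X * V := fun X => add_sub_cancel_left _ _
  have hMα : ∀ X, MvPowerSeries.coeff α (M X - L X) = MvPowerSeries.coeff α (defect c ρ z X) :=
    fun X => by
      rw [hML, coeff_mul_of_left fun β hβ => h β (hlt hβ) X, hV0, mul_one]
  have hMβ : ∀ β, mo.toSyn β < mo.toSyn α → ∀ X, MvPowerSeries.coeff β (M X - L X) = 0 :=
    fun β hβ X => by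
      rw [hML, coeff_mul_of_left fun γ hγ => h γ ((hlt hγ).trans hβ) X, h β hβ, zero_mul]
  have hL0 : ∀ X, MvPowerSeries.constantCoeff (L X) = lieDerivative X :=
    constantCoeff_firstOrder (constantCoeff_parSer h0')
  have hM0 : ∀ X, MvPowerSeries.constantCoeff (M X) = lieDerivative X := fun X => by
    have := hMβ 0 (hlt (pos_iff_ne_zero.2 hα)) X
    rw [MvPowerSeries.coeff_zero_eq_constantCoeff_apply, map_sub, sub_eq_zero] at this
    rw [this, hL0]
  have hcurv : ∀ X Y, curvature M X Y ∈ J.map scalars := fun X Y => by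
    have h1 : ∀ X, CongrMod J (M X) (opSer z * ρ X * V) := fun X => by
      have e : M X - opSer z * ρ X * V = L X * (1 - opSer z * V) - errSer c z X * V := by
        simp only [hM, defect]; noncomm_ring
      rw [CongrMod, e, hUV, sub_self, mul_zero, zero_sub]
      exact neg_mem (map_mul_mem (hcJ _) _)
    have h2 := curvature_congr h1 X Y
    rw [curvature_conj ρ hVU] at h2
    have h3 : opSer z * curvature ρ X Y * V ∈ J.map scalars :=
      map_mul_mem (Ideal.mul_mem_left _ _ (curvature_mem hρ X Y)) V
    have := add_mem h2 h3
    rwa [sub_add_cancel] at this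
  have hcβ : ∀ β, mo.toSyn β < mo.toSyn α → ∀ X Y,
      MvPowerSeries.coeff β (curvature M X Y - curvature L X Y) = 0 := fun β hβ X Y => by
    rw [coeff_curvature_sub hM0 hL0 fun X γ hγ => hMβ γ ((hlt hγ).trans hβ) X]
    simp only [cobd₂, hMβ β hβ, mul_zero, zero_mul, sub_self]
  have hcα : ∀ X Y, MvPowerSeries.coeff α (curvature M X Y - curvature L X Y) =
      cobd₂ (fun X => MvPowerSeries.coeff α (defect c ρ z X)) X Y := fun X Y => by
    rw [coeff_curvature_sub hM0 hL0 fun X γ hγ => hMβ γ (hlt hγ) X]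
    simp only [hMα]
  -- The relations need not lie in `J` yet, but through exponent `α` they agree with the evaluated
  -- curvature of `M`: the two curvatures differ there by a coboundary only, to which the
  -- evaluations are blind.
  have hq : ∀ r, ∃ q ∈ J, (∀ β, mo.toSyn β ≤ mo.toSyn α →
      MvPowerSeries.coeff β (relation (parSer z) r - q) = 0) := fun r => by
    obtain ⟨X, Y, l, hb, hl⟩ := exists_relTest (𝕜 := 𝕜) hn r
    refine ⟨∑ i, serL (l i) (curvature M (X i) (Y i)), sum_mem fun i _ => serL_mem _ (hcurv _ _),
      fun β hβ => ?_⟩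
    rw [← sum_serL_curvature_firstOrder (parSer z) hl, ← neg_eq_zero, ← map_neg, neg_sub,
      ← Finset.sum_sub_distrib, map_sum]
    have e : ∀ i, MvPowerSeries.coeff β (serL (l i) (curvature M (X i) (Y i)) -
        serL (l i) (curvature (firstOrder (parSer z)) (X i) (Y i))) =
        l i (MvPowerSeries.coeff β (curvature M (X i) (Y i) - curvature L (X i) (Y i))) :=
      fun i => by rw [← map_sub, coeff_serL]
    rw [Finset.sum_congr rfl fun i _ => e i]
    rcases hβ.lt_or_eq with hβ | hβ
    · exact Finset.sum_eq_zero fun i _ => by rw [hcβ β hβ, map_zero]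
    · rw [mo.toSyn.injective hβ]
      simp only [hcα]
      exact hb _ hd
  choose q hqJ hq using hq
  -- Replacing the relations by these elements of `J` turns the difference of curvatures into an
  -- element of the ideal without altering it through exponent `α`. It has no earlier coefficients
  -- and `α` is not a leading exponent, so its coefficient at `α`, the coboundary of the defect,
  -- vanishes.
  have hE : curvature M X Y - curvature L X Y +
      ∑ r, scalars (relation (parSer z) r - q r) * MvPowerSeries.C (curvRel X Y r) ∈
        J.map scalars := by
    have e : curvature M X Y - curvature L X Y +
        ∑ r, scalars (relation (parSer z) r - q r) * MvPowerSeries.C (curvRel X Y r) =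
        curvature M X Y - ∑ r, scalars (q r) * MvPowerSeries.C (curvRel X Y r) := by
      have : curvature L X Y = _ := curvature_firstOrder (parSer z) X Y
      rw [this]
      simp only [map_sub, sub_mul, Finset.sum_sub_distrib]
      abel
    rw [e]
    exact sub_mem (hcurv X Y) (sum_mem fun r _ => scalars_mul_mem (hqJ r) _)
  have hEβ : ∀ β, mo.toSyn β ≤ mo.toSyn α → MvPowerSeries.coeff β
      (∑ r, scalars (relation (parSer z) r - q r) * MvPowerSeries.C (curvRel X Y r) :
        OpSeries σ 𝕜 n) = 0 := fun β hβ => by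
    rw [map_sum]
    exact Finset.sum_eq_zero fun r _ => by rw [coeff_scalars_mul_C, hq r β hβ, zero_smul]
  have := coeff_eq_zero_of_notMem_leadSet hE hαJ fun β hβ => by
    rw [map_add, hcβ β hβ, hEβ β hβ.le, add_zero]
  rwa [map_add, hcα, hEβ α le_rfl, add_zero] at this

/-- Every deformation is equivalent to one of order one. -/
theorem IsDeformation.exists_firstOrder [Finite σ] [LinearOrder σ] [WellFoundedGT σ] (hn : 2 ≤ n)
    {J : Ideal (MvPowerSeries σ 𝕜)} (hρ : IsDeformation J ρ) :
    ∃ t : Param n → MvPowerSeries σ 𝕜, (∀ p, MvPowerSeries.constantCoeff (t p) = 0) ∧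
      (∀ r, relation t r ∈ J) ∧ Equivalent J ρ (firstOrder t) := by
  classical
  -- Only the general properties of a monomial order are used; its well-foundedness drives the
  -- recursion.
  let mo : MonomialOrder σ := MonomialOrder.lex
  obtain ⟨c, hc, hc1, hcJ⟩ := exists_division mo J n
  have : Inhabited (ReductionCoeff 𝕜 n) := ⟨⟨0, 0, 0⟩⟩
  let P : (σ →₀ ℕ) → ((σ →₀ ℕ) → ReductionCoeff 𝕜 n) → Prop := fun α z =>
    (z α).u ∈ DiffOp 𝕜 n ∧ IsDiffCochain (z α).q ∧ (α = 0 → (z α).u = 1 ∧ (z α).t = 0) ∧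
      ∀ X, MvPowerSeries.coeff α (defect c ρ z X) = 0
  have hz0 : (0 : Module.End 𝕜 (Form 𝕜 n)) ∈ DiffOp 𝕜 n := zero_mem _
  obtain ⟨z, hz⟩ : ∃ z, ∀ α, P α z := by
    refine exists_of_wellFounded (o := mo.toSyn) mo.toSyn.injective P (fun α z z' h hP => ?_)
      fun α z hP => ?_
    · obtain ⟨h1, h2, h3, h4⟩ := hP
      rw [h α le_rfl] at h1 h2 h3
      exact ⟨h1, h2, h3, fun X => by rw [← coeff_defect_congr hc h X, h4]⟩
    by_cases hα : α = 0
    · refine ⟨⟨1, 0, 0⟩, ?_⟩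
      subst hα
      refine ⟨?_, ?_, ?_, fun X => ?_⟩
      · rw [Function.update_self]; exact one_mem _
      · rw [Function.update_self]; exact isDiffCochain_zero
      · rw [Function.update_self]; exact fun _ => ⟨rfl, rfl⟩
      · rw [defect, map_sub, map_sub, coeff_errSer, Finset.sum_eq_zero, sub_zero,
          MvPowerSeries.coeff_zero_eq_constantCoeff_apply,
          MvPowerSeries.coeff_zero_eq_constantCoeff_apply, map_mul, map_mul,
          hρ.constantCoeff_eq, constantCoeff_firstOrder (constantCoeff_parSer (by
            rw [Function.update_self])), constantCoeff_opSer (by rw [Function.update_self]),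
          one_mul, mul_one, sub_self]
        -- The error at exponent zero involves only the datum at zero, which is chosen to be zero.
        intro β hβ
        have h1 := hc _ _ (Finsupp.mem_support_iff.1 hβ)
        rw [map_zero] at h1
        have h2 : β = 0 := mo.toSyn.injective (by
          rw [map_zero]; exact le_antisymm h1 (mo.zero_le _))
        rw [h2, Function.update_self]
        exact smul_zero _
    have hpos : mo.toSyn 0 < mo.toSyn α := mo.toSyn_strictMono (pos_iff_ne_zero.2 hα)
    -- The datum at `α` is reset, so that the defect there is exactly what the new choice has to
    -- cancel.
    set z₀ := Function.update z α ⟨0, 0, 0⟩ with hz₀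
    have hup : ∀ v, Function.update z α v = Function.update z₀ α v := fun v => by
      rw [hz₀, Function.update_idem]
    have hlt : ∀ β, mo.toSyn β < mo.toSyn α → z₀ β = z β := fun β hβ =>
      Function.update_of_ne (fun h => by rw [h] at hβ; exact lt_irrefl _ hβ) _ _
    have hself : z₀ α = ⟨0, 0, 0⟩ := Function.update_self _ _ _
    obtain ⟨h0, h0'⟩ := (hP 0 hpos).2.2.1 rfl
    rw [← hlt 0 hpos] at h0 h0'
    have hdef : ∀ β, mo.toSyn β < mo.toSyn α → ∀ X,
        MvPowerSeries.coeff β (defect c ρ z₀ X) = 0 := fun β hβ X => by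
      rw [coeff_defect_congr hc (fun γ hγ => hlt γ (hγ.trans_lt hβ)) X, (hP β hβ).2.2.2]
    have hcoch : IsDiffCochain fun X => MvPowerSeries.coeff α (defect c ρ z₀ X) := by
      refine isDiffCochain_coeff_defect hc hρ.differentiable (fun β hβ => ?_) fun β hβ => ?_
      · rcases hβ.lt_or_eq with h | h
        · rw [hlt β h]; exact (hP β h).1
        · rw [mo.toSyn.injective h, hself]; exact hz0
      · rcases hβ.lt_or_eq with h | h
        · rw [hlt β h]; exact (hP β h).2.1
        · rw [mo.toSyn.injective h, hself]; exact isDiffCochain_zero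
    -- At a leading exponent the error term absorbs the defect. Otherwise the defect is a cocycle
    -- and is split between the conjugation and the parameters.
    by_cases hαJ : α ∈ leadSet mo J
    · refine ⟨⟨0, 0, fun X => MvPowerSeries.coeff α (defect c ρ z₀ X)⟩, ?_, ?_,
        fun h => (hα h).elim, fun X => ?_⟩
      · rw [Function.update_self]; exact hz0
      · rw [Function.update_self]; exact hcoch
      · rw [hup, coeff_defect_update hρ.constantCoeff_eq hα h0 h0' hself, hc1 α hαJ, cobd_apply]
        simp
    · obtain ⟨u, hu, t, hut⟩ := hcoch.exists_cobd hn
        (cobd₂_coeff_defect hn hρ hcJ hα hαJ h0 h0' hdef hcoch.map_zero)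
      refine ⟨⟨u, t, 0⟩, ?_, ?_, fun h => (hα h).elim, fun X => ?_⟩
      · rw [Function.update_self]; exact hu
      · rw [Function.update_self]; exact isDiffCochain_zero
      · rw [hup, coeff_defect_update hρ.constantCoeff_eq hα h0 h0' hself, hut X]
        simp
  obtain ⟨h0, h0'⟩ := (hz 0).2.2.1 rfl
  have hU0 : MvPowerSeries.constantCoeff (opSer z) = 1 := constantCoeff_opSer h0
  set U : (OpSeries σ 𝕜 n)ˣ := ⟨opSer z, MvPowerSeries.invOfUnit (opSer z) 1,
    MvPowerSeries.mul_invOfUnit _ 1 (by rw [hU0]; rfl),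
    MvPowerSeries.invOfUnit_mul _ 1 (by rw [hU0]; rfl)⟩ with hU
  have ht := constantCoeff_parSer h0'
  have hcongr : ∀ X, CongrMod J (firstOrder (parSer z) X) (U.1 * ρ X * (U⁻¹).1) := fun X => by
    have h1 : defect c ρ z X = 0 := by
      ext1 α
      rw [(hz α).2.2.2, map_zero]
    have h2 : firstOrder (parSer z) X - U.1 * ρ X * (U⁻¹).1 = - (errSer c z X * (U⁻¹).1) := by
      have h3 : U.1 * ρ X = firstOrder (parSer z) X * U.1 + errSer c z X := by
        rw [defect, sub_sub, sub_eq_zero] at h1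
        exact h1
      rw [h3, add_mul, mul_assoc, Units.mul_inv, mul_one]
      abel
    rw [CongrMod, h2]
    exact neg_mem (map_mul_mem (hcJ _) _)
  refine ⟨parSer z, ht, (isDeformation_firstOrder_iff hn ht).1
    ⟨isDiffCochain_firstOrder _, constantCoeff_firstOrder ht, fun X Y => ?_⟩, U,
    fun α => mem_diffOp_iff.1 (hz α).1, hU0, hcongr⟩
  have h2 := curvature_congr hcongr X Y
  rw [curvature_conj ρ (Units.inv_mul U)] at h2
  have h3 : U.1 * curvature ρ X Y * (U⁻¹).1 ∈ J.map scalars :=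
    map_mul_mem (Ideal.mul_mem_left _ _ (curvature_mem hρ X Y)) _
  have := add_mem h2 h3
  rwa [sub_add_cancel] at this

end Reduction

/-! ### Miniversality -/

section Miniversal

variable {σ : Type}

/-- The family is affine in the parameters, so only the exponent zero and the unit exponents
contribute and the sum over exponents is finite. -/
theorem substitute_infDeformation (s : Param n → MvPowerSeries σ 𝕜) (X : Vect n) :
    substitute s (infDeformation 𝕜 n X) = firstOrder s X := by
  classical
  ext1 β
  have e : ∀ α : Param n →₀ ℕ, MvPowerSeries.coeff β (α.prod fun i e => s i ^ e) •
      MvPowerSeries.coeff α (infDeformation 𝕜 n X) =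
      (if α = 0 then MvPowerSeries.coeff β (MvPowerSeries.C (lieDerivative X) : OpSeries σ 𝕜 n)
        else 0) + ∑ p, if α = Finsupp.single p 1 then
          MvPowerSeries.coeff β (s p) • coc p X else 0 := fun α => by
    rw [infDeformation, coeff_firstOrder, smul_add, Finset.smul_sum]
    congr 1
    · rw [MvPowerSeries.coeff_C, MvPowerSeries.coeff_C]
      by_cases h : α = 0
      · rw [if_pos h, if_pos h, h, Finsupp.prod_zero_index, MvPowerSeries.coeff_one]
        split_ifs
        · rw [one_smul]
        · rw [zero_smul]
      · rw [if_neg h, if_neg h, smul_zero]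
    · refine Finset.sum_congr rfl fun p _ => ?_
      rw [MvPowerSeries.coeff_X]
      by_cases h : α = Finsupp.single p 1
      · rw [if_pos h, if_pos h, h,
          Finsupp.prod_single_index (h := fun i e => s i ^ e) (pow_zero _), pow_one, one_smul]
      · rw [if_neg h, if_neg h, zero_smul, smul_zero]
  have hfin : ∀ (α₀ : Param n →₀ ℕ) (v : Module.End 𝕜 (Form 𝕜 n)),
      (Function.support fun α => if α = α₀ then v else 0).Finite := fun α₀ v =>
    (Set.finite_singleton α₀).subset fun α hα => by
      by_contra h
      exact hα (if_neg h)
  have hsing : ∀ (α₀ : Param n →₀ ℕ) (v : Module.End 𝕜 (Form 𝕜 n)),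
      ∑ᶠ α, (if α = α₀ then v else 0) = v := fun α₀ v => by
    rw [finsum_eq_single _ α₀ fun α h => if_neg h, if_pos rfl]
  change ∑ᶠ α : Param n →₀ ℕ, _ = _
  rw [finsum_congr e, finsum_add_distrib (hfin _ _)
    ((Set.finite_range fun p : Param n => Finsupp.single p 1).subset fun α hα => by
      obtain ⟨p, -, hp⟩ := Finset.exists_ne_zero_of_sum_ne_zero hα
      exact ⟨p, by by_contra h; exact hp (if_neg (Ne.symm h))⟩),
    finsum_sum_comm _ _ fun p _ => hfin _ _, hsing, coeff_firstOrder]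
  simp only [hsing]

theorem map_relation {A B : Type} [CommRing A] [CommRing B] (φ : A →+* B) (t : Param n → A)
    (r : Rel n) : φ (relation t r) = relation (fun p => φ (t p)) r := by
  cases r <;> simp only [relation, map_add, map_mul]

/-- Substitution of the values `t` sends the relations into `J`, hence descends to the quotients. -/
theorem exists_isInducedBy {J : Ideal (MvPowerSeries σ 𝕜)} {ρ : Vect n → OpSeries σ 𝕜 n}
    {t : Param n → MvPowerSeries σ 𝕜} (ht : ∀ p, MvPowerSeries.constantCoeff (t p) = 0)
    (hr : ∀ r, relation t r ∈ J) (h : Equivalent J ρ (firstOrder t)) :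
    ∃ ψ, IsInducedBy (Ideal.span (Set.range (quadRel 𝕜 n))) (infDeformation 𝕜 n) J ρ ψ := by
  have hs : MvPowerSeries.HasSubst t := MvPowerSeries.hasSubst_of_constantCoeff_zero ht
  let φ : MvPowerSeries (Param n) 𝕜 →ₐ[𝕜] MvPowerSeries σ 𝕜 ⧸ J :=
    (Ideal.Quotient.mkₐ 𝕜 J).comp (MvPowerSeries.substAlgHom hs)
  have hφX : ∀ p, φ (MvPowerSeries.X p) = Ideal.Quotient.mk J (t p) := fun p => by
    change Ideal.Quotient.mk J (MvPowerSeries.substAlgHom hs (MvPowerSeries.X p)) = _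
    rw [MvPowerSeries.substAlgHom_X]
  have hφ : ∀ a ∈ Ideal.span (Set.range (quadRel 𝕜 n)), φ a = 0 := by
    intro a ha
    refine (Ideal.span_le (I := RingHom.ker φ.toRingHom)).2 ?_ ha
    rintro _ ⟨r, rfl⟩
    change φ.toRingHom (relation MvPowerSeries.X r) = 0
    rw [map_relation]
    change relation (fun p => φ (MvPowerSeries.X p)) r = 0
    simp only [hφX]
    rw [← map_relation]
    exact Ideal.Quotient.eq_zero_iff_mem.2 (hr r)
  refine ⟨Ideal.Quotient.liftₐ _ φ hφ, t, ht, fun p => ?_, ?_⟩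
  · rw [← hφX]
    rfl
  · simpa only [substitute_infDeformation] using h

/-- Equivalent first-order deformations have the same parameters to first order. -/
theorem sub_mem_of_equivalent [Finite σ] (hn : 2 ≤ n) {J : Ideal (MvPowerSeries σ 𝕜)}
    (hJ : maxIdeal σ 𝕜 ^ 2 ≤ J) {ρ : Vect n → OpSeries σ 𝕜 n}
    {s s' : Param n → MvPowerSeries σ 𝕜} (hs : ∀ p, MvPowerSeries.constantCoeff (s p) = 0)
    (hs' : ∀ p, MvPowerSeries.constantCoeff (s' p) = 0) (h : Equivalent J ρ (firstOrder s))
    (h' : Equivalent J ρ (firstOrder s')) (p : Param n) : s' p - s p ∈ J := by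
  classical
  obtain ⟨U, -, hU, h⟩ := h
  obtain ⟨U', -, hU', h'⟩ := h'
  obtain ⟨X, l, hb, hl⟩ := exists_paramTest (𝕜 := 𝕜) hn p
  have hUi : MvPowerSeries.constantCoeff (U⁻¹).1 = 1 := by
    have := congrArg MvPowerSeries.constantCoeff U.inv_mul
    rwa [map_mul, hU, mul_one, map_one] at this
  -- The quotient of the two conjugations intertwines the two families modulo `J`.
  set W : OpSeries σ 𝕜 n := U'.1 * (U⁻¹).1 with hW
  have hW0 : MvPowerSeries.constantCoeff W = 1 := by rw [hW, map_mul, hU', hUi, one_mul]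
  let D : Vect n → OpSeries σ 𝕜 n := fun X => firstOrder s' X * W - W * firstOrder s X
  have hD : ∀ X, D X ∈ J.map scalars := fun X => by
    have e : D X = (firstOrder s' X - U'.1 * ρ X * (U'⁻¹).1) * W -
        W * (firstOrder s X - U.1 * ρ X * (U⁻¹).1) := by
      have e1 : U'.1 * ρ X * (U'⁻¹).1 * W = U'.1 * ρ X * (U⁻¹).1 := by
        rw [hW, mul_assoc, ← mul_assoc (U'⁻¹).1, Units.inv_mul, one_mul]
      have e2 : W * (U.1 * ρ X * (U⁻¹).1) = U'.1 * ρ X * (U⁻¹).1 := by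
        have e3 : W * (U.1 * ρ X * (U⁻¹).1) = U'.1 * ((U⁻¹).1 * U.1) * ρ X * (U⁻¹).1 := by
          simp only [hW, mul_assoc]
        rw [e3, Units.inv_mul, mul_one]
      simp only [sub_mul, mul_sub, e1, e2, D]
      abel
    rw [e]
    exact sub_mem (map_mul_mem (h' X) _) (Ideal.mul_mem_left _ _ (h X))
  -- To first order the failure of intertwining is the difference of the parameters times the
  -- cocycles, plus a coboundary. The evaluations dual to the `coc p` therefore isolate one
  -- parameter.
  have hcoeff : ∀ α : σ →₀ ℕ, α.degree < 2 → ∀ X, MvPowerSeries.coeff α (D X) =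
      ∑ p, MvPowerSeries.coeff α (s' p - s p) • coc p X +
        cobd (MvPowerSeries.coeff α (W - 1)) X := fun α hα X => by
    have h0 : ∀ β < α, β = 0 := fun β hβ => by
      rw [← Finsupp.degree_eq_zero_iff]
      have := degree_lt_of_lt hβ
      omega
    have h1 : ∀ β < α, MvPowerSeries.coeff β (firstOrder s' X - firstOrder s X) = 0 := by
      intro β hβ
      rw [h0 β hβ, MvPowerSeries.coeff_zero_eq_constantCoeff_apply, map_sub,
        constantCoeff_firstOrder hs, constantCoeff_firstOrder hs', sub_self]
    have h2 : ∀ β < α, MvPowerSeries.coeff β (W - 1) = 0 := by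
      intro β hβ
      rw [h0 β hβ, MvPowerSeries.coeff_zero_eq_constantCoeff_apply, map_sub, hW0, map_one,
        sub_self]
    have e : D X = (firstOrder s' X - firstOrder s X) * W +
        (firstOrder s X * (W - 1) - (W - 1) * firstOrder s X) := by
      simp only [D]; noncomm_ring
    rw [e, map_add, map_sub, coeff_mul_of_left h1, coeff_mul_of_left h2, coeff_mul_of_right h2,
      hW0, constantCoeff_firstOrder hs, mul_one, cobd_apply, map_sub, coeff_firstOrder,
      coeff_firstOrder, add_sub_add_left_eq_sub, ← Finset.sum_sub_distrib]
    simp only [map_sub, sub_smul]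
  have hΘ : ∑ i, serL (l i) (D (X i)) ∈ J := sum_mem fun i _ => serL_mem _ (hD _)
  rw [← sub_add_cancel (s' p - s p) (∑ i, serL (l i) (D (X i)))]
  refine add_mem (hJ (mem_maxIdeal_pow _ _ fun α hα => ?_)) hΘ
  rw [map_sub, sub_eq_zero, map_sum]
  simp only [coeff_serL]
  have e : ∀ i, l i (MvPowerSeries.coeff α (D (X i))) =
      ∑ p', MvPowerSeries.coeff α (s' p' - s p') * l i (coc p' (X i)) +
        l i (cobd (MvPowerSeries.coeff α (W - 1)) (X i)) := fun i => by
    rw [hcoeff α hα, map_add, map_sum]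
    simp only [map_smul, smul_eq_mul]
  rw [Finset.sum_congr rfl fun i _ => e i, Finset.sum_add_distrib, hb, add_zero, Finset.sum_comm]
  simp only [← Finset.mul_sum, hl]
  rw [Finset.sum_eq_single p (fun p' _ hp => by rw [if_neg hp, mul_zero]) (by simp), if_pos rfl,
    mul_one]

/-- A homomorphism to an algebra whose maximal ideal has zero square is determined by the images
of the parameters. -/
theorem algHom_apply_eq {τ : Type} [Fintype τ] {I : Ideal (MvPowerSeries τ 𝕜)}
    {J : Ideal (MvPowerSeries σ 𝕜)} (hJ : maxIdeal σ 𝕜 ^ 2 ≤ J)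
    (ψ : (MvPowerSeries τ 𝕜 ⧸ I) →ₐ[𝕜] (MvPowerSeries σ 𝕜 ⧸ J)) {s : τ → MvPowerSeries σ 𝕜}
    (hs : ∀ i, MvPowerSeries.constantCoeff (s i) = 0)
    (hψ : ∀ i, Ideal.Quotient.mk J (s i) = ψ (Ideal.Quotient.mk I (MvPowerSeries.X i)))
    (a : 𝕜) (g : τ → MvPowerSeries τ 𝕜) :
    ψ (Ideal.Quotient.mk I (MvPowerSeries.C a + ∑ i, MvPowerSeries.X i * g i)) =
      algebraMap 𝕜 _ a + ∑ i, Ideal.Quotient.mk J (s i) *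
        algebraMap 𝕜 _ (MvPowerSeries.constantCoeff (g i)) := by
  have hC : ∀ b, ψ (Ideal.Quotient.mk I (MvPowerSeries.C b)) = algebraMap 𝕜 _ b :=
    fun b => ψ.commutes b
  have key : ∀ (a : 𝕜) (g : τ → MvPowerSeries τ 𝕜),
      ψ (Ideal.Quotient.mk I (MvPowerSeries.C a + ∑ i, MvPowerSeries.X i * g i)) =
        algebraMap 𝕜 _ a + ∑ i, Ideal.Quotient.mk J (s i) * ψ (Ideal.Quotient.mk I (g i)) := by
    intro a g
    simp only [map_add, map_sum, map_mul, hψ, hC]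
  -- Two images of parameters multiply to zero, so only the constant terms of the cofactors matter.
  -- The argument is purely algebraic: no continuity of `ψ` is assumed.
  have hmul : ∀ i j, Ideal.Quotient.mk J (s i) * Ideal.Quotient.mk J (s j) = 0 := fun i j => by
    rw [← map_mul, Ideal.Quotient.eq_zero_iff_mem]
    refine hJ ?_
    rw [pow_two]
    exact Ideal.mul_mem_mul (mem_maxIdeal.2 (hs i)) (mem_maxIdeal.2 (hs j))
  rw [key]
  congr 1
  refine Finset.sum_congr rfl fun i _ => ?_
  -- The expansion is applied a second time, to the cofactor, to bring out a second parameter.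
  obtain ⟨h, hg, -⟩ := exists_eq_sum_X_mul
    (g i - MvPowerSeries.C (MvPowerSeries.constantCoeff (g i)))
    (by rw [map_sub, MvPowerSeries.constantCoeff_C, sub_self])
  rw [show g i = MvPowerSeries.C (MvPowerSeries.constantCoeff (g i)) +
    ∑ j, MvPowerSeries.X j * h j by rw [← hg]; abel, key, mul_add, Finset.mul_sum]
  simp only [← mul_assoc, hmul, zero_mul, Finset.sum_const_zero, add_zero, map_add, map_sum,
    map_mul, MvPowerSeries.constantCoeff_X, MvPowerSeries.constantCoeff_C]

theorem isInducedBy_unique [Finite σ] (hn : 2 ≤ n) {I : Ideal (MvPowerSeries (Param n) 𝕜)}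
    {J : Ideal (MvPowerSeries σ 𝕜)} (hJ : maxIdeal σ 𝕜 ^ 2 ≤ J) {ρ : Vect n → OpSeries σ 𝕜 n}
    {ψ ψ' : (MvPowerSeries (Param n) 𝕜 ⧸ I) →ₐ[𝕜] (MvPowerSeries σ 𝕜 ⧸ J)}
    (h : IsInducedBy I (infDeformation 𝕜 n) J ρ ψ)
    (h' : IsInducedBy I (infDeformation 𝕜 n) J ρ ψ') : ψ = ψ' := by
  obtain ⟨s, hs, hψ, h⟩ := h
  obtain ⟨s', hs', hψ', h'⟩ := h'
  simp only [substitute_infDeformation] at h h'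
  have hss : ∀ p, Ideal.Quotient.mk J (s' p) = Ideal.Quotient.mk J (s p) := fun p =>
    Ideal.Quotient.eq.2 (sub_mem_of_equivalent hn hJ hs hs' h h' p)
  refine AlgHom.ext fun x => ?_
  obtain ⟨f, rfl⟩ := Ideal.Quotient.mk_surjective x
  obtain ⟨g, hg, -⟩ := exists_eq_sum_X_mul (f - MvPowerSeries.C (MvPowerSeries.constantCoeff f))
    (by rw [map_sub, MvPowerSeries.constantCoeff_C, sub_self])
  rw [show f = MvPowerSeries.C (MvPowerSeries.constantCoeff f) + ∑ j, MvPowerSeries.X j * g j by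
    rw [← hg]; abel, algHom_apply_eq hJ ψ hs hψ, algHom_apply_eq hJ ψ' hs' hψ']
  simp only [hss]

theorem isMiniversal_infDeformation (hn : 2 ≤ n) :
    IsMiniversal (Ideal.span (Set.range (quadRel 𝕜 n))) (infDeformation 𝕜 n) := by
  refine ⟨isDeformation_firstOrder constantCoeff_X' fun r => Ideal.subset_span ⟨r, rfl⟩,
    fun m J ρ hρ => ⟨?_, fun hJ ψ ψ' => isInducedBy_unique hn hJ⟩⟩
  obtain ⟨t, ht, hr, h⟩ := hρ.exists_firstOrder hn
  exact exists_isInducedBy ht hr h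

end Miniversal

end FormDeformation

end

theorem theorem4p1 (𝕜 : Type) [RCLike 𝕜] (n : ℕ) (hn : 2 ≤ n) :
    -- (i) the relations are necessary and sufficient for integrability
    ((∀ I : Ideal (MvPowerSeries (FormDeformation.Param n) 𝕜),
        FormDeformation.IsHomogeneousIdeal I →
          (FormDeformation.Integrates I (FormDeformation.infDeformation 𝕜 n) ↔
            ∀ r, FormDeformation.quadRel 𝕜 n r ∈ I)) ∧
      (∀ I : Ideal (MvPowerSeries (FormDeformation.Param n) 𝕜),
        FormDeformation.Integrates I (FormDeformation.infDeformation 𝕜 n) →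
          ∀ r, FormDeformation.quadRel 𝕜 n r ∈
            I ⊔ FormDeformation.maxIdeal (FormDeformation.Param n) 𝕜 ^ 3) ∧
      (∀ I : Ideal (MvPowerSeries (FormDeformation.Param n) 𝕜),
        FormDeformation.IsDeformation I (FormDeformation.infDeformation 𝕜 n) ↔
          ∀ r, FormDeformation.quadRel 𝕜 n r ∈ I) ∧
      (∀ c : FormDeformation.Param n → 𝕜,
        FormDeformation.Integrates (⊥ : Ideal (MvPowerSeries Unit 𝕜))
            (FormDeformation.firstOrder (n := n)
              fun p => MvPowerSeries.C (c p) * MvPowerSeries.X ()) ↔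
          ∀ r, FormDeformation.relation c r = 0)) ∧
    -- (ii) every formal deformation is equivalent to one of order 1
    (∀ (m : ℕ) (J : Ideal (MvPowerSeries (Fin m) 𝕜))
      (ρ : FormDeformation.Vect n → FormDeformation.OpSeries (Fin m) 𝕜 n),
      FormDeformation.IsDeformation J ρ →
        ∃ t : FormDeformation.Param n → MvPowerSeries (Fin m) 𝕜,
          (∀ p, MvPowerSeries.constantCoeff (t p) = 0) ∧
          (∀ r, FormDeformation.relation t r ∈ J) ∧
          FormDeformation.Equivalent J ρ (FormDeformation.firstOrder t)) ∧
    -- the relations define the base of the miniversal deformation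
    FormDeformation.IsMiniversal (Ideal.span (Set.range (FormDeformation.quadRel 𝕜 n)))
      (FormDeformation.infDeformation 𝕜 n) := by
  refine ⟨⟨fun I hI => FormDeformation.integrates_iff_of_homogeneous hn hI,
    fun I h r => h.quadRel_mem hn r,
    fun I => FormDeformation.isDeformation_firstOrder_iff hn FormDeformation.constantCoeff_X',
    FormDeformation.integrates_line_iff hn⟩, fun m J ρ hρ => hρ.exists_firstOrder hn,
    FormDeformation.isMiniversal_infDeformation hn⟩
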